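/- Let $(M,\mathrm g)$ be a conformally flat pseudo-Riemannian manifold of signature $(p,q)$ and dimension $n=p+q\ge 2$: $M$ (Hausdorff, second countable) is covered by adapted charts with values in $\mathbb R^n$ whose coordinate changes locally preserve the Lie algebra $\mathfrak o(p+1,q+1)$ of vector fields on $\mathbb R^n$ generated by $$\partial_i,\qquad x_i\partial_j-x_j\partial_i,\qquad x^i\partial_i,\qquad x_jx^j\partial_i-2x_ix^j\partial_j ,$$ with indices lowered by $g=\mathrm{diag}(1,\dots,1,-1,\dots,-1)$, and in each adapted chart $\mathrm g_{ij}=F\,g_{ij}$ with a smooth function $F>0$. Let $|\mathrm{vol}|$ be the volume of $\mathrm g$, and write $\lambda$-densities as $f\,|\mathrm{vol}|^\lambda$ with $f$ a smooth function. Let $\mathcal D^2_{\lambda,\mu}$ be the space of differential operators of order at most two from $\lambda$-densities to $\mu$-densities on $M$, and let $\mathcal S^2_\delta$ be the space of symbols $P=P_2^{ij}\xi_i\xi_j+P_1^i\xi_i+P_0$, i.e. fiberwise polynomials of degree at most two on $T^*M$, with values in $\delta$-densities. The Lie algebra $\mathfrak o(p+1,q+1)$ acts locally on both by Lie derivatives.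 Fix a real $\hbar\neq0$. For $\lambda+\mu=1$ and $\delta=\mu-\lambda$, call a linear bijection $\mathcal Q_{\lambda,\mu}:\mathcal S^2_\delta\to\mathcal D^2_{\lambda,\mu}$ a *symmetric conformal isomorphism* if * it is equivariant under the local action of $\mathfrak o(p+1,q+1)$ (as an identity of germs in the adapted charts); * it preserves the principal symbol at each order; * for every $P\in\mathcal S^2_\delta$ the operator $\mathcal Q_{\lambda,\mu;\hbar}(P)=\mathcal Q_{\lambda,\mu}(P(i\hbar\,\xi))$, acting on complex-valued densities, is symmetric (formally self-adjoint) for the pairing $\varphi\otimes\psi\mapsto\int_M\overline\varphi\,\psi$ of compactly supported $\lambda$- and $\mu$-densities. Let $H=\mathrm g^{ij}\xi_i\xi_j$ (that is, $\mathrm g^{ij}\xi_i\xi_j\,|\mathrm{vol}|^\delta\in\mathcal S^2_\delta$), let $\Delta$ be the Laplace operator of $\mathrm g$ and $R$ its scalar curvature (positive on round spheres). Then for each of $$(\lambda,\mu)=\Big(\tfrac{n-2}{2n},\tfrac{n+2}{2n}\Big),\qquad(0,1),\qquad\Big(-\tfrac1n,\tfrac{n+1}n\Big)$$ a symmetric conformal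 isomorphism exists. It is unique, except possibly when $n=2$ and $(\lambda,\mu)=(0,1)$ (for $n=2$ the first two pairs coincide). In all cases, every symmetric conformal isomorphism satisfies, respectively, $$\mathcal Q_{\frac{n-2}{2n},\frac{n+2}{2n};\hbar}(H)=-\hbar^2\Big(\Delta-\frac{n-2}{4(n-1)}R\Big),$$ $$\mathcal Q_{0,1;\hbar}(H)=-\hbar^2\Delta,$$ $$\mathcal Q_{-\frac1n,\frac{n+1}n;\hbar}(H)=-\hbar^2\Big(\Delta+\frac1{(n-1)(n+2)}R\Big).$$ -/

import Mathlib

open scoped Manifold ContDiff Topology ComplexConjugate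
open MeasureTheory

noncomputable section

namespace ConformalQuantization

/-- The model space `ℝⁿ` of coordinate vectors. -/
abbrev Coord (n : ℕ) : Type := Fin n → ℝ

/-! ### The flat model: coordinate calculus and the conformal Lie algebra -/

/-- The diagonal coefficients of the flat metric `diag(1,…,1,-1,…,-1)` on `ℝⁿ`
with `p` plus signs and `n - p` minus signs. -/
def eta (n p : ℕ) (i : Fin n) : ℝ := if (i : ℕ) < p then 1 else -1

/-- The partial derivative `∂u/∂xⁱ` of a (real- or vector-valued) function of the coordinates. -/
def pd {n : ℕ} {V : Type*} [NormedAddCommGroup V] [NormedSpace ℝ V]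
    (i : Fin n) (u : Coord n → V) (y : Coord n) : V :=
  fderiv ℝ u y (Pi.single i 1)

/-- The translation `X_i = ∂_i`. -/
def translationField (n : ℕ) (i : Fin n) : Coord n → Coord n :=
  fun _ => Pi.single i 1

/-- The (pseudo-)rotation `X_ij = x_i ∂_j - x_j ∂_i`, where `x_i = g_ij x^j`. -/
def rotationField (n p : ℕ) (i j : Fin n) : Coord n → Coord n :=
  fun x => (eta n p i * x i) • Pi.single j 1 - (eta n p j * x j) • Pi.single i 1

/-- The homothety `X_0 = xⁱ ∂_i`. -/
def dilationField (n : ℕ) : Coord n → Coord n :=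
  fun x => x

/-- The inversion `X̄_i = x_j x^j ∂_i - 2 x_i x^j ∂_j`. -/
def inversionField (n p : ℕ) (i : Fin n) : Coord n → Coord n :=
  fun x => (∑ j, eta n p j * x j * x j) • Pi.single i 1 - (2 * (eta n p i * x i)) • x

/-- The conformal Lie algebra `o(p+1,q+1)`, `q = n - p`, of vector fields on `ℝⁿ`: the linear
span of the translations, rotations, the homothety and the inversions. -/
def conformalAlgebra (n p : ℕ) : Submodule ℝ (Coord n → Coord n) :=
  Submodule.span ℝ
    (Set.range (translationField n)
      ∪ Set.range (fun ij : Fin n × Fin n => rotationField n p ij.1 ij.2)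
      ∪ {dilationField n}
      ∪ Set.range (inversionField n p))

/-! ### Curvature and Laplacian of a matrix of metric coefficients, in coordinates -/

section Coordinates

variable {n : ℕ} (G : Coord n → Matrix (Fin n) (Fin n) ℝ)

/-- `Γᵏ_ij = ½ gᵏˡ (∂_i g_jl + ∂_j g_il - ∂_l g_ij)`. -/
def christoffel (k i j : Fin n) (y : Coord n) : ℝ :=
  (1 / 2) * ∑ l, (G y)⁻¹ k l *
    (pd i (fun z => G z j l) y + pd j (fun z => G z i l) y - pd l (fun z => G z i j) y)

/-- `R_jk = ∂_i Γⁱ_jk - ∂_j Γⁱ_ik + Γⁱ_il Γˡ_jk - Γⁱ_jl Γˡ_ik` (positive on round spheres). -/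
def ricci (j k : Fin n) (y : Coord n) : ℝ :=
  ∑ i, (pd i (christoffel G i j k) y - pd j (christoffel G i i k) y
    + ∑ l, (christoffel G i i l y * christoffel G l j k y
      - christoffel G i j l y * christoffel G l i k y))

/-- The scalar curvature `gʲᵏ R_jk`. -/
def scalarCurvatureCoord (y : Coord n) : ℝ :=
  ∑ j, ∑ k, (G y)⁻¹ j k * ricci G j k y

/-- The Laplacian `gⁱʲ (∂_i ∂_j u - Γᵏ_ij ∂_k u)`. -/
def laplacianCoord (u : Coord n → ℂ) (y : Coord n) : ℂ :=
  ∑ i, ∑ j, (((G y)⁻¹ i j : ℝ) : ℂ) *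
    (pd i (pd j u) y - ∑ k, ((christoffel G k i j y : ℝ) : ℂ) * pd k u y)

/-- The coefficient `|det (g_ij)|^{1/2}` of the volume `|vol|` of the metric. -/
def volCoeff (y : Coord n) : ℝ := Real.sqrt |(G y).det|

/-- The divergence of `X` with respect to the volume of the metric. -/
def divergence (X : Coord n → Coord n) (y : Coord n) : ℝ :=
  (∑ i, pd i (fun z => volCoeff G z * X z i) y) / volCoeff G y

/-- The Lie derivative `L_X^w f = X(f) + w Div(X) f` of the `w`-density `f |vol|^w`. -/
def lieDensity (w : ℝ) (X : Coord n → Coord n) (f : Coord n → ℝ) (y : Coord n) : ℝ :=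
  (∑ i, X y i * pd i f y) + w * divergence G X y * f y

/-- The Lie derivative of the components `A^i` of a vector field with values in `w`-densities. -/
def lieVector (w : ℝ) (X : Coord n → Coord n) (A : Coord n → Fin n → ℝ)
    (y : Coord n) (k : Fin n) : ℝ :=
  (∑ i, (X y i * pd i (fun z => A z k) y - pd i (fun z => X z k) y * A y i))
    + w * divergence G X y * A y k

/-- The Lie derivative of the components `A^{ij}` of a contravariant two-tensor field with values
in `w`-densities. -/
def lieTensor (w : ℝ) (X : Coord n → Coord n) (A : Coord n → Fin n → Fin n → ℝ)
    (y : Coord n) (k l : Fin n) : ℝ :=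
  (∑ i, (X y i * pd i (fun z => A z k l) y - pd i (fun z => X z k) y * A y i l
      - pd i (fun z => X z l) y * A y k i))
    + w * divergence G X y * A y k l

end Coordinates

/-! ### Differential operators on a commutative algebra -/

/-- The commutator `[T, f]` of an operator with the multiplication by `f`. -/
def opComm {A : Type*} [CommRing A] [Algebra ℝ A] (T : Module.End ℝ A) (f : A) : Module.End ℝ A :=
  T * LinearMap.mulLeft ℝ f - LinearMap.mulLeft ℝ f * T

/-- Differential operators of order at most `k` on a commutative algebra: those of order zero are
the multiplications, and `T` has order at most `k + 1` if all commutators `[T, f]` have order at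
most `k`. -/
def diffOps (A : Type*) [CommRing A] [Algebra ℝ A] : ℕ → Submodule ℝ (Module.End ℝ A)
  | 0 => LinearMap.range (LinearMap.mul ℝ A)
  | k + 1 =>
    { carrier := {T | ∀ f : A, opComm T f ∈ diffOps A k}
      add_mem' := fun {S T} hS hT f => by
        have h : opComm (S + T) f = opComm S f + opComm T f := by
          simp only [opComm, add_mul, mul_add]; abel
        rw [h]
        exact (diffOps A k).add_mem (hS f) (hT f)
      zero_mem' := fun f => by
        have h : opComm (0 : Module.End ℝ A) f = 0 := by simp [opComm]
        rw [h]
        exact (diffOps A k).zero_mem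
      smul_mem' := fun r T hT f => by
        have h : opComm (r • T) f = r • opComm T f := by
          simp only [opComm, smul_mul_assoc, mul_smul_comm, smul_sub]
        rw [h]
        exact (diffOps A k).smul_mem r (hT f) }

/-! ### Manifolds with a flat conformal structure -/

section Manifold

variable (n p : ℕ) (M : Type*) [TopologicalSpace M] [ChartedSpace (Coord n) M]

/-- The atlas of `M` is an atlas of adapted charts of a flat conformal structure of signature
`(p, n - p)`: the coordinate changes carry the conformal Lie algebra of vector fields of `ℝⁿ`
locally to itself, so that this Lie algebra acts locally on `M`, by the same formulas in all
charts of the atlas. -/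
def IsFlatConformalAtlas : Prop :=
  ∀ c ∈ atlas (Coord n) M, ∀ c' ∈ atlas (Coord n) M, ∀ X ∈ conformalAlgebra n p,
    ∀ y ∈ (c.symm.trans c').source, ∃ Y ∈ conformalAlgebra n p,
      ∀ᶠ z in 𝓝 y, fderiv ℝ (fun w => c' (c.symm w)) z (X z) = Y (c' (c.symm z))

/-- Real-valued smooth functions on `M`. Given the volume `|vol|` of a metric, `f` stands for the
density `f |vol|^w` of any prescribed weight `w`. -/
abbrev SmoothFun : Type _ := C^∞⟮𝓘(ℝ, Coord n), M; 𝓘(ℝ, ℝ), ℝ⟯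

/-- Complex-valued smooth functions on `M`. -/
abbrev SmoothFunC : Type _ := C^∞⟮𝓘(ℝ, Coord n), M; 𝓘(ℝ, ℂ), ℂ⟯

variable {M}

/-- The tangent space of `M` at `x`. -/
abbrev Tangent (x : M) : Type := TangentSpace 𝓘(ℝ, Coord n) x

/-- The cotangent space of `M` at `x`. -/
abbrev Cotangent (x : M) : Type := Tangent n x →L[ℝ] ℝ

variable {n}

/-- The coordinate vector `∂_i` of the chart `c`, at the point with coordinates `y`. -/
def coordVec (c : OpenPartialHomeomorph M (Coord n)) (y : Coord n) (i : Fin n) :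
    Tangent n (c.symm y) :=
  mfderiv 𝓘(ℝ, Coord n) 𝓘(ℝ, Coord n) c.symm y (Pi.single i 1 : Coord n)

/-- The coordinate covector `dxⁱ` of the chart `c`, at the point with coordinates `y`. -/
def coordCovec (c : OpenPartialHomeomorph M (Coord n)) (y : Coord n) (i : Fin n) :
    Cotangent n (c.symm y) :=
  (ContinuousLinearMap.proj (R := ℝ) (φ := fun _ : Fin n => ℝ) i).comp
    (mfderiv 𝓘(ℝ, Coord n) 𝓘(ℝ, Coord n) c (c.symm y) : Tangent n (c.symm y) →L[ℝ] Coord n)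

/-- The differential `df` at `x`. -/
def differential (f : SmoothFun n M) (x : M) : Cotangent n x :=
  (mfderiv 𝓘(ℝ, Coord n) 𝓘(ℝ, ℝ) f x : Tangent n x →L[ℝ] ℝ)

variable (n M)

/-- A pseudo-Riemannian metric on `M`. -/
structure PseudoRiemannianMetric where
  /-- the scalar product of the tangent space at each point -/
  val : ∀ x : M, LinearMap.BilinForm ℝ (Tangent n x)
  isSymm : ∀ x, (val x).IsSymm
  nondegenerate : ∀ x, (val x).Nondegenerate
  smooth : ∀ c ∈ atlas (Coord n) M, ∀ i j, ContDiffOn ℝ ∞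
    (fun y => val (c.symm y) (coordVec c y i) (coordVec c y j)) c.target

/-- Symbols of degree at most two: fiberwise polynomials `P₂ⁱʲ ξ_i ξ_j + P₁ⁱ ξ_i + P₀` on the
cotangent bundle, that is, triples `(P₂, P₁, P₀)` of a smooth symmetric contravariant two-tensor
field (a bilinear form on each cotangent space), a smooth vector field and a smooth function.
Given the volume `|vol|` of a metric, `P` stands for the density-valued symbol `P |vol|^δ`. -/
def symbols : Submodule ℝ
    ((∀ x : M, LinearMap.BilinForm ℝ (Cotangent n x)) × (∀ x : M, Tangent n x) × (M → ℝ)) where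
  carrier := {P | (∀ x, ∀ ξ ζ, P.1 x ξ ζ = P.1 x ζ ξ) ∧
    ∀ c ∈ atlas (Coord n) M,
      (∀ i j, ContDiffOn ℝ ∞
        (fun y => P.1 (c.symm y) (coordCovec c y i) (coordCovec c y j)) c.target) ∧
      (∀ i, ContDiffOn ℝ ∞ (fun y => coordCovec c y i (P.2.1 (c.symm y))) c.target) ∧
      ContDiffOn ℝ ∞ (fun y => P.2.2 (c.symm y)) c.target}
  add_mem' := by
    rintro P Q ⟨hP, hP'⟩ ⟨hQ, hQ'⟩
    refine ⟨fun x ξ ζ => ?_, fun c hc => ⟨fun i j => ?_, fun i => ?_, ?_⟩⟩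
    · simp [hP x ξ ζ, hQ x ξ ζ]
    · simpa using ((hP' c hc).1 i j).add ((hQ' c hc).1 i j)
    · simpa using ((hP' c hc).2.1 i).add ((hQ' c hc).2.1 i)
    · simpa using (hP' c hc).2.2.add (hQ' c hc).2.2
  zero_mem' := by
    refine ⟨fun x ξ ζ => by simp, fun c hc => ⟨fun i j => ?_, fun i => ?_, ?_⟩⟩
    · simpa using contDiffOn_const
    · simpa using contDiffOn_const
    · simpa using contDiffOn_const
  smul_mem' := by
    rintro r P ⟨hP, hP'⟩
    refine ⟨fun x ξ ζ => ?_, fun c hc => ⟨fun i j => ?_, fun i => ?_, ?_⟩⟩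
    · simp [hP x ξ ζ]
    · simpa using contDiffOn_const.mul ((hP' c hc).1 i j)
    · simpa using contDiffOn_const.mul ((hP' c hc).2.1 i)
    · simpa using contDiffOn_const.mul (hP' c hc).2.2

/-- A symbol of degree at most two. -/
abbrev Symbol : Type _ := symbols n M

variable {n M}

namespace Symbol

/-- The homogeneous component of degree two. -/
def part2 (P : Symbol n M) : Symbol n M :=
  ⟨(P.1.1, 0, 0), P.2.1, fun c hc =>
    ⟨(P.2.2 c hc).1, fun i => by simpa using contDiffOn_const, by simpa using contDiffOn_const⟩⟩

/-- The homogeneous component of degree one. -/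
def part1 (P : Symbol n M) : Symbol n M :=
  ⟨(0, P.1.2.1, 0), fun x ξ ζ => by simp, fun c hc =>
    ⟨fun i j => by simpa using contDiffOn_const, (P.2.2 c hc).2.1,
      by simpa using contDiffOn_const⟩⟩

/-- The homogeneous component of degree zero. -/
def part0 (P : Symbol n M) : Symbol n M :=
  ⟨(0, 0, P.1.2.2), fun x ξ ζ => by simp, fun c hc =>
    ⟨fun i j => by simpa using contDiffOn_const, fun i => by simpa using contDiffOn_const,
      (P.2.2 c hc).2.2⟩⟩

/-- The components `P₂ⁱʲ` in the chart `c`. -/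
def comp2 (P : Symbol n M) (c : OpenPartialHomeomorph M (Coord n)) (y : Coord n)
    (i j : Fin n) : ℝ :=
  P.1.1 (c.symm y) (coordCovec c y i) (coordCovec c y j)

/-- The components `P₁ⁱ` in the chart `c`. -/
def comp1 (P : Symbol n M) (c : OpenPartialHomeomorph M (Coord n)) (y : Coord n)
    (i : Fin n) : ℝ :=
  coordCovec c y i (P.1.2.1 (c.symm y))

/-- The component `P₀` in the chart `c`. -/
def comp0 (P : Symbol n M) (c : OpenPartialHomeomorph M (Coord n)) (y : Coord n) : ℝ :=
  P.1.2.2 (c.symm y)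

end Symbol

namespace PseudoRiemannianMetric

variable (g : PseudoRiemannianMetric n M)

/-- The coefficients `g_ij` of the metric in the chart `c`. -/
def coeff (c : OpenPartialHomeomorph M (Coord n)) (y : Coord n) : Matrix (Fin n) (Fin n) ℝ :=
  Matrix.of fun i j => g.val (c.symm y) (coordVec c y i) (coordVec c y j)

/-- The metric represents the flat conformal structure of signature `(p, n - p)`: in each adapted
chart `g_ij = F · diag(1,…,1,-1,…,-1)` with `F > 0`. -/
def IsConformallyFlat (p : ℕ) : Prop :=
  ∀ c ∈ atlas (Coord n) M, ∀ y ∈ c.target, ∃ F : ℝ, 0 < F ∧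
    g.coeff c y = F • Matrix.diagonal (eta n p)

/-- The scalar curvature function of the metric. -/
def scalarCurvature (x : M) : ℝ :=
  scalarCurvatureCoord (g.coeff (chartAt (Coord n) x)) (chartAt (Coord n) x x)

/-- The Laplace operator of the metric, on complex-valued functions. -/
def laplacian (φ : SmoothFunC n M) (x : M) : ℂ :=
  laplacianCoord (g.coeff (chartAt (Coord n) x)) (fun y => φ ((chartAt (Coord n) x).symm y))
    (chartAt (Coord n) x x)

/-- The volume of the metric in the domain of the chart `c`, as a measure on `M`. -/
def chartVolume [MeasurableSpace M] (c : OpenPartialHomeomorph M (Coord n)) : Measure M :=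
  Measure.map c.symm
    ((volume.restrict c.target).withDensity fun y => ENNReal.ofReal (volCoeff (g.coeff c) y))

/-- The volume measure `|vol|` of the metric. The measures `chartVolume c` agree on the
intersections of chart domains, and their supremum is the measure on `M` which restricts to each
of them. -/
def vol [MeasurableSpace M] : Measure M :=
  ⨆ c : atlas (Coord n) M, g.chartVolume (c : OpenPartialHomeomorph M (Coord n))

/-- The vector `ξ♯` with `g(ξ♯, v) = ξ(v)`. -/
def sharp (x : M) (ξ : Cotangent n x) : Tangent n x :=
  haveI : FiniteDimensional ℝ (Tangent n x) := inferInstanceAs (FiniteDimensional ℝ (Coord n))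
  ((g.val x).toDual (g.nondegenerate x)).symm (ξ : Tangent n x →ₗ[ℝ] ℝ)

theorem val_sharp (x : M) (ξ : Cotangent n x) (v : Tangent n x) :
    g.val x (g.sharp x ξ) v = ξ v := by
  have : FiniteDimensional ℝ (Tangent n x) := inferInstanceAs (FiniteDimensional ℝ (Coord n))
  exact LinearMap.BilinForm.apply_toDual_symm_apply _ _

/-- The inverse metric, as a bilinear form on the cotangent space. -/
def inv (x : M) : LinearMap.BilinForm ℝ (Cotangent n x) :=
  LinearMap.mk₂ ℝ (fun ξ ζ => ζ (g.sharp x ξ))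
    (fun ξ ξ' ζ => by simp [sharp]) (fun r ξ ζ => by simp [sharp])
    (fun ξ ζ ζ' => by simp) (fun r ξ ζ => by simp)

theorem inv_apply (x : M) (ξ ζ : Cotangent n x) : g.inv x ξ ζ = ζ (g.sharp x ξ) := rfl

theorem inv_symm (x : M) (ξ ζ : Cotangent n x) : g.inv x ξ ζ = g.inv x ζ ξ := by
  have h : ∀ ξ ζ : Cotangent n x, g.inv x ξ ζ = g.val x (g.sharp x ζ) (g.sharp x ξ) :=
    fun ξ ζ => (g.val_sharp x ζ _).symm
  rw [h, h]
  exact (g.isSymm x).eq _ _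

theorem inv_mul_coeff [IsManifold 𝓘(ℝ, Coord n) ∞ M] {c : OpenPartialHomeomorph M (Coord n)}
    (hc : c ∈ atlas (Coord n) M) {y : Coord n} (hy : y ∈ c.target) :
    Matrix.of (fun i j => g.inv (c.symm y) (coordCovec c y i) (coordCovec c y j))
      * g.coeff c y = 1 := by
  have : IsManifold 𝓘(ℝ, Coord n) 1 M := IsManifold.of_le (n := ∞) (by simp)
  have hd := mdifferentiable_of_mem_atlas (I := 𝓘(ℝ, Coord n)) hc
  have h1 : ∀ v : Coord n, (mfderiv 𝓘(ℝ, Coord n) 𝓘(ℝ, Coord n) c (c.symm y))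
      ((mfderiv 𝓘(ℝ, Coord n) 𝓘(ℝ, Coord n) c.symm y) v) = v := fun v => by
    have := hd.comp_symm_deriv hy
    exact DFunLike.congr_fun this v
  have h2 : ∀ v : Tangent n (c.symm y), (mfderiv 𝓘(ℝ, Coord n) 𝓘(ℝ, Coord n) c.symm y)
      ((mfderiv 𝓘(ℝ, Coord n) 𝓘(ℝ, Coord n) c (c.symm y)) v) = v := fun v => by
    have := hd.symm_comp_deriv (c.map_target hy)
    rw [c.right_inv hy] at this
    exact DFunLike.congr_fun this v
  have h3 : ∀ v : Tangent n (c.symm y),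
      v = ∑ k, coordCovec c y k v • coordVec c y k := fun v => by
    have key : ∀ (D : Coord n →L[ℝ] Tangent n (c.symm y)) (w : Coord n),
        D w = ∑ k, w k • D (Pi.single k 1) := fun D w => by
      conv_lhs => rw [pi_eq_sum_univ' w]
      simp only [map_sum, map_smul]
    conv_lhs => rw [← h2 v]
    exact key (mfderiv 𝓘(ℝ, Coord n) 𝓘(ℝ, Coord n) c.symm y)
      (mfderiv 𝓘(ℝ, Coord n) 𝓘(ℝ, Coord n) c (c.symm y) v)
  have h4 : ∀ i k, coordCovec c y i (coordVec c y k) = if i = k then (1 : ℝ) else 0 := by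
    intro i k
    have h := congrFun (h1 (Pi.single k 1)) i
    rw [Pi.single_apply] at h
    exact h
  ext i k
  have h6 : (∑ j, g.inv (c.symm y) (coordCovec c y i) (coordCovec c y j)
      * g.val (c.symm y) (coordVec c y j) (coordVec c y k))
      = g.val (c.symm y) (g.sharp _ (coordCovec c y i)) (coordVec c y k) := by
    conv_rhs => rw [h3 (g.sharp _ (coordCovec c y i))]
    simp [inv_apply]
  rw [val_sharp, h4] at h6
  simpa [Matrix.mul_apply, coeff, Matrix.one_apply] using h6

theorem inv_coeff [IsManifold 𝓘(ℝ, Coord n) ∞ M] {c : OpenPartialHomeomorph M (Coord n)}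
    (hc : c ∈ atlas (Coord n) M) {y : Coord n} (hy : y ∈ c.target) (i j : Fin n) :
    g.inv (c.symm y) (coordCovec c y i) (coordCovec c y j) = (g.coeff c y)⁻¹ i j := by
  rw [Matrix.inv_eq_left_inv (g.inv_mul_coeff hc hy)]
  rfl

theorem coeff_det_ne_zero [IsManifold 𝓘(ℝ, Coord n) ∞ M]
    {c : OpenPartialHomeomorph M (Coord n)}
    (hc : c ∈ atlas (Coord n) M) {y : Coord n} (hy : y ∈ c.target) : (g.coeff c y).det ≠ 0 :=
  fun h => by
    have h' := congrArg Matrix.det (g.inv_mul_coeff hc hy)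
    rw [Matrix.det_mul, h] at h'
    simp at h'

theorem contDiffOn_det {s : Set (Coord n)} {G : Coord n → Matrix (Fin n) (Fin n) ℝ}
    (hG : ∀ i j, ContDiffOn ℝ ∞ (fun y => G y i j) s) : ContDiffOn ℝ ∞ (fun y => (G y).det) s := by
  simp only [Matrix.det_apply']
  exact ContDiffOn.sum fun σ _ =>
    contDiffOn_const.mul (contDiffOn_prod fun i _ => hG _ _)

theorem contDiffOn_inv [IsManifold 𝓘(ℝ, Coord n) ∞ M] {c : OpenPartialHomeomorph M (Coord n)}
    (hc : c ∈ atlas (Coord n) M) (i j : Fin n) : ContDiffOn ℝ ∞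
      (fun y => g.inv (c.symm y) (coordCovec c y i) (coordCovec c y j)) c.target := by
  have hG : ∀ i j, ContDiffOn ℝ ∞ (fun y => g.coeff c y i j) c.target := g.smooth c hc
  refine ContDiffOn.congr (f := fun y => ((g.coeff c y).det)⁻¹ * (g.coeff c y).adjugate i j) ?_
    fun y hy => ?_
  · refine ((contDiffOn_det hG).inv fun y hy => g.coeff_det_ne_zero hc hy).mul ?_
    simp only [Matrix.adjugate_apply]
    refine contDiffOn_det fun k l => ?_
    by_cases h : k = j
    · subst h
      simpa using contDiffOn_const
    · simpa [Matrix.updateRow_ne h] using hG k l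
  · rw [g.inv_coeff hc hy, Matrix.inv_def, Ring.inverse_eq_inv']
    rfl

/-- The symbol `H = gⁱʲ ξ_i ξ_j`. -/
def hamiltonian [IsManifold 𝓘(ℝ, Coord n) ∞ M] : Symbol n M :=
  ⟨(g.inv, 0, 0), g.inv_symm, fun c hc =>
    ⟨g.contDiffOn_inv hc, fun i => by simpa using contDiffOn_const,
      by simpa using contDiffOn_const⟩⟩

end PseudoRiemannianMetric

/-! ### Conformally equivariant quantization of symbols of degree at most two -/

/-- The linear isomorphisms from symbols of degree at most two onto differential operators of order
at most two. Operators from `l`-densities to `m`-densities, and symbols with values in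
`(m - l)`-densities, are written with the help of the volume of a metric. -/
abbrev QuantizationMap (n : ℕ) (M : Type*) [TopologicalSpace M] [ChartedSpace (Coord n) M] :
    Type _ :=
  symbols n M ≃ₗ[ℝ] diffOps (SmoothFun n M) 2

/-- The differential operator `Q(P)`. -/
def QuantizationMap.op (Q : QuantizationMap n M) (P : Symbol n M) :
    Module.End ℝ (SmoothFun n M) :=
  (Q P : Module.End ℝ (SmoothFun n M))

/-- `Q` intertwines the local actions of the conformal Lie algebra on symbols with values in
`(m - l)`-densities and on differential operators from `l`-densities to `m`-densities:
`Q(L_X^{m-l} P) = L_X^m ∘ Q(P) - Q(P) ∘ L_X^l`.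
As the vector fields `X` of the Lie algebra are only defined in the domain of an adapted chart `c`,
this is an identity of germs: `P'` and `f'` are global objects which coincide with
`L_X^{m-l} P` and `L_X^l f` near the point with coordinates `y`. -/
def QuantizationMap.IsEquivariant (Q : QuantizationMap n M) (g : PseudoRiemannianMetric n M)
    (p : ℕ) (l m : ℝ) : Prop :=
  ∀ c ∈ atlas (Coord n) M, ∀ X ∈ conformalAlgebra n p, ∀ y ∈ c.target,
    ∀ (P P' : Symbol n M) (f f' : SmoothFun n M),
      (∀ᶠ z in 𝓝 y,
        (∀ i j, P'.comp2 c z i j = lieTensor (g.coeff c) (m - l) X (P.comp2 c) z i j) ∧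
        (∀ i, P'.comp1 c z i = lieVector (g.coeff c) (m - l) X (P.comp1 c) z i) ∧
        P'.comp0 c z = lieDensity (g.coeff c) (m - l) X (P.comp0 c) z) →
      (∀ᶠ z in 𝓝 y,
        f' (c.symm z) = lieDensity (g.coeff c) l X (fun w => f (c.symm w)) z) →
      Q.op P' f (c.symm y)
        = lieDensity (g.coeff c) m X (fun w => Q.op P f (c.symm w)) y - Q.op P f' (c.symm y)

/-- `Q` preserves the principal symbol at each order: for `P` of degree at most `k`, the operator
`Q(P)` is of order at most `k`, with principal symbol the component of degree `k` of `P`. The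
principal symbol `σ` of an operator `T` of order `k` is determined by its commutators with
functions: `[…[T, f], …, f] = k! σ(df)`. -/
def QuantizationMap.PreservesPrincipalSymbol (Q : QuantizationMap n M) : Prop :=
  ∀ P : Symbol n M,
    (∀ (f u : SmoothFun n M) (x : M),
      opComm (opComm (Q.op P) f) f u x
        = 2 * P.1.1 x (differential f x) (differential f x) * u x) ∧
    (P.1.1 = 0 → ∀ (f u : SmoothFun n M) (x : M),
      opComm (Q.op P) f u x = differential f x (P.1.2.1 x) * u x) ∧
    (P.1.1 = 0 → P.1.2.1 = 0 → ∀ (u : SmoothFun n M) (x : M),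
      Q.op P u x = P.1.2.2 x * u x)

/-- The real part of a smooth complex-valued function. -/
def rePart (φ : SmoothFunC n M) : SmoothFun n M :=
  ⟨fun x => (φ x).re, (Complex.reCLM.contDiff (n := ∞)).contMDiff.comp φ.contMDiff⟩

/-- The imaginary part of a smooth complex-valued function. -/
def imPart (φ : SmoothFunC n M) : SmoothFun n M :=
  ⟨fun x => (φ x).im, (Complex.imCLM.contDiff (n := ∞)).contMDiff.comp φ.contMDiff⟩

/-- The complex-linear extension of a real operator to complex-valued functions. -/
def complexify (T : Module.End ℝ (SmoothFun n M)) (φ : SmoothFunC n M) (x : M) : ℂ :=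
  (T (rePart φ) x : ℂ) + Complex.I * (T (imPart φ) x : ℂ)

/-- The operator `Q_ħ(P) = Q(P(iħξ))` on complex-valued functions, for a real symbol
`P = P₂ + P₁ + P₀`. -/
def QuantizationMap.quantize (Q : QuantizationMap n M) (h : ℝ) (P : Symbol n M)
    (φ : SmoothFunC n M) (x : M) : ℂ :=
  (Complex.I * h) ^ 2 * complexify (Q.op P.part2) φ x
    + (Complex.I * h) * complexify (Q.op P.part1) φ x
    + complexify (Q.op P.part0) φ x

/-- All operators `Q_ħ(P)`, from `l`-densities to `m`-densities with `l + m = 1`, are symmetric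
(formally self-adjoint) for the pairing of compactly supported densities by integration. -/
def QuantizationMap.IsSymmetric [MeasurableSpace M] (Q : QuantizationMap n M)
    (g : PseudoRiemannianMetric n M) (h : ℝ) : Prop :=
  ∀ (P : Symbol n M) (φ ψ : SmoothFunC n M), HasCompactSupport φ → HasCompactSupport ψ →
    ∫ x, conj (φ x) * Q.quantize h P ψ x ∂g.vol
      = ∫ x, conj (Q.quantize h P φ x) * ψ x ∂g.vol

/-- `Q` is an isomorphism of modules over the conformal Lie algebra, from the symbols with values
in `(m - l)`-densities to the operators from `l`-densities to `m`-densities, which preserves the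
principal symbols and for which all operators `Q_ħ(P)` are symmetric. -/
structure QuantizationMap.IsSymmetricConformal [MeasurableSpace M] (Q : QuantizationMap n M)
    (g : PseudoRiemannianMetric n M) (p : ℕ) (h l m : ℝ) : Prop where
  equivariant : Q.IsEquivariant g p l m
  principalSymbol : Q.PreservesPrincipalSymbol
  symmetric : Q.IsSymmetric g h

end Manifold

end ConformalQuantization

end

noncomputable section

namespace ConformalQuantization

/-! ### Calculus of partial derivatives -/

section PartialDerivatives

variable {n : ℕ}

/-! Local construction. Densities are written relative to |vol|, and in an adapted chart the metric
is exp(2σ)η, so multiplication by exp(rnσ) = |vol|^r turns every coefficient into one of a density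
on flat space. There the quantization of P₂ + P₁ + P₀ is explicit: ∂_i P₂ⁱʲ ∂_j + a ∂_i∂_j P₂ⁱʲ + b
□(η_kl P₂ᵏˡ) + P₁ⁱ∂_i + ½ ∂_iP₁ⁱ + P₀. A conformal field X has divergence n·h with h affine, and its
second derivatives are linear in dh. Hence ∂P₂∂ fails to be equivariant only by a multiple of ⟨dh,
div P₂⟩, and the two other terms of degree two only by ⟨dh, div P₂⟩ and ⟨dh, d tr P₂⟩. With λ + μ =
1 everything cancels as soon as a and b solve the two linear equations `IsConformalWeights`
(`IsRingConformal.op_lieTensor`, `IsRingConformal.quant_lie`). These computations take place in an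
arbitrary commutative ring with commuting derivations and are transported to germs by means of
`SmoothFn`.

Gluing. Coordinate changes are only known to preserve the Lie algebra. Conjugation by powers of
|vol| brings the flat operator to the form div(P₂ df) + U f + lower terms, where everything but the
potential U is manifestly independent of the chart (`chartQuant_change`). The difference of the
potentials in two charts, at a point, is a linear functional of P₂ which is equivariant under the
conformal fields vanishing there. Such a functional is zero unless nδ is 1, 1 + n/2 or n + 1
(`symbolFunctional_eq_zero`): the dilation leaves only the quadratic Taylor coefficients of P₂, and
inversions and rotations force the remaining four-index tensor to vanish
(`invariantTensor_eq_zero`). For the three pairs nδ is 2, n and n + 2; the only resonance is nδ = 2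
= 1 + n/2 for n = 2, and there λ = 0, a = b = 0 and U = 0.

Bijectivity. A linear map which preserves principal symbols is onto the operators of order two,
because iterated commutators with functions are derivations, hence vector fields, and can be removed
order by order (`PreservesSymbols.surjective`).

Symmetry and uniqueness. Since the operators are real, symmetry of Q_ħ means that Q(P₂) is
self-adjoint and Q(P₁) skew-adjoint (`isSymmetric_iff`); for the divergence form this is Green's
identity. Two symmetric conformal isomorphisms agree in degree zero by the principal symbol and in
degree one by skewness; in degree two they differ by a function, which depends equivariantly on P₂
and so vanishes by the same functional lemma. For nδ = 2, |vol|^δ H has constant flat coefficients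
and is annihilated by dilations; the equivariance of the difference alone then determines Q(H),
which also settles n = 2 (`QuantizationMap.IsSymmetricConformal.op_hamiltonian`).

Value on H. The potential of H is a combination of □σ and |dσ|², and for the three pairs it is
proportional to the scalar curvature of exp(2σ)η (`chartPot_hamiltonian`). -/

theorem eventuallyEq_pd {V : Type*} [NormedAddCommGroup V] [NormedSpace ℝ V]
    {u v : Coord n → V} {y : Coord n} (h : u =ᶠ[𝓝 y] v) (i : Fin n) :
    pd i u =ᶠ[𝓝 y] pd i v := by
  filter_upwards [h.fderiv (𝕜 := ℝ)] with z hz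
  simp [pd, hz]

theorem pd_congr {V : Type*} [NormedAddCommGroup V] [NormedSpace ℝ V]
    {u v : Coord n → V} {y : Coord n} (h : u =ᶠ[𝓝 y] v) (i : Fin n) : pd i u y = pd i v y :=
  (eventuallyEq_pd h i).eq_of_nhds

theorem contDiff_pd {V : Type*} [NormedAddCommGroup V] [NormedSpace ℝ V] {u : Coord n → V}
    (h : ContDiff ℝ ∞ u) (i : Fin n) : ContDiff ℝ ∞ (pd i u) :=
  (h.fderiv_right (m := ∞) (by simp)).clm_apply contDiff_const

theorem contDiffAt_pd {V : Type*} [NormedAddCommGroup V] [NormedSpace ℝ V] {u : Coord n → V}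
    {y : Coord n} (h : ContDiffAt ℝ ∞ u y) (i : Fin n) : ContDiffAt ℝ ∞ (pd i u) y :=
  (h.fderiv_right (m := ∞) (by simp)).clm_apply contDiffAt_const

theorem pd_pd_comm {V : Type*} [NormedAddCommGroup V] [NormedSpace ℝ V] {u : Coord n → V}
    {y : Coord n} (h : ContDiffAt ℝ ∞ u y) (i j : Fin n) :
    pd i (pd j u) y = pd j (pd i u) y := by
  have hd : DifferentiableAt ℝ (fderiv ℝ u) y :=
    (h.fderiv_right (m := 1) (by norm_cast)).differentiableAt (by simp)
  have key : ∀ k l : Fin n, pd k (pd l u) y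
      = fderiv ℝ (fderiv ℝ u) y (Pi.single k 1) (Pi.single l 1) := fun k l => by
    unfold pd
    rw [fderiv_clm_apply hd (by fun_prop)]
    simp
  rw [key, key]
  exact (h.isSymmSndFDerivAt (by simpa using ENat.LEInfty.out)).eq _ _

theorem fderiv_apply_eq_sum {V : Type*} [NormedAddCommGroup V] [NormedSpace ℝ V]
    (u : Coord n → V) (y v : Coord n) : fderiv ℝ u y v = ∑ i, v i • pd i u y := by
  conv_lhs => rw [pi_eq_sum_univ' v]
  simp [pd, map_sum]

theorem pd_mul {u v : Coord n → ℝ} {y : Coord n} (hu : DifferentiableAt ℝ u y)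
    (hv : DifferentiableAt ℝ v y) (i : Fin n) :
    pd i (fun z => u z * v z) y = u y * pd i v y + v y * pd i u y := by
  unfold pd
  rw [fderiv_fun_mul hu hv]
  simp

theorem pd_add {V : Type*} [NormedAddCommGroup V] [NormedSpace ℝ V] {u v : Coord n → V}
    {y : Coord n} (hu : DifferentiableAt ℝ u y)
    (hv : DifferentiableAt ℝ v y) (i : Fin n) :
    pd i (fun z => u z + v z) y = pd i u y + pd i v y := by
  unfold pd
  rw [fderiv_fun_add hu hv]
  simp

theorem pd_const_mul {u : Coord n → ℝ} {y : Coord n} (hu : DifferentiableAt ℝ u y) (r : ℝ)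
    (i : Fin n) : pd i (fun z => r * u z) y = r * pd i u y := by
  rw [pd_mul (by fun_prop) hu]
  simp [pd]

theorem pd_sum {V : Type*} [NormedAddCommGroup V] [NormedSpace ℝ V] {ι : Type*} (s : Finset ι)
    {u : ι → Coord n → V} {y : Coord n} (hu : ∀ k ∈ s, DifferentiableAt ℝ (u k) y) (i : Fin n) :
    pd i (fun z => ∑ k ∈ s, u k z) y = ∑ k ∈ s, pd i (u k) y := by
  unfold pd
  rw [fderiv_fun_sum hu]
  simp

theorem pd_const {V : Type*} [NormedAddCommGroup V] [NormedSpace ℝ V] (a : V) (i : Fin n)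
    (y : Coord n) : pd i (fun _ : Coord n => a) y = 0 := by
  simp [pd]

theorem pd_coord (i k : Fin n) (y : Coord n) :
    pd i (fun z : Coord n => z k) y = if k = i then 1 else 0 := by
  unfold pd
  rw [(hasFDerivAt_apply k y).fderiv]
  simp [Pi.single_apply]

theorem pd_comp {m : ℕ} {V : Type*} [NormedAddCommGroup V] [NormedSpace ℝ V]
    {u : Coord m → V} {ψ : Coord n → Coord m} {y : Coord n}
    (hu : DifferentiableAt ℝ u (ψ y)) (hψ : DifferentiableAt ℝ ψ y) (i : Fin n) :
    pd i (fun z => u (ψ z)) y = ∑ a, pd i (fun z => ψ z a) y • pd a u (ψ y) := by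
  have h1 : pd i (fun z => u (ψ z)) y = fderiv ℝ u (ψ y) (fderiv ℝ ψ y (Pi.single i 1)) := by
    unfold pd
    rw [show (fun z => u (ψ z)) = u ∘ ψ from rfl, fderiv_comp y hu hψ]
    rfl
  rw [h1, fderiv_apply_eq_sum]
  refine Finset.sum_congr rfl fun a _ => ?_
  congr 1
  unfold pd
  rw [fderiv_apply hψ]
  rfl

end PartialDerivatives

/-! ### The algebra of smooth functions on the coordinate space -/

section SmoothAlgebra

variable (n : ℕ)

/-- The algebra of smooth real functions on `ℝⁿ`. -/
def smoothAlg : Subalgebra ℝ (Coord n → ℝ) where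
  carrier := {f | ContDiff ℝ ∞ f}
  mul_mem' := fun {f g} (hf : ContDiff ℝ ∞ f) (hg : ContDiff ℝ ∞ g) => hf.mul hg
  add_mem' := fun {f g} (hf : ContDiff ℝ ∞ f) (hg : ContDiff ℝ ∞ g) => hf.add hg
  algebraMap_mem' := fun r => by
    change ContDiff ℝ ∞ (fun _ => r)
    exact contDiff_const

/-- The ring of smooth real functions on `ℝⁿ`. -/
def SmoothFn : Type := smoothAlg n

variable {n}

instance : CommRing (SmoothFn n) := inferInstanceAs (CommRing (smoothAlg n))

instance : Algebra ℝ (SmoothFn n) := inferInstanceAs (Algebra ℝ (smoothAlg n))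

instance : FunLike (SmoothFn n) (Coord n) ℝ where
  coe f := f.1
  coe_injective _ _ h := Subtype.ext h

namespace SmoothFn

/-- The smooth function with the given values. -/
def mk (f : Coord n → ℝ) (hf : ContDiff ℝ ∞ f) : SmoothFn n := ⟨f, hf⟩

@[simp] theorem mk_apply (f : Coord n → ℝ) (hf : ContDiff ℝ ∞ f) (x : Coord n) :
    mk f hf x = f x := rfl

@[ext] theorem ext {f g : SmoothFn n} (h : ∀ x, f x = g x) : f = g := DFunLike.ext _ _ h

@[simp] theorem add_apply (f g : SmoothFn n) (x : Coord n) : (f + g) x = f x + g x := rfl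

@[simp] theorem sub_apply (f g : SmoothFn n) (x : Coord n) : (f - g) x = f x - g x := rfl

@[simp] theorem mul_apply (f g : SmoothFn n) (x : Coord n) : (f * g) x = f x * g x := rfl

@[simp] theorem neg_apply (f : SmoothFn n) (x : Coord n) : (-f) x = -f x := rfl

@[simp] theorem smul_apply (r : ℝ) (f : SmoothFn n) (x : Coord n) : (r • f) x = r * f x := rfl

@[simp] theorem zero_apply (x : Coord n) : (0 : SmoothFn n) x = 0 := rfl

@[simp] theorem one_apply (x : Coord n) : (1 : SmoothFn n) x = 1 := rfl

@[simp] theorem algebraMap_apply (r : ℝ) (x : Coord n) :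
    algebraMap ℝ (SmoothFn n) r x = r := rfl

/-- Evaluation at a point. -/
def evalHom (x : Coord n) : SmoothFn n →+* ℝ where
  toFun f := f x
  map_one' := rfl
  map_mul' _ _ := rfl
  map_zero' := rfl
  map_add' _ _ := rfl

@[simp] theorem sum_apply {ι : Type*} (s : Finset ι) (f : ι → SmoothFn n) (x : Coord n) :
    (∑ i ∈ s, f i) x = ∑ i ∈ s, f i x := map_sum (evalHom x) f s

@[simp] theorem natCast_apply (k : ℕ) (x : Coord n) : (k : SmoothFn n) x = k :=
  map_natCast (evalHom x) k

@[simp] theorem two_apply (x : Coord n) : (2 : SmoothFn n) x = 2 :=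
  map_ofNat (evalHom x) 2

end SmoothFn

theorem contDiff_coe (f : SmoothFn n) : ContDiff ℝ ∞ f := f.2

theorem differentiableAt_coe (f : SmoothFn n) (y : Coord n) :
    DifferentiableAt ℝ f y := ((contDiff_coe f).differentiable (by simp)) y

/-- The partial derivatives as derivations. -/
def der (i : Fin n) : Derivation ℝ (SmoothFn n) (SmoothFn n) :=
  Derivation.mk'
    { toFun := fun f => SmoothFn.mk (pd i f) (contDiff_pd (contDiff_coe f) i)
      map_add' := fun f g => SmoothFn.ext (fun y =>
        pd_add (differentiableAt_coe f y) (differentiableAt_coe g y) i)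
      map_smul' := fun r f => SmoothFn.ext (fun y =>
        pd_const_mul (differentiableAt_coe f y) r i) }
    fun f g => SmoothFn.ext (fun y => pd_mul (differentiableAt_coe f y) (differentiableAt_coe g y) i)

@[simp] theorem coe_der (i : Fin n) (f : SmoothFn n) :
    ⇑(der i f) = pd i f := rfl

theorem der_comm (i j : Fin n) (f : SmoothFn n) : der i (der j f) = der j (der i f) :=
  SmoothFn.ext (fun _ => pd_pd_comm (contDiff_coe f).contDiffAt i j)

/-- The coordinate functions, centered at `y`. -/
def cen (y : Coord n) (k : Fin n) : SmoothFn n :=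
  SmoothFn.mk (fun x => x k - y k) (by fun_prop)

@[simp] theorem cen_apply (y : Coord n) (k : Fin n) (x : Coord n) :
    cen y k x = x k - y k := rfl

theorem der_cen (y : Coord n) (i k : Fin n) : der i (cen y k) = if k = i then 1 else 0 := by
  refine SmoothFn.ext (fun x => ?_)
  have h : pd i (fun x : Coord n => x k - y k) x = if k = i then 1 else 0 := by
    have := pd_coord i k x
    unfold pd at this ⊢
    rw [fderiv_sub_const]
    exact this
  refine h.trans ?_
  split_ifs <;> rfl

/-- The exponential of a smooth function. -/
def smoothExp (f : SmoothFn n) : SmoothFn n :=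
  SmoothFn.mk (fun x => Real.exp (f x)) (Real.contDiff_exp.comp (contDiff_coe f))

@[simp] theorem smoothExp_apply (f : SmoothFn n) (x : Coord n) :
    smoothExp f x = Real.exp (f x) := rfl

theorem der_smoothExp (i : Fin n) (f : SmoothFn n) :
    der i (smoothExp f) = smoothExp f * der i f := by
  refine SmoothFn.ext (fun x => ?_)
  change pd i (fun x => Real.exp (f x)) x
    = Real.exp (f x) * pd i f x
  unfold pd
  rw [fderiv_exp (differentiableAt_coe f x)]
  simp

theorem smoothExp_add (f g : SmoothFn n) : smoothExp (f + g) = smoothExp f * smoothExp g :=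
  SmoothFn.ext (fun _ => Real.exp_add _ _)

theorem smoothExp_zero : smoothExp (0 : SmoothFn n) = 1 :=
  SmoothFn.ext (fun _ => Real.exp_zero)

/-- A function which is smooth at a point has the germ of a globally smooth function. -/
theorem exists_smoothAlg_eventuallyEq {u : Coord n → ℝ} {y : Coord n} {s : Set (Coord n)}
    (hs : s ∈ 𝓝 y) (hu : ContDiffOn ℝ ∞ u s) :
    ∃ f : SmoothFn n, u =ᶠ[𝓝 y] f := by
  obtain ⟨r, hr, hrs⟩ := Metric.nhds_basis_closedBall.mem_iff.1 hs
  let χ : ContDiffBump y := ⟨r / 3, r / 2, by positivity, by linarith⟩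
  have hsupp : tsupport χ ⊆ interior s := by
    rw [χ.tsupport_eq]
    refine (Metric.closedBall_subset_ball (by change r / 2 < r; linarith)).trans ?_
    exact (interior_maximal (Metric.ball_subset_closedBall.trans hrs) Metric.isOpen_ball)
  refine ⟨SmoothFn.mk (fun x => χ x * u x) ?_, ?_⟩
  · refine contDiff_iff_contDiffAt.2 fun x => ?_
    by_cases hx : x ∈ tsupport χ
    · exact χ.contDiff.contDiffAt.mul
        ((hu.contDiffAt (mem_interior_iff_mem_nhds.1 (hsupp hx))))
    · have : (fun x => χ x * u x) =ᶠ[𝓝 x] fun _ => 0 := by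
        filter_upwards [(isClosed_tsupport χ).isOpen_compl.mem_nhds hx] with z hz
        simp [image_eq_zero_of_notMem_tsupport hz]
      exact contDiffAt_const.congr_of_eventuallyEq this
  · filter_upwards [χ.eventuallyEq_one] with z hz
    simp [hz]

/-! ### Averages along segments and the Hadamard lemma -/

/-- Differentiation under the integral reproduces an integral of the same shape, with `j + 1` in
place of `j` and `fderiv ℝ r` in place of `r`. The induction on the order of smoothness therefore
has to range over all exponents and all target spaces. -/
theorem contDiff_segmentIntegral (y : Coord n) (k : ℕ) : ∀ {E : Type} [NormedAddCommGroup E]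
    [NormedSpace ℝ E] [CompleteSpace E] (j : ℕ) (r : Coord n → E), ContDiff ℝ ∞ r →
    ContDiff ℝ k (fun x => ∫ t in (0 : ℝ)..1, t ^ j • r (y + t • (x - y))) ∧
    ∀ x, HasFDerivAt (fun x => ∫ t in (0 : ℝ)..1, t ^ j • r (y + t • (x - y)))
      (∫ t in (0 : ℝ)..1, t ^ (j + 1) • fderiv ℝ r (y + t • (x - y))) x := by
  have hder : ∀ {E : Type} [NormedAddCommGroup E]
      [NormedSpace ℝ E] [CompleteSpace E] (j : ℕ) (r : Coord n → E), ContDiff ℝ ∞ r →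
      ∀ x, HasFDerivAt (fun x => ∫ t in (0 : ℝ)..1, t ^ j • r (y + t • (x - y)))
      (∫ t in (0 : ℝ)..1, t ^ (j + 1) • fderiv ℝ r (y + t • (x - y))) x := by
    intro E _ _ _ j r hr x
    have hrd : Differentiable ℝ r := hr.differentiable (by simp)
    have hfc : Continuous (fderiv ℝ r) := hr.continuous_fderiv (by simp)
    have hF' : Continuous fun q : ℝ × Coord n =>
        q.1 ^ (j + 1) • fderiv ℝ r (y + q.1 • (q.2 - y)) := by fun_prop
    obtain ⟨C, hC⟩ := (isCompact_Icc.prod (isCompact_closedBall x 1)).exists_bound_of_continuousOn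
      (f := fun q : ℝ × Coord n => q.1 ^ (j + 1) • fderiv ℝ r (y + q.1 • (q.2 - y)))
      (s := Set.Icc (0 : ℝ) 1 ×ˢ Metric.closedBall x 1) hF'.continuousOn
    refine (intervalIntegral.hasFDerivAt_integral_of_dominated_of_fderiv_le
      (F := fun x t => t ^ j • r (y + t • (x - y)))
      (F' := fun x t => t ^ (j + 1) • fderiv ℝ r (y + t • (x - y)))
      (s := Metric.closedBall x 1) (bound := fun _ => C)
      (Metric.closedBall_mem_nhds x one_pos) ?_ ?_ ?_ ?_ ?_ ?_)
    · exact Filter.Eventually.of_forall fun z => (by fun_prop : Continuous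
        fun t : ℝ => t ^ j • r (y + t • (z - y))).aestronglyMeasurable
    · exact (by fun_prop : Continuous
        fun t : ℝ => t ^ j • r (y + t • (x - y))).intervalIntegrable _ _
    · exact (by fun_prop : Continuous
        fun t : ℝ => t ^ (j + 1) • fderiv ℝ r (y + t • (x - y))).aestronglyMeasurable
    · refine Filter.Eventually.of_forall fun t ht z hz => hC (t, z) ⟨?_, hz⟩
      rw [Set.uIoc_of_le zero_le_one] at ht
      exact ⟨ht.1.le, ht.2⟩
    · exact intervalIntegrable_const
    · refine Filter.Eventually.of_forall fun t _ z _ => ?_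
      have h1 : HasFDerivAt (fun x : Coord n => y + t • (x - y))
          (t • ContinuousLinearMap.id ℝ (Coord n)) z :=
        (((hasFDerivAt_id z).sub_const y).const_smul t).const_add y
      have h2 := ((hrd (y + t • (z - y))).hasFDerivAt.comp z h1).const_smul (t ^ j)
      refine h2.congr_fderiv ?_
      ext v
      simp [pow_succ, mul_smul]
  induction k with
  | zero =>
    intro E _ _ _ j r hr
    refine ⟨?_, hder j r hr⟩
    have h : Differentiable ℝ (fun x => ∫ t in (0 : ℝ)..1, t ^ j • r (y + t • (x - y))) :=
      fun x => (hder j r hr x).differentiableAt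
    exact contDiff_zero.2 h.continuous
  | succ k ih =>
    intro E _ _ _ j r hr
    refine ⟨?_, hder j r hr⟩
    push_cast
    rw [contDiff_succ_iff_hasFDerivAt]
    · exact ⟨_, (ih (j + 1) (fderiv ℝ r) (hr.fderiv_right (by simp))).1, hder j r hr⟩

/-- The average of a smooth function along the segments from `y`. -/
def avg (y : Coord n) (r : SmoothFn n) : SmoothFn n :=
  SmoothFn.mk (fun x => ∫ t in (0 : ℝ)..1, r (y + t • (x - y))) (by
    refine contDiff_infty.2 fun k => ?_
    simpa using (contDiff_segmentIntegral y k 0 r (contDiff_coe r)).1)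

/-- The integrand is the derivative of tʲ r(y + t(x - y)). The convention `0 ^ 0 = 1` lets one
statement serve both uses: `j = 0` gives the Hadamard lemma, and `j = 1` inverts E + 1 for the Euler
field E. -/
theorem segment_ftc (y x : Coord n) (r : SmoothFn n) (j : ℕ) :
    ∫ t in (0 : ℝ)..1, ((j : ℝ) * t ^ (j - 1) * r (y + t • (x - y))
      + t ^ j * fderiv ℝ r (y + t • (x - y)) (x - y))
      = r x - 0 ^ j * r y := by
  have hrd : Differentiable ℝ r := (contDiff_coe r).differentiable (by simp)
  have hrc : Continuous r := hrd.continuous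
  have hfc : Continuous (fderiv ℝ r) := (contDiff_coe r).continuous_fderiv (by simp)
  have hd : ∀ t : ℝ, HasDerivAt (fun t : ℝ => t ^ j * r (y + t • (x - y)))
      ((j : ℝ) * t ^ (j - 1) * r (y + t • (x - y))
      + t ^ j * fderiv ℝ r (y + t • (x - y)) (x - y)) t := fun t => by
    have h1 : HasDerivAt (fun t : ℝ => y + t • (x - y)) (x - y) t := by
      simpa using ((hasDerivAt_id t).smul_const (x - y)).const_add y
    exact (hasDerivAt_pow j t).mul ((hrd (y + t • (x - y))).hasFDerivAt.comp_hasDerivAt t h1)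
  rw [intervalIntegral.integral_eq_sub_of_hasDerivAt (fun t _ => hd t)
    ((by fun_prop : Continuous _).intervalIntegrable _ _)]
  simp

/-- The average `s` of `r` satisfies `E s + s = r` for the Euler field `E` centered at `y`. -/
theorem euler_avg (y : Coord n) (r : SmoothFn n) :
    ∑ k, cen y k * der k (avg y r) + avg y r = r := by
  refine SmoothFn.ext (fun x => ?_)
  have h0 := (contDiff_segmentIntegral y 0 0 r (contDiff_coe r)).2 x
  have hfc : Continuous (fderiv ℝ r) := (contDiff_coe r).continuous_fderiv (by simp)
  have hrc : Continuous r := (contDiff_coe r).continuous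
  have h1 : (∑ k, (x k - y k) * pd k (avg y r) x)
      = ∫ t in (0 : ℝ)..1, t * fderiv ℝ r (y + t • (x - y)) (x - y) := by
    have h2 := fderiv_apply_eq_sum (avg y r) x (x - y)
    have h3 : fderiv ℝ (avg y r) x
        = ∫ t in (0 : ℝ)..1, t ^ (0 + 1) • fderiv ℝ r (y + t • (x - y)) := by
      refine HasFDerivAt.fderiv ?_
      simp only [pow_zero, one_smul] at h0
      exact h0
    rw [h3, ContinuousLinearMap.intervalIntegral_apply] at h2
    · simpa using h2.symm
    · exact (by fun_prop : Continuous _).intervalIntegrable _ _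
  have h4 := segment_ftc y x r 1
  rw [intervalIntegral.integral_add] at h4
  · simp only [Nat.cast_one, one_mul, Nat.sub_self, pow_zero, pow_one, zero_mul, sub_zero] at h4
    have h5 : ((∑ k, cen y k * der k (avg y r) + avg y r : SmoothFn n)) x
        = (∑ k, (x k - y k) * pd k (avg y r) x)
          + ∫ t in (0 : ℝ)..1, r (y + t • (x - y)) := by
      simp [avg]
    rw [h5, h1, add_comm]
    exact h4
  · exact (by fun_prop : Continuous _).intervalIntegrable _ _
  · exact (by fun_prop : Continuous _).intervalIntegrable _ _

/-- The Hadamard lemma. -/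
theorem hadamard (y : Coord n) (r : SmoothFn n) :
    r = algebraMap ℝ (SmoothFn n) (r y) + ∑ k, cen y k * avg y (der k r) := by
  refine SmoothFn.ext (fun x => ?_)
  have hfc : Continuous (fderiv ℝ r) := (contDiff_coe r).continuous_fderiv (by simp)
  have h4 := segment_ftc y x r 0
  simp only [CharP.cast_eq_zero, zero_mul, zero_add, pow_zero, one_mul] at h4
  have h1 : (∑ k, (x k - y k) * ∫ t in (0 : ℝ)..1, pd k r (y + t • (x - y)))
      = ∫ t in (0 : ℝ)..1, fderiv ℝ r (y + t • (x - y)) (x - y) := by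
    simp_rw [fderiv_apply_eq_sum, ← intervalIntegral.integral_const_mul]
    rw [← intervalIntegral.integral_finsetSum]
    · simp
    · intro k _
      have : Continuous (pd k r) := (contDiff_pd (contDiff_coe r) k).continuous
      exact (by fun_prop : Continuous _).intervalIntegrable _ _
  have h5 : ((algebraMap ℝ (SmoothFn n) (r y)
      + ∑ k, cen y k * avg y (der k r) : SmoothFn n)) x
      = r y
        + ∑ k, (x k - y k) * ∫ t in (0 : ℝ)..1, pd k r (y + t • (x - y)) := by
    simp [avg]
  rw [h5, h1, h4]
  ring

end SmoothAlgebra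

end ConformalQuantization
end

noncomputable section

namespace ConformalQuantization

/-! ### Lie derivatives and second order operators over a ring with commuting derivations -/

section RingCalculus

variable {n : ℕ} {R : Type*} [CommRing R] [Algebra ℝ R] (d : Fin n → Derivation ℝ R R)

/-- The divergence of a vector field. -/
def ringDiv (X : Fin n → R) : R := ∑ i, d i (X i)

/-- The derivative of a function along a vector field. -/
def ringAlong (X : Fin n → R) (f : R) : R := ∑ i, X i * d i f

/-- The Lie derivative of a density of weight `w`. -/
def ringLie (w : R) (X : Fin n → R) (f : R) : R := ringAlong d X f + w * (ringDiv d X * f)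

/-- The Lie derivative of a contravariant two-tensor with values in `w`-densities. -/
def ringLieTensor (w : R) (X : Fin n → R) (p : Fin n → Fin n → R) (k l : Fin n) : R :=
  ∑ i, (X i * d i (p k l) - d i (X k) * p i l - d i (X l) * p k i) + w * (ringDiv d X * p k l)

/-- The Lie derivative of a vector with values in `w`-densities. -/
def ringLieVector (w : R) (X : Fin n → R) (A : Fin n → R) (k : Fin n) : R :=
  ∑ i, (X i * d i (A k) - d i (X k) * A i) + w * (ringDiv d X * A k)

/-- The second order operator `∂_i pⁱʲ ∂_j`. -/
def ringDivGrad (p : Fin n → Fin n → R) (f : R) : R := ∑ i, ∑ j, d i (p i j * d j f)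

/-- The zeroth order term `a ∂_i ∂_j pⁱʲ + b □ (η_kl pᵏˡ)`. -/
def ringPot (e : Fin n → R) (a b : R) (p : Fin n → Fin n → R) : R :=
  a * ∑ i, ∑ j, d i (d j (p i j)) + b * ∑ i, ∑ k, e i * e k * d i (d i (p k k))

/-- The operator `∂_i pⁱʲ ∂_j + a ∂_i ∂_j pⁱʲ + b □ (η_kl pᵏˡ)`. -/
def ringOp (e : Fin n → R) (a b : R) (p : Fin n → Fin n → R) (f : R) : R :=
  ringDivGrad d p f + ringPot d e a b p * f

theorem derivation_two (D : Derivation ℝ R R) : D 2 = 0 := by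
  simpa using D.map_natCast 2

/-- Sums over pairs of indices agree if the summands agree up to an antisymmetric term. -/
theorem sum_sum_congr_swap {M : Type*} [AddCommGroup M] {E G : Fin n → Fin n → M}
    (A : Fin n → Fin n → M) (h : ∀ i j, E i j = G i j + A i j - A j i) :
    ∑ i, ∑ j, E i j = ∑ i, ∑ j, G i j := by
  simp only [h, Finset.sum_sub_distrib, Finset.sum_add_distrib]
  rw [Finset.sum_comm (f := fun i j => A j i)]
  abel

variable {d} (hd : ∀ i j f, d i (d j f) = d j (d i f))

include hd in
/-- The divergence intertwines the Lie derivatives. -/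
theorem ringDiv_lieVector (X W : Fin n → R) :
    ringDiv d (ringLieVector d 1 X W) = ringLie d 1 X (ringDiv d W) := by
  have h1 : ringLie d 1 X (ringDiv d W)
      = ∑ l, ∑ i, (X i * d i (d l (W l)) + d l (X l) * d i (W i)) := by
    simp only [ringLie, ringAlong, ringDiv, one_mul, Finset.sum_add_distrib, map_sum,
      Finset.mul_sum, Finset.sum_mul]
    rw [Finset.sum_comm]
    congr 1
    rw [Finset.sum_comm]
  rw [h1]
  have h2 : ringDiv d (ringLieVector d 1 X W)
      = ∑ l, ∑ i, (d l (X i) * d i (W l) + X i * d l (d i (W l)) - d l (d i (X l)) * W i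
        - d i (X l) * d l (W i) + (d l (d i (X i)) * W l + d i (X i) * d l (W l))) := by
    simp only [ringLieVector, ringDiv, one_mul, map_add, map_sum, map_sub, Derivation.leibniz,
      smul_eq_mul, Finset.sum_mul]
    refine Finset.sum_congr rfl fun l _ => ?_
    rw [← Finset.sum_add_distrib]
    refine Finset.sum_congr rfl fun i _ => ?_
    ring
  rw [h2]
  -- The two sides agree only after summation: the listed terms occur on one side with the indices
  -- exchanged. The second derivatives of X cancel in this way, which is why weight one needs no
  -- condition on X.
  refine sum_sum_congr_swap (fun l i => d l (X i) * d i (W l) + d i (X i) * d l (W l)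
    + d l (d i (X i)) * W l) fun l i => ?_
  rw [hd l i (W l), hd l i (X l)]
  ring

include hd in
/-- The flux `p df` is natural under Lie derivatives. -/
theorem ringLieVector_flux (X : Fin n → R) (p : Fin n → Fin n → R) (f : R) (k : Fin n) :
    ringLieVector d 1 X (fun k => ∑ j, p k j * d j f) k
      = ∑ j, ringLieTensor d 1 X p k j * d j f + ∑ j, p k j * d j (ringAlong d X f) := by
  have h1 : ringLieVector d 1 X (fun k => ∑ j, p k j * d j f) k
      = ∑ i, ∑ j, (X i * (p k j * d i (d j f) + d j f * d i (p k j)) - d i (X k) * (p i j * d j f)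
        + d i (X i) * (p k j * d j f)) := by
    rw [ringLieVector, ringDiv, one_mul, Finset.sum_mul, ← Finset.sum_add_distrib]
    refine Finset.sum_congr rfl fun i _ => ?_
    simp only [map_sum, Derivation.leibniz, smul_eq_mul, Finset.mul_sum, ← Finset.sum_sub_distrib,
      ← Finset.sum_add_distrib]
  have h2 : ∑ j, ringLieTensor d 1 X p k j * d j f + ∑ j, p k j * d j (ringAlong d X f)
      = ∑ i, ∑ j, ((X i * d i (p k j) - d i (X k) * p i j - d i (X j) * p k i) * d j f
        + d i (X i) * p k j * d j f + p k j * (X i * d j (d i f) + d i f * d j (X i))) := by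
    rw [Finset.sum_comm, ← Finset.sum_add_distrib]
    refine Finset.sum_congr rfl fun j _ => ?_
    simp only [ringLieTensor, ringAlong, ringDiv, one_mul, map_sum, Derivation.leibniz,
      smul_eq_mul, Finset.sum_mul, Finset.mul_sum, add_mul, ← Finset.sum_add_distrib]
  rw [h1, h2]
  refine sum_sum_congr_swap (fun i j => d i (X j) * p k i * d j f) fun i j => ?_
  rw [hd j i f]
  ring

theorem ringDivGrad_eq (p : Fin n → Fin n → R) (f : R) :
    ringDivGrad d p f = ringDiv d (fun i => ∑ j, p i j * d j f) := by
  simp only [ringDivGrad, ringDiv, map_sum]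

include hd in
/-- `∂_i pⁱʲ ∂_j` is an invariant operator from functions to `1`-densities. -/
theorem ringDivGrad_lieTensor_one (X : Fin n → R) (p : Fin n → Fin n → R) (f : R) :
    ringDivGrad d (ringLieTensor d 1 X p) f
      = ringLie d 1 X (ringDivGrad d p f) - ringDivGrad d p (ringAlong d X f) := by
  rw [ringDivGrad_eq, ringDivGrad_eq, ringDivGrad_eq, ← ringDiv_lieVector hd, eq_sub_iff_add_eq]
  unfold ringDiv
  rw [← Finset.sum_add_distrib]
  refine Finset.sum_congr rfl fun i _ => ?_
  rw [ringLieVector_flux hd, map_add]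

theorem ringDivGrad_smul (p : Fin n → Fin n → R) (h f : R) :
    ringDivGrad d (fun i j => h * p i j) f
      = h * ringDivGrad d p f + ∑ i, ∑ j, p i j * d i h * d j f := by
  simp only [ringDivGrad, Finset.mul_sum, ← Finset.sum_add_distrib, Derivation.leibniz,
    smul_eq_mul]
  refine Finset.sum_congr rfl fun i _ => Finset.sum_congr rfl fun j _ => ?_
  ring

theorem ringDivGrad_mul {p : Fin n → Fin n → R} (hp : ∀ i j, p i j = p j i) (h f : R) :
    ringDivGrad d p (h * f)
      = h * ringDivGrad d p f + 2 * (∑ i, ∑ j, p i j * d i h * d j f) + ringDivGrad d p h * f := by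
  simp only [ringDivGrad, Finset.mul_sum, Finset.sum_mul, ← Finset.sum_add_distrib,
    Derivation.leibniz, smul_eq_mul, map_add]
  refine sum_sum_congr_swap (fun i j => p i j * d i f * d j h) fun i j => ?_
  rw [hp j i]
  ring

theorem ringDivGrad_sub (p q : Fin n → Fin n → R) (f : R) :
    ringDivGrad d (fun i j => p i j - q i j) f = ringDivGrad d p f - ringDivGrad d q f := by
  simp only [ringDivGrad, sub_mul, map_sub, Finset.sum_sub_distrib]

theorem ringDivGrad_add_right (p : Fin n → Fin n → R) (f f' : R) :
    ringDivGrad d p (f + f') = ringDivGrad d p f + ringDivGrad d p f' := by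
  simp only [ringDivGrad, mul_add, map_add, Finset.sum_add_distrib]

theorem ringDivGrad_const_mul {p : Fin n → Fin n → R} {w : R} (hw : ∀ i, d i w = 0) (f : R) :
    ringDivGrad d p (w * f) = w * ringDivGrad d p f := by
  simp only [ringDivGrad, Derivation.leibniz, hw, smul_eq_mul, mul_zero, add_zero,
    Finset.mul_sum]
  refine Finset.sum_congr rfl fun i _ => Finset.sum_congr rfl fun j _ => ?_
  ring

theorem ringDivGrad_const_smul {p : Fin n → Fin n → R} {w : R} (hw : ∀ i, d i w = 0) (f : R) :
    ringDivGrad d (fun i j => w * p i j) f = w * ringDivGrad d p f := by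
  rw [ringDivGrad_smul]
  simp [hw]

/-- A vector field on the flat model with conformal factor `h`: the first and second derivatives
are those of a conformal Killing field of `diag(e)`. -/
structure IsRingConformal (d : Fin n → Derivation ℝ R R) (e : Fin n → R) (X : Fin n → R)
    (h : R) : Prop where
  div_eq : ringDiv d X = n * h
  first : ∀ i j, e j * d i (X j) + e i * d j (X i) = if i = j then 2 * e i * h else 0
  second : ∀ a b j, d a (d b (X j)) = (if j = a then d b h else 0) + (if j = b then d a h else 0)
    - (if a = b then e a * e j * d j h else 0)
  third : ∀ a b, d a (d b h) = 0

variable {e : Fin n → R} {X : Fin n → R} {h : R}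

include hd in
-- The divergence fails to commute with the Lie derivative only through second derivatives of X, and
-- these are linear in dh. The coefficient of ⟨dh, p⟩ is nw from the density factor, -n from ∂_k∂_i
-- Xᵏ = n ∂_i h, and -2 from ∂_k∂_i Xˡ, whose metric part also leaves the trace term.
theorem IsRingConformal.divTensor (hX : IsRingConformal d e X h) {w : R} (hw : ∀ i, d i w = 0)
    {p : Fin n → Fin n → R} (hp : ∀ i j, p i j = p j i) (l : Fin n) :
    ∑ k, d k (ringLieTensor d w X p k l)
      = ringLieVector d w X (fun l => ∑ k, d k (p k l)) l
        + (n * w - n - 2) * ∑ i, d i h * p i l + e l * d l h * ∑ k, e k * p k k := by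
  have h1 : ∑ k, d k (ringLieTensor d w X p k l)
      = ∑ k, ∑ i, (d k (X i) * d i (p k l) + X i * d k (d i (p k l)) - d k (d i (X k)) * p i l
        - d i (X k) * d k (p i l) - d k (d i (X l)) * p k i - d i (X l) * d k (p k i)) +
        ∑ k, (w * n * d k h * p k l + w * n * h * d k (p k l)) := by
    rw [← Finset.sum_add_distrib]
    refine Finset.sum_congr rfl fun k _ => ?_
    rw [ringLieTensor, hX.div_eq, map_add, map_sum]
    congr 1
    · refine Finset.sum_congr rfl fun i _ => ?_
      simp only [map_sub, Derivation.leibniz, smul_eq_mul]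
      ring
    · simp only [Derivation.leibniz, smul_eq_mul, hw, Derivation.map_natCast]
      ring
  have h2 : ringLieVector d w X (fun l => ∑ k, d k (p k l)) l
      = ∑ k, ∑ i, (X i * d i (d k (p k l)) - d i (X l) * d k (p k i))
        + ∑ k, w * n * h * d k (p k l) := by
    rw [ringLieVector, hX.div_eq, Finset.sum_comm]
    simp only [map_sum, Finset.mul_sum, Finset.sum_sub_distrib]
    congr 1
    refine Finset.sum_congr rfl fun i _ => ?_
    ring
  have h3 : ∑ k, ∑ i, d k (d i (X k)) * p i l = n * ∑ i, d i h * p i l := by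
    rw [Finset.sum_comm, Finset.mul_sum]
    refine Finset.sum_congr rfl fun i _ => ?_
    rw [← Finset.sum_mul]
    have : ∑ k, d k (d i (X k)) = d i (ringDiv d X) := by
      rw [ringDiv, map_sum]
      exact Finset.sum_congr rfl fun k _ => hd _ _ _
    rw [this, hX.div_eq]
    simp [Derivation.leibniz]
    ring
  have h4 : ∑ k, ∑ i, d k (d i (X l)) * p k i
      = 2 * ∑ i, d i h * p i l - e l * d l h * ∑ k, e k * p k k := by
    simp only [hX.second, sub_mul, add_mul, ite_mul, zero_mul, Finset.sum_sub_distrib,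
      Finset.sum_add_distrib, Finset.sum_ite_eq, Finset.mem_univ, if_true]
    have h5 : ∑ k, ∑ i, (if l = k then d i h * p k i else 0) = ∑ i, d i h * p i l := by
      rw [Finset.sum_comm]
      simp only [Finset.sum_ite_eq, Finset.mem_univ, if_true]
      exact Finset.sum_congr rfl fun i _ => by rw [hp]
    have h6 : ∑ k, e k * e l * d l h * p k k = e l * d l h * ∑ k, e k * p k k := by
      rw [Finset.mul_sum]
      exact Finset.sum_congr rfl fun i _ => by ring
    rw [h5, h6, two_mul]
  have h6 : ∑ k, ∑ i, (d k (X i) * d i (p k l) - d i (X k) * d k (p i l)) = 0 := by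
    simp only [Finset.sum_sub_distrib]
    rw [Finset.sum_comm (f := fun k i => d i (X k) * d k (p i l))]
    ring
  have h7 : ∑ k, ∑ i, (d k (X i) * d i (p k l) + X i * d k (d i (p k l)) - d k (d i (X k)) * p i l
        - d i (X k) * d k (p i l) - d k (d i (X l)) * p k i - d i (X l) * d k (p k i))
      = ∑ k, ∑ i, (d k (X i) * d i (p k l) - d i (X k) * d k (p i l))
        + ∑ k, ∑ i, (X i * d i (d k (p k l)) - d i (X l) * d k (p k i))
        - ∑ k, ∑ i, d k (d i (X k)) * p i l - ∑ k, ∑ i, d k (d i (X l)) * p k i := by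
    simp only [← Finset.sum_add_distrib, ← Finset.sum_sub_distrib]
    refine Finset.sum_congr rfl fun k _ => Finset.sum_congr rfl fun i _ => ?_
    rw [hd k i (p k l)]
    ring
  have h8 : ∑ k, (w * n * d k h * p k l + w * n * h * d k (p k l))
      = w * n * ∑ i, d i h * p i l + ∑ k, w * n * h * d k (p k l) := by
    rw [Finset.sum_add_distrib, Finset.mul_sum]
    congr 1
    exact Finset.sum_congr rfl fun i _ => by ring
  rw [h1, h2, h7, h6, h3, h4, h8]
  ring

include hd in
-- For weight one the divergence is natural. Any other weight adds (w - 1) n h W to the Lie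
-- derivative, and the divergence of this term contributes the derivative of h.
theorem IsRingConformal.divVector (hX : IsRingConformal d e X h) {w : R} (hw : ∀ i, d i w = 0)
    (W : Fin n → R) :
    ringDiv d (ringLieVector d w X W)
      = ringLie d w X (ringDiv d W) + (n * w - n) * ∑ i, d i h * W i := by
  have h1 : ringLieVector d w X W = fun k => ringLieVector d 1 X W k + (w - 1) * (n * h * W k) := by
    funext k
    simp only [ringLieVector, hX.div_eq]
    ring
  rw [h1]
  have h2 := ringDiv_lieVector hd X W
  have h3 : ringDiv d (fun k => ringLieVector d 1 X W k + (w - 1) * (n * h * W k))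
      = ringDiv d (ringLieVector d 1 X W)
        + (w - 1) * n * (∑ i, d i h * W i + h * ringDiv d W) := by
    simp only [ringDiv, map_add, Finset.sum_add_distrib, Finset.mul_sum, mul_add]
    rw [← Finset.sum_add_distrib, ← Finset.sum_add_distrib]
    rw [← Finset.sum_add_distrib]
    refine Finset.sum_congr rfl fun i _ => ?_
    simp only [Derivation.leibniz, smul_eq_mul, map_sub, hw, Derivation.map_natCast,
      Derivation.map_one_eq_zero]
    ring
  rw [h3, h2, ringLie, ringLie, hX.div_eq]
  ring

/-- The trace of a Lie derivative. -/
theorem IsRingConformal.traceTensor (hX : IsRingConformal d e X h)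
    (hed : ∀ i j, d i (e j) = 0)
    {w : R} {p : Fin n → Fin n → R} (hp : ∀ i j, p i j = p j i) :
    ∑ k, e k * ringLieTensor d w X p k k
      = ringAlong d X (∑ k, e k * p k k) + (n * w - 2) * h * ∑ k, e k * p k k := by
  have h1 : ∑ k, e k * ringLieTensor d w X p k k
      = ∑ k, ∑ i, (e k * X i * d i (p k k)) - ∑ k, ∑ i, 2 * e k * d i (X k) * p i k
        + n * w * h * ∑ k, e k * p k k := by
    simp only [ringLieTensor, hX.div_eq, mul_add, Finset.sum_add_distrib, Finset.mul_sum]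
    congr 1
    · rw [← Finset.sum_sub_distrib]
      refine Finset.sum_congr rfl fun k _ => ?_
      rw [← Finset.sum_sub_distrib]
      refine Finset.sum_congr rfl fun i _ => ?_
      rw [hp k i]
      ring
    · exact Finset.sum_congr rfl fun k _ => by ring
  have h2 : ∑ k, ∑ i, 2 * e k * d i (X k) * p i k = ∑ k, ∑ i, if i = k then 2 * e i * h * p i k
      else 0 := by
    -- As p is symmetric, only the symmetric part of the lowered derivative of X enters, and this is
    -- given by the conformal Killing equation.
    refine sum_sum_congr_swap (fun k i => e k * d i (X k) * p i k) fun k i => ?_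
    have := hX.first i k
    have h3 := congrArg (· * p i k) this
    simp only [ite_mul, zero_mul] at h3
    rw [← h3, hp k i]
    ring
  have h4 : ringAlong d X (∑ k, e k * p k k) = ∑ k, ∑ i, (e k * X i * d i (p k k)) := by
    rw [Finset.sum_comm]
    refine Finset.sum_congr rfl fun i _ => ?_
    simp only [map_sum, Derivation.leibniz, hed, smul_eq_mul, mul_zero, add_zero, Finset.mul_sum]
    exact Finset.sum_congr rfl fun k _ => by ring
  rw [h1, h2, h4]
  simp only [Finset.sum_ite_eq', Finset.mem_univ, if_true]
  have h5 : ∑ k, 2 * e k * h * p k k = 2 * h * ∑ k, e k * p k k := by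
    rw [Finset.mul_sum]
    exact Finset.sum_congr rfl fun k _ => by ring
  rw [h5]
  ring

/-- The flat d'Alembertian of a Lie derivative along a conformal field. -/
theorem IsRingConformal.boxAlong (hd : ∀ i j f, d i (d j f) = d j (d i f))
    (hX : IsRingConformal d e X h) (he : ∀ i, e i * e i = 1)
    (hed : ∀ i j, d i (e j) = 0) (t : R) :
    ∑ a, e a * d a (d a (ringAlong d X t))
      = ringAlong d X (∑ a, e a * d a (d a t)) + 2 * h * ∑ a, e a * d a (d a t)
        + (2 - n) * ∑ a, e a * d a h * d a t := by
  have h1 : ∑ a, e a * d a (d a (ringAlong d X t))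
      = ∑ a, ∑ i, e a * d a (d a (X i)) * d i t + ∑ a, ∑ i, 2 * e a * d a (X i) * d a (d i t)
        + ∑ a, ∑ i, e a * X i * d i (d a (d a t)) := by
    simp only [← Finset.sum_add_distrib]
    refine Finset.sum_congr rfl fun a _ => ?_
    simp only [ringAlong, map_sum, Finset.mul_sum, Derivation.leibniz, smul_eq_mul, map_add]
    refine Finset.sum_congr rfl fun i _ => ?_
    rw [hd i a (d a t), hd i a t]
    ring
  have h2 : ∑ a, ∑ i, e a * d a (d a (X i)) * d i t = (2 - n) * ∑ a, e a * d a h * d a t := by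
    have h3 : ∀ a i, e a * d a (d a (X i)) * d i t
        = (if i = a then 2 * (e a * d a h * d a t) else 0) - e i * d i h * d i t := fun a i => by
      rw [hX.second, if_pos rfl]
      split_ifs with h4
      · subst h4
        linear_combination (-e i * d i h * d i t) * he i
      · linear_combination (-e i * d i h * d i t) * he a
    simp only [h3, Finset.sum_sub_distrib, Finset.sum_ite_eq', Finset.mem_univ, if_true,
      Finset.sum_const, Finset.card_univ, Fintype.card_fin, nsmul_eq_mul, ← Finset.mul_sum]
    ring
  have h5 : ∑ a, ∑ i, 2 * e a * d a (X i) * d a (d i t)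
      = ∑ a, ∑ i, if a = i then 2 * e a * h * d a (d i t) else 0 := by
    refine sum_sum_congr_swap (fun a i => e a * d a (X i) * d a (d i t)) fun a i => ?_
    -- The conformal Killing equation with raised indices, obtained by multiplying the lowered one
    -- by e_a e_i and using that the squares of e are 1.
    have h6 : e a * d a (X i) + e i * d i (X a) = if a = i then 2 * e a * h else 0 := by
      have := congrArg (e a * e i * ·) (hX.first a i)
      split_ifs at this ⊢ with h7
      · subst h7
        linear_combination this - 2 * e a * d a (X a) * he a + 2 * e a * h * he a
      · linear_combination this - e a * d a (X i) * he i - e i * d i (X a) * he a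
    have h8 := congrArg (· * d a (d i t)) h6
    simp only [ite_mul, zero_mul] at h8
    rw [← h8, hd i a t]
    ring
  have h9 : ∑ a, ∑ i, e a * X i * d i (d a (d a t)) = ringAlong d X (∑ a, e a * d a (d a t)) := by
    rw [Finset.sum_comm]
    unfold ringAlong
    refine Finset.sum_congr rfl fun i _ => ?_
    simp only [map_sum, Derivation.leibniz, hed, smul_eq_mul, mul_zero, add_zero, Finset.mul_sum]
    exact Finset.sum_congr rfl fun k _ => by ring
  rw [h1, h2, h5, h9]
  simp only [Finset.sum_ite_eq, Finset.mem_univ, if_true]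
  have h10 : ∑ a, 2 * e a * h * d a (d a t) = 2 * h * ∑ a, e a * d a (d a t) := by
    rw [Finset.mul_sum]
    exact Finset.sum_congr rfl fun k _ => by ring
  rw [h10]
  ring

/-- The zeroth order term by way of divergences and traces. -/
theorem ringPot_eq (hed : ∀ i j, d i (e j) = 0) (a b : R)
    {p : Fin n → Fin n → R} (hp : ∀ i j, p i j = p j i) :
    ringPot d e a b p = a * ringDiv d (fun l => ∑ k, d k (p k l))
      + b * ∑ i, e i * d i (d i (∑ k, e k * p k k)) := by
  have h1 : ∑ i, ∑ j, d i (d j (p i j)) = ringDiv d (fun l => ∑ k, d k (p k l)) := by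
    simp only [ringDiv, map_sum]
    exact Finset.sum_congr rfl fun i _ => Finset.sum_congr rfl fun j _ => by rw [hp]
  have h2 : ∑ i, ∑ k, e i * e k * d i (d i (p k k))
      = ∑ i, e i * d i (d i (∑ k, e k * p k k)) := by
    refine Finset.sum_congr rfl fun i _ => ?_
    simp only [map_sum, Derivation.leibniz, hed, smul_eq_mul, mul_zero, add_zero, Finset.mul_sum]
    exact Finset.sum_congr rfl fun k _ => by ring
  rw [ringPot, h1, h2]

theorem ringLieTensor_symm {X : Fin n → R} {w : R} {p : Fin n → Fin n → R}
    (hp : ∀ i j, p i j = p j i) (i j : Fin n) :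
    ringLieTensor d w X p i j = ringLieTensor d w X p j i := by
  simp only [ringLieTensor, hp i j]
  congr 1
  refine Finset.sum_congr rfl fun k _ => ?_
  rw [hp i k, hp k j]
  ring

include hd in
/-- The anomaly of the zeroth order term under conformal fields. -/
theorem IsRingConformal.pot_lieTensor (hX : IsRingConformal d e X h)
    (he : ∀ i, e i * e i = 1) (hed : ∀ i j, d i (e j) = 0)
    {w l a b : R} (hw : ∀ i, d i w = 0) (ha : ∀ i, d i a = 0) (hb : ∀ i, d i b = 0)
    (h1 : a * (2 * n * w - 2 * n - 2) = -(l * n)) (h2 : a + b * (2 * n * w - n - 2) = 0)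
    {p : Fin n → Fin n → R} (hp : ∀ i j, p i j = p j i) :
    ringPot d e a b (ringLieTensor d w X p)
      = ringLie d w X (ringPot d e a b p) - l * n * ringDivGrad d p h := by
  have hp' : ∀ i j, ringLieTensor d w X p i j = ringLieTensor d w X p j i :=
    ringLieTensor_symm hp
  rw [ringPot_eq hed a b hp', ringPot_eq hed a b hp, hX.traceTensor hed hp]
  have e1 : (fun l => ∑ k, d k (ringLieTensor d w X p k l))
      = fun l => ringLieVector d w X (fun l => ∑ k, d k (p k l)) l
        + (n * w - n - 2) * ∑ i, d i h * p i l + e l * d l h * ∑ k, e k * p k k :=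
    funext fun l => hX.divTensor hd hw hp l
  set W : Fin n → R := fun l => ∑ k, d k (p k l) with hW
  generalize (∑ k, e k * p k k) = t at e1 ⊢
  have e2 : ringDiv d (fun l => ringLieVector d w X W l
        + (n * w - n - 2) * ∑ i, d i h * p i l + e l * d l h * t)
      = ringLie d w X (ringDiv d W) + (2 * n * w - 2 * n - 2) * ∑ i, d i h * W i
        + ∑ i, e i * d i h * d i t := by
    have e3 := hX.divVector hd hw W
    have e4 : ∑ l, d l ((n * w - n - 2) * ∑ i, d i h * p i l)
        = (n * w - n - 2) * ∑ i, d i h * W i := by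
      simp only [Derivation.leibniz, map_sub, hw, Derivation.map_natCast, smul_eq_mul, mul_zero,
        add_zero, sub_zero, map_sum, hX.third, derivation_two, ← Finset.mul_sum, hW]
      congr 1
      rw [Finset.sum_comm]
      refine Finset.sum_congr rfl fun i _ => ?_
      rw [Finset.mul_sum]
      exact Finset.sum_congr rfl fun j _ => by rw [hp i j]
    have e5 : ∑ l, d l (e l * d l h * t) = ∑ i, e i * d i h * d i t := by
      refine Finset.sum_congr rfl fun i _ => ?_
      simp only [Derivation.leibniz, hed, hX.third, smul_eq_mul]
      ring
    unfold ringDiv at e3 ⊢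
    simp only [map_add, Finset.sum_add_distrib]
    rw [e3, e4, e5]
    ring
  have e6 : ∑ a, e a * d a (d a (ringAlong d X t + (n * w - 2) * h * t))
      = ringLie d w X (∑ a, e a * d a (d a t)) + (2 * n * w - n - 2) * ∑ i, e i * d i h * d i t := by
    have e7 : ∑ a, e a * d a (d a ((n * w - 2) * h * t))
        = (n * w - 2) * h * ∑ a, e a * d a (d a t) + 2 * (n * w - 2) * ∑ i, e i * d i h * d i t := by
      rw [Finset.mul_sum, Finset.mul_sum, ← Finset.sum_add_distrib]
      refine Finset.sum_congr rfl fun i _ => ?_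
      simp only [Derivation.leibniz, map_sub, hw, Derivation.map_natCast, smul_eq_mul, mul_zero,
        add_zero, sub_zero, map_add, hX.third, derivation_two]
      ring
    simp only [map_add, mul_add, Finset.sum_add_distrib]
    rw [e7, hX.boxAlong hd he hed, ringLie, hX.div_eq]
    ring
  have e8 : ∀ u v, ringAlong d X (a * u + b * v)
      = a * ringAlong d X u + b * ringAlong d X v := fun u v => by
    simp only [ringAlong, map_add, Derivation.leibniz, ha, hb, smul_eq_mul, Finset.mul_sum,
      mul_zero, add_zero, ← Finset.sum_add_distrib]
    exact Finset.sum_congr rfl fun i _ => by ring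
  -- The factor h is affine, so no second derivative of it survives.
  have e9 : ringDivGrad d p h = ∑ i, d i h * W i := by
    simp only [ringDivGrad, Derivation.leibniz, hX.third, smul_eq_mul, mul_zero, zero_add, hW,
      Finset.mul_sum]
    rw [Finset.sum_comm]
  rw [e1, e2, e6, e9]
  simp only [ringLie, e8]
  -- The two conditions on a and b are the vanishing of the coefficients of the two independent
  -- anomalies, ⟨dh, div p⟩ and ⟨dh, d tr p⟩.
  linear_combination (∑ i, d i h * W i) * h1 + (∑ i, e i * d i h * d i t) * h2

include hd in
/-- The flat quantization of symbols of degree two is conformally equivariant. -/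
theorem IsRingConformal.op_lieTensor (hX : IsRingConformal d e X h)
    (he : ∀ i, e i * e i = 1) (hed : ∀ i j, d i (e j) = 0)
    {l m a b : R} (hl : ∀ i, d i l = 0) (ha : ∀ i, d i a = 0)
    (hb : ∀ i, d i b = 0) (hlm : l + m = 1)
    (h1 : a * (2 * n * (m - l) - 2 * n - 2) = -(l * n))
    (h2 : a + b * (2 * n * (m - l) - n - 2) = 0)
    {p : Fin n → Fin n → R} (hp : ∀ i j, p i j = p j i) (f : R) :
    ringOp d e a b (ringLieTensor d (m - l) X p) f
      = ringLie d m X (ringOp d e a b p f) - ringOp d e a b p (ringLie d l X f) := by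
  obtain rfl : m = 1 - l := by linear_combination hlm
  have hw : ∀ i, d i (1 - l - l) = 0 := fun i => by simp [hl]
  have hnl : ∀ i, d i (2 * (l * n)) = 0 := fun i => by simp [Derivation.leibniz, hl, derivation_two]
  -- The weight m - l = 1 - 2l differs by 2l from the weight 1 for which ∂p∂ is natural on
  -- functions. The difference is multiplication by 2l · n · h, so only derivatives falling on h
  -- remain.
  have e1 : ringLieTensor d (1 - l - l) X p
      = fun i j => ringLieTensor d 1 X p i j - (2 * (l * n)) * (h * p i j) := by
    funext i j
    simp only [ringLieTensor, hX.div_eq]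
    ring
  have e2 : ringDivGrad d (ringLieTensor d (1 - l - l) X p) f
      = ringLie d 1 X (ringDivGrad d p f) - ringDivGrad d p (ringAlong d X f)
        - 2 * (l * n) * (h * ringDivGrad d p f + ∑ i, ∑ j, p i j * d i h * d j f) := by
    rw [e1, ringDivGrad_sub, ringDivGrad_lieTensor_one hd,
      ringDivGrad_const_smul hnl, ringDivGrad_smul]
  have hnl' : ∀ i, d i (l * n) = 0 := fun i => by simp [Derivation.leibniz, hl]
  have e3 : ringDivGrad d p (ringLie d l X f) = ringDivGrad d p (ringAlong d X f)
      + (l * n) * (h * ringDivGrad d p f + 2 * (∑ i, ∑ j, p i j * d i h * d j f)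
        + ringDivGrad d p h * f) := by
    rw [ringLie, ringDivGrad_add_right, hX.div_eq,
      show l * (n * h * f) = (l * n) * (h * f) by ring, ringDivGrad_const_mul hnl',
      ringDivGrad_mul hp]
  have e4 := hX.pot_lieTensor hd he hed hw ha hb h1 h2 hp
  have e5 : ringAlong d X (ringDivGrad d p f + ringPot d e a b p * f)
      = ringAlong d X (ringDivGrad d p f) + ringAlong d X (ringPot d e a b p) * f
        + ringPot d e a b p * ringAlong d X f := by
    simp only [ringAlong, map_add, Derivation.leibniz, smul_eq_mul, Finset.mul_sum,
      Finset.sum_mul, ← Finset.sum_add_distrib]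
    exact Finset.sum_congr rfl fun i _ => by ring
  simp only [ringOp]
  rw [e2, e3, e4]
  simp only [ringLie, e5, hX.div_eq]
  ring

/-- Conjugation of `∂_i qⁱʲ ∂_j` by an invertible function `α`. -/
theorem ringDivGrad_conj {q : Fin n → Fin n → R} (hq : ∀ i j, q i j = q j i) {α β : R}
    (hαβ : α * β = 1) (f : R) :
    ringDivGrad d (fun i j => β * β * q i j) (α * f)
      = β * ringDivGrad d q f + ringDivGrad d (fun i j => β * β * q i j) α * f := by
  have hβ : ∀ i, d i β = -(β * β * d i α) := fun i => by
    have h1 := congrArg (d i) hαβ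
    simp only [Derivation.leibniz, Derivation.map_one_eq_zero, smul_eq_mul] at h1
    linear_combination β * h1 - d i β * hαβ
  rw [ringDivGrad_mul (fun i j => by rw [hq]), ringDivGrad_smul]
  -- The gradient of β² contributes exactly minus the cross term which comes from differentiating α
  -- f. Hence the conjugated operator has no further first order part.
  have h2 : ∑ i, ∑ j, q i j * d i (β * β) * d j f
      = -(2 * β) * ∑ i, ∑ j, β * β * q i j * d i α * d j f := by
    simp only [Finset.mul_sum]
    refine Finset.sum_congr rfl fun i _ => Finset.sum_congr rfl fun j _ => ?_
    simp only [Derivation.leibniz, smul_eq_mul, hβ]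
    ring
  rw [h2]
  linear_combination (β * ringDivGrad d q f - 2 * ∑ i, ∑ j, β * β * q i j * d i α * d j f) * hαβ

end RingCalculus

end ConformalQuantization
end

noncomputable section

namespace ConformalQuantization

/-! ### The conformal Lie algebra of vector fields -/

section ConformalFields

variable {n p : ℕ}

theorem eta_mul_self (i : Fin n) : eta n p i * eta n p i = 1 := by
  unfold eta
  split_ifs <;> norm_num

theorem eta_ne_zero (i : Fin n) : eta n p i ≠ 0 := by
  unfold eta
  split_ifs <;> norm_num

/-- The coefficients of the flat metric as constant functions. -/
def etaFun (n p : ℕ) (i : Fin n) : SmoothFn n := algebraMap ℝ (SmoothFn n) (eta n p i)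

theorem etaFun_mul_self (i : Fin n) : etaFun n p i * etaFun n p i = 1 := by
  rw [etaFun, ← map_mul, eta_mul_self, map_one]

theorem der_etaFun (i j : Fin n) : der i (etaFun n p j) = 0 := Derivation.map_algebraMap _ _

@[simp] theorem coe_etaFun (i : Fin n) (x : Coord n) :
    etaFun n p i x = eta n p i := rfl

/-- `Xr` are the components of the vector field `X`. -/
def HasComponents (X : Coord n → Coord n) (Xr : Fin n → SmoothFn n) : Prop :=
  ∀ z i, X z i = Xr i z

/-! ### Conformal factors of the generating fields -/

section Generators

variable {R : Type*} [CommRing R] [Algebra ℝ R] {d : Fin n → Derivation ℝ R R} {e x : Fin n → R}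

theorem isRingConformal_translation (i : Fin n) :
    IsRingConformal d e (fun k => if k = i then 1 else 0) 0 := by
  have h0 : ∀ a k, d a (if k = i then (1 : R) else 0) = 0 := fun a k => by
    split_ifs <;> simp
  exact ⟨by simp [ringDiv, h0], by simp [h0], by simp [h0], by simp⟩

theorem isRingConformal_dilation (hx : ∀ i k, d i (x k) = if k = i then 1 else 0) :
    IsRingConformal d e x 1 := by
  have h0 : ∀ (b a k : Fin n), d b (if k = a then (1 : R) else 0) = 0 := fun b a k => by
    split_ifs <;> simp
  refine ⟨by simp [ringDiv, hx], fun a k => ?_, fun a b k => ?_, by simp⟩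
  · simp only [hx]
    by_cases hak : a = k
    · subst hak; simp; ring
    · simp [hak, Ne.symm hak]
  · simp only [hx, h0]
    simp

theorem der_rotation (hx : ∀ i k, d i (x k) = if k = i then 1 else 0)
    (hed : ∀ i j, d i (e j) = 0) (i j a k : Fin n) :
    d a ((if k = j then e i * x i else 0) - (if k = i then e j * x j else 0))
      = (if k = j then if i = a then e i else 0 else 0)
      - (if k = i then if j = a then e j else 0 else 0) := by
  have h1 : ∀ i j, d a (if k = j then e i * x i else 0)
      = if k = j then if i = a then e i else 0 else 0 := fun i j => by
    rw [apply_ite (d a)]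
    simp [Derivation.leibniz, hed, hx]
  rw [map_sub, h1, h1]

theorem isRingConformal_rotation (hx : ∀ i k, d i (x k) = if k = i then 1 else 0)
    (hed : ∀ i j, d i (e j) = 0) (i j : Fin n) :
    IsRingConformal d e (fun k => (if k = j then e i * x i else 0)
        - (if k = i then e j * x j else 0)) 0 := by
  have h0 := der_rotation hx hed i j
  have h1 : ∀ b a k, d b ((if k = j then if i = a then e i else 0 else 0)
      - (if k = i then if j = a then e j else 0 else 0)) = 0 := fun b a k => by
    have h2 : ∀ i j, d b (if k = j then if i = a then e i else 0 else 0) = 0 := fun i j => by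
      split_ifs <;> simp [hed]
    rw [map_sub, h2, h2, sub_zero]
  refine ⟨?_, ?_, ?_, by simp⟩
  · simp only [ringDiv, h0, Finset.sum_sub_distrib, Finset.sum_ite_eq', Finset.mem_univ,
      if_true, mul_zero]
    rcases eq_or_ne i j with rfl | hij
    · simp
    · simp [hij, Ne.symm hij]
  · intro a k
    simp only [h0, mul_zero, ite_self]
    have h2 : ∀ i j : Fin n, e k * (if k = j then if i = a then e i else 0 else 0)
        = e a * (if a = i then if j = k then e j else 0 else 0) := fun i j => by
      rcases eq_or_ne k j with rfl | h3
      · rcases eq_or_ne i a with rfl | h4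
        · simp [mul_comm]
        · simp [h4, Ne.symm h4]
      · simp [h3, Ne.symm h3]
    rw [mul_sub, mul_sub, h2, h2]
    ring
  · intro a b k
    simp only [h0, h1, map_zero, mul_zero, ite_self, add_zero, sub_zero]

theorem der_inversion (hx : ∀ i k, d i (x k) = if k = i then 1 else 0)
    (hed : ∀ i j, d i (e j) = 0) (i a k : Fin n) :
    d a ((if k = i then ∑ j, e j * x j * x j else 0) - 2 * (e i * x i) * x k)
      = (if k = i then 2 * e a * x a else 0) - (if i = a then 2 * e i * x k else 0)
        - (if k = a then 2 * e i * x i else 0) := by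
  have hs : d a (∑ j, e j * x j * x j) = 2 * e a * x a := by
    simp only [map_sum, Derivation.leibniz, smul_eq_mul, hed, hx, mul_ite,
      mul_one, mul_zero, add_zero, Finset.sum_add_distrib, Finset.sum_ite_eq',
      Finset.mem_univ, if_true]
    ring
  have h1 : d a (if k = i then ∑ j, e j * x j * x j else 0)
      = if k = i then 2 * e a * x a else 0 := by
    rw [apply_ite (d a), hs, map_zero]
  rw [map_sub, h1]
  simp only [Derivation.leibniz, smul_eq_mul, hed, hx, derivation_two]
  split_ifs <;> ring

/-- The inversions are the only generators with a nonconstant conformal factor, -2x_i. They alone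
are responsible for the anomalies and hence for the conditions on a and b; that the factor is affine
is what makes its third-order condition hold. -/
theorem isRingConformal_inversion (hx : ∀ i k, d i (x k) = if k = i then 1 else 0)
    (he : ∀ i, e i * e i = 1) (hed : ∀ i j, d i (e j) = 0) (i : Fin n) :
    IsRingConformal d e (fun k => (if k = i then ∑ j, e j * x j * x j else 0)
        - 2 * (e i * x i) * x k) (-2 * (e i * x i)) := by
  have h0 := der_inversion hx hed i
  have hh : ∀ a, d a (-2 * (e i * x i)) = if i = a then -2 * e i else 0 := fun a => by
    simp only [Derivation.leibniz, smul_eq_mul, hed, hx, derivation_two, map_neg]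
    split_ifs <;> ring
  refine ⟨?_, ?_, ?_, ?_⟩
  · simp only [ringDiv, h0, Finset.sum_sub_distrib, Finset.sum_ite_eq, Finset.sum_ite_eq',
      Finset.mem_univ, if_true, Finset.sum_const, Finset.card_univ, Fintype.card_fin,
      nsmul_eq_mul]
    ring
  · intro a k
    simp only [h0, mul_sub]
    have h2 : ∀ a k : Fin n, e k * (if k = i then 2 * e a * x a else 0)
        = e a * (if i = k then 2 * e i * x a else 0) := fun a k => by
      rcases eq_or_ne k i with rfl | h3
      · simp only [if_true]; ring
      · simp [h3, Ne.symm h3]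
    have h3 : e k * (if k = a then 2 * e i * x i else 0) + e a * (if a = k then 2 * e i * x i else 0)
        = -if a = k then 2 * e a * (-2 * (e i * x i)) else 0 := by
      rcases eq_or_ne a k with rfl | h4
      · simp only [if_true]; ring
      · simp [h4, Ne.symm h4]
    linear_combination h2 a k + h2 k a - h3
  · intro a b k
    rw [hh, hh, hh, h0]
    have e2 : d a (if k = i then 2 * e b * x b else 0)
        = -(if a = b then e a * e k * (if i = k then -2 * e i else 0) else 0) := by
      rcases eq_or_ne k i with rfl | h2
      · rcases eq_or_ne a b with rfl | h3
        · simp only [if_true, Derivation.leibniz, hed, hx, derivation_two, smul_eq_mul]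
          linear_combination (-2 * e a) * he k
        · simp [h3, Ne.symm h3, Derivation.leibniz, hed, hx, derivation_two]
      · simp [h2, Ne.symm h2]
    have e3 : d a (if i = b then 2 * e i * x k else 0)
        = -(if k = a then if i = b then -2 * e i else 0 else 0) := by
      rw [apply_ite (d a)]
      simp only [Derivation.leibniz, hed, hx, derivation_two, smul_eq_mul, map_zero]
      split_ifs <;> ring
    have e4 : d a (if k = b then 2 * e i * x i else 0)
        = -(if k = b then if i = a then -2 * e i else 0 else 0) := by
      rw [apply_ite (d a)]
      simp only [Derivation.leibniz, hed, hx, derivation_two, smul_eq_mul, map_zero]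
      split_ifs <;> ring
    rw [map_sub, map_sub, e2, e3, e4]
    ring
  · intro a b
    rw [hh]
    split_ifs <;> simp [Derivation.leibniz, hed, derivation_two]

theorem IsRingConformal.add {X Y : Fin n → R} {h h' : R} (h2 : IsRingConformal d e X h)
    (h2' : IsRingConformal d e Y h') : IsRingConformal d e (X + Y) (h + h') := by
  refine ⟨?_, ?_, ?_, ?_⟩
  · have h3 := h2.div_eq
    have h4 := h2'.div_eq
    simp only [ringDiv, Pi.add_apply, map_add, Finset.sum_add_distrib] at *
    linear_combination h3 + h4
  · intro i j
    have h3 := h2.first i j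
    have h4 := h2'.first i j
    simp only [Pi.add_apply, map_add]
    split_ifs at * <;> linear_combination h3 + h4
  · intro a b j
    simp only [Pi.add_apply, map_add, h2.second, h2'.second]
    split_ifs <;> ring
  · intro a b
    simp [h2.third, h2'.third]

theorem IsRingConformal.smul {X : Fin n → R} {h : R} (h2 : IsRingConformal d e X h) (r : ℝ) :
    IsRingConformal d e (r • X) (r • h) := by
  have hm : ∀ i, (r • X) i = algebraMap ℝ R r * X i := fun i => Algebra.smul_def _ _
  have hd : ∀ i u, d i (algebraMap ℝ R r * u) = algebraMap ℝ R r * d i u := fun i u => by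
    simp [Derivation.leibniz]
  rw [Algebra.smul_def r h]
  refine ⟨?_, ?_, ?_, ?_⟩
  · have h3 := h2.div_eq
    rw [ringDiv] at h3 ⊢
    simp only [hm, hd, ← Finset.mul_sum]
    rw [h3]
    ring
  · intro i j
    have h3 := h2.first i j
    simp only [hm, hd]
    split_ifs at * <;> linear_combination algebraMap ℝ R r * h3
  · intro a b j
    simp only [hm, hd, h2.second]
    split_ifs <;> ring
  · intro a b
    simp [hd, h2.third]

end Generators

/-- All the conditions are linear in the pair (X, h), so it is enough to know them for the
generators. -/
theorem exists_isRingConformal {X : Coord n → Coord n} (hX : X ∈ conformalAlgebra n p) :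
    ∃ (Xr : Fin n → SmoothFn n) (h : SmoothFn n), HasComponents X Xr ∧
      IsRingConformal der (etaFun n p) Xr h := by
  induction hX using Submodule.span_induction with
  | mem X hX =>
    rcases hX with ((⟨i, rfl⟩ | ⟨⟨i, j⟩, rfl⟩) | hX) | ⟨i, rfl⟩
    · refine ⟨_, _, fun z k => ?_, isRingConformal_translation i⟩
      simp only [translationField, Pi.single_apply]
      split_ifs <;> rfl
    · refine ⟨_, _, fun z k => ?_, isRingConformal_rotation (der_cen 0) der_etaFun i j⟩
      simp only [rotationField, Pi.single_apply, Pi.sub_apply, Pi.smul_apply, smul_eq_mul,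
        mul_ite, mul_one, mul_zero]
      split_ifs <;> simp
    · rw [Set.mem_singleton_iff] at hX
      subst hX
      exact ⟨_, _, fun z k => by simp [dilationField], isRingConformal_dilation (der_cen 0)⟩
    · refine ⟨_, _, fun z k => ?_,
        isRingConformal_inversion (der_cen 0) etaFun_mul_self der_etaFun i⟩
      simp only [inversionField, Pi.single_apply, Pi.sub_apply, Pi.smul_apply, smul_eq_mul,
        mul_ite, mul_one, mul_zero]
      split_ifs <;> simp
  | zero => exact ⟨0, 0, fun z k => rfl, ⟨by simp [ringDiv], by simp, by simp, by simp⟩⟩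
  | add X Y _ _ hX hY =>
    obtain ⟨Xr, h, h1, h2⟩ := hX
    obtain ⟨Yr, h', h1', h2'⟩ := hY
    exact ⟨Xr + Yr, h + h', fun z k => by simp [h1 z k, h1' z k], h2.add h2'⟩
  | smul r X _ hX =>
    obtain ⟨Xr, h, h1, h2⟩ := hX
    exact ⟨r • Xr, r • h, fun z k => by simp [h1 z k], h2.smul r⟩

/-- Recentring the dilation, the rotations and the inversions at an arbitrary point provides enough
elements of the isotropy algebra of that point. -/
theorem comp_sub_mem_conformalAlgebra {X : Coord n → Coord n} (hX : X ∈ conformalAlgebra n p)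
    (y : Coord n) : (fun x => X (x - y)) ∈ conformalAlgebra n p := by
  have ht : ∀ i, translationField n i ∈ conformalAlgebra n p := fun i =>
    Submodule.subset_span (Or.inl (Or.inl (Or.inl ⟨i, rfl⟩)))
  have hr : ∀ i j, rotationField n p i j ∈ conformalAlgebra n p := fun i j =>
    Submodule.subset_span (Or.inl (Or.inl (Or.inr ⟨(i, j), rfl⟩)))
  have hdil : dilationField n ∈ conformalAlgebra n p :=
    Submodule.subset_span (Or.inl (Or.inr rfl))
  have hi : ∀ i, inversionField n p i ∈ conformalAlgebra n p := fun i =>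
    Submodule.subset_span (Or.inr ⟨i, rfl⟩)
  induction hX using Submodule.span_induction with
  | mem X hX =>
    rcases hX with ((⟨i, rfl⟩ | ⟨⟨i, j⟩, rfl⟩) | hX) | ⟨i, rfl⟩
    · exact ht i
    · have : (fun x => rotationField n p i j (x - y)) = rotationField n p i j
          - (eta n p i * y i) • translationField n j + (eta n p j * y j) • translationField n i := by
        funext x
        simp only [rotationField, translationField, Pi.sub_apply, Pi.add_apply, Pi.smul_apply]
        module
      rw [this]
      exact Submodule.add_mem _ (Submodule.sub_mem _ (hr i j) (Submodule.smul_mem _ _ (ht j)))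
        (Submodule.smul_mem _ _ (ht i))
    · rw [Set.mem_singleton_iff] at hX
      subst hX
      have : (fun x => dilationField n (x - y)) = dilationField n
          - ∑ i, y i • translationField n i := by
        funext x
        simp only [dilationField, translationField, Pi.sub_apply, Finset.sum_apply, Pi.smul_apply]
        conv_lhs => rw [pi_eq_sum_univ' y]
      rw [this]
      exact Submodule.sub_mem _ hdil (Submodule.sum_mem _ fun i _ => Submodule.smul_mem _ _ (ht i))
    -- Expansion in powers of y: the linear terms are rotations and a dilation, and the quadratic
    -- terms are constant fields.
    · have : (fun x => inversionField n p i (x - y)) = inversionField n p i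
          + (2 : ℝ) • ∑ j, y j • rotationField n p i j + (2 * eta n p i * y i) • dilationField n
          + (∑ j, eta n p j * y j * y j) • translationField n i
          - (2 * eta n p i * y i) • ∑ j, y j • translationField n j := by
        funext x
        ext k
        simp only [inversionField, rotationField, dilationField, translationField, Pi.sub_apply,
          Pi.add_apply, Finset.sum_apply, Pi.smul_apply, smul_eq_mul, Pi.single_apply, mul_ite,
          mul_one, mul_zero, mul_sub, Finset.sum_sub_distrib, Finset.sum_ite_eq, Finset.mem_univ,
          if_true]
        have h1 : ∑ j, eta n p j * (x j - y j) * (x j - y j)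
            = ∑ j, eta n p j * x j * x j - 2 * ∑ j, y j * (eta n p j * x j)
              + ∑ j, eta n p j * y j * y j := by
          rw [Finset.mul_sum, ← Finset.sum_sub_distrib, ← Finset.sum_add_distrib]
          exact Finset.sum_congr rfl fun j _ => by ring
        by_cases hk : k = i
        · simp only [hk, if_true]
          simp only [mul_sub, Finset.sum_sub_distrib] at h1
          linear_combination h1
        · simp only [hk, if_false, Finset.sum_const_zero]
          ring
      rw [this]
      exact Submodule.sub_mem _ (Submodule.add_mem _ (Submodule.add_mem _ (Submodule.add_mem _ (hi i)
        (Submodule.smul_mem _ _ (Submodule.sum_mem _ fun j _ => Submodule.smul_mem _ _ (hr i j))))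
        (Submodule.smul_mem _ _ hdil)) (Submodule.smul_mem _ _ (ht i)))
        (Submodule.smul_mem _ _ (Submodule.sum_mem _ fun j _ => Submodule.smul_mem _ _ (ht j)))
  | zero => exact Submodule.zero_mem _
  | add X Y _ _ hX hY => exact Submodule.add_mem _ hX hY
  | smul r X _ hX => exact Submodule.smul_mem _ r hX

end ConformalFields

end ConformalQuantization
end

noncomputable section

namespace ConformalQuantization

/-! ### Invariant functionals on germs of symbols of degree two -/

section InvariantTensors

/-- A four-index tensor which is annihilated by the inversions and by the rotations vanishes,
outside of the resonant weights. -/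
theorem invariantTensor_eq_zero {n p : ℕ} {w : ℝ} {L : Fin n → Fin n → Fin n → Fin n → ℝ}
    (h12 : ∀ a b k l, L a b k l = L b a k l) (h34 : ∀ a b k l, L a b k l = L a b l k)
    (hinv : ∀ a c k l, (w - 1) * L c a k l
      - (if a = c then eta n p c / 2 * ∑ m, eta n p m * L m m k l else 0)
      - (if k = c then ∑ i, L i a i l else 0) - (if l = c then ∑ i, L i a k i else 0)
      + eta n p c * eta n p k * L k a c l + eta n p c * eta n p l * L l a k c = 0)
    (hrot : ∀ r s c a k l, (if s = c then eta n p r * L r a k l else 0)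
      - (if r = c then eta n p s * L s a k l else 0)
      + (if s = a then eta n p r * L c r k l else 0)
      - (if r = a then eta n p s * L c s k l else 0)
      - (if r = k then eta n p r * L c a s l else 0)
      + (if s = k then eta n p s * L c a r l else 0)
      - (if r = l then eta n p r * L c a k s else 0)
      + (if s = l then eta n p s * L c a k r else 0) = 0)
    (h1 : w ≠ 1) (h2 : w ≠ 1 + n / 2) (h3 : w ≠ n + 1) (a b k l : Fin n) : L a b k l = 0 := by
  have hη : ∀ i, eta n p i * eta n p i = 1 := eta_mul_self
  -- Contraction of the inversion equation over its first two indices: the mixed traces cancel in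
  -- pairs, and the trace is multiplied by w - 1 - n/2.
  have hT : ∀ k l, ∑ m, eta n p m * L m m k l = 0 := fun k l => by
    have key : ∑ c, eta n p c * ((w - 1) * L c c k l
      - (if c = c then eta n p c / 2 * ∑ m, eta n p m * L m m k l else 0)
      - (if k = c then ∑ i, L i c i l else 0) - (if l = c then ∑ i, L i c k i else 0)
      + eta n p c * eta n p k * L k c c l + eta n p c * eta n p l * L l c k c) = 0 :=
      Finset.sum_eq_zero fun c _ => by rw [hinv c c k l, mul_zero]
    simp only [if_true, mul_add, mul_sub, mul_ite, mul_zero, Finset.sum_add_distrib,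
      Finset.sum_sub_distrib, Finset.sum_ite_eq, Finset.mem_univ] at key
    have e1 : ∑ c, eta n p c * ((w - 1) * L c c k l) = (w - 1) * ∑ m, eta n p m * L m m k l := by
      rw [Finset.mul_sum]; exact Finset.sum_congr rfl fun i _ => by ring
    have e2 : ∑ c, eta n p c * (eta n p c / 2 * ∑ m, eta n p m * L m m k l)
        = n / 2 * ∑ m, eta n p m * L m m k l := by
      have : ∀ c, eta n p c * (eta n p c / 2 * ∑ m, eta n p m * L m m k l)
          = 1 / 2 * ∑ m, eta n p m * L m m k l := fun c => by
        linear_combination (1 / 2 * ∑ m, eta n p m * L m m k l) * hη c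
      simp only [this, Finset.sum_const, Finset.card_univ, Fintype.card_fin, nsmul_eq_mul]
      ring
    have e3 : ∑ c, eta n p c * (eta n p c * eta n p k * L k c c l)
        = eta n p k * ∑ i, L i k i l := by
      rw [Finset.mul_sum]
      exact Finset.sum_congr rfl fun i _ => by
        rw [h12 k i]; linear_combination (eta n p k * L i k i l) * hη i
    have e4 : ∑ c, eta n p c * (eta n p c * eta n p l * L l c k c)
        = eta n p l * ∑ i, L i l k i := by
      rw [Finset.mul_sum]
      exact Finset.sum_congr rfl fun i _ => by
        rw [h12 l i]; linear_combination (eta n p l * L i l k i) * hη i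
    rw [e1, e2, e3, e4] at key
    have : (w - (1 + n / 2)) * ∑ m, eta n p m * L m m k l = 0 := by linear_combination key
    exact (mul_eq_zero.1 this).resolve_left (sub_ne_zero.2 h2)
  -- Contraction over the last two indices, with the first trace already gone: again the mixed
  -- traces cancel, and the factor is w - 1.
  have hS : ∀ c a, ∑ k, eta n p k * L c a k k = 0 := fun c a => by
    have key : ∑ k, eta n p k * ((w - 1) * L c a k k
      - (if a = c then eta n p c / 2 * ∑ m, eta n p m * L m m k k else 0)
      - (if k = c then ∑ i, L i a i k else 0) - (if k = c then ∑ i, L i a k i else 0)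
      + eta n p c * eta n p k * L k a c k + eta n p c * eta n p k * L k a k c) = 0 :=
      Finset.sum_eq_zero fun k _ => by rw [hinv a c k k, mul_zero]
    simp only [hT, ite_self, mul_zero, sub_zero, mul_add, mul_sub, mul_ite, Finset.sum_add_distrib,
      Finset.sum_sub_distrib, Finset.sum_ite_eq', Finset.mem_univ, if_true] at key
    have e1 : ∑ k, eta n p k * ((w - 1) * L c a k k) = (w - 1) * ∑ k, eta n p k * L c a k k := by
      rw [Finset.mul_sum]; exact Finset.sum_congr rfl fun i _ => by ring
    have e3 : ∑ k, eta n p k * (eta n p c * eta n p k * L k a c k)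
        = eta n p c * ∑ i, L i a c i := by
      rw [Finset.mul_sum]
      exact Finset.sum_congr rfl fun i _ => by linear_combination (eta n p c * L i a c i) * hη i
    have e4 : ∑ k, eta n p k * (eta n p c * eta n p k * L k a k c)
        = eta n p c * ∑ i, L i a i c := by
      rw [Finset.mul_sum]
      exact Finset.sum_congr rfl fun i _ => by linear_combination (eta n p c * L i a i c) * hη i
    rw [e1, e3, e4] at key
    have : (w - 1) * ∑ k, eta n p k * L c a k k = 0 := by linear_combination key
    exact (mul_eq_zero.1 this).resolve_left (sub_ne_zero.2 h1)
  -- Contraction of an index of the first pair with one of the second pair: both pure traces are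
  -- known to vanish, and the factor is w - (n + 1).
  have hM : ∀ a l, ∑ i, L i a i l = 0 := fun a l => by
    have key : ∑ c, ((w - 1) * L c a c l
      - (if a = c then eta n p c / 2 * ∑ m, eta n p m * L m m c l else 0)
      - (if c = c then ∑ i, L i a i l else 0) - (if l = c then ∑ i, L i a c i else 0)
      + eta n p c * eta n p c * L c a c l + eta n p c * eta n p l * L l a c c) = 0 :=
      Finset.sum_eq_zero fun c _ => hinv a c c l
    simp only [hT, ite_self, mul_zero, sub_zero, Finset.sum_add_distrib, hη, one_mul,
      Finset.sum_sub_distrib, Finset.sum_ite_eq, Finset.mem_univ, if_true, ← Finset.mul_sum,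
      Finset.sum_const, Finset.card_univ, Fintype.card_fin, nsmul_eq_mul] at key
    have e1 : ∑ c, eta n p c * eta n p l * L l a c c = 0 := by
      have := hS l a
      calc _ = eta n p l * ∑ c, eta n p c * L l a c c := by
            rw [Finset.mul_sum]; exact Finset.sum_congr rfl fun i _ => by ring
        _ = 0 := by rw [this, mul_zero]
    have e2 : ∑ i, L i a l i = ∑ i, L i a i l := Finset.sum_congr rfl fun i _ => h34 _ _ _ _
    rw [e1, e2] at key
    have : (w - (n + 1)) * ∑ i, L i a i l = 0 := by linear_combination key
    exact (mul_eq_zero.1 this).resolve_left (sub_ne_zero.2 h3)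
  have hM' : ∀ a l, ∑ i, L i a l i = 0 := fun a l => by
    rw [← hM a l]; exact Finset.sum_congr rfl fun i _ => h34 _ _ _ _
  -- For a tensor without traces, contracting the rotation equation expresses the two terms with
  -- exchanged indices, which also occur in the inversion equation, through -n L. Together the two
  -- equations give (w - 1 - n) L = 0.
  have key : ∑ r, ((if a = r then eta n p r * L r b k l else 0)
      - (if r = r then eta n p a * L a b k l else 0)
      + (if a = b then eta n p r * L r r k l else 0)
      - (if r = b then eta n p a * L r a k l else 0)
      - (if r = k then eta n p r * L r b a l else 0)
      + (if a = k then eta n p a * L r b r l else 0)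
      - (if r = l then eta n p r * L r b k a else 0)
      + (if a = l then eta n p a * L r b k r else 0)) = 0 :=
    Finset.sum_eq_zero fun r _ => hrot r a r b k l
  have e1 : (∑ r, if a = b then eta n p r * L r r k l else 0) = 0 := by
    split_ifs
    · exact hT k l
    · simp
  have e2 : (∑ r, if a = k then eta n p a * L r b r l else 0) = 0 := by
    split_ifs
    · rw [← Finset.mul_sum, hM, mul_zero]
    · simp
  have e3 : (∑ r, if a = l then eta n p a * L r b k r else 0) = 0 := by
    split_ifs
    · rw [← Finset.mul_sum, hM', mul_zero]
    · simp
  simp only [Finset.sum_add_distrib, Finset.sum_sub_distrib, e1, e2, e3, if_true,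
    Finset.sum_ite_eq, Finset.sum_ite_eq', Finset.mem_univ, Finset.sum_const, Finset.card_univ,
    Fintype.card_fin, nsmul_eq_mul] at key
  have h4 := hinv b a k l
  simp only [hT, hM, hM', mul_zero, ite_self, sub_zero] at h4
  have h5 : (w - (n + 1)) * L a b k l = 0 := by
    have h6 := h12 b a k l
    linear_combination eta n p a * key + h4
      + (n * L a b k l - eta n p a * 0) * hη a + eta n p a * eta n p a * h6
      - 0 * hη a
  exact (mul_eq_zero.1 h5).resolve_left (sub_ne_zero.2 h3)

end InvariantTensors

/-! ### Reduction of invariant functionals to the quadratic part of the Taylor expansion -/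

section InvariantFunctionals

variable {n p : ℕ}

section

variable {R : Type*} [CommRing R] [Algebra ℝ R] {d : Fin n → Derivation ℝ R R}

/-- The matrix with the single entry `u`. -/
def singleEntry (k l : Fin n) (u : R) : Fin n → Fin n → R :=
  fun i j => if i = k then if j = l then u else 0 else 0

/-- The equations for a functional on matrices become equations between its scalar components, which
can be tested on monomials in the coordinates. -/
theorem ringLieTensor_singleEntry (w : R) (X : Fin n → R) (k l : Fin n) (u : R) :
    ringLieTensor d w X (singleEntry k l u)
      = singleEntry k l (ringAlong d X u + w * (ringDiv d X * u))
        - ∑ m, singleEntry m l (d k (X m) * u) - ∑ m, singleEntry k m (d l (X m) * u) := by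
  funext i j
  simp only [ringLieTensor, Pi.sub_apply, Finset.sum_apply, singleEntry, Finset.sum_sub_distrib]
  have e1 : ∑ m, X m * d m (if i = k then if j = l then u else 0 else 0)
      = if i = k then if j = l then ringAlong d X u else 0 else 0 := by
    split_ifs <;> simp [ringAlong]
  have e2 : ∑ m, d m (X i) * (if m = k then if j = l then u else 0 else 0)
      = ∑ m, if i = m then if j = l then d k (X m) * u else 0 else 0 := by
    simp
  have e3 : ∑ m, d m (X j) * (if i = k then if m = l then u else 0 else 0)
      = ∑ m, if i = k then if j = m then d l (X m) * u else 0 else 0 := by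
    split_ifs <;> simp
  rw [e1, e2, e3]
  split_ifs <;> ring

end

/-- A linear functional on germs of symmetric tensors at `y` which is invariant under the isotropy
algebra of `y` in the conformal Lie algebra, acting on tensors with values in `δ`-densities,
vanishes outside of the resonances. -/
theorem invariantFunctional_eq_zero {y : Coord n} {δ : ℝ}
    (ℓ : (Fin n → Fin n → SmoothFn n) →ₗ[ℝ] ℝ) (hsymm : ∀ q, ℓ (fun i j => q j i) = ℓ q)
    (hinv : ∀ X ∈ conformalAlgebra n p, X y = 0 → ∀ Xr, HasComponents X Xr → ∀ q,
      ℓ (ringLieTensor der (algebraMap ℝ _ δ) Xr q) = δ * ringDiv der Xr y * ℓ q)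
    (h1 : n * δ ≠ 1) (h2 : n * δ ≠ 1 + n / 2) (h3 : n * δ ≠ n + 1) : ℓ = 0 := by
  let φ : Fin n → Fin n → SmoothFn n →ₗ[ℝ] ℝ := fun k l =>
    { toFun := fun u => ℓ (singleEntry k l u)
      map_add' := fun u v => by
        rw [← map_add]; congr 1; funext i j
        simp only [singleEntry, Pi.add_apply]; split_ifs <;> simp
      map_smul' := fun r u => by
        rw [RingHom.id_apply, ← map_smul]; congr 1; funext i j
        simp only [singleEntry, Pi.smul_apply]; split_ifs <;> simp }
  have hφ : ∀ k l u, ℓ (singleEntry k l u) = φ k l u := fun _ _ _ => rfl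
  have hc : ∀ k l (r : ℝ) u, φ k l (algebraMap ℝ _ r * u) = r * φ k l u := fun k l r u => by
    rw [← Algebra.smul_def, map_smul, smul_eq_mul]
  have h34 : ∀ k l u, φ k l u = φ l k u := fun k l u => by
    rw [← hφ, ← hφ, ← hsymm]
    congr 1
    funext i j
    simp only [singleEntry]
    split_ifs <;> rfl
  have main : ∀ X ∈ conformalAlgebra n p, X y = 0 → ∀ Xr, HasComponents X Xr → ∀ k l u,
      φ k l (ringAlong der Xr u + algebraMap ℝ _ δ * (ringDiv der Xr * u))
        - ∑ m, φ m l (der k (Xr m) * u) - ∑ m, φ k m (der l (Xr m) * u)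
        = δ * ringDiv der Xr y * φ k l u := fun X hX hy Xr hXr k l u => by
    have := hinv X hX hy Xr hXr (singleEntry k l u)
    rw [ringLieTensor_singleEntry, map_sub, map_sub, map_sum, map_sum] at this
    exact this
  -- For the Euler field E the density factor is the same on both sides and cancels; the two upper
  -- indices each contribute -1. So each component annihilates the range of E - 2.
  have hdil : ∀ k l u, φ k l (∑ i, cen y i * der i u - 2 * u) = 0 := fun k l u => by
    have hX : (fun x => dilationField n (x - y)) ∈ conformalAlgebra n p :=
      comp_sub_mem_conformalAlgebra (Submodule.subset_span (Or.inl (Or.inr rfl))) y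
    have := main _ hX (by simp [dilationField]) (cen y) (fun z i => by simp [dilationField]) k l u
    have hdiv : ringDiv der (cen y) = algebraMap ℝ (SmoothFn n) n := by
      simp [ringDiv, der_cen]
    rw [hdiv, map_add, hc, hc] at this
    simp only [der_cen, ite_mul, one_mul, zero_mul, apply_ite (φ _ _), map_zero,
      Finset.sum_ite_eq', Finset.mem_univ, if_true, SmoothFn.algebraMap_apply] at this
    have h2 : (2 : SmoothFn n) = algebraMap ℝ _ 2 := (map_ofNat (algebraMap ℝ _) 2).symm
    rw [map_sub, h2, hc]
    unfold ringAlong at this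
    linear_combination this
  have heul : ∀ a u, ∑ i, cen y i * der i (cen y a * u)
      = cen y a * u + cen y a * ∑ i, cen y i * der i u := fun a u => by
    simp only [Derivation.leibniz, der_cen, smul_eq_mul, mul_add, Finset.sum_add_distrib, mul_ite,
      mul_one, mul_zero, Finset.sum_ite_eq, Finset.mem_univ, if_true, Finset.mul_sum]
    rw [add_comm]
    congr 1
    exact Finset.sum_congr rfl fun i _ => by ring
  have hconst : ∀ k l (r : ℝ), φ k l (algebraMap ℝ _ r) = 0 := fun k l r => by
    have := hdil k l (algebraMap ℝ _ r)
    simp only [Derivation.map_algebraMap, mul_zero, Finset.sum_const_zero, zero_sub, map_neg] at this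
    rw [← map_ofNat (algebraMap ℝ (SmoothFn n)) 2, hc] at this
    linarith
  have hlin : ∀ k l a (r : ℝ), φ k l (cen y a * algebraMap ℝ _ r) = 0 := fun k l a r => by
    have := hdil k l (cen y a * algebraMap ℝ _ r)
    rw [heul] at this
    simp only [Derivation.map_algebraMap, mul_zero, Finset.sum_const_zero, add_zero] at this
    rw [map_sub, ← map_ofNat (algebraMap ℝ (SmoothFn n)) 2, hc] at this
    linarith
  -- On cubic remainders E - 2 is onto: if s is the average of r then E s + s = r, so applying E - 2
  -- to x_a x_b x_c s gives x_a x_b x_c r. No continuity of the functional is needed.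
  have hcub : ∀ k l a b c r, φ k l (cen y a * (cen y b * (cen y c * r))) = 0 :=
    fun k l a b c r => by
      have := hdil k l (cen y a * (cen y b * (cen y c * avg y r)))
      rw [heul, heul, heul] at this
      rw [← this]
      congr 1
      linear_combination -(cen y a * (cen y b * cen y c)) * euler_avg y r
  -- Three applications of the Hadamard lemma split a function into constant, linear and quadratic
  -- monomials and a cubic remainder. Constants and linear terms are eigenvectors of E for the
  -- eigenvalues 0 and 1, different from 2.
  have hquad : (∀ a b k l, φ k l (cen y a * cen y b) = 0) → ∀ k l u, φ k l u = 0 := by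
    intro hL k l u
    have hq : ∀ a b r, φ k l (cen y a * (cen y b * r)) = 0 := fun a b r => by
      rw [hadamard y r, mul_add, mul_add, map_add, Finset.mul_sum, Finset.mul_sum, map_sum,
        Finset.sum_eq_zero fun c _ => hcub k l a b c _, add_zero,
        show cen y a * (cen y b * algebraMap ℝ (SmoothFn n) (r y))
          = algebraMap ℝ (SmoothFn n) (r y) * (cen y a * cen y b) by ring, hc, hL, mul_zero]
    have hl : ∀ a r, φ k l (cen y a * r) = 0 := fun a r => by
      rw [hadamard y r, mul_add, map_add, Finset.mul_sum, map_sum, hlin,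
        Finset.sum_eq_zero fun c _ => hq a c _, add_zero]
    rw [hadamard y u, map_add, map_sum, hconst, Finset.sum_eq_zero fun c _ => hl c _, add_zero]
  have hvan : ∀ a b k l, φ k l (cen y a * cen y b) = 0 := by
    refine invariantTensor_eq_zero (p := p) (w := n * δ)
      (L := fun a b k l => φ k l (cen y a * cen y b)) (fun a b k l => by rw [mul_comm])
      (fun a b k l => h34 _ _ _) ?_ ?_ h1 h2 h3
    · intro a c k l
      -- The inversions have quadratic coefficients and raise the degree by one, so a linear test
      -- function yields an equation for the values on quadratic monomials.
      have hX : (fun x => inversionField n p c (x - y)) ∈ conformalAlgebra n p :=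
        comp_sub_mem_conformalAlgebra (Submodule.subset_span (Or.inr ⟨c, rfl⟩)) y
      have h := main _ hX (by simp [inversionField]) (fun k => (if k = c then
        ∑ j, etaFun n p j * cen y j * cen y j else 0) - 2 * (etaFun n p c * cen y c) * cen y k)
        (fun z k => by
          simp only [inversionField, Pi.single_apply, Pi.sub_apply, Pi.smul_apply, smul_eq_mul,
            mul_ite, mul_one, mul_zero]
          split_ifs <;> simp) k l (cen y a)
      have hdiv := (isRingConformal_inversion (der_cen y) (etaFun_mul_self (p := p)) der_etaFun
        c).div_eq
      rw [hdiv] at h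
      simp only [der_inversion (der_cen y) der_etaFun, sub_mul, map_sub, Finset.sum_sub_distrib]
        at h
      have e0 : ((n : SmoothFn n) * (-2 * (etaFun n p c * cen y c))) y = 0 := by simp
      have e1 : ringAlong der (fun k => (if k = c then
          ∑ j, etaFun n p j * cen y j * cen y j else 0) - 2 * (etaFun n p c * cen y c) * cen y k)
          (cen y a) = (if a = c then ∑ j, etaFun n p j * (cen y j * cen y j) else 0)
            - algebraMap ℝ _ (2 * eta n p c) * (cen y c * cen y a) := by
        simp only [ringAlong, der_cen, mul_ite, mul_one, mul_zero, Finset.sum_ite_eq,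
          Finset.mem_univ, if_true, etaFun, map_mul, map_ofNat]
        simp only [mul_assoc]
      have e2 : algebraMap ℝ (SmoothFn n) δ * ((n : SmoothFn n) * (-2 * (etaFun n p c * cen y c))
          * cen y a) = algebraMap ℝ _ (-2 * n * δ * eta n p c) * (cen y c * cen y a) := by
        simp only [etaFun, map_mul, map_neg, map_ofNat, map_natCast]
        ring
      have e3 : ∀ i j a, 2 * etaFun n p i * cen y j * cen y a
          = algebraMap ℝ _ (2 * eta n p i) * (cen y j * cen y a) := fun i j a => by
        simp only [etaFun, map_mul, map_ofNat]
        ring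
      rw [e0, e1, e2] at h
      simp only [map_add, map_sub, map_sum, apply_ite (φ _ _), map_zero, ite_mul, zero_mul, e3] at h
      simp only [etaFun, hc, Finset.sum_ite_eq', Finset.mem_univ, if_true, mul_zero,
        zero_mul] at h
      have e4 : ∀ (q : Prop) [Decidable q] (f : Fin n → ℝ),
          (∑ x, if q then 2 * eta n p c * f x else 0) = 2 * eta n p c * if q then ∑ x, f x else 0 := by
        intro q _ f
        split_ifs
        · rw [Finset.mul_sum]
        · simp
      have e5 : (if a = c then ∑ m, eta n p m * φ k l (cen y m * cen y m) else 0)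
          = 2 * eta n p c * (if a = c then eta n p c / 2 * ∑ m, eta n p m * φ k l (cen y m * cen y m)
            else 0) := by
        split_ifs
        · linear_combination (-∑ m, eta n p m * φ k l (cen y m * cen y m))
            * eta_mul_self (p := p) c
        · simp
      have hη := eta_mul_self (p := p) c
      rw [e4, e4, e5] at h
      simp only [eq_comm (a := c)] at h
      linear_combination (-eta n p c / 2) * h
        - ((n * δ - 1) * φ k l (cen y c * cen y a)
          - (if a = c then eta n p c / 2 * ∑ m, eta n p m * φ k l (cen y m * cen y m) else 0)
          - (if k = c then ∑ i, φ i l (cen y i * cen y a) else 0)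
          - (if l = c then ∑ i, φ k i (cen y i * cen y a) else 0)) * hη
    · intro r s c a k l
      -- Rotations preserve the degree and have divergence zero, so they are tested on the quadratic
      -- monomials themselves.
      have hX : (fun x => rotationField n p r s (x - y)) ∈ conformalAlgebra n p :=
        comp_sub_mem_conformalAlgebra
          (Submodule.subset_span (Or.inl (Or.inl (Or.inr ⟨(r, s), rfl⟩)))) y
      have h := main _ hX (by simp [rotationField]) (fun k =>
        (if k = s then etaFun n p r * cen y r else 0)
          - (if k = r then etaFun n p s * cen y s else 0))
        (fun z k => by
          simp only [rotationField, Pi.single_apply, Pi.sub_apply, Pi.smul_apply, smul_eq_mul,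
            mul_ite, mul_one, mul_zero]
          split_ifs <;> simp) k l (cen y c * cen y a)
      have hdiv := (isRingConformal_rotation (der_cen y) (der_etaFun (p := p)) r s).div_eq
      rw [hdiv] at h
      simp only [der_rotation (der_cen y) der_etaFun, sub_mul, map_sub, Finset.sum_sub_distrib,
        mul_zero, zero_mul, add_zero, SmoothFn.zero_apply] at h
      have e1 : ringAlong der (fun k => (if k = s then etaFun n p r * cen y r else 0)
          - (if k = r then etaFun n p s * cen y s else 0)) (cen y c * cen y a)
          = (if s = c then algebraMap ℝ _ (eta n p r) * (cen y r * cen y a) else 0)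
          - (if r = c then algebraMap ℝ _ (eta n p s) * (cen y s * cen y a) else 0)
          + (if s = a then algebraMap ℝ _ (eta n p r) * (cen y c * cen y r) else 0)
          - (if r = a then algebraMap ℝ _ (eta n p s) * (cen y c * cen y s) else 0) := by
        simp only [ringAlong, Derivation.leibniz, smul_eq_mul, der_cen, sub_mul, mul_add, ite_mul,
          zero_mul, Finset.sum_add_distrib, Finset.sum_ite_eq',
          Finset.mem_univ, if_true, etaFun, mul_ite, mul_one, mul_zero, eq_comm (a := c),
          eq_comm (a := a)]
        split_ifs <;> ring
      rw [e1] at h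
      simp only [map_add, map_sub, apply_ite (φ _ _), map_zero, ite_mul, zero_mul, hc, etaFun,
        Finset.sum_ite_eq', Finset.mem_univ, if_true] at h
      linear_combination h
  refine LinearMap.ext fun q => ?_
  have hq : q = ∑ k, ∑ l, singleEntry k l (q k l) := by
    funext i j
    simp [singleEntry, Finset.sum_apply]
  rw [hq, map_sum]
  simp only [map_sum, hφ, hquad hvan, Finset.sum_const_zero, LinearMap.zero_apply]

end InvariantFunctionals

end ConformalQuantization
end

noncomputable section

namespace ConformalQuantization

/-! ### Charts: derivatives, components and extension of germs -/

section Charts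

variable {n : ℕ} {M : Type*} [TopologicalSpace M] [ChartedSpace (Coord n) M]

/-- The derivative of a chart. -/
def chartDeriv (c : OpenPartialHomeomorph M (Coord n)) (x : M) : Coord n →L[ℝ] Coord n :=
  mfderiv 𝓘(ℝ, Coord n) 𝓘(ℝ, Coord n) c x

/-- The derivative of the inverse of a chart. -/
def chartSymmDeriv (c : OpenPartialHomeomorph M (Coord n)) (y : Coord n) : Coord n →L[ℝ] Coord n :=
  mfderiv 𝓘(ℝ, Coord n) 𝓘(ℝ, Coord n) c.symm y

/-- The coordinate covector `dxⁱ` at a point of `M`. -/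
def covecAt (c : OpenPartialHomeomorph M (Coord n)) (x : M) (i : Fin n) : Cotangent n x :=
  (ContinuousLinearMap.proj (R := ℝ) (φ := fun _ : Fin n => ℝ) i).comp (chartDeriv c x)

/-- The coordinate vector `∂_i` at a point of `M`. -/
def vecAt (c : OpenPartialHomeomorph M (Coord n)) (x : M) (i : Fin n) : Tangent n x :=
  chartSymmDeriv c (c x) (Pi.single i 1)

/-- The coordinate change, as a function. -/
def trans (c c' : OpenPartialHomeomorph M (Coord n)) (z : Coord n) : Coord n := c' (c.symm z)

/-- The Jacobian matrix `∂ψᵃ/∂xⁱ` of the coordinate change. -/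
def jac (c c' : OpenPartialHomeomorph M (Coord n)) (i a : Fin n) (z : Coord n) : ℝ :=
  pd i (fun w => trans c c' w a) z

theorem covecAt_apply (c : OpenPartialHomeomorph M (Coord n)) (x : M) (i : Fin n)
    (v : Tangent n x) : covecAt c x i v = chartDeriv c x v i := rfl

/-- The point is kept as a variable with an equation because the tangent and cotangent spaces depend
on it: `c.symm (c x)` and `x` are equal but give different types, and substitution avoids the
transport. -/
theorem comp2_eq (P : Symbol n M) {c : OpenPartialHomeomorph M (Coord n)} {x : M} {y : Coord n}
    (h : c.symm y = x) (i j : Fin n) : P.comp2 c y i j = P.1.1 x (covecAt c x i) (covecAt c x j) := by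
  subst h; rfl

theorem comp1_eq (P : Symbol n M) {c : OpenPartialHomeomorph M (Coord n)} {x : M} {y : Coord n}
    (h : c.symm y = x) (i : Fin n) : P.comp1 c y i = covecAt c x i (P.1.2.1 x) := by
  subst h; rfl

theorem comp0_eq (P : Symbol n M) {c : OpenPartialHomeomorph M (Coord n)} {x : M} {y : Coord n}
    (h : c.symm y = x) : P.comp0 c y = P.1.2.2 x := by
  subst h; rfl

theorem coeff_eq (g : PseudoRiemannianMetric n M) {c : OpenPartialHomeomorph M (Coord n)} {x : M}
    {y : Coord n} (hx : x ∈ c.source) (h : c x = y) (i j : Fin n) :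
    g.coeff c y i j = g.val x (vecAt c x i) (vecAt c x j) := by
  have h' : c.symm y = x := by rw [← h, c.left_inv hx]
  subst h'
  have e : ∀ i, coordVec c y i = vecAt c (c.symm y) i := fun i => by
    unfold vecAt
    rw [h]
    rfl
  change g.val _ (coordVec c y i) (coordVec c y j) = _
  rw [e, e]

variable [IsManifold 𝓘(ℝ, Coord n) ∞ M]

theorem contDiffOn_trans {c c' : OpenPartialHomeomorph M (Coord n)} (hc : c ∈ atlas (Coord n) M)
    (hc' : c' ∈ atlas (Coord n) M) : ContDiffOn ℝ ∞ (trans c c') (c.symm.trans c').source := by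
  have := contMDiffOn_of_mem_contDiffGroupoid
    (HasGroupoid.compatible (G := contDiffGroupoid ∞ 𝓘(ℝ, Coord n)) hc hc')
  rwa [contMDiffOn_iff_contDiffOn] at this

theorem contDiffAt_trans {c c' : OpenPartialHomeomorph M (Coord n)} (hc : c ∈ atlas (Coord n) M)
    (hc' : c' ∈ atlas (Coord n) M) {x : M} (hx : x ∈ c.source) (hx' : x ∈ c'.source) :
    ContDiffAt ℝ ∞ (trans c c') (c x) := by
  refine (contDiffOn_trans hc hc').contDiffAt ((c.symm.trans c').open_source.mem_nhds ?_)
  simp [c.map_source hx, c.left_inv hx, hx']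

theorem chartDeriv_symmDeriv {c : OpenPartialHomeomorph M (Coord n)} (hc : c ∈ atlas (Coord n) M)
    {x : M} (hx : x ∈ c.source) (v : Coord n) :
    chartDeriv c x (chartSymmDeriv c (c x) v) = v := by
  have : IsManifold 𝓘(ℝ, Coord n) 1 M := IsManifold.of_le (n := ∞) (by simp)
  have hd := mdifferentiable_of_mem_atlas (I := 𝓘(ℝ, Coord n)) hc
  have h : ∀ (y : Coord n), y ∈ c.target → ∀ x, c.symm y = x →
      chartDeriv c x (chartSymmDeriv c y v) = v := by
    rintro y hy x rfl
    exact DFunLike.congr_fun (hd.comp_symm_deriv hy) v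
  exact h (c x) (c.map_source hx) x (c.left_inv hx)

theorem chartSymmDeriv_deriv {c : OpenPartialHomeomorph M (Coord n)} (hc : c ∈ atlas (Coord n) M)
    {x : M} (hx : x ∈ c.source) (v : Coord n) :
    chartSymmDeriv c (c x) (chartDeriv c x v) = v := by
  have : IsManifold 𝓘(ℝ, Coord n) 1 M := IsManifold.of_le (n := ∞) (by simp)
  have hd := mdifferentiable_of_mem_atlas (I := 𝓘(ℝ, Coord n)) hc
  exact DFunLike.congr_fun (hd.symm_comp_deriv hx) v

theorem fderiv_trans {c c' : OpenPartialHomeomorph M (Coord n)} (hc : c ∈ atlas (Coord n) M)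
    (hc' : c' ∈ atlas (Coord n) M) {x : M} (hx : x ∈ c.source) (hx' : x ∈ c'.source)
    (v : Coord n) : fderiv ℝ (trans c c') (c x) v = chartDeriv c' x (chartSymmDeriv c (c x) v) := by
  have : IsManifold 𝓘(ℝ, Coord n) 1 M := IsManifold.of_le (n := ∞) (by simp)
  have h : ∀ (y : Coord n), y ∈ c.target → ∀ x, c.symm y = x → x ∈ c'.source →
      fderiv ℝ (trans c c') y v = chartDeriv c' x (chartSymmDeriv c y v) := by
    rintro y hy x rfl hx'
    have h1 := (mdifferentiable_of_mem_atlas (I := 𝓘(ℝ, Coord n)) hc).mdifferentiableAt_symm hy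
    have h2 := (mdifferentiable_of_mem_atlas (I := 𝓘(ℝ, Coord n)) hc').mdifferentiableAt hx'
    have h3 := mfderiv_comp y h2 h1
    rw [mfderiv_eq_fderiv] at h3
    exact DFunLike.congr_fun h3 v
  exact h (c x) (c.map_source hx) x (c.left_inv hx) hx'

theorem jac_eq {c c' : OpenPartialHomeomorph M (Coord n)} (hc : c ∈ atlas (Coord n) M)
    (hc' : c' ∈ atlas (Coord n) M) {x : M} (hx : x ∈ c.source) (hx' : x ∈ c'.source)
    (i a : Fin n) : jac c c' i a (c x) = covecAt c' x a (vecAt c x i) := by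
  rw [covecAt_apply]
  unfold jac pd vecAt
  rw [← fderiv_trans hc hc' hx hx',
    fderiv_apply ((contDiffAt_trans hc hc' hx hx').differentiableAt (by simp))]
  rfl

theorem covecAt_vecAt {c : OpenPartialHomeomorph M (Coord n)} (hc : c ∈ atlas (Coord n) M)
    {x : M} (hx : x ∈ c.source) (i k : Fin n) :
    covecAt c x i (vecAt c x k) = if i = k then 1 else 0 := by
  rw [covecAt_apply, vecAt, chartDeriv_symmDeriv hc hx, Pi.single_apply]

theorem eq_sum_vecAt {c : OpenPartialHomeomorph M (Coord n)} (hc : c ∈ atlas (Coord n) M)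
    {x : M} (hx : x ∈ c.source) (v : Tangent n x) :
    v = ∑ i, covecAt c x i v • vecAt c x i := by
  have key : ∀ (D : Coord n →L[ℝ] Tangent n x) (w : Coord n),
      D w = ∑ k, w k • D (Pi.single k 1) := fun D w => by
    conv_lhs => rw [pi_eq_sum_univ' w]
    simp only [map_sum, map_smul]
  have h := key (chartSymmDeriv c (c x)) (chartDeriv c x v)
  exact (chartSymmDeriv_deriv hc hx v).symm.trans h

theorem eq_sum_covecAt {c : OpenPartialHomeomorph M (Coord n)} (hc : c ∈ atlas (Coord n) M)
    {x : M} (hx : x ∈ c.source) (ξ : Cotangent n x) :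
    ξ = ∑ i, ξ (vecAt c x i) • covecAt c x i := by
  refine ContinuousLinearMap.ext fun v => ?_
  conv_lhs => rw [eq_sum_vecAt hc hx v]
  simp [mul_comm]

theorem covecAt_change {c c' : OpenPartialHomeomorph M (Coord n)} (hc : c ∈ atlas (Coord n) M)
    (hc' : c' ∈ atlas (Coord n) M) {x : M} (hx : x ∈ c.source) (hx' : x ∈ c'.source)
    (a : Fin n) : covecAt c' x a = ∑ i, jac c c' i a (c x) • covecAt c x i := by
  rw [eq_sum_covecAt hc hx (covecAt c' x a)]
  simp only [jac_eq hc hc' hx hx']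

theorem vecAt_change {c c' : OpenPartialHomeomorph M (Coord n)} (hc : c ∈ atlas (Coord n) M)
    (hc' : c' ∈ atlas (Coord n) M) {x : M} (hx : x ∈ c.source) (hx' : x ∈ c'.source)
    (i : Fin n) : vecAt c x i = ∑ a, jac c c' i a (c x) • vecAt c' x a := by
  rw [eq_sum_vecAt hc' hx' (vecAt c x i)]
  simp only [jac_eq hc hc' hx hx']

theorem comp2_change (P : Symbol n M) {c c' : OpenPartialHomeomorph M (Coord n)}
    (hc : c ∈ atlas (Coord n) M)
    (hc' : c' ∈ atlas (Coord n) M) {x : M} (hx : x ∈ c.source) (hx' : x ∈ c'.source)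
    (a b : Fin n) : P.comp2 c' (c' x) a b
      = ∑ i, ∑ j, jac c c' i a (c x) * jac c c' j b (c x) * P.comp2 c (c x) i j := by
  rw [comp2_eq P (c'.left_inv hx'), covecAt_change hc hc' hx hx', covecAt_change hc hc' hx hx']
  simp only [comp2_eq P (c.left_inv hx), map_sum, map_smul, LinearMap.sum_apply,
    LinearMap.smul_apply, smul_eq_mul, Finset.mul_sum]
  rw [Finset.sum_comm]
  exact Finset.sum_congr rfl fun i _ => Finset.sum_congr rfl fun j _ => by ring

theorem comp1_change (P : Symbol n M) {c c' : OpenPartialHomeomorph M (Coord n)}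
    (hc : c ∈ atlas (Coord n) M)
    (hc' : c' ∈ atlas (Coord n) M) {x : M} (hx : x ∈ c.source) (hx' : x ∈ c'.source)
    (a : Fin n) : P.comp1 c' (c' x) a = ∑ i, jac c c' i a (c x) * P.comp1 c (c x) i := by
  rw [comp1_eq P (c'.left_inv hx'), covecAt_change hc hc' hx hx']
  simp [comp1_eq P (c.left_inv hx)]

theorem coeff_change (g : PseudoRiemannianMetric n M) {c c' : OpenPartialHomeomorph M (Coord n)}
    (hc : c ∈ atlas (Coord n) M)
    (hc' : c' ∈ atlas (Coord n) M) {x : M} (hx : x ∈ c.source) (hx' : x ∈ c'.source)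
    (i j : Fin n) : g.coeff c (c x) i j
      = ∑ a, ∑ b, jac c c' i a (c x) * jac c c' j b (c x) * g.coeff c' (c' x) a b := by
  rw [coeff_eq g hx rfl, vecAt_change hc hc' hx hx', vecAt_change hc hc' hx hx']
  simp only [coeff_eq g hx' rfl, map_sum, map_smul, LinearMap.sum_apply,
    LinearMap.smul_apply, smul_eq_mul, Finset.mul_sum]
  rw [Finset.sum_comm]
  exact Finset.sum_congr rfl fun i _ => Finset.sum_congr rfl fun j _ => by ring

theorem jac_mul_jac {c c' : OpenPartialHomeomorph M (Coord n)}
    (hc : c ∈ atlas (Coord n) M)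
    (hc' : c' ∈ atlas (Coord n) M) {x : M} (hx : x ∈ c.source) (hx' : x ∈ c'.source)
    (i j : Fin n) : ∑ a, jac c c' i a (c x) * jac c' c a j (c' x) = if i = j then 1 else 0 := by
  have h := covecAt_vecAt hc hx j i
  rw [vecAt_change hc hc' hx hx', map_sum] at h
  simp only [map_smul, smul_eq_mul, ← jac_eq hc' hc hx' hx] at h
  rw [h]
  simp only [eq_comm]

omit [ChartedSpace (Coord n) M] [IsManifold 𝓘(ℝ, Coord n) ∞ M] in
theorem mem_source_of_eventually {c c' : OpenPartialHomeomorph M (Coord n)} {x : M}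
    (hx : x ∈ c.source) (hx' : x ∈ c'.source) :
    ∀ᶠ z in 𝓝 (c x), z ∈ c.target ∧ c.symm z ∈ c.source ∧ c.symm z ∈ c'.source := by
  have h : c x ∈ (c.symm.trans c').source := by simp [c.map_source hx, c.left_inv hx, hx']
  filter_upwards [(c.symm.trans c').open_source.mem_nhds h] with z hz
  simp only [OpenPartialHomeomorph.trans_source, OpenPartialHomeomorph.symm_source,
    Set.mem_inter_iff, Set.mem_preimage] at hz
  exact ⟨hz.1, c.map_target hz.1, hz.2⟩

theorem contDiffAt_jac {c c' : OpenPartialHomeomorph M (Coord n)} (hc : c ∈ atlas (Coord n) M)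
    (hc' : c' ∈ atlas (Coord n) M) {x : M} (hx : x ∈ c.source) (hx' : x ∈ c'.source)
    (i a : Fin n) : ContDiffAt ℝ ∞ (jac c c' i a) (c x) :=
  contDiffAt_pd (contDiffAt_pi.1 (contDiffAt_trans hc hc' hx hx') a) i

/-- A function of the coordinates of one chart is pulled back along a coordinate change. -/
theorem eventually_trans {c c' : OpenPartialHomeomorph M (Coord n)} (hc : c ∈ atlas (Coord n) M)
    (hc' : c' ∈ atlas (Coord n) M) {x : M} (hx : x ∈ c.source) (hx' : x ∈ c'.source)
    {q : Coord n → Prop} (hq : ∀ᶠ z in 𝓝 (c' x), q z) :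
    ∀ᶠ z in 𝓝 (c x), q (trans c c' z) := by
  have h : Filter.Tendsto (trans c c') (𝓝 (c x)) (𝓝 (c' x)) := by
    have := (contDiffAt_trans hc hc' hx hx').continuousAt
    unfold ContinuousAt at this
    rwa [trans, c.left_inv hx] at this
  exact h.eventually hq

/-! ### Smooth functions in charts -/

theorem contDiffOn_comp_symm {E : Type*} [NormedAddCommGroup E] [NormedSpace ℝ E] {f : M → E}
    (hf : ContMDiff 𝓘(ℝ, Coord n) 𝓘(ℝ, E) ∞ f)
    {c : OpenPartialHomeomorph M (Coord n)} (hc : c ∈ atlas (Coord n) M) :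
    ContDiffOn ℝ ∞ (fun y => f (c.symm y)) c.target := by
  have h := contMDiffOn_symm_of_mem_maximalAtlas (I := 𝓘(ℝ, Coord n)) (n := ∞)
    (IsManifold.subset_maximalAtlas hc)
  exact contMDiffOn_iff_contDiffOn.1 (hf.comp_contMDiffOn h)

theorem contMDiffAt_of_chart {E : Type*} [NormedAddCommGroup E] [NormedSpace ℝ E] {f : M → E}
    {c : OpenPartialHomeomorph M (Coord n)} (hc : c ∈ atlas (Coord n) M) {x : M}
    (hx : x ∈ c.source) (hf : ContDiffAt ℝ ∞ (fun y => f (c.symm y)) (c x)) :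
    ContMDiffAt 𝓘(ℝ, Coord n) 𝓘(ℝ, E) ∞ f x := by
  have h1 : ContMDiffAt 𝓘(ℝ, Coord n) 𝓘(ℝ, Coord n) ∞ c x :=
    (contMDiffOn_of_mem_maximalAtlas (IsManifold.subset_maximalAtlas hc)).contMDiffAt
      (c.open_source.mem_nhds hx)
  refine (hf.contMDiffAt.comp x h1).congr_of_eventuallyEq ?_
  filter_upwards [c.open_source.mem_nhds hx] with z hz
  simp [c.left_inv hz]

theorem contDiffAt_comp_symm {E : Type*} [NormedAddCommGroup E] [NormedSpace ℝ E] {f : M → E}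
    (hf : ContMDiff 𝓘(ℝ, Coord n) 𝓘(ℝ, E) ∞ f)
    {c : OpenPartialHomeomorph M (Coord n)} (hc : c ∈ atlas (Coord n) M) {y : Coord n}
    (hy : y ∈ c.target) : ContDiffAt ℝ ∞ (fun y => f (c.symm y)) y :=
  (contDiffOn_comp_symm hf hc).contDiffAt (c.open_target.mem_nhds hy)

theorem differential_apply (f : SmoothFun n M) {c : OpenPartialHomeomorph M (Coord n)}
    (hc : c ∈ atlas (Coord n) M) {x : M} (hx : x ∈ c.source) (i : Fin n) :
    differential f x (vecAt c x i) = pd i (fun z => f (c.symm z)) (c x) := by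
  have : IsManifold 𝓘(ℝ, Coord n) 1 M := IsManifold.of_le (n := ∞) (by simp)
  have h : ∀ (y : Coord n), y ∈ c.target → ∀ x, c.symm y = x →
      (differential f x : Coord n →L[ℝ] ℝ) (chartSymmDeriv c y (Pi.single i 1))
        = pd i (fun z => f (c.symm z)) y := by
    rintro y hy x rfl
    have h1 := (mdifferentiable_of_mem_atlas (I := 𝓘(ℝ, Coord n)) hc).mdifferentiableAt_symm hy
    have h2 : MDifferentiableAt 𝓘(ℝ, Coord n) 𝓘(ℝ, ℝ) f (c.symm y) :=
      (f.contMDiff.mdifferentiable (by simp)) _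
    have h3 := mfderiv_comp y h2 h1
    rw [mfderiv_eq_fderiv] at h3
    exact (DFunLike.congr_fun h3 (Pi.single i 1)).symm
  exact h (c x) (c.map_source hx) x (c.left_inv hx)

theorem differential_eq (f : SmoothFun n M) {c : OpenPartialHomeomorph M (Coord n)}
    (hc : c ∈ atlas (Coord n) M) {x : M} (hx : x ∈ c.source) :
    differential f x = ∑ i, pd i (fun z => f (c.symm z)) (c x) • covecAt c x i := by
  rw [eq_sum_covecAt hc hx (differential f x)]
  simp only [differential_apply f hc hx]

variable [T2Space M]

/-- A smooth function on the coordinate space which vanishes outside of a compact subset of the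
target of a chart, as a smooth function on `M`. -/
theorem contMDiff_indicator_chart {c : OpenPartialHomeomorph M (Coord n)}
    (hc : c ∈ atlas (Coord n) M) {u : Coord n → ℝ} (hu : ContDiffOn ℝ ∞ u c.target)
    {K : Set (Coord n)} (hK : IsCompact K) (hKc : K ⊆ c.target) (huK : ∀ z ∉ K, u z = 0) :
    ContMDiff 𝓘(ℝ, Coord n) 𝓘(ℝ, ℝ) ∞ (c.source.indicator fun x => u (c x)) := by
  intro x
  by_cases hx : x ∈ c.source
  · refine contMDiffAt_of_chart hc hx ?_
    refine (hu.contDiffAt (c.open_target.mem_nhds (c.map_source hx))).congr_of_eventuallyEq ?_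
    filter_upwards [c.open_target.mem_nhds (c.map_source hx)] with z hz
    simp [Set.indicator_of_mem (c.map_target hz), c.right_inv hz]
  -- The Hausdorff property enters here: the compact image of the support is closed in M, so a point
  -- outside the chart domain has a neighbourhood on which the extended function is zero.
  · have hcl : IsClosed (c.symm '' K) := (hK.image_of_continuousOn
      (c.continuousOn_symm.mono hKc)).isClosed
    have hx' : x ∉ c.symm '' K := by
      rintro ⟨z, hz, rfl⟩
      exact hx (c.map_target (hKc hz))
    refine (contMDiffAt_const (c := (0 : ℝ))).congr_of_eventuallyEq ?_
    filter_upwards [hcl.isOpen_compl.mem_nhds hx'] with w hw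
    by_cases hws : w ∈ c.source
    · rw [Set.indicator_of_mem hws]
      exact huK _ fun h => hw ⟨c w, h, c.left_inv hws⟩
    · rw [Set.indicator_of_notMem hws]

/-- Germs of smooth functions in a chart extend to smooth functions on `M`, supported in the domain
of the chart. -/
theorem exists_smoothFun_germ {c : OpenPartialHomeomorph M (Coord n)}
    (hc : c ∈ atlas (Coord n) M) {y : Coord n} (hy : y ∈ c.target) {u : Coord n → ℝ}
    {s : Set (Coord n)} (hs : s ∈ 𝓝 y) (hu : ContDiffOn ℝ ∞ u s) :
    ∃ F : SmoothFun n M, (∀ᶠ z in 𝓝 y, F (c.symm z) = u z) ∧ HasCompactSupport F ∧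
      tsupport F ⊆ c.source ∩ c ⁻¹' s := by
  obtain ⟨r, hr, hrs⟩ := Metric.nhds_basis_closedBall.mem_iff.1
    (Filter.inter_mem (c.open_target.mem_nhds hy) hs)
  let χ : ContDiffBump y := ⟨r / 3, r / 2, by positivity, by linarith⟩
  have hKs : Metric.closedBall y (r / 2) ⊆ c.target ∩ s :=
    (Metric.closedBall_subset_closedBall (by linarith)).trans hrs
  have hK : IsCompact (Metric.closedBall y (r / 2)) := isCompact_closedBall _ _
  have hχ0 : ∀ z ∉ Metric.closedBall y (r / 2), χ z * u z = 0 := fun z hz => by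
    rw [χ.zero_of_le_dist, zero_mul]
    simp only [Metric.mem_closedBall, not_le] at hz
    exact hz.le
  have hsmooth : ContDiffOn ℝ ∞ (fun z => χ z * u z) c.target := by
    intro z hz
    by_cases hz2 : z ∈ Metric.closedBall y (r / 2)
    · have h2 : s ∈ 𝓝 z := by
        have : Metric.ball y r ∈ 𝓝 z := Metric.isOpen_ball.mem_nhds
          (Metric.closedBall_subset_ball (by linarith) hz2)
        exact Filter.mem_of_superset this
          ((Metric.ball_subset_closedBall.trans hrs).trans Set.inter_subset_right)
      exact (χ.contDiff.contDiffAt.mul (hu.contDiffAt h2)).contDiffWithinAt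
    · refine ContDiffAt.contDiffWithinAt ?_
      refine (contDiffAt_const (c := (0 : ℝ))).congr_of_eventuallyEq ?_
      filter_upwards [Metric.isClosed_closedBall.isOpen_compl.mem_nhds hz2] with w hw
      exact hχ0 w hw
  have hcK : IsCompact (c.symm '' Metric.closedBall y (r / 2)) := hK.image_of_continuousOn
      (c.continuousOn_symm.mono (hKs.trans Set.inter_subset_left))
  have hsub : tsupport (c.source.indicator fun x => χ (c x) * u (c x))
      ⊆ c.symm '' Metric.closedBall y (r / 2) := by
    refine closure_minimal ?_ hcK.isClosed
    intro x hx
    have hxs : x ∈ c.source := by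
      by_contra h
      exact hx (Set.indicator_of_notMem h _)
    refine ⟨c x, ?_, c.left_inv hxs⟩
    by_contra h
    exact hx (by rw [Set.indicator_of_mem hxs]; exact hχ0 _ h)
  refine ⟨⟨c.source.indicator fun x => χ (c x) * u (c x), contMDiff_indicator_chart hc hsmooth hK
    (hKs.trans Set.inter_subset_left) hχ0⟩, ?_, HasCompactSupport.intro' hcK hcK.isClosed
      (fun x hx => image_eq_zero_of_notMem_tsupport fun h => hx (hsub h)), ?_⟩
  · filter_upwards [χ.eventuallyEq_one, c.open_target.mem_nhds hy] with z hz hzt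
    change c.source.indicator (fun x => χ (c x) * u (c x)) (c.symm z) = u z
    rw [Set.indicator_of_mem (c.map_target hzt), c.right_inv hzt, hz]
    simp
  · refine hsub.trans ?_
    rintro _ ⟨z, hz, rfl⟩
    refine ⟨c.map_target (hKs hz).1, ?_⟩
    rw [Set.mem_preimage, c.right_inv (hKs hz).1]
    exact (hKs hz).2

theorem contDiffAt_trans_jac {c c' : OpenPartialHomeomorph M (Coord n)}
    (hc : c ∈ atlas (Coord n) M) (hc' : c' ∈ atlas (Coord n) M) {x : M} (hx : x ∈ c.source)
    (hx' : x ∈ c'.source) (i a : Fin n) :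
    ContDiffAt ℝ ∞ (fun z => jac c c' i a (trans c' c z)) (c' x) := by
  have h := contDiffAt_trans hc' hc hx' hx
  refine ContDiffAt.comp (c' x) ?_ h
  rw [trans, c'.left_inv hx']
  exact contDiffAt_jac hc hc' hx hx' i a

/-- Germs of symmetric two-tensors in a chart extend to symbols on `M`. -/
theorem exists_symbol_germ {c : OpenPartialHomeomorph M (Coord n)}
    (hc : c ∈ atlas (Coord n) M) {y : Coord n} (hy : y ∈ c.target) {q : Fin n → Fin n → Coord n → ℝ}
    {s : Set (Coord n)} (hs : s ∈ 𝓝 y) (hq : ∀ i j, ContDiffOn ℝ ∞ (q i j) s)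
    (hsymm : ∀ i j, q i j = q j i) :
    ∃ P : Symbol n M, P.1.2.1 = 0 ∧ P.1.2.2 = 0 ∧
      ∀ᶠ z in 𝓝 y, ∀ i j, P.comp2 c z i j = q i j z := by
  choose F hF1 _ hF3 using fun i j => exists_smoothFun_germ hc hy hs (hq i j)
  -- Outside the chart domain the vectors `vecAt` carry no meaning, but the coefficients vanish
  -- there. The average over both orders of the indices makes the form symmetric everywhere and not
  -- only near the point.
  let S : ∀ x : M, LinearMap.BilinForm ℝ (Cotangent n x) := fun x =>
    LinearMap.mk₂ ℝ (fun ξ ζ => ∑ i, ∑ j, (F i j x + F j i x) / 2 * ξ (vecAt c x i)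
        * ζ (vecAt c x j))
      (fun ξ ξ' ζ => by
        simp only [ContinuousLinearMap.add_apply, mul_add, add_mul, Finset.sum_add_distrib])
      (fun r ξ ζ => by
        simp only [ContinuousLinearMap.smul_apply, smul_eq_mul, Finset.mul_sum]
        exact Finset.sum_congr rfl fun i _ => Finset.sum_congr rfl fun j _ => by ring)
      (fun ξ ζ ζ' => by
        simp only [ContinuousLinearMap.add_apply, mul_add, Finset.sum_add_distrib])
      (fun r ξ ζ => by
        simp only [ContinuousLinearMap.smul_apply, smul_eq_mul, Finset.mul_sum]
        exact Finset.sum_congr rfl fun i _ => Finset.sum_congr rfl fun j _ => by ring)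
  have hS : ∀ x ξ ζ, S x ξ ζ = ∑ i, ∑ j, (F i j x + F j i x) / 2 * ξ (vecAt c x i)
        * ζ (vecAt c x j) := fun _ _ _ => rfl
  have hsymmS : ∀ x ξ ζ, S x ξ ζ = S x ζ ξ := fun x ξ ζ => by
    rw [hS, hS, Finset.sum_comm]
    refine Finset.sum_congr rfl fun i _ => Finset.sum_congr rfl fun j _ => ?_
    ring
  have hsm : ∀ c' ∈ atlas (Coord n) M, ∀ a b, ContDiffOn ℝ ∞
      (fun y => S (c'.symm y) (coordCovec c' y a) (coordCovec c' y b)) c'.target := by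
    intro c' hc' a b y' hy'
    refine ContDiffAt.contDiffWithinAt ?_
    by_cases hx : c'.symm y' ∈ c.source
    · have hx' := c'.map_target hy'
      have hJ : ∀ i a, ContDiffAt ℝ ∞ (fun z => jac c c' i a (trans c' c z)) y' := fun i a => by
        have := contDiffAt_trans_jac hc hc' hx hx' i a
        rwa [c'.right_inv hy'] at this
      have hFs : ∀ i j, ContDiffAt ℝ ∞ (fun z => F i j (c'.symm z)) y' := fun i j =>
        contDiffAt_comp_symm (F i j).contMDiff hc' hy'
      have h1 : ContDiffAt ℝ ∞ (fun z => ∑ i, ∑ j, (F i j (c'.symm z) + F j i (c'.symm z)) / 2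
          * jac c c' i a (trans c' c z) * jac c c' j b (trans c' c z)) y' :=
        ContDiffAt.sum fun i _ => ContDiffAt.sum fun j _ =>
          ((((hFs i j).add (hFs j i)).div_const 2).mul (hJ i a)).mul (hJ j b)
      refine h1.congr_of_eventuallyEq ?_
      have h2 := mem_source_of_eventually hx' hx
      rw [c'.right_inv hy'] at h2
      filter_upwards [h2] with z hz
      rw [hS]
      refine Finset.sum_congr rfl fun i _ => Finset.sum_congr rfl fun j _ => ?_
      rw [trans, jac_eq hc hc' hz.2.2 hz.2.1, jac_eq hc hc' hz.2.2 hz.2.1]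
      rfl
    -- A point outside the domain of c lies outside the closed supports of all coefficients, so the
    -- tensor is zero nearby in every other chart.
    · refine (contDiffAt_const (c := (0 : ℝ))).congr_of_eventuallyEq ?_
      have h3 : ∀ i j, ∀ᶠ z in 𝓝 y', F i j (c'.symm z) = 0 := fun i j => by
        have h4 : c'.symm y' ∈ (tsupport (F i j))ᶜ := fun h => hx (hF3 i j h).1
        have h5 := (c'.continuousAt_symm hy').eventually
          ((isClosed_tsupport (F i j)).isOpen_compl.mem_nhds h4)
        filter_upwards [h5] with z hz
        exact image_eq_zero_of_notMem_tsupport hz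
      filter_upwards [Filter.eventually_all.2 fun i => Filter.eventually_all.2 (h3 i)] with z hz
      simp [hS, hz]
  refine ⟨⟨(S, 0, 0), hsymmS, fun c' hc' => ⟨hsm c' hc', fun i => by simpa using contDiffOn_const,
    by simpa using contDiffOn_const⟩⟩, rfl, rfl, ?_⟩
  filter_upwards [Filter.eventually_all.2 fun i => Filter.eventually_all.2 (hF1 i),
    c.open_target.mem_nhds hy] with z hz hzt i j
  rw [comp2_eq _ rfl]
  change S _ _ _ = _
  rw [hS]
  simp only [covecAt_vecAt hc (c.map_target hzt), mul_ite, mul_one, mul_zero,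
    Finset.sum_ite_eq, Finset.mem_univ, if_true, ite_mul, zero_mul]
  rw [hz, hz, hsymm j i]
  ring

end Charts

end ConformalQuantization
end

noncomputable section

namespace ConformalQuantization

/-! ### Conformal factors, and naturality of divergences and Lie derivatives -/

section ConformalFactor

variable {n : ℕ} {p : ℕ}

/-- `G = exp(2σ) η` near `y`. -/
def HasConformalFactor (p : ℕ) (G : Coord n → Matrix (Fin n) (Fin n) ℝ) (σ : SmoothFn n)
    (y : Coord n) : Prop :=
  ∀ᶠ z in 𝓝 y, G z = Real.exp (2 * σ z) • Matrix.diagonal (eta n p)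

theorem HasConformalFactor.eventually {G : Coord n → Matrix (Fin n) (Fin n) ℝ} {σ : SmoothFn n}
    {y : Coord n} (h : HasConformalFactor p G σ y) :
    ∀ᶠ z in 𝓝 y, HasConformalFactor p G σ z :=
  eventually_eventually_nhds.2 h

theorem volCoeff_conformal {G : Coord n → Matrix (Fin n) (Fin n) ℝ} {y : Coord n} {s : ℝ}
    (h : G y = Real.exp (2 * s) • Matrix.diagonal (eta n p)) :
    volCoeff G y = Real.exp (n * s) := by
  have h1 : |∏ i, eta n p i| = 1 := by
    rw [Finset.abs_prod]
    refine Finset.prod_eq_one fun i _ => ?_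
    unfold eta
    split_ifs <;> simp
  rw [volCoeff, h, Matrix.det_smul, Matrix.det_diagonal, abs_mul, h1, mul_one, Fintype.card_fin,
    abs_of_pos (by positivity), ← Real.exp_nat_mul, ← Real.exp_half]
  congr 1
  ring

theorem HasConformalFactor.volCoeff_eventuallyEq {G : Coord n → Matrix (Fin n) (Fin n) ℝ}
    {σ : SmoothFn n} {y : Coord n} (h : HasConformalFactor p G σ y) :
    volCoeff G =ᶠ[𝓝 y] smoothExp ((n : SmoothFn n) * σ) := by
  filter_upwards [h] with z hz
  rw [volCoeff_conformal hz]
  simp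

/-- The divergence in terms of the conformal factor. -/
theorem HasConformalFactor.divergence_eq {G : Coord n → Matrix (Fin n) (Fin n) ℝ}
    {σ : SmoothFn n} {y : Coord n} (h : HasConformalFactor p G σ y) {X : Coord n → Coord n}
    (hX : ∀ i, DifferentiableAt ℝ (fun z => X z i) y) :
    divergence G X y = ∑ i, pd i (fun z => X z i) y + n * ∑ i, X y i * pd i σ y := by
  have h1 : ∀ i, pd i (fun z => volCoeff G z * X z i) y
      = smoothExp ((n : SmoothFn n) * σ) y
        * (pd i (fun z => X z i) y + n * (X y i * pd i σ y)) := fun i => by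
    have h2 : (fun z => volCoeff G z * X z i) =ᶠ[𝓝 y]
        fun z => smoothExp ((n : SmoothFn n) * σ) z * X z i := by
      filter_upwards [h.volCoeff_eventuallyEq] with z hz
      rw [hz]
    rw [pd_congr h2, pd_mul (differentiableAt_coe _ y) (hX i), ← coe_der, der_smoothExp]
    simp [Derivation.leibniz]
    ring
  rw [divergence, Finset.sum_congr rfl fun i _ => h1 i, ← Finset.mul_sum,
    h.volCoeff_eventuallyEq.eq_of_nhds, mul_div_cancel_left₀ _ (by simp [Real.exp_ne_zero]),
    Finset.sum_add_distrib, Finset.mul_sum]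

end ConformalFactor

/-! ### Independence of the chart for divergences and Lie derivatives -/

section Naturality

variable {n p : ℕ} {M : Type*} [TopologicalSpace M] [ChartedSpace (Coord n) M]
  [IsManifold 𝓘(ℝ, Coord n) ∞ M] {g : PseudoRiemannianMetric n M}

omit [IsManifold 𝓘(ℝ, Coord n) ∞ M] in
-- The factor is recovered from one diagonal coefficient as η₀ g₀₀, which needs a positive
-- dimension; σ is half its logarithm. Only the germ matters, so σ may be taken smooth on the whole
-- coordinate space.
theorem exists_conformalFactor (hn : 0 < n) (hg : g.IsConformallyFlat p)
    {c : OpenPartialHomeomorph M (Coord n)}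
    (hc : c ∈ atlas (Coord n) M) {y : Coord n} (hy : y ∈ c.target) :
    ∃ σ : SmoothFn n, HasConformalFactor p (g.coeff c) σ y := by
  let i : Fin n := ⟨0, hn⟩
  have h1 : ∀ z ∈ c.target, 0 < eta n p i * g.coeff c z i i ∧
      g.coeff c z = (eta n p i * g.coeff c z i i) • Matrix.diagonal (eta n p) := fun z hz => by
    obtain ⟨F, hF, hG⟩ := hg c hc z hz
    have : eta n p i * g.coeff c z i i = F := by
      rw [hG]
      simp only [Matrix.smul_apply, Matrix.diagonal_apply_eq, smul_eq_mul]
      linear_combination F * eta_mul_self (p := p) i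
    rw [this]
    exact ⟨hF, hG⟩
  have h2 : ContDiffOn ℝ ∞ (fun z => Real.log (eta n p i * g.coeff c z i i) / 2) c.target := by
    refine ContDiffOn.div_const (ContDiffOn.log (contDiffOn_const.mul ?_)
      fun z hz => (h1 z hz).1.ne') 2
    exact g.smooth c hc i i
  obtain ⟨σ, hσ⟩ := exists_smoothAlg_eventuallyEq (c.open_target.mem_nhds hy) h2
  refine ⟨σ, ?_⟩
  filter_upwards [hσ, c.open_target.mem_nhds hy] with z hz hzt
  rw [← hz, mul_div_cancel₀ _ two_ne_zero, Real.exp_log (h1 z hzt).1]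
  exact (h1 z hzt).2

variable {c c' : OpenPartialHomeomorph M (Coord n)}

/-- `Z` and `Z'` are the components of the same vector field near a point, in two charts. -/
def FieldsRelated (c c' : OpenPartialHomeomorph M (Coord n)) (Z Z' : Coord n → Coord n)
    (y : Coord n) : Prop :=
  ∀ᶠ z in 𝓝 y, ∀ a, Z' (trans c c' z) a = ∑ i, jac c c' i a z * Z z i

theorem pd_trans (hc : c ∈ atlas (Coord n) M) (hc' : c' ∈ atlas (Coord n) M) {x : M}
    (hx : x ∈ c.source) (hx' : x ∈ c'.source) {u : Coord n → ℝ}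
    (hu : DifferentiableAt ℝ u (c' x)) (i : Fin n) :
    pd i (fun z => u (trans c c' z)) (c x) = ∑ a, jac c c' i a (c x) * pd a u (c' x) := by
  have h1 : trans c c' (c x) = c' x := by rw [trans, c.left_inv hx]
  rw [pd_comp (by rwa [h1]) ((contDiffAt_trans hc hc' hx hx').differentiableAt (by simp)), h1]
  rfl

theorem pd_jac_comm (hc : c ∈ atlas (Coord n) M) (hc' : c' ∈ atlas (Coord n) M) {x : M}
    (hx : x ∈ c.source) (hx' : x ∈ c'.source) (i j a : Fin n) :
    pd i (jac c c' j a) (c x) = pd j (jac c c' i a) (c x) :=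
  pd_pd_comm (contDiffAt_pi.1 (contDiffAt_trans hc hc' hx hx') a) i j

/-- The derivative of a related vector field. -/
theorem FieldsRelated.pd_eq (hc : c ∈ atlas (Coord n) M) (hc' : c' ∈ atlas (Coord n) M) {x : M}
    (hx : x ∈ c.source) (hx' : x ∈ c'.source) {Z Z' : Coord n → Coord n}
    (hZ : ∀ i, DifferentiableAt ℝ (fun z => Z z i) (c x))
    (hZ' : ∀ i, DifferentiableAt ℝ (fun z => Z' z i) (c' x))
    (h : FieldsRelated c c' Z Z' (c x)) (j a : Fin n) :
    ∑ b, jac c c' j b (c x) * pd b (fun z => Z' z a) (c' x)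
      = ∑ i, (jac c c' i a (c x) * pd j (fun z => Z z i) (c x)
        + Z (c x) i * pd j (jac c c' i a) (c x)) := by
  have hJ : ∀ i a, DifferentiableAt ℝ (jac c c' i a) (c x) := fun i a =>
    (contDiffAt_jac hc hc' hx hx' i a).differentiableAt (by simp)
  rw [← pd_trans hc hc' hx hx' (hZ' a)]
  have h1 : (fun z => Z' (trans c c' z) a) =ᶠ[𝓝 (c x)] fun z => ∑ i, jac c c' i a z * Z z i := by
    filter_upwards [h] with z hz using hz a
  rw [pd_congr h1, pd_sum _ fun i _ => (hJ i a).fun_mul (hZ i)]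
  exact Finset.sum_congr rfl fun i _ => pd_mul (hJ i a) (hZ i) j

/-- The divergence is independent of the chart. -/
theorem divergence_change (hn : 0 < n) (hg : g.IsConformallyFlat p)
    (hc : c ∈ atlas (Coord n) M) (hc' : c' ∈ atlas (Coord n) M) {x : M}
    (hx : x ∈ c.source) (hx' : x ∈ c'.source) {Z Z' : Coord n → Coord n}
    (hZ : ∀ i, DifferentiableAt ℝ (fun z => Z z i) (c x))
    (hZ' : ∀ i, DifferentiableAt ℝ (fun z => Z' z i) (c' x))
    (h : FieldsRelated c c' Z Z' (c x)) :
    divergence (g.coeff c') Z' (c' x) = divergence (g.coeff c) Z (c x) := by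
  obtain ⟨σ, hσ⟩ := exists_conformalFactor hn hg hc (c.map_source hx)
  obtain ⟨σ', hσ'⟩ := exists_conformalFactor hn hg hc' (c'.map_source hx')
  rw [hσ.divergence_eq hZ, hσ'.divergence_eq hZ']
  have hJ : ∀ i a, DifferentiableAt ℝ (jac c c' i a) (c x) := fun i a =>
    (contDiffAt_jac hc hc' hx hx' i a).differentiableAt (by simp)
  have ht : trans c c' (c x) = c' x := by rw [trans, c.left_inv hx]
  have hψ : DifferentiableAt ℝ (trans c c') (c x) :=
    (contDiffAt_trans hc hc' hx hx').differentiableAt (by simp)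
  have hσ'ψ : DifferentiableAt ℝ (fun z => σ' (trans c c' z)) (c x) :=
    DifferentiableAt.comp (c x) (differentiableAt_coe σ' _) hψ
  have hω : DifferentiableAt ℝ (fun z => Real.exp (2 * (σ z - σ' (trans c c' z)))) (c x) :=
    (((differentiableAt_coe σ _).fun_sub hσ'ψ).const_mul 2).exp
  -- As both metrics are conformal to η, the Jacobian matrix is η-orthogonal up to the scalar
  -- exp(2(σ - σ'∘ψ)), where ψ is the coordinate change.
  have hmetric : ∀ᶠ z in 𝓝 (c x), ∀ j k, (∑ a, eta n p a * (jac c c' j a z * jac c c' k a z))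
      = if j = k then eta n p j * Real.exp (2 * (σ z - σ' (trans c c' z))) else 0 := by
    filter_upwards [hσ, eventually_trans hc hc' hx hx' hσ', mem_source_of_eventually hx hx']
      with z h1 h2 h3 j k
    have h4 := coeff_change g hc hc' h3.2.1 h3.2.2 j k
    rw [c.right_inv h3.1] at h4
    rw [show c' (c.symm z) = trans c c' z from rfl, h1, h2] at h4
    simp only [Matrix.smul_apply, Matrix.diagonal_apply, smul_eq_mul, mul_ite, mul_zero,
      Finset.sum_ite_eq, Finset.mem_univ, if_true] at h4
    have h5 : ∑ a, jac c c' j a z * jac c c' k a z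
        * (Real.exp (2 * σ' (trans c c' z)) * eta n p a)
        = Real.exp (2 * σ' (trans c c' z))
          * ∑ a, eta n p a * (jac c c' j a z * jac c c' k a z) := by
      rw [Finset.mul_sum]; exact Finset.sum_congr rfl fun a _ => by ring
    rw [h5] at h4
    have h6 : Real.exp (2 * σ z) = Real.exp (2 * σ' (trans c c' z))
        * Real.exp (2 * (σ z - σ' (trans c c' z))) := by
      rw [← Real.exp_add]; congr 1; ring
    have h7 := Real.exp_ne_zero (2 * σ' (trans c c' z))
    refine mul_left_cancel₀ h7 (h4.symm.trans ?_)
    split_ifs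
    · rw [h6]; ring
    · ring
  set E := Real.exp (2 * (σ (c x) - σ' (c' x))) with hE
  have hE0 : E ≠ 0 := Real.exp_ne_zero _
  have hm0 : ∀ j k, (∑ a, eta n p a * (jac c c' j a (c x) * jac c c' k a (c x)))
      = if j = k then eta n p j * E else 0 := fun j k => by
    have := hmetric.self_of_nhds j k
    rw [ht] at this
    exact this
  -- Conformality gives the inverse Jacobian as a rescaled transpose.
  have hinv : ∀ j a, E * eta n p j * jac c' c a j (c' x) = eta n p a * jac c c' j a (c x) := by
    intro j a
    have h1 : ∑ k, (∑ b, eta n p b * (jac c c' j b (c x) * jac c c' k b (c x)))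
        * jac c' c a k (c' x) = E * eta n p j * jac c' c a j (c' x) := by
      simp only [hm0, ite_mul, zero_mul, Finset.sum_ite_eq, Finset.mem_univ, if_true]
      ring
    rw [← h1]
    simp only [Finset.sum_mul]
    rw [Finset.sum_comm]
    have h2 : ∀ b, ∑ k, eta n p b * (jac c c' j b (c x) * jac c c' k b (c x)) * jac c' c a k (c' x)
        = eta n p b * jac c c' j b (c x) * if a = b then 1 else 0 := fun b => by
      rw [← jac_mul_jac hc' hc hx' hx a b, Finset.mul_sum]
      exact Finset.sum_congr rfl fun k _ => by ring
    simp [h2]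
  have hdω : ∀ i, pd i (fun z => Real.exp (2 * (σ z - σ' (trans c c' z)))) (c x)
      = 2 * E * (pd i σ (c x) - ∑ a, jac c c' i a (c x) * pd a σ' (c' x)) := fun i => by
    rw [← pd_trans hc hc' hx hx' (differentiableAt_coe σ' _)]
    unfold pd
    rw [fderiv_exp (((differentiableAt_coe σ _).fun_sub hσ'ψ).const_mul 2),
      fderiv_const_mul ((differentiableAt_coe σ _).fun_sub hσ'ψ),
      fderiv_fun_sub (differentiableAt_coe σ _) hσ'ψ, ht]
    simp [hE]
    ring
  -- The logarithmic derivative of the Jacobian determinant, obtained without determinants: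
  -- differentiate the squared length of each row and divide by the conformal factor. Every row
  -- contributes the same amount, whence the factor n.
  have htrace : ∀ i, ∑ j, ∑ a, pd i (jac c c' j a) (c x) * jac c' c a j (c' x)
      = n * (pd i σ (c x) - ∑ a, jac c c' i a (c x) * pd a σ' (c' x)) := by
    intro i
    have h1 : ∀ j, ∑ a, eta n p a * (2 * (jac c c' j a (c x) * pd i (jac c c' j a) (c x)))
        = eta n p j * (2 * E * (pd i σ (c x) - ∑ a, jac c c' i a (c x) * pd a σ' (c' x))) := by
      intro j
      have h2 : (fun z => ∑ a, eta n p a * (jac c c' j a z * jac c c' j a z)) =ᶠ[𝓝 (c x)]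
          fun z => eta n p j * Real.exp (2 * (σ z - σ' (trans c c' z))) := by
        filter_upwards [hmetric] with z hz
        rw [hz, if_pos rfl]
      have h3 := pd_congr h2 i
      rw [pd_const_mul hω, hdω, pd_sum _ fun a _ => ((hJ j a).fun_mul (hJ j a)).const_mul _] at h3
      rw [← h3]
      refine Finset.sum_congr rfl fun a _ => ?_
      rw [pd_const_mul ((hJ j a).fun_mul (hJ j a)), pd_mul (hJ j a) (hJ j a)]
      ring
    have h4 : ∀ j, ∑ a, pd i (jac c c' j a) (c x) * jac c' c a j (c' x)
        = pd i σ (c x) - ∑ a, jac c c' i a (c x) * pd a σ' (c' x) := by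
      intro j
      have h5 : ∑ a, eta n p a * (2 * (jac c c' j a (c x) * pd i (jac c c' j a) (c x)))
          = (2 * E * eta n p j) * ∑ a, pd i (jac c c' j a) (c x) * jac c' c a j (c' x) := by
        rw [Finset.mul_sum]
        refine Finset.sum_congr rfl fun a _ => ?_
        linear_combination (-2 * pd i (jac c c' j a) (c x)) * hinv j a
      have h6 := h1 j
      rw [h5] at h6
      refine mul_left_cancel₀ (mul_ne_zero (mul_ne_zero two_ne_zero hE0) (eta_ne_zero (p := p) j)) ?_
      rw [h6]
      ring
    simp only [h4, Finset.sum_const, Finset.card_univ, Fintype.card_fin, nsmul_eq_mul]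
  have hdiv : ∑ a, pd a (fun z => Z' z a) (c' x) = ∑ i, pd i (fun z => Z z i) (c x)
      + ∑ i, Z (c x) i * ∑ j, ∑ a, pd i (jac c c' j a) (c x) * jac c' c a j (c' x) := by
    have h1 : ∀ a, pd a (fun z => Z' z a) (c' x) = ∑ j, jac c' c a j (c' x)
        * ∑ b, jac c c' j b (c x) * pd b (fun z => Z' z a) (c' x) := fun a => by
      simp only [Finset.mul_sum]
      rw [Finset.sum_comm]
      have : ∀ b, ∑ j, jac c' c a j (c' x) * (jac c c' j b (c x) * pd b (fun z => Z' z a) (c' x))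
          = (if a = b then 1 else 0) * pd b (fun z => Z' z a) (c' x) := fun b => by
        rw [← jac_mul_jac hc' hc hx' hx a b, Finset.sum_mul]
        exact Finset.sum_congr rfl fun k _ => by ring
      simp [this]
    simp only [h1, h.pd_eq hc hc' hx hx' hZ hZ']
    simp only [Finset.mul_sum]
    have h2 : ∀ a j i, jac c' c a j (c' x) * (jac c c' i a (c x) * pd j (fun z => Z z i) (c x)
          + Z (c x) i * pd j (jac c c' i a) (c x))
        = jac c c' i a (c x) * jac c' c a j (c' x) * pd j (fun z => Z z i) (c x)
          + Z (c x) i * (pd i (jac c c' j a) (c x) * jac c' c a j (c' x)) := fun a j i => by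
      rw [pd_jac_comm hc hc' hx hx' j i a]; ring
    simp only [h2, Finset.sum_add_distrib]
    congr 1
    · have h3 : ∑ a, ∑ j, ∑ i, jac c c' i a (c x) * jac c' c a j (c' x)
          * pd j (fun z => Z z i) (c x) = ∑ j, ∑ i, (∑ a, jac c c' i a (c x) * jac c' c a j (c' x))
          * pd j (fun z => Z z i) (c x) := by
        rw [Finset.sum_comm]
        refine Finset.sum_congr rfl fun j _ => ?_
        rw [Finset.sum_comm]
        exact Finset.sum_congr rfl fun i _ => by rw [Finset.sum_mul]
      rw [h3]
      simp [jac_mul_jac hc hc' hx hx']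
    · rw [Finset.sum_comm (s := Finset.univ (α := Fin n))]
      have h4 : ∀ j, ∑ a, ∑ i, Z (c x) i * (pd i (jac c c' j a) (c x) * jac c' c a j (c' x))
          = ∑ i, ∑ a, Z (c x) i * (pd i (jac c c' j a) (c x) * jac c' c a j (c' x)) :=
        fun j => Finset.sum_comm
      simp only [h4]
      rw [Finset.sum_comm]
  rw [hdiv]
  simp only [htrace]
  have h8 : ∑ a, Z' (c' x) a * pd a σ' (c' x)
      = ∑ i, Z (c x) i * ∑ a, jac c c' i a (c x) * pd a σ' (c' x) := by
    have h9 := h.self_of_nhds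
    rw [ht] at h9
    simp only [h9, Finset.sum_mul, Finset.mul_sum]
    rw [Finset.sum_comm]
    exact Finset.sum_congr rfl fun i _ => Finset.sum_congr rfl fun a _ => by ring
  rw [h8]
  have h10 : ∑ i, Z (c x) i * (n * (pd i σ (c x) - ∑ a, jac c c' i a (c x) * pd a σ' (c' x)))
      = n * ∑ i, Z (c x) i * pd i σ (c x)
        - n * ∑ i, Z (c x) i * ∑ a, jac c c' i a (c x) * pd a σ' (c' x) := by
    rw [Finset.mul_sum, Finset.mul_sum, ← Finset.sum_sub_distrib]
    exact Finset.sum_congr rfl fun i _ => by ring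
  rw [h10]
  ring

/-- The algebra behind the naturality of the Lie derivative of tensors. -/
theorem sum_lie_change {n : ℕ} {J : Fin n → Fin n → ℝ} {dJ : Fin n → Fin n → Fin n → ℝ}
    (hdJ : ∀ i j a, dJ i j a = dJ j i a) {X Y : Fin n → ℝ} {dX dY : Fin n → Fin n → ℝ}
    {A A' : Fin n → Fin n → ℝ} {dA : Fin n → Fin n → Fin n → ℝ} {a b : Fin n} {dA' : Fin n → ℝ}
    (hY : ∀ e, Y e = ∑ i, J i e * X i)
    (hdY : ∀ j a, ∑ e, J j e * dY e a = ∑ i, (J i a * dX j i + X i * dJ j i a))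
    (hA' : ∀ a b, A' a b = ∑ j, ∑ k, J j a * J k b * A j k)
    (hdA' : ∀ i, ∑ e, J i e * dA' e = ∑ j, ∑ k, (J j a * J k b * dA i j k
      + A j k * (J j a * dJ i k b + J k b * dJ i j a))) :
    ∑ e, (Y e * dA' e - dY e a * A' e b - dY e b * A' a e)
      = ∑ j, ∑ k, J j a * J k b * ∑ i, (X i * dA i j k - dX i j * A i k - dX i k * A j i) := by
  have h1 : ∑ e, Y e * dA' e = ∑ i, ∑ j, ∑ k, X i * (J j a * J k b * dA i j k
      + A j k * (J j a * dJ i k b + J k b * dJ i j a)) := by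
    simp only [hY, Finset.sum_mul]
    rw [Finset.sum_comm]
    refine Finset.sum_congr rfl fun i _ => ?_
    simp only [← Finset.mul_sum]
    rw [← hdA', Finset.mul_sum]
    exact Finset.sum_congr rfl fun e _ => by ring
  have h2 : ∑ e, dY e a * A' e b = ∑ i, ∑ j, ∑ k, J k b * A j k
      * (J i a * dX j i + X i * dJ j i a) := by
    simp only [hA', Finset.mul_sum]
    rw [Finset.sum_comm]
    conv_lhs => enter [2, j]; rw [Finset.sum_comm]
    rw [Finset.sum_comm (s := Finset.univ (α := Fin n))]
    have h3 : ∀ k j, ∑ e, dY e a * (J j e * J k b * A j k)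
        = ∑ i, J k b * A j k * (J i a * dX j i + X i * dJ j i a) := fun k j => by
      rw [← Finset.mul_sum, ← hdY, Finset.mul_sum]
      exact Finset.sum_congr rfl fun e _ => by ring
    simp only [h3]
    rw [Finset.sum_comm]
    conv_lhs => enter [2, j]; rw [Finset.sum_comm]
    rw [Finset.sum_comm]
  have h2' : ∑ e, dY e b * A' a e = ∑ i, ∑ j, ∑ k, J j a * A j k
      * (J i b * dX k i + X i * dJ k i b) := by
    simp only [hA', Finset.mul_sum]
    rw [Finset.sum_comm]
    conv_lhs => enter [2, j]; rw [Finset.sum_comm]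
    have h3 : ∀ j k, ∑ e, dY e b * (J j a * J k e * A j k)
        = ∑ i, J j a * A j k * (J i b * dX k i + X i * dJ k i b) := fun j k => by
      rw [← Finset.mul_sum, ← hdY, Finset.mul_sum]
      exact Finset.sum_congr rfl fun e _ => by ring
    simp only [h3]
    conv_lhs => enter [2, j]; rw [Finset.sum_comm]
    rw [Finset.sum_comm]
  have h4 : ∑ j, ∑ k, J j a * J k b * ∑ i, (X i * dA i j k - dX i j * A i k - dX i k * A j i)
      = ∑ i, ∑ j, ∑ k, X i * (J j a * J k b * dA i j k)
        - ∑ i, ∑ j, ∑ k, J k b * A j k * (J i a * dX j i)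
        - ∑ i, ∑ j, ∑ k, J j a * A j k * (J i b * dX k i) := by
    have e1 : ∑ i, ∑ j, ∑ k, X i * (J j a * J k b * dA i j k)
        = ∑ j, ∑ k, ∑ i, J j a * J k b * (X i * dA i j k) := by
      rw [Finset.sum_comm]
      refine Finset.sum_congr rfl fun j _ => ?_
      rw [Finset.sum_comm]
      exact Finset.sum_congr rfl fun k _ => Finset.sum_congr rfl fun i _ => by ring
    have e2 : ∑ i, ∑ j, ∑ k, J k b * A j k * (J i a * dX j i)
        = ∑ j, ∑ k, ∑ i, J j a * J k b * (dX i j * A i k) := by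
      refine Finset.sum_congr rfl fun j _ => ?_
      rw [Finset.sum_comm]
      exact Finset.sum_congr rfl fun k _ => Finset.sum_congr rfl fun i _ => by ring
    have e3 : ∑ i, ∑ j, ∑ k, J j a * A j k * (J i b * dX k i)
        = ∑ j, ∑ k, ∑ i, J j a * J k b * (dX i k * A j i) := by
      rw [Finset.sum_comm]
      refine Finset.sum_congr rfl fun j _ => ?_
      exact Finset.sum_congr rfl fun k _ => Finset.sum_congr rfl fun i _ => by ring
    rw [e1, e2, e3]
    simp only [← Finset.sum_sub_distrib, Finset.mul_sum]
    exact Finset.sum_congr rfl fun j _ => Finset.sum_congr rfl fun k _ =>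
      Finset.sum_congr rfl fun i _ => by ring
  rw [Finset.sum_sub_distrib, Finset.sum_sub_distrib, h1, h2, h2', h4]
  simp only [← Finset.sum_sub_distrib]
  refine Finset.sum_congr rfl fun i _ => Finset.sum_congr rfl fun j _ =>
    Finset.sum_congr rfl fun k _ => ?_
  -- The second derivatives of the coordinate change cancel because they are symmetric in the two
  -- lower indices.
  rw [hdJ j i a, hdJ k i b]
  ring

/-- The Lie derivative of tensors is independent of the chart. -/
theorem lieTensor_change (hn : 0 < n) (hg : g.IsConformallyFlat p)
    (hc : c ∈ atlas (Coord n) M) (hc' : c' ∈ atlas (Coord n) M) {x : M}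
    (hx : x ∈ c.source) (hx' : x ∈ c'.source) {X Y : Coord n → Coord n}
    (hX : ∀ i, DifferentiableAt ℝ (fun z => X z i) (c x))
    (hY : ∀ i, DifferentiableAt ℝ (fun z => Y z i) (c' x))
    (h : FieldsRelated c c' X Y (c x)) (w : ℝ) (P : Symbol n M) (a b : Fin n) :
    lieTensor (g.coeff c') w Y (P.comp2 c') (c' x) a b
      = ∑ i, ∑ j, jac c c' i a (c x) * jac c c' j b (c x)
        * lieTensor (g.coeff c) w X (P.comp2 c) (c x) i j := by
  have hJ : ∀ i a, DifferentiableAt ℝ (jac c c' i a) (c x) := fun i a =>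
    (contDiffAt_jac hc hc' hx hx' i a).differentiableAt (by simp)
  have ht : trans c c' (c x) = c' x := by rw [trans, c.left_inv hx]
  have hA : ∀ i j, DifferentiableAt ℝ (fun z => P.comp2 c z i j) (c x) := fun i j =>
    (((P.2.2 c hc).1 i j).contDiffAt (c.open_target.mem_nhds (c.map_source hx))).differentiableAt
      (by simp)
  have hA' : ∀ i j, DifferentiableAt ℝ (fun z => P.comp2 c' z i j) (c' x) := fun i j =>
    (((P.2.2 c' hc').1 i j).contDiffAt
      (c'.open_target.mem_nhds (c'.map_source hx'))).differentiableAt (by simp)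
  unfold lieTensor
  rw [divergence_change hn hg hc hc' hx hx' hX hY h, comp2_change P hc hc' hx hx']
  have key := sum_lie_change (J := fun i a => jac c c' i a (c x))
    (dJ := fun i j a => pd i (jac c c' j a) (c x)) (X := X (c x)) (Y := Y (c' x))
    (dX := fun j i => pd j (fun z => X z i) (c x)) (dY := fun j i => pd j (fun z => Y z i) (c' x))
    (A := P.comp2 c (c x)) (A' := P.comp2 c' (c' x))
    (dA := fun i j k => pd i (fun z => P.comp2 c z j k) (c x))
    (dA' := fun e => pd e (fun z => P.comp2 c' z a b) (c' x)) (a := a) (b := b)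
    (fun i j a => pd_jac_comm hc hc' hx hx' i j a)
    (fun e => by have := h.self_of_nhds e; rwa [ht] at this)
    (fun j a => h.pd_eq hc hc' hx hx' hX hY j a)
    (fun a b => comp2_change P hc hc' hx hx' a b)
    (fun i => ?_)
  · rw [key]
    simp only [mul_add, Finset.sum_add_distrib, Finset.mul_sum]
    congr 1
    exact Finset.sum_congr rfl fun j _ => Finset.sum_congr rfl fun k _ => by ring
  · rw [← pd_trans hc hc' hx hx' (hA' a b)]
    have h1 : (fun z => P.comp2 c' (trans c c' z) a b) =ᶠ[𝓝 (c x)] fun z => ∑ j, ∑ k,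
        jac c c' j a z * jac c c' k b z * P.comp2 c z j k := by
      filter_upwards [mem_source_of_eventually hx hx'] with z hz
      have := comp2_change P hc hc' hz.2.1 hz.2.2 a b
      rwa [c.right_inv hz.1] at this
    rw [pd_congr h1, pd_sum _ fun j _ => DifferentiableAt.fun_sum fun k _ =>
      ((hJ j a).fun_mul (hJ k b)).fun_mul (hA j k)]
    refine Finset.sum_congr rfl fun j _ => ?_
    rw [pd_sum _ fun k _ => ((hJ j a).fun_mul (hJ k b)).fun_mul (hA j k)]
    refine Finset.sum_congr rfl fun k _ => ?_
    rw [pd_mul ((hJ j a).fun_mul (hJ k b)) (hA j k), pd_mul (hJ j a) (hJ k b)]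

end Naturality

end ConformalQuantization
end

noncomputable section

namespace ConformalQuantization

/-! ### The quantization of a symbol in a chart, in terms of the ring of smooth functions -/

section RingQuantization

variable {n : ℕ} {R : Type*} [CommRing R] [Algebra ℝ R] {d : Fin n → Derivation ℝ R R}

/-- The total operator of a symbol with components `q`, `w`, `s`, in flat coordinates. -/
def ringQuant (d : Fin n → Derivation ℝ R R) (e : Fin n → R) (a b : R) (q : Fin n → Fin n → R)
    (w : Fin n → R) (s f : R) : R :=
  ringOp d e a b q f + (ringAlong d w f + algebraMap ℝ R (1 / 2) * ringDiv d w * f) + s * f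

theorem algebraMap_half_mul_two : algebraMap ℝ R (1 / 2) * 2 = 1 := by
  rw [← map_ofNat (algebraMap ℝ R) 2, ← map_mul]
  norm_num

/-- The commutator of two vector fields acting on functions. -/
theorem ringAlong_lieVector (hd : ∀ i j f, d i (d j f) = d j (d i f)) (w : R) (X W : Fin n → R)
    (f : R) : ringAlong d (ringLieVector d w X W) f
      = ringAlong d X (ringAlong d W f) - ringAlong d W (ringAlong d X f)
        + w * (ringDiv d X * ringAlong d W f) := by
  have h1 : ∀ X W : Fin n → R, ringAlong d X (ringAlong d W f)
      = ∑ i, ∑ k, (X i * d i (W k) * d k f + X i * W k * d i (d k f)) := fun X W => by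
    simp only [ringAlong, map_sum, Derivation.leibniz, smul_eq_mul, Finset.mul_sum]
    exact Finset.sum_congr rfl fun i _ => Finset.sum_congr rfl fun k _ => by ring
  have h2 : ringAlong d (ringLieVector d w X W) f
      = ∑ k, ∑ i, (X i * d i (W k) - d i (X k) * W i) * d k f
        + w * (ringDiv d X * ringAlong d W f) := by
    simp only [ringAlong, ringLieVector, add_mul, Finset.sum_add_distrib, Finset.sum_mul,
      Finset.mul_sum]
    congr 1
    exact Finset.sum_congr rfl fun i _ => by ring
  rw [h1, h1, h2]
  congr 1
  rw [Finset.sum_comm]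
  have h3 : ∑ i, ∑ k, (W i * d i (X k) * d k f + W i * X k * d i (d k f))
      = ∑ i, ∑ k, (W i * d i (X k) * d k f + X i * W k * d i (d k f)) := by
    simp only [Finset.sum_add_distrib]
    congr 1
    rw [Finset.sum_comm]
    exact Finset.sum_congr rfl fun i _ => Finset.sum_congr rfl fun k _ => by rw [hd]; ring
  rw [h3]
  simp only [← Finset.sum_sub_distrib]
  exact Finset.sum_congr rfl fun i _ => Finset.sum_congr rfl fun k _ => by ring

theorem ringAlong_mul (X : Fin n → R) (f f' : R) :
    ringAlong d X (f * f') = ringAlong d X f * f' + f * ringAlong d X f' := by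
  simp only [ringAlong, Derivation.leibniz, smul_eq_mul, Finset.sum_mul, Finset.mul_sum,
    ← Finset.sum_add_distrib]
  exact Finset.sum_congr rfl fun i _ => by ring

theorem ringAlong_add (X : Fin n → R) (f f' : R) :
    ringAlong d X (f + f') = ringAlong d X f + ringAlong d X f' := by
  simp only [ringAlong, map_add, mul_add, Finset.sum_add_distrib]

theorem ringAlong_const {w : R} (hw : ∀ i, d i w = 0) (X : Fin n → R) : ringAlong d X w = 0 := by
  simp [ringAlong, hw]

theorem ringAlong_smul (h : R) (X : Fin n → R) (f : R) :
    ringAlong d (fun i => h * X i) f = h * ringAlong d X f := by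
  simp only [ringAlong, Finset.mul_sum, mul_assoc]

theorem ringDiv_smul (h : R) (X : Fin n → R) :
    ringDiv d (fun i => h * X i) = h * ringDiv d X + ringAlong d X h := by
  simp only [ringDiv, ringAlong, Derivation.leibniz, smul_eq_mul, Finset.mul_sum,
    Finset.sum_add_distrib]

theorem ringDiv_lieVector_weight (hd : ∀ i j f, d i (d j f) = d j (d i f)) {w : R}
    (hw : ∀ i, d i w = 0) (X W : Fin n → R) :
    ringDiv d (ringLieVector d w X W) = ringLie d w X (ringDiv d W)
      + (w - 1) * ringAlong d W (ringDiv d X) := by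
  have h1 : ringLieVector d w X W
      = fun k => ringLieVector d 1 X W k + (w - 1) * ringDiv d X * W k := by
    funext k
    simp only [ringLieVector]
    ring
  have h2 : ∀ A B : Fin n → R, ringDiv d (fun k => A k + B k) = ringDiv d A + ringDiv d B :=
    fun A B => by simp [ringDiv, Finset.sum_add_distrib]
  have h3 : ∀ i, d i (w - 1) = 0 := fun i => by simp [hw]
  rw [h1, h2, ringDiv_lieVector hd, ringDiv_smul, ringAlong_mul, ringAlong_const h3]
  simp only [ringLie]
  ring

/-- In degree one the half divergence compensates the weight. A vector field of weight 1 - 2l has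
the divergence anomaly -2l · w(div X), half of which is the term produced when w differentiates the
factor l · div X in the Lie derivative of f. -/
theorem IsRingConformal.quant_lie (hd : ∀ i j f, d i (d j f) = d j (d i f))
    {e X : Fin n → R} {h : R} (hX : IsRingConformal d e X h)
    (he : ∀ i, e i * e i = 1) (hed : ∀ i j, d i (e j) = 0)
    {l m a b : R} (hl : ∀ i, d i l = 0) (ha : ∀ i, d i a = 0)
    (hb : ∀ i, d i b = 0) (hlm : l + m = 1)
    (h1 : a * (2 * n * (m - l) - 2 * n - 2) = -(l * n))
    (h2 : a + b * (2 * n * (m - l) - n - 2) = 0)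
    {q : Fin n → Fin n → R} (hq : ∀ i j, q i j = q j i) (w : Fin n → R) (s f : R) :
    ringQuant d e a b (ringLieTensor d (m - l) X q) (ringLieVector d (m - l) X w)
        (ringLie d (m - l) X s) f
      = ringLie d m X (ringQuant d e a b q w s f)
        - ringQuant d e a b q w s (ringLie d l X f) := by
  have hm : m = 1 - l := by linear_combination hlm
  have hw : ∀ i, d i (m - l) = 0 := fun i => by simp [hm, hl]
  have hh : ∀ i, d i (algebraMap ℝ R (1 / 2)) = 0 := fun i => by simp
  have e1 := hX.op_lieTensor hd he hed hl ha hb hlm h1 h2 hq f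
  have e2 := algebraMap_half_mul_two (R := R)
  simp only [ringQuant]
  rw [e1, ringAlong_lieVector hd, ringDiv_lieVector_weight hd hw]
  simp only [ringLie, ringAlong_mul, ringAlong_add, ringAlong_const hl, ringAlong_const hh]
  subst hm
  linear_combination (-l) * f * ringAlong d w (ringDiv d X) * e2

end RingQuantization

/-! ### Passage between coefficients relative to |vol| and flat density coefficients -/

section VolPow

variable {n : ℕ}

/-- The power `|vol|^r`, for the metric `exp(2σ) η`. -/
def volPow (σ : SmoothFn n) (r : ℝ) : SmoothFn n := smoothExp (algebraMap ℝ _ (r * n) * σ)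

theorem volPow_mul (σ : SmoothFn n) (r s : ℝ) : volPow σ r * volPow σ s = volPow σ (r + s) := by
  rw [volPow, volPow, volPow, ← smoothExp_add]
  congr 1
  rw [add_mul, map_add]
  ring

theorem volPow_zero (σ : SmoothFn n) : volPow σ 0 = 1 := by
  rw [volPow, ← smoothExp_zero]
  congr 1
  simp

theorem der_volPow (σ : SmoothFn n) (r : ℝ) (i : Fin n) :
    der i (volPow σ r) = volPow σ r * (algebraMap ℝ _ (r * n) * der i σ) := by
  rw [volPow, der_smoothExp]
  congr 1
  simp [Derivation.leibniz]

variable {p : ℕ} {G : Coord n → Matrix (Fin n) (Fin n) ℝ} {σ : SmoothFn n} {y : Coord n}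

theorem HasConformalFactor.rpow_eventuallyEq (h : HasConformalFactor p G σ y) (r : ℝ) :
    (fun z => volCoeff G z ^ r) =ᶠ[𝓝 y] volPow σ r := by
  filter_upwards [h.volCoeff_eventuallyEq] with z hz
  rw [hz]
  simp only [smoothExp_apply, volPow, SmoothFn.mul_apply, SmoothFn.natCast_apply,
    SmoothFn.algebraMap_apply]
  rw [← Real.exp_mul]
  congr 1
  ring

theorem HasConformalFactor.volCoeff_eq (h : HasConformalFactor p G σ y) :
    volCoeff G =ᶠ[𝓝 y] volPow σ 1 := by
  filter_upwards [h.rpow_eventuallyEq 1] with z hz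
  rw [← hz, Real.rpow_one]

theorem HasConformalFactor.divergence_eventuallyEq (h : HasConformalFactor p G σ y)
    {Z : Coord n → Coord n} {Zr : Fin n → SmoothFn n}
    (hZ : ∀ᶠ z in 𝓝 y, ∀ i, Z z i = Zr i z) :
    divergence G Z =ᶠ[𝓝 y]
      (volPow σ (-1) * ringDiv der (fun i => volPow σ 1 * Zr i) : SmoothFn n) := by
  have h1 : ∀ i, pd i (fun z => volCoeff G z * Z z i) =ᶠ[𝓝 y]
      pd i (volPow σ 1 * Zr i : SmoothFn n) :=
    fun i => by
      refine eventuallyEq_pd ?_ i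
      filter_upwards [h.volCoeff_eq, hZ] with z h1 h2
      rw [h1, h2]
      rfl
  have h0 : ∀ z, volPow σ (-1) z * volPow σ 1 z = 1 := fun z => by
    have := congrArg (fun f : SmoothFn n => f z) (volPow_mul σ (-1) 1)
    simpa [volPow_zero] using this
  filter_upwards [h.volCoeff_eq, Filter.eventually_all.2 h1] with z h2 h3
  rw [divergence, h2, Finset.sum_congr rfl fun i _ => h3 i]
  simp only [SmoothFn.mul_apply, ringDiv, SmoothFn.sum_apply, coe_der]
  rw [div_eq_iff (fun h => by simpa [h] using h0 z)]
  linear_combination -(∑ i, pd i (volPow σ 1 * Zr i : SmoothFn n) z) * h0 z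

/-- Lie derivatives of densities, in terms of the ring of smooth functions. -/
theorem HasConformalFactor.lieDensity_eventuallyEq (h : HasConformalFactor p G σ y)
    {X : Coord n → Coord n} {Xr : Fin n → SmoothFn n} (hX : HasComponents X Xr)
    {f : Coord n → ℝ} {fr : SmoothFn n} (hf : f =ᶠ[𝓝 y] fr) (w : ℝ) :
    lieDensity G w X f =ᶠ[𝓝 y]
      (volPow σ (-w) * ringLie der (algebraMap ℝ _ w) Xr (volPow σ w * fr) : SmoothFn n) := by
  have h1 : ∀ i, pd i f =ᶠ[𝓝 y] pd i fr := fun i => eventuallyEq_pd hf i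
  have h0 : volPow σ (-w) * volPow σ w = 1 := by rw [volPow_mul]; simp [volPow_zero]
  have h0' : volPow σ (-1) * volPow σ 1 = 1 := by rw [volPow_mul]; simp [volPow_zero]
  have hr : volPow σ (-w) * ringLie der (algebraMap ℝ _ w) Xr (volPow σ w * fr)
      = ringAlong der Xr fr + algebraMap ℝ _ w
        * (volPow σ (-1) * ringDiv der (fun i => volPow σ 1 * Xr i)) * fr := by
    have h3 : ∀ r : ℝ, ringAlong der Xr (volPow σ r)
        = volPow σ r * (algebraMap ℝ _ r * (n * ringAlong der Xr σ)) := fun r => by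
      simp only [ringAlong, der_volPow, Finset.mul_sum, map_mul, map_natCast]
      exact Finset.sum_congr rfl fun i _ => by ring
    rw [ringLie, ringAlong_mul, ringDiv_smul, h3, h3, map_one]
    linear_combination (ringAlong der Xr fr + algebraMap ℝ _ w
      * (n * ringAlong der Xr σ) * fr + algebraMap ℝ _ w * ringDiv der Xr * fr) * h0
      - algebraMap ℝ _ w * fr * (ringDiv der Xr + n * ringAlong der Xr σ) * h0'
  rw [hr]
  filter_upwards [hf, Filter.eventually_all.2 h1,
    h.divergence_eventuallyEq (.of_forall hX)] with z h2 h3 h4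
  rw [lieDensity, h2, h4, Finset.sum_congr rfl fun i _ => by rw [h3 i, hX z i]]
  simp [ringAlong]

/-- Lie derivatives of vectors, in terms of the ring of smooth functions. -/
theorem HasConformalFactor.lieVector_eventuallyEq (h : HasConformalFactor p G σ y)
    {X : Coord n → Coord n} {Xr : Fin n → SmoothFn n} (hX : HasComponents X Xr)
    {A : Coord n → Fin n → ℝ} {Ar : Fin n → SmoothFn n}
    (hA : ∀ᶠ z in 𝓝 y, ∀ i, A z i = Ar i z) (w : ℝ) (k : Fin n) :
    (fun z => lieVector G w X A z k) =ᶠ[𝓝 y]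
      (volPow σ (-w) * ringLieVector der (algebraMap ℝ _ w) Xr (fun i => volPow σ w * Ar i) k :
        SmoothFn n) := by
  have h1 := h.lieDensity_eventuallyEq hX (f := fun z => A z k) (fr := Ar k)
    (hA.mono fun z hz => hz k) w
  have h0 : volPow σ (-w) * volPow σ w = 1 := by rw [volPow_mul]; simp [volPow_zero]
  have h2 : volPow σ (-w) * ringLieVector der (algebraMap ℝ _ w) Xr (fun i => volPow σ w * Ar i) k
      = volPow σ (-w) * ringLie der (algebraMap ℝ _ w) Xr (volPow σ w * Ar k)
        - ∑ i, der i (Xr k) * Ar i := by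
    simp only [ringLieVector, ringLie, ringAlong, Finset.sum_sub_distrib]
    have : ∑ i, der i (Xr k) * (volPow σ w * Ar i) = volPow σ w * ∑ i, der i (Xr k) * Ar i := by
      rw [Finset.mul_sum]; exact Finset.sum_congr rfl fun i _ => by ring
    rw [this]
    linear_combination -(∑ i, der i (Xr k) * Ar i) * h0
  have hX' : ∀ k, (fun z => X z k) = Xr k := fun k => funext fun z => hX z k
  rw [h2]
  filter_upwards [h1, hA] with z h3 h4
  rw [SmoothFn.sub_apply, ← h3]
  simp only [lieVector, lieDensity, Finset.sum_sub_distrib, SmoothFn.sum_apply, coe_der,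
    SmoothFn.mul_apply, hX', h4]
  ring

/-- Lie derivatives of tensors, in terms of the ring of smooth functions. -/
theorem HasConformalFactor.lieTensor_eventuallyEq (h : HasConformalFactor p G σ y)
    {X : Coord n → Coord n} {Xr : Fin n → SmoothFn n} (hX : HasComponents X Xr)
    {A : Coord n → Fin n → Fin n → ℝ} {Ar : Fin n → Fin n → SmoothFn n}
    (hA : ∀ᶠ z in 𝓝 y, ∀ i j, A z i j = Ar i j z) (w : ℝ) (k l : Fin n) :
    (fun z => lieTensor G w X A z k l) =ᶠ[𝓝 y] (volPow σ (-w)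
      * ringLieTensor der (algebraMap ℝ _ w) Xr (fun i j => volPow σ w * Ar i j) k l :
        SmoothFn n) := by
  have h1 := h.lieDensity_eventuallyEq hX (f := fun z => A z k l) (fr := Ar k l)
    (hA.mono fun z hz => hz k l) w
  have h0 : volPow σ (-w) * volPow σ w = 1 := by rw [volPow_mul]; simp [volPow_zero]
  have h2 : volPow σ (-w)
      * ringLieTensor der (algebraMap ℝ _ w) Xr (fun i j => volPow σ w * Ar i j) k l
      = volPow σ (-w) * ringLie der (algebraMap ℝ _ w) Xr (volPow σ w * Ar k l)
        - ∑ i, der i (Xr k) * Ar i l - ∑ i, der i (Xr l) * Ar k i := by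
    simp only [ringLieTensor, ringLie, ringAlong, Finset.sum_sub_distrib]
    have e1 : ∑ i, der i (Xr k) * (volPow σ w * Ar i l)
        = volPow σ w * ∑ i, der i (Xr k) * Ar i l := by
      rw [Finset.mul_sum]; exact Finset.sum_congr rfl fun i _ => by ring
    have e2 : ∑ i, der i (Xr l) * (volPow σ w * Ar k i)
        = volPow σ w * ∑ i, der i (Xr l) * Ar k i := by
      rw [Finset.mul_sum]; exact Finset.sum_congr rfl fun i _ => by ring
    rw [e1, e2]
    linear_combination -(∑ i, der i (Xr k) * Ar i l + ∑ i, der i (Xr l) * Ar k i) * h0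
  have hX' : ∀ k, (fun z => X z k) = Xr k := fun k => funext fun z => hX z k
  rw [h2]
  filter_upwards [h1, hA] with z h3 h4
  rw [SmoothFn.sub_apply, SmoothFn.sub_apply, ← h3]
  simp only [lieTensor, lieDensity, Finset.sum_sub_distrib, SmoothFn.sum_apply, coe_der,
    SmoothFn.mul_apply, hX', h4]
  ring

/-- The zeroth order term of the quantization of a homogeneous symbol of degree two, in a chart. -/
def confPot (p : ℕ) (a b l : ℝ) (G : Coord n → Matrix (Fin n) (Fin n) ℝ)
    (q : Coord n → Fin n → Fin n → ℝ) (z : Coord n) : ℝ :=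
  volCoeff G z ^ (l - 1)
    * (∑ i, ∑ j, pd i (fun y => volCoeff G y ^ (1 - 2 * l) * q y i j
        * pd j (fun x => volCoeff G x ^ l) y) z
      + (a * ∑ i, ∑ j, pd i (pd j fun y => volCoeff G y ^ (1 - 2 * l) * q y i j) z
        + b * ∑ i, ∑ k, eta n p i * eta n p k
          * pd i (pd i fun y => volCoeff G y ^ (1 - 2 * l) * q y k k) z) * volCoeff G z ^ l)

theorem HasConformalFactor.confPot_eventuallyEq (h : HasConformalFactor p G σ y) (a b l : ℝ)
    {q : Coord n → Fin n → Fin n → ℝ} {qr : Fin n → Fin n → SmoothFn n}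
    (hq : ∀ᶠ z in 𝓝 y, ∀ i j, q z i j = qr i j z) :
    confPot p a b l G q =ᶠ[𝓝 y] (volPow σ (l - 1)
      * ringOp der (etaFun n p) (algebraMap ℝ _ a) (algebraMap ℝ _ b)
        (fun i j => volPow σ (1 - 2 * l) * qr i j) (volPow σ l) : SmoothFn n) := by
  have h1 : ∀ i j, (fun z => volCoeff G z ^ (1 - 2 * l) * q z i j)
      =ᶠ[𝓝 y] (volPow σ (1 - 2 * l) * qr i j : SmoothFn n) := fun i j => by
    filter_upwards [h.rpow_eventuallyEq (1 - 2 * l), hq] with z h1 h2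
    rw [h1, h2]
    rfl
  have h2 : ∀ i j, (fun y => volCoeff G y ^ (1 - 2 * l) * q y i j
        * pd j (fun x => volCoeff G x ^ l) y)
      =ᶠ[𝓝 y] (volPow σ (1 - 2 * l) * qr i j * der j (volPow σ l) : SmoothFn n) := fun i j => by
    filter_upwards [h1 i j, eventuallyEq_pd (h.rpow_eventuallyEq l) j] with z h1 h2
    rw [h1, h2]
    rfl
  filter_upwards [h.rpow_eventuallyEq (l - 1), h.rpow_eventuallyEq l,
    Filter.eventually_all.2 fun i => Filter.eventually_all.2 fun j => eventuallyEq_pd (h2 i j) i,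
    Filter.eventually_all.2 fun i => Filter.eventually_all.2 fun j =>
      eventuallyEq_pd (eventuallyEq_pd (h1 i j) j) i,
    Filter.eventually_all.2 fun i => Filter.eventually_all.2 fun k =>
      eventuallyEq_pd (eventuallyEq_pd (h1 k k) i) i] with z h3 h4 h5 h6 h7
  simp only [confPot, h3, h4, h5, h6, h7, ringOp, ringDivGrad, ringPot, SmoothFn.mul_apply,
    SmoothFn.add_apply, SmoothFn.sum_apply, SmoothFn.algebraMap_apply, coe_der, etaFun]

/-- The quantization of a symbol with components `q`, `w`, `s`, in a chart. -/
def confOp (p : ℕ) (a b l : ℝ) (G : Coord n → Matrix (Fin n) (Fin n) ℝ)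
    (q : Coord n → Fin n → Fin n → ℝ) (w : Coord n → Coord n) (s f : Coord n → ℝ)
    (z : Coord n) : ℝ :=
  divergence G (fun y i => ∑ j, q y i j * pd j f y) z + confPot p a b l G q z * f z
    + (∑ i, w z i * pd i f z + 1 / 2 * divergence G w z * f z) + s z * f z

/-- The right hand side is the flat quantization: the inputs are multiplied by |vol|^δ and |vol|^λ,
and the result is divided by |vol|^μ, where μ = 1 - λ. Conjugation turns it into divergence form, in
which the choice of flat coordinates survives only in `confPot`, the value of the degree-two
operator on |vol|^λ. -/
theorem HasConformalFactor.confOp_eventuallyEq (h : HasConformalFactor p G σ y) (a b l : ℝ)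
    {q : Coord n → Fin n → Fin n → ℝ} {qr : Fin n → Fin n → SmoothFn n}
    (hq : ∀ᶠ z in 𝓝 y, ∀ i j, q z i j = qr i j z) (hqr : ∀ i j, qr i j = qr j i)
    {w : Coord n → Coord n} {wr : Fin n → SmoothFn n} (hw : ∀ᶠ z in 𝓝 y, ∀ i, w z i = wr i z)
    {s f : Coord n → ℝ} {sr fr : SmoothFn n} (hs : s =ᶠ[𝓝 y] sr) (hf : f =ᶠ[𝓝 y] fr) :
    confOp p a b l G q w s f =ᶠ[𝓝 y] (volPow σ (l - 1)
      * ringQuant der (etaFun n p) (algebraMap ℝ _ a) (algebraMap ℝ _ b)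
        (fun i j => volPow σ (1 - 2 * l) * qr i j) (fun i => volPow σ (1 - 2 * l) * wr i)
        (volPow σ (1 - 2 * l) * sr) (volPow σ l * fr) : SmoothFn n) := by
  have h1 : ∀ i, pd i f =ᶠ[𝓝 y] pd i fr := fun i => eventuallyEq_pd hf i
  have hflux : ∀ᶠ z in 𝓝 y, ∀ i, (fun y i => ∑ j, q y i j * pd j f y) z i
      = (∑ j, qr i j * der j fr) z := by
    filter_upwards [hq, Filter.eventually_all.2 h1] with z h2 h3 i
    simp [h2, h3]
  have hαβ : volPow σ l * volPow σ (-l) = 1 := by rw [volPow_mul]; simp [volPow_zero]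
  have hv : volPow σ (-1) * volPow σ 1 = 1 := by rw [volPow_mul]; simp [volPow_zero]
  have h2 : volPow σ (1 - 2 * l) = volPow σ (-l) * volPow σ (-l) * volPow σ 1 := by
    rw [volPow_mul, volPow_mul]; congr 1; ring
  have h3 : volPow σ (l - 1) = volPow σ l * volPow σ (-1) := by rw [volPow_mul]; congr 1
  have hA : ∀ (X : Fin n → SmoothFn n) (r : ℝ), ringAlong der X (volPow σ r)
      = volPow σ r * (algebraMap ℝ _ r * (n * ringAlong der X σ)) := fun X r => by
    simp only [ringAlong, der_volPow, Finset.mul_sum, map_mul, map_natCast]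
    exact Finset.sum_congr rfl fun i _ => by ring
  have key : volPow σ (l - 1)
      * ringQuant der (etaFun n p) (algebraMap ℝ _ a) (algebraMap ℝ _ b)
        (fun i j => volPow σ (1 - 2 * l) * qr i j) (fun i => volPow σ (1 - 2 * l) * wr i)
        (volPow σ (1 - 2 * l) * sr) (volPow σ l * fr)
      = volPow σ (-1) * ringDiv der (fun i => volPow σ 1 * ∑ j, qr i j * der j fr)
        + volPow σ (l - 1) * ringOp der (etaFun n p) (algebraMap ℝ _ a) (algebraMap ℝ _ b)
          (fun i j => volPow σ (1 - 2 * l) * qr i j) (volPow σ l) * fr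
        + (ringAlong der wr fr + algebraMap ℝ _ (1 / 2)
          * (volPow σ (-1) * ringDiv der (fun i => volPow σ 1 * wr i)) * fr) + sr * fr := by
    have e1 := ringDivGrad_conj (d := der) (q := fun i j => volPow σ 1 * qr i j)
      (fun i j => by rw [hqr]) hαβ fr
    have e2 : ringDivGrad der (fun i j => volPow σ 1 * qr i j) fr
        = ringDiv der (fun i => volPow σ 1 * ∑ j, qr i j * der j fr) := by
      rw [ringDivGrad_eq]
      congr 1
      funext i
      rw [Finset.mul_sum]
      exact Finset.sum_congr rfl fun j _ => by ring
    rw [e2] at e1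
    simp only [← mul_assoc, ← h2] at e1
    simp only [ringQuant, ringOp]
    simp only [← mul_assoc] at e1 ⊢
    rw [e1, ringAlong_smul, ringAlong_mul, ringDiv_smul _ wr, ringDiv_smul _ wr, hA, hA, hA, h3, h2]
    have e4 := algebraMap_half_mul_two (R := SmoothFn n)
    simp only [map_sub, map_one, map_mul, map_ofNat]
    set α := volPow σ l
    set β := volPow σ (-l)
    set v := volPow σ 1
    set v' := volPow σ (-1)
    set A := ringAlong der wr fr
    set B := ringAlong der wr σ
    set D := ringDiv der wr
    set t := (algebraMap ℝ (SmoothFn n)) l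
    set c := (algebraMap ℝ (SmoothFn n)) (1 / 2)
    have e5 : (c : SmoothFn n) * 2 = 1 := e4
    set T := A + t * (n * B) * fr + c * (D + (1 - 2 * t) * (n * B)) * fr + sr * fr
    linear_combination (v' * ringDiv der (fun i => v * ∑ j, qr i j * der j fr)
      + T * (α * β + 1) * v * v') * hαβ + (T - c * (D + n * B) * fr) * hv - t * n * B * fr * e5
  rw [key]
  filter_upwards [h.divergence_eventuallyEq hflux, h.confPot_eventuallyEq a b l hq,
    h.divergence_eventuallyEq hw, hw, hs, hf, Filter.eventually_all.2 h1] with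
    z h4 h5 h6 h7 h8 h9 h10
  rw [confOp, h4, h5, h6, h8, h9, Finset.sum_congr rfl fun i _ => by rw [h7 i, h10 i]]
  simp [ringAlong]

end VolPow

end ConformalQuantization
end

noncomputable section

namespace ConformalQuantization

/-! ### The quantization of a symbol in a chart of the manifold -/

section RingLinear

variable {n : ℕ} {R : Type*} [CommRing R] [Algebra ℝ R] {d : Fin n → Derivation ℝ R R}

theorem ringQuant_add_smul (e : Fin n → R) (a b : R) {u r : R} (hr : ∀ i, d i r = 0)
    (q q' : Fin n → Fin n → R) (w w' : Fin n → R) (s s' f : R) :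
    ringQuant d e a b (fun i j => u * (q i j + r * q' i j)) (fun i => u * (w i + r * w' i))
        (u * (s + r * s')) f
      = ringQuant d e a b (fun i j => u * q i j) (fun i => u * w i) (u * s) f
        + r * ringQuant d e a b (fun i j => u * q' i j) (fun i => u * w' i) (u * s') f := by
  have h1 : ∀ x i, d i (r * x) = r * d i x := fun x i => by simp [Derivation.leibniz, hr]
  have h2 : ∀ x y : R, u * (x + r * y) = u * x + r * (u * y) := fun x y => by ring
  simp only [h2, ringQuant, ringOp, ringDivGrad, ringPot, ringAlong, ringDiv, add_mul, map_add,
    mul_add, Finset.sum_add_distrib, mul_assoc, h1]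
  simp only [Finset.mul_sum, mul_left_comm _ r]
  simp only [← Finset.mul_sum]
  ring

theorem ringQuant_right_add_smul (e : Fin n → R) (a b : R) {r : R} (hr : ∀ i, d i r = 0)
    (q : Fin n → Fin n → R) (w : Fin n → R) (s f f' : R) :
    ringQuant d e a b q w s (f + r * f')
      = ringQuant d e a b q w s f + r * ringQuant d e a b q w s f' := by
  simp only [ringQuant, ringOp, ringDivGrad_add_right, ringDivGrad_const_mul hr, ringAlong_add,
    ringAlong_mul, ringAlong_const hr]
  ring

end RingLinear

section Chart

variable {n p : ℕ} {M : Type*} [TopologicalSpace M] [ChartedSpace (Coord n) M]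
  {g : PseudoRiemannianMetric n M} {c c' : OpenPartialHomeomorph M (Coord n)} {y : Coord n}

theorem Symbol.exists_rep2 (P : Symbol n M) (hc : c ∈ atlas (Coord n) M) (hy : y ∈ c.target) :
    ∃ q : Fin n → Fin n → SmoothFn n, (∀ i j, q i j = q j i) ∧
      ∀ᶠ z in 𝓝 y, ∀ i j, P.comp2 c z i j = q i j z := by
  choose r hr using fun i j => exists_smoothAlg_eventuallyEq (c.open_target.mem_nhds hy)
    ((P.2.2 c hc).1 i j)
  -- Representatives chosen for each pair of indices need not be symmetric away from the point;
  -- using the ordered pair makes them symmetric globally, as the ring identities require.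
  refine ⟨fun i j => r (min i j) (max i j), fun i j => by
    beta_reduce; rw [min_comm, max_comm], ?_⟩
  filter_upwards [Filter.eventually_all.2 fun i => Filter.eventually_all.2 fun j => hr i j]
    with z hz i j
  rw [← hz]
  rcases le_total i j with h | h
  · rw [min_eq_left h, max_eq_right h]; rfl
  · rw [min_eq_right h, max_eq_left h]; exact P.2.1 _ _ _

theorem Symbol.exists_rep1 (P : Symbol n M) (hc : c ∈ atlas (Coord n) M) (hy : y ∈ c.target) :
    ∃ w : Fin n → SmoothFn n, ∀ᶠ z in 𝓝 y, ∀ i, P.comp1 c z i = w i z := by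
  choose r hr using fun i => exists_smoothAlg_eventuallyEq (c.open_target.mem_nhds hy)
    ((P.2.2 c hc).2.1 i)
  exact ⟨r, Filter.eventually_all.2 hr⟩

theorem Symbol.exists_rep0 (P : Symbol n M) (hc : c ∈ atlas (Coord n) M) (hy : y ∈ c.target) :
    ∃ s : SmoothFn n, P.comp0 c =ᶠ[𝓝 y] s :=
  exists_smoothAlg_eventuallyEq (c.open_target.mem_nhds hy) (P.2.2 c hc).2.2

theorem exists_rep [IsManifold 𝓘(ℝ, Coord n) ∞ M] (f : SmoothFun n M)
    (hc : c ∈ atlas (Coord n) M) (hy : y ∈ c.target) :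
    ∃ r : SmoothFn n, (fun z => f (c.symm z)) =ᶠ[𝓝 y] r :=
  exists_smoothAlg_eventuallyEq (c.open_target.mem_nhds hy) (contDiffOn_comp_symm f.contMDiff hc)

/-- The quantization of `P` in the chart `c`. -/
def chartQuant (g : PseudoRiemannianMetric n M) (p : ℕ) (a b l : ℝ)
    (c : OpenPartialHomeomorph M (Coord n)) (P : Symbol n M) (f : SmoothFun n M) : Coord n → ℝ :=
  confOp p a b l (g.coeff c) (P.comp2 c) (P.comp1 c) (P.comp0 c) (fun x => f (c.symm x))

/-- The zeroth order term of the quantization of the component of degree two, in the chart `c`. -/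
def chartPot (g : PseudoRiemannianMetric n M) (p : ℕ) (a b l : ℝ)
    (c : OpenPartialHomeomorph M (Coord n)) (P : Symbol n M) : Coord n → ℝ :=
  confPot p a b l (g.coeff c) (P.comp2 c)

theorem divergence_zero (G : Coord n → Matrix (Fin n) (Fin n) ℝ) (y : Coord n) :
    divergence G (fun _ _ => 0) y = 0 := by
  simp [divergence, pd]

/-- The potential is the value on the constant function 1, because the divergence form kills
constants. Linearity in the symbol is inherited from the whole operator in this way. -/
theorem chartPot_eq (a b l : ℝ) (P : Symbol n M) :
    chartPot g p a b l c P = chartQuant g p a b l c P.part2 1 := by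
  funext z
  have h1 : P.part2.comp1 c = fun _ _ => 0 := by funext z i; simp [Symbol.comp1, Symbol.part2]
  have h0 : P.part2.comp0 c = fun _ => 0 := by funext z; simp [Symbol.comp0, Symbol.part2]
  have h2 : P.part2.comp2 c = P.comp2 c := rfl
  rw [chartQuant, confOp, h0, h1, h2, divergence_zero]
  have h3 : ∀ j y, pd j (fun x : Coord n => (1 : SmoothFun n M) (c.symm x)) y = 0 := fun j y =>
    pd_const (1 : ℝ) j y
  simp only [h3, mul_zero, Finset.sum_const_zero, divergence_zero]
  simp [chartPot]

variable [IsManifold 𝓘(ℝ, Coord n) ∞ M]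

/-- All germs at one point are represented at once by elements of the ring of smooth functions, so
that ring identities hold for the operator near that point. -/
theorem chartQuant_rep (hc : c ∈ atlas (Coord n) M) (hy : y ∈ c.target) {σ : SmoothFn n}
    (hσ : HasConformalFactor p (g.coeff c) σ y) (a b l : ℝ) (P : Symbol n M) (f : SmoothFun n M) :
    ∃ (q : Fin n → Fin n → SmoothFn n) (w : Fin n → SmoothFn n) (s r : SmoothFn n),
      (∀ i j, q i j = q j i) ∧ (∀ᶠ z in 𝓝 y, ∀ i j, P.comp2 c z i j = q i j z) ∧
      (∀ᶠ z in 𝓝 y, ∀ i, P.comp1 c z i = w i z) ∧ P.comp0 c =ᶠ[𝓝 y] s ∧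
      (fun z => f (c.symm z)) =ᶠ[𝓝 y] r ∧
      chartQuant g p a b l c P f =ᶠ[𝓝 y] (volPow σ (l - 1)
        * ringQuant der (etaFun n p) (algebraMap ℝ _ a) (algebraMap ℝ _ b)
          (fun i j => volPow σ (1 - 2 * l) * q i j) (fun i => volPow σ (1 - 2 * l) * w i)
          (volPow σ (1 - 2 * l) * s) (volPow σ l * r) : SmoothFn n) := by
  obtain ⟨q, hq, hq'⟩ := P.exists_rep2 hc hy
  obtain ⟨w, hw⟩ := P.exists_rep1 hc hy
  obtain ⟨s, hs⟩ := P.exists_rep0 hc hy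
  obtain ⟨r, hr⟩ := exists_rep f hc hy
  exact ⟨q, w, s, r, hq, hq', hw, hs, hr, hσ.confOp_eventuallyEq a b l hq' hq hw hs hr⟩

theorem contDiffAt_chartQuant (hn : 0 < n) (hg : g.IsConformallyFlat p)
    (hc : c ∈ atlas (Coord n) M) (hy : y ∈ c.target) (a b l : ℝ) (P : Symbol n M)
    (f : SmoothFun n M) : ContDiffAt ℝ ∞ (chartQuant g p a b l c P f) y := by
  obtain ⟨σ, hσ⟩ := exists_conformalFactor hn hg hc hy
  obtain ⟨q, w, s, r, -, -, -, -, -, h⟩ := chartQuant_rep hc hy hσ a b l P f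
  exact (contDiff_coe _).contDiffAt.congr_of_eventuallyEq h

theorem chartQuant_add_smul (hn : 0 < n) (hg : g.IsConformallyFlat p)
    (hc : c ∈ atlas (Coord n) M) (hy : y ∈ c.target) (a b l : ℝ) (P P' : Symbol n M) (t : ℝ)
    (f : SmoothFun n M) : chartQuant g p a b l c (P + t • P') f y
      = chartQuant g p a b l c P f y + t * chartQuant g p a b l c P' f y := by
  obtain ⟨σ, hσ⟩ := exists_conformalFactor hn hg hc hy
  obtain ⟨q, w, s, r, hq, hq', hw, hs, hr, h⟩ := chartQuant_rep hc hy hσ a b l P f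
  obtain ⟨q₁, w₁, s₁, -, hq₁, hq₁', hw₁, hs₁, -, -⟩ := chartQuant_rep hc hy hσ a b l P' f
  have h' := hσ.confOp_eventuallyEq a b l hq₁' hq₁ hw₁ hs₁ hr
  have h'' := hσ.confOp_eventuallyEq (q := (P + t • P').comp2 c) (w := (P + t • P').comp1 c)
    (s := (P + t • P').comp0 c) a b l (qr := fun i j => q i j + algebraMap ℝ _ t * q₁ i j)
    (wr := fun i => w i + algebraMap ℝ _ t * w₁ i) (sr := s + algebraMap ℝ _ t * s₁)
    (by
      filter_upwards [hq', hq₁'] with z h1 h2 i j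
      simp [← h1, ← h2, Symbol.comp2])
    (fun i j => by rw [hq, hq₁])
    (by
      filter_upwards [hw, hw₁] with z h1 h2 i
      simp [← h1, ← h2, Symbol.comp1])
    (by
      filter_upwards [hs, hs₁] with z h1 h2
      simp [← h1, ← h2, Symbol.comp0]) hr
  rw [ringQuant_add_smul _ _ _ (fun i => by simp)] at h''
  rw [h.eq_of_nhds, show chartQuant g p a b l c P' f y = _ from h'.eq_of_nhds,
    show chartQuant g p a b l c (P + t • P') f y = _ from h''.eq_of_nhds]
  simp only [SmoothFn.mul_apply, SmoothFn.add_apply, SmoothFn.algebraMap_apply]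
  ring

theorem chartQuant_right_add_smul (hn : 0 < n) (hg : g.IsConformallyFlat p)
    (hc : c ∈ atlas (Coord n) M) (hy : y ∈ c.target) (a b l : ℝ) (P : Symbol n M) (t : ℝ)
    (f f' : SmoothFun n M) : chartQuant g p a b l c P (f + t • f') y
      = chartQuant g p a b l c P f y + t * chartQuant g p a b l c P f' y := by
  obtain ⟨σ, hσ⟩ := exists_conformalFactor hn hg hc hy
  obtain ⟨q, w, s, r, hq, hq', hw, hs, hr, h⟩ := chartQuant_rep hc hy hσ a b l P f
  obtain ⟨r', hr'⟩ := exists_rep f' hc hy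
  have h' := hσ.confOp_eventuallyEq a b l hq' hq hw hs hr'
  have h'' := hσ.confOp_eventuallyEq a b l hq' hq hw hs
    (f := fun z => (f + t • f') (c.symm z)) (fr := r + algebraMap ℝ _ t * r') (by
      filter_upwards [hr, hr'] with z h1 h2
      simp [← h1, ← h2])
  rw [mul_add, mul_left_comm, ringQuant_right_add_smul _ _ _ (fun i => by simp)] at h''
  rw [h.eq_of_nhds, show chartQuant g p a b l c P f' y = _ from h'.eq_of_nhds,
    show chartQuant g p a b l c P (f + t • f') y = _ from h''.eq_of_nhds]
  simp only [SmoothFn.mul_apply, SmoothFn.add_apply, SmoothFn.algebraMap_apply]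
  ring

/-- The coefficients for which the quantization is conformally equivariant. -/
def IsConformalWeights (n : ℕ) (a b l : ℝ) : Prop :=
  a * (2 * n * (1 - 2 * l) - 2 * n - 2) = -(l * n) ∧ a + b * (2 * n * (1 - 2 * l) - n - 2) = 0

/-- The quantization in a chart is equivariant for the conformal Lie algebra. -/
theorem chartQuant_equivariant (hn : 0 < n) (hg : g.IsConformallyFlat p) {a b l m : ℝ}
    (hab : IsConformalWeights n a b l) (hlm : l + m = 1)
    (hc : c ∈ atlas (Coord n) M) {X : Coord n → Coord n} (hX : X ∈ conformalAlgebra n p)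
    (hy : y ∈ c.target) {P P' : Symbol n M} {f f' : SmoothFun n M}
    (h2 : ∀ᶠ z in 𝓝 y, ∀ i j, P'.comp2 c z i j
      = lieTensor (g.coeff c) (m - l) X (P.comp2 c) z i j)
    (h1 : ∀ᶠ z in 𝓝 y, ∀ i, P'.comp1 c z i = lieVector (g.coeff c) (m - l) X (P.comp1 c) z i)
    (h0 : ∀ᶠ z in 𝓝 y, P'.comp0 c z = lieDensity (g.coeff c) (m - l) X (P.comp0 c) z)
    (hf : ∀ᶠ z in 𝓝 y, f' (c.symm z) = lieDensity (g.coeff c) l X (fun w => f (c.symm w)) z) :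
    chartQuant g p a b l c P' f y = lieDensity (g.coeff c) m X (chartQuant g p a b l c P f) y
      - chartQuant g p a b l c P f' y := by
  obtain rfl : m = 1 - l := by linear_combination hlm
  have hδ : 1 - l - l = 1 - 2 * l := by ring
  rw [hδ] at h2 h1 h0
  obtain ⟨σ, hσ⟩ := exists_conformalFactor hn hg hc hy
  obtain ⟨Xr, hh, hXr, hconf⟩ := exists_isRingConformal hX
  obtain ⟨q, w, s, r, hq, hq', hw, hs, hr, h⟩ := chartQuant_rep hc hy hσ a b l P f
  set δ := 1 - 2 * l with hδ'
  have hp : ∀ t (u : SmoothFn n), volPow σ t * (volPow σ (-t) * u) = u := fun t u => by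
    rw [← mul_assoc, volPow_mul]; simp [volPow_zero]
  have hh2 : ∀ᶠ z in 𝓝 y, ∀ i j, P'.comp2 c z i j = (volPow σ (-δ)
      * ringLieTensor der (algebraMap ℝ _ δ) Xr (fun i j => volPow σ δ * q i j) i j) z := by
    filter_upwards [h2, Filter.eventually_all.2 fun i => Filter.eventually_all.2 fun j =>
      hσ.lieTensor_eventuallyEq hXr hq' δ i j] with z e1 e2 i j
    rw [e1, e2]
  have hh1 : ∀ᶠ z in 𝓝 y, ∀ i, P'.comp1 c z i = (volPow σ (-δ)
      * ringLieVector der (algebraMap ℝ _ δ) Xr (fun i => volPow σ δ * w i) i) z := by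
    filter_upwards [h1, Filter.eventually_all.2 fun i =>
      hσ.lieVector_eventuallyEq hXr hw δ i] with z e1 e2 i
    rw [e1, e2]
  have hh0 : P'.comp0 c =ᶠ[𝓝 y] (volPow σ (-δ)
      * ringLie der (algebraMap ℝ _ δ) Xr (volPow σ δ * s) : SmoothFn n) := by
    filter_upwards [h0, hσ.lieDensity_eventuallyEq hXr hs δ] with z e1 e2
    rw [e1, e2]
  have hhf : (fun z => f' (c.symm z)) =ᶠ[𝓝 y] (volPow σ (-l)
      * ringLie der (algebraMap ℝ _ l) Xr (volPow σ l * r) : SmoothFn n) := by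
    filter_upwards [hf, hσ.lieDensity_eventuallyEq hXr hr l] with z e1 e2
    rw [e1, e2]
  -- Each Lie derivative relative to |vol| is a flat Lie derivative conjugated by a power of |vol|.
  -- These powers cancel in the flat formula, and the claim becomes `IsRingConformal.quant_lie`
  -- multiplied by |vol|^(-m).
  have k1 := (hσ.confOp_eventuallyEq a b l hh2 (fun i j => by
    rw [ringLieTensor_symm (fun i j => by rw [hq])]) hh1 hh0 hr).eq_of_nhds
  have k2 := (hσ.confOp_eventuallyEq a b l hq' hq hw hs hhf).eq_of_nhds
  have k3 := (hσ.lieDensity_eventuallyEq hXr h (1 - l)).eq_of_nhds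
  rw [show l - 1 = -(1 - l) by ring] at k1 k2 k3
  simp only [← hδ', hp] at k1 k2 k3
  rw [show chartQuant g p a b l c P' f y = _ from k1,
    show chartQuant g p a b l c P f' y = _ from k2, k3]
  have hc' : ∀ (t : ℝ) i, der i (algebraMap ℝ (SmoothFn n) t) = 0 := fun t i => by simp
  have key := hconf.quant_lie der_comm etaFun_mul_self der_etaFun (hc' l) (hc' a) (hc' b)
    (m := algebraMap ℝ _ (1 - l)) (by rw [← map_add]; simp)
    (by
      have := congrArg (algebraMap ℝ (SmoothFn n)) hab.1
      rw [← hδ', ← hδ] at this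
      rw [← map_ofNat (algebraMap ℝ (SmoothFn n)) 2]
      simpa using this)
    (by
      have := congrArg (algebraMap ℝ (SmoothFn n)) hab.2
      rw [← hδ', ← hδ] at this
      rw [← map_ofNat (algebraMap ℝ (SmoothFn n)) 2]
      simpa using this)
    (q := fun i j => volPow σ δ * q i j) (fun i j => by rw [hq]) (fun i => volPow σ δ * w i)
    (volPow σ δ * s) (volPow σ l * r)
  rw [← map_sub, hδ] at key
  rw [key]
  simp only [SmoothFn.mul_apply, SmoothFn.sub_apply]
  ring

end Chart

end ConformalQuantization
end

noncomputable section

namespace ConformalQuantization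

/-! ### Invariant functionals on symbols, and independence of the chart -/

section Invariant

variable {n p : ℕ} {M : Type*} [TopologicalSpace M] [ChartedSpace (Coord n) M]
  [IsManifold 𝓘(ℝ, Coord n) ∞ M] {g : PseudoRiemannianMetric n M}
  {c c' : OpenPartialHomeomorph M (Coord n)} {y : Coord n}

theorem dilation_mem (y : Coord n) : (fun z => z - y) ∈ conformalAlgebra n p :=
  comp_sub_mem_conformalAlgebra (X := dilationField n)
    (Submodule.subset_span (Or.inl (Or.inr rfl))) y

theorem differentiable_conformal {X : Coord n → Coord n} (hX : X ∈ conformalAlgebra n p)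
    (i : Fin n) (z : Coord n) : DifferentiableAt ℝ (fun z => X z i) z := by
  obtain ⟨Xr, -, hXr, -⟩ := exists_isRingConformal hX
  rw [show (fun z => X z i) = Xr i from funext fun z => hXr z i]
  exact differentiableAt_coe _ _

theorem HasConformalFactor.divergence_of_zero {G : Coord n → Matrix (Fin n) (Fin n) ℝ}
    {σ : SmoothFn n} (h : HasConformalFactor p G σ y) {X : Coord n → Coord n}
    {Xr : Fin n → SmoothFn n} (hX : HasComponents X Xr) (h0 : X y = 0) :
    divergence G X y = ringDiv der Xr y := by
  have h1 : ∀ i, (fun z => X z i) = Xr i := fun i => funext fun z => hX z i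
  rw [h.divergence_eq fun i => by rw [h1]; exact differentiableAt_coe _ _, h0]
  simp [ringDiv, h1]

theorem HasConformalFactor.divergence_dilation {G : Coord n → Matrix (Fin n) (Fin n) ℝ}
    {σ : SmoothFn n} (h : HasConformalFactor p G σ y) :
    divergence G (fun z => z - y) y = n := by
  have h1 : divergence G (fun z => z - y) y = ringDiv der (cen y) y :=
    h.divergence_of_zero (Xr := cen y) (fun z i => rfl) (sub_self y)
  rw [h1]
  simp [ringDiv, der_cen]

theorem ringLieTensor_add {R : Type*} [CommRing R] [Algebra ℝ R]
    {d : Fin n → Derivation ℝ R R} (w : R) (X : Fin n → R)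
    (q q' : Fin n → Fin n → R) (i j : Fin n) :
    ringLieTensor d w X (fun i j => q i j + q' i j) i j
      = ringLieTensor d w X q i j + ringLieTensor d w X q' i j := by
  simp only [ringLieTensor, map_add, mul_add]
  rw [add_add_add_comm, ← Finset.sum_add_distrib]
  congr 1
  exact Finset.sum_congr rfl fun k _ => by ring

theorem ringLieTensor_transpose {R : Type*} [CommRing R] [Algebra ℝ R]
    {d : Fin n → Derivation ℝ R R} (w : R) (X : Fin n → R)
    (q : Fin n → Fin n → R) (i j : Fin n) :
    ringLieTensor d w X (fun i j => q j i) i j = ringLieTensor d w X q j i := by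
  simp only [ringLieTensor]
  congr 1
  exact Finset.sum_congr rfl fun k _ => by ring

omit [IsManifold 𝓘(ℝ, Coord n) ∞ M] in
theorem comp2_add_smul (P P' : Symbol n M) (t : ℝ) (z : Coord n) (i j : Fin n) :
    (P + t • P').comp2 c z i j = P.comp2 c z i j + t * P'.comp2 c z i j := by
  simp [Symbol.comp2]

/-- A functional on homogeneous symbols of degree two which is equivariant for the conformal
vector fields vanishing at a point is zero, for generic weights. -/
theorem symbolFunctional_eq_zero [T2Space M] (hn : 0 < n) (hg : g.IsConformallyFlat p)
    (hc : c ∈ atlas (Coord n) M) (hy : y ∈ c.target) {δ : ℝ} (D : Symbol n M →ₗ[ℝ] ℝ)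
    (hD : ∀ X ∈ conformalAlgebra n p, X y = 0 → ∀ P P' : Symbol n M,
      P.1.2.1 = 0 → P.1.2.2 = 0 → P'.1.2.1 = 0 → P'.1.2.2 = 0 →
      (∀ᶠ z in 𝓝 y, ∀ i j, P'.comp2 c z i j = lieTensor (g.coeff c) δ X (P.comp2 c) z i j) →
      D P' = δ * divergence (g.coeff c) X y * D P)
    (h1 : n * δ ≠ 1) (h2 : n * δ ≠ 1 + n / 2) (h3 : n * δ ≠ n + 1)
    {P : Symbol n M} (hP1 : P.1.2.1 = 0) (hP0 : P.1.2.2 = 0) : D P = 0 := by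
  obtain ⟨σ, hσ⟩ := exists_conformalFactor hn hg hc hy
  -- Locality of the functional is not assumed. A symbol with zero germ equals its own Lie
  -- derivative near y, so the dilation gives D P = nδ · D P, and nδ ≠ 1.
  have hloc : ∀ P : Symbol n M, P.1.2.1 = 0 → P.1.2.2 = 0 →
      (∀ᶠ z in 𝓝 y, ∀ i j, P.comp2 c z i j = 0) → D P = 0 := by
    intro P hP1 h0 h2
    have h3 := hD _ (dilation_mem y) (sub_self y) P P hP1 h0 hP1 h0 (by
      filter_upwards [eventually_eventually_nhds.2 h2] with z hz i j
      have h4 : ∀ i j, P.comp2 c z i j = 0 := hz.self_of_nhds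
      have h5 : ∀ k i j, pd k (fun w => P.comp2 c w i j) z = 0 := fun k i j => by
        rw [pd_congr (v := fun _ => (0 : ℝ)) (hz.mono fun w hw => hw i j)]
        exact pd_const _ _ _
      simp [lieTensor, h4, h5])
    rw [hσ.divergence_dilation] at h3
    have h4 : (1 - n * δ) * D P = 0 := by linear_combination h3
    exact (mul_eq_zero.1 h4).resolve_left (sub_ne_zero.2 h1.symm)
  -- An arbitrary matrix of functions is symmetrised and read as a density of weight δ in flat
  -- coordinates. By locality the value of D on the extension depends only on the germ, so a
  -- functional on matrices results.
  have hex : ∀ q : Fin n → Fin n → SmoothFn n, ∃ P : Symbol n M, P.1.2.1 = 0 ∧ P.1.2.2 = 0 ∧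
      ∀ᶠ z in 𝓝 y, ∀ i j, P.comp2 c z i j = (volPow σ (-δ) * (q i j + q j i) : SmoothFn n) z :=
    fun q => exists_symbol_germ hc hy Filter.univ_mem
      (q := fun i j => (volPow σ (-δ) * (q i j + q j i) : SmoothFn n))
      (fun i j => (contDiff_coe _).contDiffOn) (fun i j => by rw [add_comm])
  choose S hS1 hS0 hS2 using hex
  have hext : ∀ (P : Symbol n M) (q : Fin n → Fin n → SmoothFn n), P.1.2.1 = 0 → P.1.2.2 = 0 →
      (∀ᶠ z in 𝓝 y, ∀ i j, P.comp2 c z i j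
        = (volPow σ (-δ) * (q i j + q j i) : SmoothFn n) z) → D P = D (S q) := by
    intro P q h1 h0 h2
    have h3 := hloc (P + (-1 : ℝ) • S q) (by simp [h1, hS1 q]) (by simp [h0, hS0 q]) (by
      filter_upwards [h2, hS2 q] with z e1 e2 i j
      rw [comp2_add_smul, e1, e2]
      ring)
    rw [map_add, map_smul, smul_eq_mul] at h3
    linarith
  let ℓ : (Fin n → Fin n → SmoothFn n) →ₗ[ℝ] ℝ :=
    { toFun := fun q => D (S q)
      map_add' := fun q q' => by
        rw [← map_add]
        refine (hext _ _ (by simp [hS1]) (by simp [hS0]) ?_).symm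
        filter_upwards [hS2 q, hS2 q'] with z e1 e2 i j
        have := comp2_add_smul (c := c) (S q) (S q') 1 z i j
        rw [one_smul] at this
        rw [this, e1, e2]
        simp only [Pi.add_apply, SmoothFn.mul_apply, SmoothFn.add_apply]
        ring
      map_smul' := fun t q => by
        rw [← map_smul]
        refine (hext _ _ (by simp [hS1]) (by simp [hS0]) ?_).symm
        filter_upwards [hS2 q] with z e1 i j
        have := comp2_add_smul (c := c) 0 (S q) t z i j
        rw [zero_add] at this
        rw [RingHom.id_apply, this, e1]
        simp [Symbol.comp2]
        ring }
  have hℓ : ∀ q, ℓ q = D (S q) := fun q => rfl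
  have hzero : ℓ = 0 := by
    refine invariantFunctional_eq_zero (p := p) (y := y) (δ := δ) ℓ (fun q => ?_) ?_ h1 h2 h3
    · rw [hℓ, hℓ]
      refine hext _ _ (hS1 _) (hS0 _) ?_
      filter_upwards [hS2 fun i j => q j i] with z e1 i j
      rw [e1, add_comm]
    · intro X hX h0 Xr hXr q
      rw [hℓ, hℓ, ← hσ.divergence_of_zero hXr h0]
      refine hD X hX h0 _ _ (hS1 _) (hS0 _) (hS1 _) (hS0 _) ?_
      filter_upwards [hS2 (ringLieTensor der (algebraMap ℝ _ δ) Xr q),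
        Filter.eventually_all.2 fun i => Filter.eventually_all.2 fun j =>
          hσ.lieTensor_eventuallyEq hXr (hS2 q) δ i j] with z e1 e2 i j
      rw [e1, e2]
      have hp : ∀ u : SmoothFn n, volPow σ δ * (volPow σ (-δ) * u) = u := fun u => by
        rw [← mul_assoc, volPow_mul]; simp [volPow_zero]
      simp only [hp]
      rw [ringLieTensor_add _ _ q (fun i j => q j i), ringLieTensor_transpose _ _ q i j]
  obtain ⟨q, hq, hq'⟩ := P.exists_rep2 hc hy
  -- The factor 1/2 undoes the symmetrisation, which doubles a symmetric matrix.
  rw [hext P (fun i j => algebraMap ℝ _ (1 / 2) * (volPow σ δ * q i j)) hP1 hP0, ← hℓ, hzero]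
  · rfl
  · filter_upwards [hq'] with z e1 i j
    rw [e1]
    have hp : ∀ u : SmoothFn n, volPow σ (-δ) * (volPow σ δ * u) = u := fun u => by
      rw [← mul_assoc, volPow_mul]; simp [volPow_zero]
    have h2 : q i j = volPow σ (-δ) * (algebraMap ℝ _ (1 / 2) * (volPow σ δ * q i j)
        + algebraMap ℝ _ (1 / 2) * (volPow σ δ * q j i)) := by
      rw [hq j i]
      linear_combination -(algebraMap ℝ (SmoothFn n) (1 / 2) * 2) * hp (q i j)
        - q i j * algebraMap_half_mul_two (R := SmoothFn n)
    exact congrArg (fun f : SmoothFn n => f z) h2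

/-- The local action of the conformal Lie algebra is the same in all charts. -/
theorem exists_fieldsRelated (hM : IsFlatConformalAtlas n p M)
    (hc : c ∈ atlas (Coord n) M) (hc' : c' ∈ atlas (Coord n) M) {x : M}
    (hx : x ∈ c.source) (hx' : x ∈ c'.source) {X : Coord n → Coord n}
    (hX : X ∈ conformalAlgebra n p) :
    ∃ Y ∈ conformalAlgebra n p, FieldsRelated c c' X Y (c x) := by
  obtain ⟨Y, hY, h⟩ := hM c hc c' hc' X hX (c x) (by
    simp only [OpenPartialHomeomorph.trans_source, OpenPartialHomeomorph.symm_source,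
      Set.mem_inter_iff, Set.mem_preimage]
    exact ⟨c.map_source hx, by rwa [c.left_inv hx]⟩)
  refine ⟨Y, hY, ?_⟩
  filter_upwards [h, mem_source_of_eventually hx hx'] with z hz hs a
  have h1 := contDiffAt_trans hc hc' hs.2.1 hs.2.2
  rw [c.right_inv hs.1] at h1
  have h2 := congrFun hz a
  change _ = Y (trans c c' z) a at h2
  rw [← h2, fderiv_apply_eq_sum]
  simp only [Finset.sum_apply, Pi.smul_apply, smul_eq_mul]
  refine Finset.sum_congr rfl fun i _ => ?_
  rw [mul_comm]
  congr 1
  unfold jac pd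
  rw [fderiv_apply (h1.differentiableAt (by simp))]
  rfl

omit [IsManifold 𝓘(ℝ, Coord n) ∞ M] in
theorem contDiffAt_comp2 (P : Symbol n M) (hc : c ∈ atlas (Coord n) M) (hy : y ∈ c.target)
    (i j : Fin n) : ContDiffAt ℝ ∞ (fun z => P.comp2 c z i j) y :=
  ((P.2.2 c hc).1 i j).contDiffAt (c.open_target.mem_nhds hy)

omit [IsManifold 𝓘(ℝ, Coord n) ∞ M] in
theorem contDiffAt_comp1 (P : Symbol n M) (hc : c ∈ atlas (Coord n) M) (hy : y ∈ c.target)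
    (i : Fin n) : ContDiffAt ℝ ∞ (fun z => P.comp1 c z i) y :=
  ((P.2.2 c hc).2.1 i).contDiffAt (c.open_target.mem_nhds hy)

/-- The components of the vector field obtained by contracting a tensor with a differential. -/
def flux (c : OpenPartialHomeomorph M (Coord n)) (P : Symbol n M) (f : SmoothFun n M)
    (z : Coord n) (i : Fin n) : ℝ := ∑ j, P.comp2 c z i j * pd j (fun w => f (c.symm w)) z

theorem contDiffAt_flux (P : Symbol n M) (f : SmoothFun n M) (hc : c ∈ atlas (Coord n) M)
    (hy : y ∈ c.target) (i : Fin n) : ContDiffAt ℝ ∞ (fun z => flux c P f z i) y :=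
  ContDiffAt.sum fun j _ => (contDiffAt_comp2 P hc hy i j).mul
    (contDiffAt_pd (contDiffAt_comp_symm f.contMDiff hc hy) j)

theorem pd_comp_symm_change (f : SmoothFun n M) (hc : c ∈ atlas (Coord n) M)
    (hc' : c' ∈ atlas (Coord n) M) {x : M} (hx : x ∈ c.source) (hx' : x ∈ c'.source) (i : Fin n) :
    pd i (fun w => f (c.symm w)) (c x)
      = ∑ a, jac c c' i a (c x) * pd a (fun w => f (c'.symm w)) (c' x) := by
  rw [← differential_apply f hc hx, vecAt_change hc hc' hx hx', map_sum]
  refine Finset.sum_congr rfl fun a _ => ?_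
  rw [map_smul, smul_eq_mul, differential_apply f hc' hx']

theorem fieldsRelated_flux (P : Symbol n M) (f : SmoothFun n M) (hc : c ∈ atlas (Coord n) M)
    (hc' : c' ∈ atlas (Coord n) M) {x : M} (hx : x ∈ c.source) (hx' : x ∈ c'.source) :
    FieldsRelated c c' (flux c P f) (flux c' P f) (c x) := by
  filter_upwards [mem_source_of_eventually hx hx'] with z hz a
  have h1 : ∀ a b, P.comp2 c' (trans c c' z) a b = _ :=
    comp2_change P hc hc' hz.2.1 hz.2.2
  have h2 : ∀ i, _ = ∑ a, _ * pd a (fun w => f (c'.symm w)) (trans c c' z) :=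
    pd_comp_symm_change f hc hc' hz.2.1 hz.2.2
  simp only [c.right_inv hz.1] at h1 h2
  simp only [flux, h1, h2, Finset.sum_mul, Finset.mul_sum]
  rw [Finset.sum_comm]
  conv_lhs => enter [2, i]; rw [Finset.sum_comm]
  exact Finset.sum_congr rfl fun i _ => Finset.sum_congr rfl fun j _ =>
    Finset.sum_congr rfl fun b _ => by ring

theorem fieldsRelated_comp1 (P : Symbol n M) (hc : c ∈ atlas (Coord n) M)
    (hc' : c' ∈ atlas (Coord n) M) {x : M} (hx : x ∈ c.source) (hx' : x ∈ c'.source) :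
    FieldsRelated c c' (P.comp1 c) (P.comp1 c') (c x) := by
  filter_upwards [mem_source_of_eventually hx hx'] with z hz a
  have := comp1_change P hc hc' hz.2.1 hz.2.2 a
  rwa [c.right_inv hz.1] at this

omit [IsManifold 𝓘(ℝ, Coord n) ∞ M] in
theorem chartQuant_eq (a b l : ℝ) (P : Symbol n M) (f : SmoothFun n M) (z : Coord n) :
    chartQuant g p a b l c P f z = divergence (g.coeff c) (flux c P f) z
      + chartPot g p a b l c P z * f (c.symm z)
      + (∑ i, P.comp1 c z i * pd i (fun x => f (c.symm x)) z
        + 1 / 2 * divergence (g.coeff c) (P.comp1 c) z * f (c.symm z))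
      + P.comp0 c z * f (c.symm z) := rfl

/-- Apart from the zeroth order term in degree two, the quantization is independent of the
chart. -/
theorem chartQuant_change (hn : 0 < n) (hg : g.IsConformallyFlat p) {a b l : ℝ}
    (hc : c ∈ atlas (Coord n) M) (hc' : c' ∈ atlas (Coord n) M) {x : M} (hx : x ∈ c.source)
    (hx' : x ∈ c'.source) {P : Symbol n M}
    (hU : chartPot g p a b l c' P (c' x) = chartPot g p a b l c P (c x)) (f : SmoothFun n M) :
    chartQuant g p a b l c' P f (c' x) = chartQuant g p a b l c P f (c x) := by
  have hy := c.map_source hx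
  have hy' := c'.map_source hx'
  rw [chartQuant_eq, chartQuant_eq, hU, c.left_inv hx, c'.left_inv hx',
    divergence_change hn hg hc hc' hx hx'
      (fun i => (contDiffAt_flux P f hc hy i).differentiableAt (by simp))
      (fun i => (contDiffAt_flux P f hc' hy' i).differentiableAt (by simp))
      (fieldsRelated_flux P f hc hc' hx hx'),
    divergence_change hn hg hc hc' hx hx'
      (fun i => (contDiffAt_comp1 P hc hy i).differentiableAt (by simp))
      (fun i => (contDiffAt_comp1 P hc' hy' i).differentiableAt (by simp))
      (fieldsRelated_comp1 P hc hc' hx hx'),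
    comp0_eq P (c.left_inv hx), comp0_eq P (c'.left_inv hx')]
  congr 3
  simp only [comp1_change P hc hc' hx hx', pd_comp_symm_change f hc hc' hx hx', Finset.sum_mul,
    Finset.mul_sum]
  rw [Finset.sum_comm]
  exact Finset.sum_congr rfl fun i _ => Finset.sum_congr rfl fun k _ => by ring

/-- The Lie derivative of the potential at a zero of the vector field. -/
theorem chartPot_lie (hn : 0 < n) (hg : g.IsConformallyFlat p) {a b l : ℝ}
    (hab : IsConformalWeights n a b l)
    (hc : c ∈ atlas (Coord n) M) {X : Coord n → Coord n} (hX : X ∈ conformalAlgebra n p)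
    (hy : y ∈ c.target) (hXy : X y = 0) {P P' : Symbol n M} {f' : SmoothFun n M}
    (hP1 : P.1.2.1 = 0) (hP0 : P.1.2.2 = 0) (hP1' : P'.1.2.1 = 0) (hP0' : P'.1.2.2 = 0)
    (h2 : ∀ᶠ z in 𝓝 y, ∀ i j, P'.comp2 c z i j
      = lieTensor (g.coeff c) (1 - 2 * l) X (P.comp2 c) z i j)
    (hf : ∀ᶠ z in 𝓝 y, f' (c.symm z) = l * divergence (g.coeff c) X z) :
    chartPot g p a b l c P' y = (1 - 2 * l) * divergence (g.coeff c) X y * chartPot g p a b l c P y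
      - divergence (g.coeff c) (flux c P f') y := by
  have hc1 : ∀ P : Symbol n M, P.1.2.1 = 0 → P.comp1 c = fun _ _ => 0 := fun P h => by
    funext z i; simp [Symbol.comp1, h]
  have hc0 : ∀ P : Symbol n M, P.1.2.2 = 0 → P.comp0 c = fun _ => 0 := fun P h => by
    funext z; simp [Symbol.comp0, h]
  have hone : ∀ (P : Symbol n M), P.1.2.1 = 0 → P.1.2.2 = 0 →
      chartQuant g p a b l c P 1 = chartPot g p a b l c P := fun P h1 h0 => by
    rw [chartPot_eq]
    congr 1
    exact Subtype.ext (Prod.ext rfl (Prod.ext h1 h0))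
  have hpd : ∀ j y, pd j (fun x : Coord n => (1 : SmoothFun n M) (c.symm x)) y = 0 := fun j y =>
    pd_const (1 : ℝ) j y
  -- Equivariance is applied to the constant function 1, whose Lie derivative is l · div X. As X
  -- vanishes at y, no derivative of the potential appears there.
  have key := chartQuant_equivariant hn hg hab (m := 1 - l) (by ring) hc hX hy (P := P) (P' := P')
    (f := 1) (f' := f') (by rwa [show 1 - l - l = 1 - 2 * l by ring])
    (.of_forall fun z i => by simp [hc1 P' hP1', hc1 P hP1, lieVector, pd_const])
    (.of_forall fun z => by simp [hc0 P' hP0', hc0 P hP0, lieDensity, pd_const])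
    (by
      filter_upwards [hf] with z hz
      simp only [hz, lieDensity, hpd]
      simp)
  rw [hone P' hP1' hP0', hone P hP1 hP0, chartQuant_eq, hc1 P hP1, hc0 P hP0, divergence_zero,
    lieDensity, hXy, hf.self_of_nhds] at key
  rw [key]
  simp only [Pi.zero_apply, zero_mul, Finset.sum_const_zero]
  ring

/-- The zeroth order term of the quantization of a symbol of degree two does not depend on the
chart. -/
theorem chartPot_change [T2Space M] (hn : 0 < n) (hM : IsFlatConformalAtlas n p M)
    (hg : g.IsConformallyFlat p) {a b l : ℝ} (hab : IsConformalWeights n a b l)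
    (h1 : n * (1 - 2 * l) ≠ 1) (h2 : n * (1 - 2 * l) ≠ 1 + n / 2) (h3 : n * (1 - 2 * l) ≠ n + 1)
    (hc : c ∈ atlas (Coord n) M) (hc' : c' ∈ atlas (Coord n) M) {x : M} (hx : x ∈ c.source)
    (hx' : x ∈ c'.source) (P : Symbol n M) :
    chartPot g p a b l c' P (c' x) = chartPot g p a b l c P (c x) := by
  have hy := c.map_source hx
  have hy' := c'.map_source hx'
  have hlin : ∀ {c : OpenPartialHomeomorph M (Coord n)}, c ∈ atlas (Coord n) M →
      ∀ {y : Coord n}, y ∈ c.target → ∀ (P P' : Symbol n M) (t : ℝ),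
      chartPot g p a b l c (P + t • P') y
        = chartPot g p a b l c P y + t * chartPot g p a b l c P' y := by
    intro c hc y hy P P' t
    simp only [chartPot_eq]
    rw [← chartQuant_add_smul hn hg hc hy]
    congr 1
    exact Subtype.ext (Prod.ext rfl (Prod.ext (by simp [Symbol.part2]) (by simp [Symbol.part2])))
  have hlin0 : ∀ {c : OpenPartialHomeomorph M (Coord n)}, c ∈ atlas (Coord n) M →
      ∀ {y : Coord n}, y ∈ c.target → chartPot g p a b l c 0 y = 0 := by
    intro c hc y hy
    have := hlin hc hy 0 0 1
    rw [one_smul, add_zero] at this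
    linarith
  -- The obstruction to gluing, as a linear functional of the symbol at the fixed point.
  let D : Symbol n M →ₗ[ℝ] ℝ :=
    { toFun := fun P => chartPot g p a b l c' P (c' x) - chartPot g p a b l c P (c x)
      map_add' := fun P P' => by
        have e1 := hlin hc hy P P' 1
        have e2 := hlin hc' hy' P P' 1
        rw [one_smul] at e1 e2
        rw [e1, e2]
        ring
      map_smul' := fun t P => by
        have e1 := hlin hc hy 0 P t
        have e2 := hlin hc' hy' 0 P t
        rw [zero_add, hlin0 hc hy] at e1
        rw [zero_add, hlin0 hc' hy'] at e2
        rw [e1, e2, RingHom.id_apply, smul_eq_mul]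
        ring }
  have hD : D P.part2 = 0 := by
    refine symbolFunctional_eq_zero hn hg hc hy (δ := 1 - 2 * l) D ?_ h1 h2 h3 rfl rfl
    intro X hX hX0 P P' hP1 hP0 hP1' hP0' hPP'
    obtain ⟨Y, hY, hXY⟩ := exists_fieldsRelated hM hc hc' hx hx' hX
    have hdiv : ∀ᶠ z in 𝓝 (c x), divergence (g.coeff c') Y (trans c c' z)
        = divergence (g.coeff c) X z := by
      filter_upwards [mem_source_of_eventually hx hx', eventually_eventually_nhds.2 hXY] with z hz hr
      have := divergence_change hn hg hc hc' hz.2.1 hz.2.2 (Z := X) (Z' := Y)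
        (fun i => differentiable_conformal hX i _) (fun i => differentiable_conformal hY i _)
        (by rwa [c.right_inv hz.1])
      rwa [c.right_inv hz.1] at this
    have ht : trans c c' (c x) = c' x := by rw [trans, c.left_inv hx]
    have hY0 : Y (c' x) = 0 := by
      funext i
      have := hXY.self_of_nhds i
      rw [ht, hX0] at this
      simpa using this
    have hback : ∀ {q : Coord n → Prop}, (∀ᶠ z in 𝓝 (c x), q (trans c c' z)) →
        ∀ᶠ z in 𝓝 (c' x), q z := by
      intro q hq
      filter_upwards [eventually_trans hc' hc hx' hx hq, mem_source_of_eventually hx' hx]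
        with z h1 h2
      rwa [trans, trans, c.left_inv h2.2.2, c'.right_inv h2.1] at h1
    obtain ⟨σ, hσ⟩ := exists_conformalFactor hn hg hc hy
    obtain ⟨Xr, hh, hXr, -⟩ := exists_isRingConformal hX
    -- One global function represents l · div X in both charts, since the divergence does not depend
    -- on the chart.
    obtain ⟨f', hf', -, -⟩ := exists_smoothFun_germ hc hy Filter.univ_mem
      (contDiff_coe (algebraMap ℝ _ l * (volPow σ (-1)
        * ringDiv der (fun i => volPow σ 1 * Xr i)) : SmoothFn n)).contDiffOn
    have hf : ∀ᶠ z in 𝓝 (c x), f' (c.symm z) = l * divergence (g.coeff c) X z := by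
      filter_upwards [hf', hσ.divergence_eventuallyEq (.of_forall hXr)] with z e1 e2
      rw [e1, e2]
      rfl
    have hfY : ∀ᶠ z in 𝓝 (c' x), f' (c'.symm z) = l * divergence (g.coeff c') Y z := by
      refine hback ?_
      filter_upwards [hf, hdiv, mem_source_of_eventually hx hx'] with z e1 e2 e3
      rw [e2, ← e1, trans, c'.left_inv e3.2.2]
    have hPY : ∀ᶠ z in 𝓝 (c' x), ∀ i j, P'.comp2 c' z i j
        = lieTensor (g.coeff c') (1 - 2 * l) Y (P.comp2 c') z i j := by
      refine hback ?_
      filter_upwards [hPP', mem_source_of_eventually hx hx', eventually_eventually_nhds.2 hXY]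
        with z e1 hz hr i j
      have := lieTensor_change hn hg hc hc' hz.2.1 hz.2.2 (X := X) (Y := Y)
        (fun i => differentiable_conformal hX i _) (fun i => differentiable_conformal hY i _)
        (by rwa [c.right_inv hz.1]) (1 - 2 * l) P i j
      rw [show trans c c' z = c' (c.symm z) from rfl, this, comp2_change P' hc hc' hz.2.1 hz.2.2]
      simp only [c.right_inv hz.1, e1]
    have k1 := chartPot_lie hn hg hab hc hX hy hX0 hP1 hP0 hP1' hP0' hPP' hf
    have k2 := chartPot_lie hn hg hab hc' hY hy' hY0 hP1 hP0 hP1' hP0' hPY hfY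
    have k3 := hdiv.self_of_nhds
    rw [ht] at k3
    -- The inhomogeneous term in the Lie derivative of the potential is the divergence of a vector
    -- field defined on M. It drops out of the difference, which therefore transforms homogeneously.
    rw [divergence_change hn hg hc hc' hx hx'
      (fun i => (contDiffAt_flux P f' hc hy i).differentiableAt (by simp))
      (fun i => (contDiffAt_flux P f' hc' hy' i).differentiableAt (by simp))
      (fieldsRelated_flux P f' hc hc' hx hx'), k3] at k2
    change chartPot g p a b l c' P' (c' x) - chartPot g p a b l c P' (c x) = _
      * (chartPot g p a b l c' P (c' x) - chartPot g p a b l c P (c x))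
    rw [k1, k2]
    ring
  exact sub_eq_zero.1 hD

omit [IsManifold 𝓘(ℝ, Coord n) ∞ M] in
/-- For the weights `(0, 1)` there is a quantization without zeroth order term. -/
theorem chartPot_zero (hn : 0 < n) (hg : g.IsConformallyFlat p)
    (hc : c ∈ atlas (Coord n) M) (hy : y ∈ c.target) (P : Symbol n M) :
    chartPot g p 0 0 0 c P y = 0 := by
  obtain ⟨σ, hσ⟩ := exists_conformalFactor hn hg hc hy
  obtain ⟨q, -, hq⟩ := P.exists_rep2 hc hy
  rw [chartPot, (hσ.confPot_eventuallyEq 0 0 0 hq).eq_of_nhds]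
  simp [volPow_zero, ringOp, ringDivGrad, ringPot]

end Invariant

end ConformalQuantization
end

noncomputable section

namespace ConformalQuantization

/-! ### Differential operators of order at most two and their symbols -/

section Algebra

variable {A : Type*} [CommRing A] [Algebra ℝ A]

theorem opComm_apply (T : Module.End ℝ A) (f u : A) : opComm T f u = T (f * u) - f * T u := by
  simp [opComm]

theorem opComm_comm (T : Module.End ℝ A) (f f' : A) :
    opComm (opComm T f) f' = opComm (opComm T f') f := by
  ext u
  simp only [opComm_apply]
  rw [mul_left_comm f f' u]
  ring

theorem opComm_sub (S T : Module.End ℝ A) (f : A) :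
    opComm (S - T) f = opComm S f - opComm T f := by
  ext u
  simp only [opComm_apply, LinearMap.sub_apply]
  ring

theorem opComm_add_right (T : Module.End ℝ A) (f f' : A) :
    opComm T (f + f') = opComm T f + opComm T f' := by
  ext u
  simp only [opComm_apply, LinearMap.add_apply, add_mul, map_add]
  ring

theorem opComm_add (S T : Module.End ℝ A) (f : A) :
    opComm (S + T) f = opComm S f + opComm T f := by
  ext u
  simp only [opComm_apply, LinearMap.add_apply]
  ring

theorem opComm_smul_right (T : Module.End ℝ A) (r : ℝ) (f : A) :
    opComm T (r • f) = r • opComm T f := by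
  ext u
  simp only [opComm_apply, LinearMap.smul_apply, smul_mul_assoc, map_smul, smul_sub]

theorem eq_mul_of_opComm_eq_zero {S : Module.End ℝ A} (h : ∀ f, opComm S f = 0) (u : A) :
    S u = S 1 * u := by
  have := opComm_apply S u 1
  rw [h u, LinearMap.zero_apply, mul_one] at this
  linear_combination -this

/-- An operator which commutes with all multiplications is multiplication by its value at 1. -/
theorem mem_diffOps_zero {S : Module.End ℝ A} :
    S ∈ diffOps A 0 ↔ ∀ f, opComm S f = 0 := by
  constructor
  · rintro ⟨a, rfl⟩ f
    ext u
    simp only [opComm_apply, LinearMap.mul_apply', LinearMap.zero_apply]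
    ring
  · intro h
    refine ⟨S 1, LinearMap.ext fun u => ?_⟩
    rw [LinearMap.mul_apply', ← eq_mul_of_opComm_eq_zero h]

/-- The symbol of an operator of order one, as a derivation. -/
def symbolDerivation (S : Module.End ℝ A) (h : ∀ f f', opComm (opComm S f) f' = 0) :
    Derivation ℝ A A :=
  Derivation.mk'
    { toFun := fun f => opComm S f 1
      map_add' := fun f f' => by rw [opComm_add_right]; rfl
      map_smul' := fun r f => by rw [opComm_smul_right]; rfl }
    -- The Leibniz rule is the vanishing of the double commutator, evaluated at 1.
    fun f f' => by
      have h1 := congrArg (fun T : Module.End ℝ A => T 1) (h f f')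
      simp only [LinearMap.coe_mk, AddHom.coe_mk, opComm_apply, LinearMap.zero_apply,
        mul_one, smul_eq_mul] at h1 ⊢
      linear_combination h1

theorem symbolDerivation_apply (S : Module.End ℝ A) (h : ∀ f f', opComm (opComm S f) f' = 0)
    (f : A) : symbolDerivation S h f = opComm S f 1 := rfl

end Algebra

section Manifold

variable {n : ℕ} {M : Type*} [TopologicalSpace M] [ChartedSpace (Coord n) M]
  [IsManifold 𝓘(ℝ, Coord n) ∞ M]

omit [IsManifold 𝓘(ℝ, Coord n) ∞ M] in
theorem differential_congr {f f' : SmoothFun n M} {x : M} (h : f =ᶠ[𝓝 x] f') :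
    differential f x = differential f' x := h.mfderiv_eq

theorem differential_add (f f' : SmoothFun n M) (x : M) :
    differential (f + f') x = differential f x + differential f' x := by
  have hc := chart_mem_atlas (Coord n) x
  have hx := mem_chart_source (Coord n) x
  rw [differential_eq _ hc hx, differential_eq _ hc hx, differential_eq _ hc hx,
    ← Finset.sum_add_distrib]
  refine Finset.sum_congr rfl fun i _ => ?_
  rw [← add_smul, ← pd_add]
  · rfl
  · exact (contDiffAt_comp_symm f.contMDiff hc (mem_chart_target _ x)).differentiableAt (by simp)
  · exact (contDiffAt_comp_symm f'.contMDiff hc (mem_chart_target _ x)).differentiableAt (by simp)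

theorem differential_mul (f f' : SmoothFun n M) (x : M) :
    differential (f * f') x = f x • differential f' x + f' x • differential f x := by
  have hc := chart_mem_atlas (Coord n) x
  have hx := mem_chart_source (Coord n) x
  rw [differential_eq _ hc hx, differential_eq _ hc hx, differential_eq _ hc hx,
    Finset.smul_sum, Finset.smul_sum, ← Finset.sum_add_distrib]
  refine Finset.sum_congr rfl fun i _ => ?_
  rw [smul_smul, smul_smul, ← add_smul]
  congr 1
  have := pd_mul ((contDiffAt_comp_symm f.contMDiff hc
    (mem_chart_target _ x)).differentiableAt (by simp))
    ((contDiffAt_comp_symm f'.contMDiff hc (mem_chart_target _ x)).differentiableAt (by simp)) i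
  rw [(chartAt (Coord n) x).left_inv hx] at this
  exact this

theorem differential_smul (r : ℝ) (f : SmoothFun n M) (x : M) :
    differential (r • f) x = r • differential f x := by
  have h1 : r • f = (r • (1 : SmoothFun n M)) * f := by simp
  have h2 : differential (r • (1 : SmoothFun n M)) x = 0 := by
    rw [differential]
    exact mfderiv_const (I := 𝓘(ℝ, Coord n)) (c := r • (1 : ℝ))
  rw [h1, differential_mul, h2, smul_zero, add_zero]
  simp

variable [T2Space M]

/-- Extensions of the coordinate functions. -/
theorem exists_coordFun {c : OpenPartialHomeomorph M (Coord n)} (hc : c ∈ atlas (Coord n) M)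
    {y : Coord n} (hy : y ∈ c.target) (i : Fin n) :
    ∃ F : SmoothFun n M, (∀ᶠ z in 𝓝 y, F (c.symm z) = z i) ∧
      ∀ᶠ z in 𝓝 y, differential F (c.symm z) = coordCovec c z i := by
  obtain ⟨F, hF, -, -⟩ := exists_smoothFun_germ hc hy Filter.univ_mem (u := fun z => z i)
    (by fun_prop)
  refine ⟨F, hF, ?_⟩
  filter_upwards [eventually_eventually_nhds.2 hF, c.open_target.mem_nhds hy] with z hz hzt
  rw [differential_eq F hc (c.map_target hzt), c.right_inv hzt]
  have h1 : ∀ j, pd j (fun z => F (c.symm z)) z = if i = j then 1 else 0 := fun j => by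
    rw [pd_congr hz, pd_coord]
  simp only [h1, ite_smul, one_smul, zero_smul, Finset.sum_ite_eq, Finset.mem_univ, if_true]
  rfl

theorem exists_differential_eq (x : M) (ξ : Cotangent n x) :
    ∃ f : SmoothFun n M, differential f x = ξ := by
  have hc := chart_mem_atlas (Coord n) x
  have hx := mem_chart_source (Coord n) x
  choose F hF hF' using exists_coordFun hc (mem_chart_target (Coord n) x)
  refine ⟨∑ i, ξ (vecAt (chartAt (Coord n) x) x i) • F i, ?_⟩
  have h1 : ∀ s : Finset (Fin n), differential (∑ i ∈ s, ξ (vecAt (chartAt (Coord n) x) x i) • F i) x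
      = ∑ i ∈ s, ξ (vecAt (chartAt (Coord n) x) x i) • covecAt (chartAt (Coord n) x) x i := by
    intro s
    induction s using Finset.induction_on with
    | empty =>
      have := differential_smul 0 (0 : SmoothFun n M) x
      simpa using this
    | insert i s hi ih =>
      rw [Finset.sum_insert hi, Finset.sum_insert hi, differential_add, ih, differential_smul]
      congr 2
      have := (hF' i).self_of_nhds
      have key : ∀ x', x' = x → differential (F i) x' = covecAt (chartAt (Coord n) x) x' i →
          differential (F i) x = covecAt (chartAt (Coord n) x) x i := by
        rintro _ rfl h; exact h
      exact key _ ((chartAt (Coord n) x).left_inv hx) this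
  rw [h1]
  exact (eq_sum_covecAt hc hx ξ).symm

/-- Take χ equal to 1 near x and supported where f vanishes. Then χ f = 0, and the Leibniz rule at x
leaves D f (x). -/
theorem Derivation.apply_eq_zero_of_eventually (D : Derivation ℝ (SmoothFun n M) (SmoothFun n M))
    {f : SmoothFun n M} {x : M} (h : ∀ᶠ z in 𝓝 x, f z = 0) : D f x = 0 := by
  have hc := chart_mem_atlas (Coord n) x
  have hx := mem_chart_source (Coord n) x
  set c := chartAt (Coord n) x
  have h1 : ∀ᶠ z in 𝓝 (c x), f (c.symm z) = 0 := by
    have := c.continuousAt_symm (c.map_source hx)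
    rw [ContinuousAt, c.left_inv hx] at this
    exact this h
  obtain ⟨s, hs, hso, hys⟩ := eventually_nhds_iff.1 h1
  obtain ⟨χ, h2, -, h3⟩ := exists_smoothFun_germ hc (c.map_source hx) (hso.mem_nhds hys)
    (u := fun _ => (1 : ℝ)) contDiffOn_const
  have h4 : χ * f = 0 := by
    ext z
    change χ z * f z = 0
    by_cases hz : z ∈ tsupport χ
    · have := h3 hz
      have h5 := hs (c z) this.2
      rw [c.left_inv this.1] at h5
      rw [h5, mul_zero]
    · rw [image_eq_zero_of_notMem_tsupport hz, zero_mul]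
  have h5 := congrArg (fun u : SmoothFun n M => u x) (D.leibniz χ f)
  rw [h4, map_zero] at h5
  have h6 := h2.self_of_nhds
  rw [c.left_inv hx] at h6
  have h7 : (0 : ℝ) = χ x * D f x + f x * D χ x := h5
  rw [h6, h.self_of_nhds] at h7
  linarith

omit [T2Space M] [IsManifold 𝓘(ℝ, Coord n) ∞ M] [ChartedSpace (Coord n) M] [TopologicalSpace M] in
theorem avg_self (y : Coord n) (r : SmoothFn n) : avg y r y = r y := by
  have := congrArg (fun f : SmoothFn n => f y) (euler_avg y r)
  simpa using this

/-- A derivation of the algebra of smooth functions is a vector field. -/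
theorem Derivation.exists_vector (D : Derivation ℝ (SmoothFun n M) (SmoothFun n M)) (x : M) :
    ∃ v : Tangent n x, ∀ f : SmoothFun n M, D f x = differential f x v := by
  have hc := chart_mem_atlas (Coord n) x
  have hx := mem_chart_source (Coord n) x
  set c := chartAt (Coord n) x
  have hy := c.map_source hx
  have hcont : ∀ {q : Coord n → Prop}, (∀ᶠ z in 𝓝 (c x), q z) → ∀ᶠ w in 𝓝 x, q (c w) :=
    fun h => (c.continuousAt hx).eventually h
  have hext : ∀ r : SmoothFn n, ∃ F : SmoothFun n M, ∀ᶠ z in 𝓝 (c x), F (c.symm z) = r z :=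
    fun r => by
      obtain ⟨F, hF, -, -⟩ := exists_smoothFun_germ hc hy Filter.univ_mem
        (contDiff_coe r).contDiffOn
      exact ⟨F, hF⟩
  choose E hE using hext
  refine ⟨∑ k, D (E (cen (c x) k)) x • vecAt c x k, fun f => ?_⟩
  obtain ⟨r, hr⟩ := exists_rep f hc hy
  -- By locality f may be replaced by its Hadamard expansion at x. The constant is killed and the
  -- centred coordinates vanish at x, so only the values of D on the coordinate functions remain.
  have h1 : D (f - (algebraMap ℝ _ (r (c x))
      + ∑ k, E (cen (c x) k) * E (avg (c x) (der k r)))) x = 0 := by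
    refine Derivation.apply_eq_zero_of_eventually D ?_
    have h2 := hcont (hr.and ((Filter.eventually_all.2 fun k => hE (cen (c x) k)).and
      (Filter.eventually_all.2 fun k => hE (avg (c x) (der k r)))))
    filter_upwards [h2, c.open_source.mem_nhds hx] with w hw hws
    rw [c.left_inv hws] at hw
    have h3 := congrArg (fun u : SmoothFn n => u (c w)) (hadamard (c x) r)
    simp only [SmoothFn.add_apply, SmoothFn.algebraMap_apply, SmoothFn.sum_apply,
      SmoothFn.mul_apply] at h3
    have h4 : ∀ G : Fin n → SmoothFun n M, (∑ k, G k) w = ∑ k, G k w := fun G => by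
      rw [← ContMDiffMap.coeFnAddMonoidHom_apply, map_sum, Finset.sum_apply]
      rfl
    have h5 : (f - (algebraMap ℝ _ (r (c x))
      + ∑ k, E (cen (c x) k) * E (avg (c x) (der k r)))) w = f w - (r (c x)
      + (∑ k, E (cen (c x) k) * E (avg (c x) (der k r))) w) := rfl
    rw [h5, h4, hw.1, h3, sub_eq_zero]
    congr 1
    refine Finset.sum_congr rfl fun k _ => ?_
    change _ = E (cen (c x) k) w * E (avg (c x) (der k r)) w
    rw [hw.2.1 k, hw.2.2 k]
  have h0 : ∀ r, E r x = r (c x) := fun r => by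
    have := (hE r).self_of_nhds
    rwa [c.left_inv hx] at this
  have h6 : ∀ G : Fin n → SmoothFun n M, (∑ k, G k) x = ∑ k, G k x := fun G => by
    rw [← ContMDiffMap.coeFnAddMonoidHom_apply, map_sum, Finset.sum_apply]
    rfl
  rw [map_sub, map_add, Derivation.map_algebraMap, zero_add, map_sum] at h1
  have h7 : D f x = ∑ k, D (E (cen (c x) k) * E (avg (c x) (der k r))) x := by
    rw [← h6, ← sub_eq_zero]
    exact h1
  rw [h7, map_sum]
  refine Finset.sum_congr rfl fun k _ => ?_
  rw [D.leibniz, map_smul, differential_apply f hc hx, pd_congr hr]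
  change E (cen (c x) k) x * _ + E (avg (c x) (der k r)) x * _ = _
  rw [h0, h0, avg_self, coe_der]
  simp [mul_comm]

/-- The vector field of a derivation, as a symbol. -/
theorem exists_symbol_derivation (D : Derivation ℝ (SmoothFun n M) (SmoothFun n M)) :
    ∃ P : Symbol n M, P.1.1 = 0 ∧ P.1.2.2 = 0 ∧
      ∀ (f : SmoothFun n M) (x : M), D f x = differential f x (P.1.2.1 x) := by
  choose v hv using Derivation.exists_vector D
  refine ⟨⟨(0, v, 0), fun x ξ ζ => by simp, fun c hc =>
    ⟨fun i j => by simpa using contDiffOn_const, fun i y hy => ?_,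
      by simpa using contDiffOn_const⟩⟩, rfl, rfl, fun f x => hv x f⟩
  -- The components of the vector field are smooth because near each point they are values of D on
  -- globally defined extensions of the coordinate functions.
  obtain ⟨F, -, hF⟩ := exists_coordFun hc hy i
  refine ContDiffAt.contDiffWithinAt ((contDiffAt_comp_symm (D F).contMDiff hc hy).congr_of_eventuallyEq ?_)
  filter_upwards [hF] with z hz
  rw [hv, hz]

/-- The principal symbol of an operator of order two. -/
theorem exists_symbol_two {T : Module.End ℝ (SmoothFun n M)} (hT : T ∈ diffOps (SmoothFun n M) 2) :
    ∃ P : Symbol n M, P.1.2.1 = 0 ∧ P.1.2.2 = 0 ∧ ∀ (f f' : SmoothFun n M) (x : M),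
      opComm (opComm T f) f' 1 x = 2 * P.1.1 x (differential f x) (differential f' x) := by
  have h0 : ∀ f f' f'', opComm (opComm (opComm T f) f') f'' = 0 := fun f f' f'' =>
    mem_diffOps_zero.1 (hT f f') f''
  set m : SmoothFun n M → Derivation ℝ (SmoothFun n M) (SmoothFun n M) :=
    fun f => symbolDerivation (opComm T f) (h0 f) with hm
  have hmm : ∀ f f', m f f' = opComm (opComm T f) f' 1 := fun f f' => rfl
  have hsymm : ∀ f f', m f f' = m f' f := fun f f' => by rw [hmm, hmm, opComm_comm]
  choose v hv using fun f => Derivation.exists_vector (m f)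
  choose F hF using fun x : M => exists_differential_eq (n := n) x
  -- The double commutator is a derivation in its second argument and is symmetric. At a point it
  -- therefore depends only on the two differentials, and the choice of functions with prescribed
  -- differential is harmless.
  have hval : ∀ (f f' : SmoothFun n M) x,
      m f f' x = m (F x (differential f x)) (F x (differential f' x)) x := fun f f' x => by
    rw [hv, ← hF x (differential f' x), ← hv, hsymm, hv, ← hF x (differential f x), ← hv, hsymm,
      hF, hF]
  let B : ∀ x : M, LinearMap.BilinForm ℝ (Cotangent n x) := fun x =>
    LinearMap.mk₂ ℝ (fun ξ ζ => 1 / 2 * m (F x ξ) (F x ζ) x)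
      (fun ξ ξ' ζ => by
        rw [hsymm, hsymm _ (F x ζ), hsymm _ (F x ζ), hv, hv, hv, hF, hF, hF]
        simp; ring)
      (fun r ξ ζ => by
        rw [hsymm, hsymm _ (F x ζ), hv, hv, hF, hF]
        simp; ring)
      (fun ξ ζ ζ' => by
        rw [hv, hv, hv, hF, hF, hF]
        simp; ring)
      (fun r ξ ζ => by
        rw [hv, hv, hF, hF]
        simp; ring)
  have hB : ∀ x ξ ζ, B x ξ ζ = 1 / 2 * m (F x ξ) (F x ζ) x := fun x ξ ζ => rfl
  refine ⟨⟨(B, 0, 0), fun x ξ ζ => by rw [hB, hB, hsymm], fun c hc =>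
    ⟨fun i j y hy => ?_, fun i => by simpa using contDiffOn_const,
      by simpa using contDiffOn_const⟩⟩, rfl, rfl, fun f f' x => ?_⟩
  · obtain ⟨f, -, hf⟩ := exists_coordFun hc hy i
    obtain ⟨f', -, hf'⟩ := exists_coordFun hc hy j
    refine ContDiffAt.contDiffWithinAt ((contDiffAt_const.mul (contDiffAt_comp_symm
      (m f f').contMDiff hc hy)).congr_of_eventuallyEq (f := fun z => 1 / 2 * m f f' (c.symm z)) ?_)
    filter_upwards [hf, hf'] with z h1 h2
    rw [hB, hval f f', h1, h2]
  · change _ = 2 * B x _ _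
    rw [← hmm, hval, hB]
    ring

/-- The operators of the values of a linear map on symbols have the expected principal symbols. -/
def PreservesSymbols (Q : Symbol n M →ₗ[ℝ] Module.End ℝ (SmoothFun n M)) : Prop :=
  ∀ P : Symbol n M,
    (∀ (f u : SmoothFun n M) (x : M),
      opComm (opComm (Q P) f) f u x
        = 2 * P.1.1 x (differential f x) (differential f x) * u x) ∧
    (P.1.1 = 0 → ∀ (f u : SmoothFun n M) (x : M),
      opComm (Q P) f u x = differential f x (P.1.2.1 x) * u x) ∧
    (P.1.1 = 0 → P.1.2.1 = 0 → ∀ (u : SmoothFun n M) (x : M),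
      Q P u x = P.1.2.2 x * u x)

variable {Q : Symbol n M →ₗ[ℝ] Module.End ℝ (SmoothFun n M)}

omit [IsManifold 𝓘(ℝ, Coord n) ∞ M] [T2Space M] in
theorem opComm_polarize (T : Module.End ℝ (SmoothFun n M)) (f f' : SmoothFun n M) :
    opComm (opComm T (f + f')) (f + f') = opComm (opComm T f) f
      + (2 : ℝ) • opComm (opComm T f) f' + opComm (opComm T f') f' := by
  rw [opComm_add_right T, opComm_add_right, opComm_add, opComm_add, opComm_comm T f' f, two_smul]
  abel

omit [T2Space M] in
-- Polarization: commutators with f and f' may be interchanged, and P₂ is symmetric.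
theorem PreservesSymbols.two (hQ : PreservesSymbols Q) (P : Symbol n M) (f f' u : SmoothFun n M)
    (x : M) : opComm (opComm (Q P) f) f' u x
      = 2 * P.1.1 x (differential f x) (differential f' x) * u x := by
  have h1 := (hQ P).1 (f + f') u x
  rw [opComm_polarize, differential_add] at h1
  have h2 : opComm (opComm (Q P) f) f u x + 2 * opComm (opComm (Q P) f) f' u x
      + opComm (opComm (Q P) f') f' u x = _ := h1
  rw [(hQ P).1, (hQ P).1] at h2
  simp only [map_add, LinearMap.add_apply, P.2.1 x (differential f' x) (differential f x)] at h2
  linarith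

omit [T2Space M] in
theorem PreservesSymbols.mem (hQ : PreservesSymbols Q) (P : Symbol n M) :
    Q P ∈ diffOps (SmoothFun n M) 2 := by
  refine fun f => fun f' => mem_diffOps_zero.2 fun f'' => LinearMap.ext fun u => ?_
  ext x
  rw [opComm_apply]
  change opComm (opComm (Q P) f) f' (f'' * u) x - f'' x * opComm (opComm (Q P) f) f' u x = 0
  rw [hQ.two, hQ.two]
  change _ * (f'' x * u x) - _ = (0 : ℝ)
  ring

/-- The components are read off from the operator in decreasing degree, since each lower symbol is
only specified once the higher components are zero. Every covector is the differential of a global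
function. -/
theorem PreservesSymbols.eq_zero (hQ : PreservesSymbols Q) {P : Symbol n M} (hP : Q P = 0) :
    P = 0 := by
  have hz : ∀ f : SmoothFun n M, opComm (0 : Module.End ℝ (SmoothFun n M)) f = 0 := fun f => by
    ext u; simp [opComm_apply]
  have h2 : P.1.1 = 0 := by
    funext x
    ext ξ ζ
    obtain ⟨f, rfl⟩ := exists_differential_eq x ξ
    obtain ⟨f', rfl⟩ := exists_differential_eq x ζ
    have := hQ.two P f f' 1 x
    rw [hP, hz, hz] at this
    have h3 : (0 : ℝ) = 2 * P.1.1 x (differential f x) (differential f' x) * 1 := this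
    simpa using h3.symm
  have h1 : P.1.2.1 = 0 := by
    funext x
    have hc := chart_mem_atlas (Coord n) x
    have hx := mem_chart_source (Coord n) x
    rw [eq_sum_vecAt hc hx (P.1.2.1 x)]
    refine Finset.sum_eq_zero fun i _ => ?_
    obtain ⟨f, hf⟩ := exists_differential_eq x (covecAt (chartAt (Coord n) x) x i)
    have := (hQ P).2.1 h2 f 1 x
    rw [hP, hz, hf] at this
    have h3 : (0 : ℝ) = covecAt (chartAt (Coord n) x) x i (P.1.2.1 x) * 1 := this
    rw [mul_one] at h3
    rw [← h3, zero_smul]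
  refine Subtype.ext (Prod.ext h2 (Prod.ext h1 ?_))
  funext x
  have := (hQ P).2.2 h2 h1 1 x
  rw [hP] at this
  have h3 : (0 : ℝ) = P.1.2.2 x * 1 := this
  simpa using h3.symm

theorem PreservesSymbols.injective (hQ : PreservesSymbols Q) : Function.Injective Q := by
  intro P P' h
  have h1 : P + (-1 : ℝ) • P' = 0 := hQ.eq_zero (by
    rw [map_add, map_smul, h]
    ext u x
    change Q P' u x + -1 * Q P' u x = 0
    ring)
  have h2 : P.1 + (-1 : ℝ) • P'.1 = 0 := congrArg Subtype.val h1
  refine Subtype.ext (Prod.ext ?_ (Prod.ext ?_ ?_))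
  · funext x
    ext ξ ζ
    have h3 : P.1.1 x ξ ζ + -1 * P'.1.1 x ξ ζ = 0 := congrArg (fun R => R.1 x ξ ζ) h2
    linarith
  · funext x
    refine funext fun k : Fin n => ?_
    have h3 : (P.1.2.1 x : Coord n) k + -1 * (P'.1.2.1 x : Coord n) k = 0 :=
      congrArg (fun R => (R.2.1 x : Coord n) k) h2
    linarith
  · funext x
    have h3 : P.1.2.2 x + -1 * P'.1.2.2 x = 0 := congrArg (fun R => R.2.2 x) h2
    linarith

/-- The symbol of a function. -/
def functionSymbol (u : SmoothFun n M) : Symbol n M :=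
  ⟨(0, 0, u), fun x ξ ζ => by simp, fun c hc =>
    ⟨fun i j => by simpa using contDiffOn_const, fun i => by simpa using contDiffOn_const,
      contDiffOn_comp_symm u.contMDiff hc⟩⟩

/-- The principal symbol of T is realized by some P2 with the same double commutators. Then T -
Q(P2) has order one, its symbol is a derivation and thus a vector field P1, and what is left after
subtracting Q(P1) is a multiplication. -/
theorem PreservesSymbols.surjective (hQ : PreservesSymbols Q) {T : Module.End ℝ (SmoothFun n M)}
    (hT : T ∈ diffOps (SmoothFun n M) 2) : ∃ P, Q P = T := by
  obtain ⟨P2, -, -, hP2⟩ := exists_symbol_two hT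
  have h1 : ∀ f f', opComm (opComm (T - Q P2) f) f' = 0 := fun f f' => by
    have hmem := (diffOps (SmoothFun n M) 2).sub_mem hT (hQ.mem P2) f f'
    refine LinearMap.ext fun u => ?_
    rw [eq_mul_of_opComm_eq_zero (mem_diffOps_zero.1 hmem), opComm_sub, opComm_sub]
    have h2 : opComm (opComm T f) f' 1 = opComm (opComm (Q P2) f) f' 1 := by
      ext x
      rw [hP2, hQ.two]
      exact (mul_one _).symm
    rw [LinearMap.sub_apply, h2, sub_self, zero_mul, LinearMap.zero_apply]
  obtain ⟨P1, hP1, -, hD⟩ := exists_symbol_derivation (symbolDerivation _ h1)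
  have h2 : ∀ f, opComm (T - Q P2 - Q P1) f = 0 := fun f => by
    refine LinearMap.ext fun u => ?_
    rw [opComm_sub, LinearMap.sub_apply, eq_mul_of_opComm_eq_zero (h1 f)]
    ext x
    have h3 := (hQ P1).2.1 hP1 f u x
    have h4 := hD f x
    rw [symbolDerivation_apply] at h4
    change opComm (T - Q P2) f 1 x * u x - opComm (Q P1) f u x = 0
    rw [h3, h4, sub_self]
  refine ⟨P2 + P1 + functionSymbol ((T - Q P2 - Q P1) 1), ?_⟩
  have h3 : Q (functionSymbol ((T - Q P2 - Q P1) 1)) = T - Q P2 - Q P1 := by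
    refine LinearMap.ext fun u => ?_
    ext x
    rw [(hQ _).2.2 rfl rfl, eq_mul_of_opComm_eq_zero h2 u]
    rfl
  rw [map_add, map_add, h3]
  abel

/-- The quantization map given by a linear map which preserves principal symbols. -/
def PreservesSymbols.toQuantization (hQ : PreservesSymbols Q) : QuantizationMap n M :=
  LinearEquiv.ofBijective (Q.codRestrict _ hQ.mem)
    ⟨fun P P' h => hQ.injective (congrArg Subtype.val h), fun T => by
      obtain ⟨P, hP⟩ := hQ.surjective T.2
      exact ⟨P, Subtype.ext hP⟩⟩

theorem PreservesSymbols.toQuantization_op (hQ : PreservesSymbols Q) (P : Symbol n M) :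
    hQ.toQuantization.op P = Q P := rfl

end Manifold

end ConformalQuantization
end

noncomputable section

namespace ConformalQuantization

/-! ### The global quantization -/

section Global

variable {n p : ℕ} {M : Type*} [TopologicalSpace M] [ChartedSpace (Coord n) M]
  [IsManifold 𝓘(ℝ, Coord n) ∞ M] {g : PseudoRiemannianMetric n M}
  {c c' : OpenPartialHomeomorph M (Coord n)} {y : Coord n}

/-- The zeroth order terms of the quantizations in two charts agree. -/
def IsChartIndependent (g : PseudoRiemannianMetric n M) (p : ℕ) (a b l : ℝ) : Prop :=
  ∀ c ∈ atlas (Coord n) M, ∀ c' ∈ atlas (Coord n) M, ∀ x ∈ c.source, x ∈ c'.source →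
    ∀ P : Symbol n M, chartPot g p a b l c' P (c' x) = chartPot g p a b l c P (c x)

theorem flux_mul (P : Symbol n M) (f u : SmoothFun n M) (hc : c ∈ atlas (Coord n) M)
    {z : Coord n} (hz : z ∈ c.target) (i : Fin n) :
    flux c P (f * u) z i = f (c.symm z) * flux c P u z i + u (c.symm z) * flux c P f z i := by
  have h1 : ∀ j, pd j (fun w => (f * u) (c.symm w)) z = _ := fun j =>
    pd_mul ((contDiffAt_comp_symm f.contMDiff hc hz).differentiableAt (by simp))
      ((contDiffAt_comp_symm u.contMDiff hc hz).differentiableAt (by simp)) j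
  simp only [flux, h1, Finset.mul_sum, ← Finset.sum_add_distrib]
  exact Finset.sum_congr rfl fun j _ => by ring

theorem divergence_flux_mul (hn : 0 < n) (hg : g.IsConformallyFlat p) (P : Symbol n M)
    (f u : SmoothFun n M) (hc : c ∈ atlas (Coord n) M) (hy : y ∈ c.target) :
    divergence (g.coeff c) (flux c P (f * u)) y
      = f (c.symm y) * divergence (g.coeff c) (flux c P u) y
        + u (c.symm y) * divergence (g.coeff c) (flux c P f) y
        + 2 * ∑ i, ∑ j, P.comp2 c y i j * pd i (fun w => f (c.symm w)) y
          * pd j (fun w => u (c.symm w)) y := by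
  obtain ⟨σ, hσ⟩ := exists_conformalFactor hn hg hc hy
  have hd : ∀ f i, DifferentiableAt ℝ (fun z => flux c P f z i) y := fun f i =>
    (contDiffAt_flux P f hc hy i).differentiableAt (by simp)
  have hs : ∀ f : SmoothFun n M, DifferentiableAt ℝ (fun z => f (c.symm z)) y := fun f =>
    (contDiffAt_comp_symm f.contMDiff hc hy).differentiableAt (by simp)
  rw [hσ.divergence_eq (hd _), hσ.divergence_eq (hd _), hσ.divergence_eq (hd _)]
  have h1 : ∀ i, pd i (fun z => flux c P (f * u) z i) y
      = f (c.symm y) * pd i (fun z => flux c P u z i) y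
        + flux c P u y i * pd i (fun w => f (c.symm w)) y
        + (u (c.symm y) * pd i (fun z => flux c P f z i) y
        + flux c P f y i * pd i (fun w => u (c.symm w)) y) := fun i => by
    have h2 : (fun z => flux c P (f * u) z i) =ᶠ[𝓝 y] fun z =>
        f (c.symm z) * flux c P u z i + u (c.symm z) * flux c P f z i := by
      filter_upwards [c.open_target.mem_nhds hy] with z hz using flux_mul P f u hc hz i
    rw [pd_congr h2, pd_add ((hs f).fun_mul (hd u i)) ((hs u).fun_mul (hd f i)),
      pd_mul (hs f) (hd u i), pd_mul (hs u) (hd f i)]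
  have h2 : ∑ i, flux c P u y i * pd i (fun w => f (c.symm w)) y
      = ∑ i, ∑ j, P.comp2 c y i j * pd i (fun w => f (c.symm w)) y
          * pd j (fun w => u (c.symm w)) y := by
    simp only [flux, Finset.sum_mul]
    exact Finset.sum_congr rfl fun i _ => Finset.sum_congr rfl fun j _ => by ring
  have h3 : ∑ i, flux c P f y i * pd i (fun w => u (c.symm w)) y
      = ∑ i, ∑ j, P.comp2 c y i j * pd i (fun w => f (c.symm w)) y
          * pd j (fun w => u (c.symm w)) y := by
    simp only [flux, Finset.sum_mul]
    rw [Finset.sum_comm]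
    refine Finset.sum_congr rfl fun i _ => Finset.sum_congr rfl fun j _ => ?_
    rw [show P.comp2 c y j i = P.comp2 c y i j from P.2.1 _ _ _]
  simp only [h1, Finset.sum_add_distrib, h2, h3, flux_mul P f u hc hy, add_mul,
    ← Finset.mul_sum, mul_assoc]
  ring

theorem tensor_differential (P : Symbol n M) (f u : SmoothFun n M) (hc : c ∈ atlas (Coord n) M)
    {x : M} (hx : x ∈ c.source) : P.1.1 x (differential f x) (differential u x)
      = ∑ i, ∑ j, P.comp2 c (c x) i j * pd i (fun w => f (c.symm w)) (c x)
          * pd j (fun w => u (c.symm w)) (c x) := by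
  rw [differential_eq f hc hx, differential_eq u hc hx]
  simp only [map_sum, LinearMap.sum_apply, map_smul, LinearMap.smul_apply, smul_eq_mul,
    comp2_eq P (c.left_inv hx)]
  simp only [Finset.mul_sum]
  rw [Finset.sum_comm]
  exact Finset.sum_congr rfl fun i _ => Finset.sum_congr rfl fun j _ => by ring

omit [IsManifold 𝓘(ℝ, Coord n) ∞ M] in
theorem chartQuant_one (a b l : ℝ) (P : Symbol n M) (z : Coord n) :
    chartQuant g p a b l c P 1 z = chartPot g p a b l c P z
      + 1 / 2 * divergence (g.coeff c) (P.comp1 c) z + P.comp0 c z := by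
  have h3 : ∀ j y, pd j (fun x : Coord n => (1 : SmoothFun n M) (c.symm x)) y = 0 := fun j y =>
    pd_const (1 : ℝ) j y
  have h4 : flux c P 1 = fun _ _ => 0 := by
    funext z i
    simp only [flux, h3, mul_zero, Finset.sum_const_zero]
  rw [chartQuant_eq, h4, divergence_zero]
  simp only [h3, mul_zero, Finset.sum_const_zero]
  simp

/-- The Leibniz rule of an operator of order two. It contains everything needed for the commutators
and shows that the symbol does not depend on a, b and l. -/
theorem chartQuant_mul (hn : 0 < n) (hg : g.IsConformallyFlat p) (a b l : ℝ) (P : Symbol n M)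
    (f u : SmoothFun n M) (hc : c ∈ atlas (Coord n) M) {x : M} (hx : x ∈ c.source) :
    chartQuant g p a b l c P (f * u) (c x) = f x * chartQuant g p a b l c P u (c x)
      + u x * chartQuant g p a b l c P f (c x) - f x * u x * chartQuant g p a b l c P 1 (c x)
      + 2 * P.1.1 x (differential f x) (differential u x) := by
  have hy := c.map_source hx
  have h1 : ∀ j, pd j (fun w => (f * u) (c.symm w)) (c x) = _ := fun j =>
    pd_mul ((contDiffAt_comp_symm f.contMDiff hc hy).differentiableAt (by simp))
      ((contDiffAt_comp_symm u.contMDiff hc hy).differentiableAt (by simp)) j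
  rw [chartQuant_one, chartQuant_eq, chartQuant_eq, chartQuant_eq,
    divergence_flux_mul hn hg P f u hc hy, tensor_differential P f u hc hx, c.left_inv hx]
  simp only [h1, c.left_inv hx, mul_add, Finset.sum_add_distrib, mul_left_comm _ (f x),
    mul_left_comm _ (u x), ← Finset.mul_sum]
  have h2 : (f * u) x = f x * u x := rfl
  rw [h2]
  ring

theorem chartQuant_zero (hn : 0 < n) (hg : g.IsConformallyFlat p)
    (hc : c ∈ atlas (Coord n) M) (hy : y ∈ c.target) (a b l : ℝ) (f : SmoothFun n M) :
    chartQuant g p a b l c 0 f y = 0 := by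
  have := chartQuant_add_smul hn hg hc hy a b l 0 0 1 f
  rw [one_smul, add_zero] at this
  linarith

omit [IsManifold 𝓘(ℝ, Coord n) ∞ M] in
theorem lieDensity_congr {G : Coord n → Matrix (Fin n) (Fin n) ℝ} {w : ℝ} {X : Coord n → Coord n}
    {u v : Coord n → ℝ} (h : u =ᶠ[𝓝 y] v) : lieDensity G w X u y = lieDensity G w X v y := by
  simp only [lieDensity, pd_congr h, h.eq_of_nhds]

variable {a b l : ℝ}

/-- The conformally equivariant quantization. -/
def quantLin (hn : 0 < n) (hg : g.IsConformallyFlat p) (hU : IsChartIndependent g p a b l) :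
    Symbol n M →ₗ[ℝ] Module.End ℝ (SmoothFun n M) where
  toFun P :=
    { toFun := fun f => ⟨fun x => chartQuant g p a b l (chartAt (Coord n) x) P f
        (chartAt (Coord n) x x), fun x => by
          have hc := chart_mem_atlas (Coord n) x
          have hx := mem_chart_source (Coord n) x
          refine contMDiffAt_of_chart hc hx ((contDiffAt_chartQuant hn hg hc
            (mem_chart_target (Coord n) x) a b l P f).congr_of_eventuallyEq ?_)
          filter_upwards [(chartAt (Coord n) x).open_target.mem_nhds (mem_chart_target (Coord n) x)]
            with z hz
          have h1 := (chartAt (Coord n) x).map_target hz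
          -- The definition uses the preferred chart at each point, which varies with the point.
          -- Chart independence replaces it by one fixed chart, where smoothness is known.
          have h2 := chartQuant_change hn hg hc (chart_mem_atlas (Coord n) _) h1
            (mem_chart_source (Coord n) _) (hU _ hc _ (chart_mem_atlas (Coord n) _) _ h1
              (mem_chart_source (Coord n) _) P) f
          rwa [(chartAt (Coord n) x).right_inv hz] at h2⟩
      map_add' := fun f f' => ContMDiffMap.ext fun x => by
        have := chartQuant_right_add_smul hn hg (chart_mem_atlas (Coord n) x)
          (mem_chart_target (Coord n) x) a b l P 1 f f'
        rw [one_smul, one_mul] at this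
        exact this
      map_smul' := fun t f => ContMDiffMap.ext fun x => by
        have h0 := chartQuant_right_add_smul hn hg (chart_mem_atlas (Coord n) x)
          (mem_chart_target (Coord n) x) a b l P 1 0 0
        have := chartQuant_right_add_smul hn hg (chart_mem_atlas (Coord n) x)
          (mem_chart_target (Coord n) x) a b l P t 0 f
        rw [one_smul, add_zero] at h0
        rw [zero_add] at this
        change chartQuant g p a b l _ P (t • f) _ = t * chartQuant g p a b l _ P f _
        linarith }
  map_add' P P' := LinearMap.ext fun f => ContMDiffMap.ext fun x => by
    have := chartQuant_add_smul hn hg (chart_mem_atlas (Coord n) x)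
      (mem_chart_target (Coord n) x) a b l P P' 1 f
    rw [one_smul, one_mul] at this
    exact this
  map_smul' t P := LinearMap.ext fun f => ContMDiffMap.ext fun x => by
    have h0 := chartQuant_zero hn hg (chart_mem_atlas (Coord n) x)
      (mem_chart_target (Coord n) x) a b l f
    have := chartQuant_add_smul hn hg (chart_mem_atlas (Coord n) x)
      (mem_chart_target (Coord n) x) a b l 0 P t f
    rw [zero_add, h0, zero_add] at this
    exact this

variable {hn : 0 < n} {hg : g.IsConformallyFlat p} {hU : IsChartIndependent g p a b l}

theorem quantLin_apply (P : Symbol n M) (f : SmoothFun n M) (hc : c ∈ atlas (Coord n) M) {x : M}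
    (hx : x ∈ c.source) : quantLin hn hg hU P f x = chartQuant g p a b l c P f (c x) :=
  chartQuant_change hn hg hc (chart_mem_atlas (Coord n) _) hx (mem_chart_source (Coord n) _)
    (hU _ hc _ (chart_mem_atlas (Coord n) _) _ hx (mem_chart_source (Coord n) _) P) f

theorem quantLin_mul (P : Symbol n M) (f u : SmoothFun n M) (x : M) :
    quantLin hn hg hU P (f * u) x = f x * quantLin hn hg hU P u x + u x * quantLin hn hg hU P f x
      - f x * u x * quantLin hn hg hU P 1 x + 2 * P.1.1 x (differential f x) (differential u x) :=
  chartQuant_mul hn hg a b l P f u (chart_mem_atlas (Coord n) x) (mem_chart_source (Coord n) x)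

theorem preservesSymbols_quantLin : PreservesSymbols (quantLin hn hg hU) := by
  have hcomm : ∀ (P : Symbol n M) (f u : SmoothFun n M) (x : M),
      opComm (quantLin hn hg hU P) f u x = u x * quantLin hn hg hU P f x
        - f x * u x * quantLin hn hg hU P 1 x
        + 2 * P.1.1 x (differential f x) (differential u x) := fun P f u x => by
    rw [opComm_apply]
    change quantLin hn hg hU P (f * u) x - f x * quantLin hn hg hU P u x = _
    rw [quantLin_mul]
    ring
  refine fun P => ⟨fun f u x => ?_, fun h2 f u x => ?_, fun h2 h1 u x => ?_⟩
  · rw [opComm_apply]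
    change opComm (quantLin hn hg hU P) f (f * u) x - f x * opComm (quantLin hn hg hU P) f u x = _
    rw [hcomm, hcomm, differential_mul, map_add, map_smul, map_smul]
    change f x * u x * _ - f x * (f x * u x) * _ + _ - _ = _
    simp only [smul_eq_mul]
    ring
  all_goals
    have hc := chart_mem_atlas (Coord n) x
    have hx := mem_chart_source (Coord n) x
    have h3 : ∀ f, flux (chartAt (Coord n) x) P f = fun _ _ => 0 := fun f => by
      funext z i
      simp [flux, Symbol.comp2, h2]
  · rw [hcomm, quantLin_apply P f hc hx, quantLin_apply P 1 hc hx, chartQuant_one, chartQuant_eq,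
      h3, divergence_zero, h2, differential_eq f hc hx, (chartAt (Coord n) x).left_inv hx]
    simp only [comp1_eq P ((chartAt (Coord n) x).left_inv hx)]
    rw [sum_apply]
    simp only [smul_apply, smul_eq_mul, mul_comm (pd _ _ _)]
    simp only [Pi.zero_apply, LinearMap.zero_apply]
    ring
  · have h4 : chartPot g p a b l (chartAt (Coord n) x) P (chartAt (Coord n) x x) = 0 := by
      have h5 : P.part2 = 0 := Subtype.ext (Prod.ext h2 rfl)
      rw [chartPot_eq, h5]
      exact chartQuant_zero hn hg hc (mem_chart_target (Coord n) x) a b l 1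
    have h5 : P.comp1 (chartAt (Coord n) x) = fun _ _ => 0 := by
      funext z i
      simp [Symbol.comp1, h1]
    rw [quantLin_apply P u hc hx, chartQuant_eq, h3, h4, h5, divergence_zero,
      comp0_eq P ((chartAt (Coord n) x).left_inv hx), (chartAt (Coord n) x).left_inv hx]
    simp

theorem quantLin_equivariant [T2Space M] {m : ℝ} (hab : IsConformalWeights n a b l)
    (hlm : l + m = 1) :
    (preservesSymbols_quantLin (hn := hn) (hg := hg) (hU := hU)).toQuantization.IsEquivariant
      g p l m := by
  intro c hc X hX y hy P P' f f' hP hf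
  have h1 : ∀ P f, ∀ z ∈ c.target, (preservesSymbols_quantLin (hn := hn) (hg := hg)
      (hU := hU)).toQuantization.op P f (c.symm z) = chartQuant g p a b l c P f z :=
    fun P f z hz => by
      rw [PreservesSymbols.toQuantization_op, quantLin_apply P f hc (c.map_target hz),
        c.right_inv hz]
  rw [h1 _ _ y hy, h1 _ _ y hy, lieDensity_congr (v := chartQuant g p a b l c P f) (by
    filter_upwards [c.open_target.mem_nhds hy] with z hz using h1 P f z hz)]
  exact chartQuant_equivariant hn hg hab hlm hc hX hy (hP.mono fun z hz => hz.1)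
    (hP.mono fun z hz => hz.2.1) (hP.mono fun z hz => hz.2.2) hf

end Global

end ConformalQuantization
end

noncomputable section

namespace ConformalQuantization

/-! ### The volume of the metric -/

section Volume

variable {n : ℕ} {M : Type*} [TopologicalSpace M] [ChartedSpace (Coord n) M]
  [MeasurableSpace M] [BorelSpace M]
  {g : PseudoRiemannianMetric n M} {c c' : OpenPartialHomeomorph M (Coord n)}

omit [MeasurableSpace M] [BorelSpace M] in
theorem continuousOn_volCoeff (hc : c ∈ atlas (Coord n) M) :
    ContinuousOn (volCoeff (g.coeff c)) c.target :=
  (PseudoRiemannianMetric.contDiffOn_det (g.smooth c hc)).continuousOn.abs.sqrt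

omit [MeasurableSpace M] [BorelSpace M] in
theorem aemeasurable_volCoeff (hc : c ∈ atlas (Coord n) M) :
    AEMeasurable (fun y => ENNReal.ofReal (volCoeff (g.coeff c) y)) (volume.restrict c.target) :=
  ((continuousOn_volCoeff hc).aemeasurable c.open_target.measurableSet).ennreal_ofReal

theorem aemeasurable_symm : AEMeasurable c.symm
    ((volume.restrict c.target).withDensity fun y => ENNReal.ofReal (volCoeff (g.coeff c) y)) :=
  (c.continuousOn_symm.aemeasurable c.open_target.measurableSet).mono_ac
    (withDensity_absolutelyContinuous _ _)

omit [ChartedSpace (Coord n) M] in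
theorem measurableSet_target_inter {S : Set M} (hS : MeasurableSet S) :
    MeasurableSet (c.target ∩ c.symm ⁻¹' S) := by
  have h := (continuousOn_iff_continuous_domRestrict.1 c.continuousOn_symm).measurable hS
  have h2 := c.open_target.measurableSet.subtype_image h
  convert h2 using 1
  ext z
  simp [and_comm]

theorem chartVolume_apply {S : Set M} (hS : MeasurableSet S) :
    g.chartVolume c S
      = ∫⁻ z in c.target ∩ c.symm ⁻¹' S, ENNReal.ofReal (volCoeff (g.coeff c) z) := by
  rw [PseudoRiemannianMetric.chartVolume, Measure.map_apply_of_aemeasurable aemeasurable_symm hS,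
    withDensity_apply' _, Measure.restrict_restrict' c.open_target.measurableSet, Set.inter_comm]

theorem chartVolume_inter_source {S : Set M} (hS : MeasurableSet S) :
    g.chartVolume c S = g.chartVolume c (S ∩ c.source) := by
  rw [chartVolume_apply hS, chartVolume_apply (hS.inter c.open_source.measurableSet)]
  congr 2
  ext z
  simp only [Set.mem_inter_iff, Set.mem_preimage]
  exact ⟨fun h => ⟨h.1, h.2, c.map_target h.1⟩, fun h => ⟨h.1, h.2.1⟩⟩

variable [IsManifold 𝓘(ℝ, Coord n) ∞ M]

omit [MeasurableSpace M] [BorelSpace M] in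
theorem volCoeff_change (hc : c ∈ atlas (Coord n) M) (hc' : c' ∈ atlas (Coord n) M) {x : M}
    (hx : x ∈ c.source) (hx' : x ∈ c'.source) :
    volCoeff (g.coeff c) (c x)
      = |(fderiv ℝ (trans c c') (c x)).det| * volCoeff (g.coeff c') (c' x) := by
  set J : Matrix (Fin n) (Fin n) ℝ := Matrix.of fun i a => jac c c' i a (c x) with hJ
  have h1 : g.coeff c (c x) = J * g.coeff c' (c' x) * J.transpose := by
    ext i j
    rw [coeff_change g hc hc' hx hx', Matrix.mul_apply]
    simp only [Matrix.mul_apply, Matrix.transpose_apply, Finset.sum_mul, hJ, Matrix.of_apply]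
    rw [Finset.sum_comm]
    exact Finset.sum_congr rfl fun a _ => Finset.sum_congr rfl fun b _ => by ring
  have h2 : (fderiv ℝ (trans c c') (c x)).det = J.det := by
    rw [ContinuousLinearMap.det, ← LinearMap.det_toMatrix', ← Matrix.det_transpose]
    congr 1
    ext i a
    simp only [Matrix.transpose_apply, LinearMap.toMatrix'_apply, hJ, Matrix.of_apply]
    unfold jac pd
    rw [fderiv_apply ((contDiffAt_trans hc hc' hx hx').differentiableAt (by simp))]
    simp
  rw [volCoeff, volCoeff, h1, h2, Matrix.det_mul, Matrix.det_mul, Matrix.det_transpose, abs_mul,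
    abs_mul, show |J.det| * |(g.coeff c' (c' x)).det| * |J.det|
      = |J.det| ^ 2 * |(g.coeff c' (c' x)).det| by ring, Real.sqrt_mul (by positivity),
    Real.sqrt_sq (abs_nonneg _)]

/-- The change of variables formula: the coordinate change maps the coordinate image of S in one
chart onto that in the other, and its Jacobian determinant is the ratio of the two volume
coefficients. -/
theorem chartVolume_eq (hc : c ∈ atlas (Coord n) M) (hc' : c' ∈ atlas (Coord n) M) {S : Set M}
    (hS : MeasurableSet S) (h : S ⊆ c.source) (h' : S ⊆ c'.source) :
    g.chartVolume c S = g.chartVolume c' S := by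
  rw [chartVolume_apply hS, chartVolume_apply hS]
  have himage : c'.target ∩ c'.symm ⁻¹' S = trans c c' '' (c.target ∩ c.symm ⁻¹' S) := by
    ext z
    constructor
    · rintro ⟨h1, h2⟩
      refine ⟨c (c'.symm z), ⟨c.map_source (h h2), ?_⟩, ?_⟩
      · rw [Set.mem_preimage, c.left_inv (h h2)]; exact h2
      · rw [trans, c.left_inv (h h2), c'.right_inv h1]
    · rintro ⟨w, ⟨h1, h2⟩, rfl⟩
      refine ⟨c'.map_source (h' h2), ?_⟩
      rw [Set.mem_preimage, trans, c'.left_inv (h' h2)]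
      exact h2
  have hd : ∀ z ∈ c.target ∩ c.symm ⁻¹' S, HasFDerivWithinAt (trans c c')
      (fderiv ℝ (trans c c') z) (c.target ∩ c.symm ⁻¹' S) z := fun z hz => by
    have := (contDiffAt_trans hc hc' (h hz.2) (h' hz.2)).differentiableAt (by simp)
    rw [c.right_inv hz.1] at this
    exact this.hasFDerivAt.hasFDerivWithinAt
  have hinj : Set.InjOn (trans c c') (c.target ∩ c.symm ⁻¹' S) := fun z hz w hw hzw =>
    c.symm.injOn hz.1 hw.1 (c'.injOn (h' hz.2) (h' hw.2) hzw)
  rw [himage, lintegral_image_eq_lintegral_abs_det_fderiv_mul volume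
    (measurableSet_target_inter hS) hd hinj]
  refine setLIntegral_congr_fun (measurableSet_target_inter hS) fun z hz => ?_
  have := volCoeff_change (g := g) hc hc' (h hz.2) (h' hz.2)
  rw [c.right_inv hz.1] at this
  rw [this, ENNReal.ofReal_mul (abs_nonneg _)]
  rfl

/-- A supremum of measures is not computed set by set, so it is compared with a glued measure. By
agreement on overlaps every chart volume is a restriction of the latter, which bounds the supremum
from above; the reverse inequality on a chart domain is immediate. -/
theorem vol_restrict [SecondCountableTopology M] (hc : c ∈ atlas (Coord n) M) :
    g.vol.restrict c.source = g.chartVolume c := by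
  rcases isEmpty_or_nonempty M with hM | hM
  · exact (Measure.eq_zero_of_isEmpty _).trans (Measure.eq_zero_of_isEmpty _).symm
  obtain ⟨s, hs, hcov⟩ := TopologicalSpace.countable_cover_nhds
    (f := fun x : M => (chartAt (Coord n) x).source) fun x => chart_source_mem_nhds _ x
  have hne : s.Nonempty := by
    by_contra h
    rw [Set.not_nonempty_iff_eq_empty.1 h] at hcov
    simp only [Set.mem_empty_iff_false, Set.iUnion_of_empty, Set.iUnion_empty] at hcov
    exact (Set.empty_ne_univ hcov).elim
  obtain ⟨e, rfl⟩ := hs.exists_eq_range hne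
  set k : ℕ → Set M := fun i => (chartAt (Coord n) (e i)).source
  have hk : ∀ i, MeasurableSet (k i) := fun i => (chartAt _ _).open_source.measurableSet
  have hcov' : ⋃ i, disjointed k i = Set.univ := by
    rw [iUnion_disjointed, ← hcov, Set.biUnion_range]
  have hD : ∀ i, MeasurableSet (disjointed k i) := fun i => MeasurableSet.disjointed hk i
  -- Second countability gives countably many chart domains covering M. Making them disjoint allows
  -- the chart volumes to be added without counting anything twice.
  set μ : Measure M := Measure.sum fun i =>
    (g.chartVolume (chartAt (Coord n) (e i))).restrict (disjointed k i)
  have hμ : ∀ c ∈ atlas (Coord n) M, ∀ S, MeasurableSet S →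
      g.chartVolume c S = μ (S ∩ c.source) := by
    intro c hc S hS
    have hSc := hS.inter c.open_source.measurableSet
    rw [chartVolume_inter_source hS, Measure.sum_apply _ hSc]
    have h1 : S ∩ c.source = ⋃ i, (S ∩ c.source) ∩ disjointed k i := by
      rw [← Set.inter_iUnion, hcov', Set.inter_univ]
    conv_lhs => rw [h1]
    rw [measure_iUnion (fun i j hij => ((disjoint_disjointed k hij).mono
      Set.inter_subset_right Set.inter_subset_right)) (fun i => hSc.inter (hD i))]
    congr 1
    funext i
    rw [Measure.restrict_apply hSc]
    exact chartVolume_eq hc (chart_mem_atlas _ _) (hSc.inter (hD i))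
      (Set.inter_subset_left.trans Set.inter_subset_right)
      (Set.inter_subset_right.trans (disjointed_subset k i))
  have hle : g.vol ≤ μ := iSup_le fun c => Measure.le_iff.2 fun S hS => by
    rw [hμ c c.2 S hS]
    exact measure_mono Set.inter_subset_left
  ext S hS
  rw [Measure.restrict_apply hS]
  refine le_antisymm ?_ ?_
  · rw [hμ c hc S hS]
    exact hle _
  · rw [chartVolume_inter_source hS]
    exact (le_iSup (fun c : atlas (Coord n) M => g.chartVolume c) ⟨c, hc⟩ : _ ≤ g.vol) _

theorem integral_vol [SecondCountableTopology M] (hc : c ∈ atlas (Coord n) M) {φ : M → ℝ}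
    (hφ : Continuous φ) (hsupp : ∀ x ∉ c.source, φ x = 0) :
    ∫ x, φ x ∂g.vol = ∫ z in c.target, volCoeff (g.coeff c) z * φ (c.symm z) := by
  rw [← setIntegral_eq_integral_of_forall_compl_eq_zero hsupp, vol_restrict hc,
    PseudoRiemannianMetric.chartVolume,
    integral_map aemeasurable_symm hφ.measurable.aestronglyMeasurable,
    integral_withDensity_eq_integral_toReal_smul₀ (aemeasurable_volCoeff hc)
      (.of_forall fun _ => ENNReal.ofReal_lt_top)]
  refine integral_congr_ae (.of_forall fun z => ?_)
  beta_reduce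
  rw [ENNReal.toReal_ofReal (by exact Real.sqrt_nonneg _), smul_eq_mul]

omit [MeasurableSpace M] [BorelSpace M] in
theorem volCoeff_pos (hc : c ∈ atlas (Coord n) M) {y : Coord n} (hy : y ∈ c.target) :
    0 < volCoeff (g.coeff c) y :=
  Real.sqrt_pos.2 (abs_pos.2 (g.coeff_det_ne_zero hc hy))

/-- Positivity on open sets is what makes a smooth function vanish once it pairs to zero with all
test functions, and hence it underlies uniqueness. -/
theorem isOpenPosMeasure_vol : g.vol.IsOpenPosMeasure := by
  refine ⟨fun U hU ⟨x, hxU⟩ => ?_⟩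
  have hc := chart_mem_atlas (Coord n) x
  set c := chartAt (Coord n) x
  have h1 : g.chartVolume c U ≤ g.vol U :=
    (le_iSup (fun c : atlas (Coord n) M => g.chartVolume c) ⟨c, hc⟩ : _ ≤ g.vol) _
  refine fun h => ?_
  have h2 : g.chartVolume c U = 0 := le_antisymm (h1.trans h.le) bot_le
  have hopen : IsOpen (c.target ∩ c.symm ⁻¹' U) := c.isOpen_inter_preimage_symm hU
  have hmem : c x ∈ c.target ∩ c.symm ⁻¹' U :=
    ⟨mem_chart_target _ x, by rw [Set.mem_preimage, c.left_inv (mem_chart_source _ x)]; exact hxU⟩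
  rw [chartVolume_apply hU.measurableSet] at h2
  rw [setLIntegral_eq_zero_iff' hopen.measurableSet ((aemeasurable_volCoeff hc).mono_measure
    (Measure.restrict_mono Set.inter_subset_left le_rfl))] at h2
  refine (hopen.measure_pos volume ⟨_, hmem⟩).ne' (measure_mono_null
    (show _ ⊆ {z | ¬_} from fun z hz hz' => ?_) (ae_iff.1 h2))
  have := ENNReal.ofReal_eq_zero.1 (hz' hz)
  exact absurd (volCoeff_pos hc hz.1) (not_lt.2 this)

theorem isLocallyFiniteMeasure_vol [T2Space M] [SecondCountableTopology M] :
    IsLocallyFiniteMeasure g.vol := by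
  refine ⟨fun x => ?_⟩
  have hc := chart_mem_atlas (Coord n) x
  set c := chartAt (Coord n) x
  have hy : c x ∈ c.target := mem_chart_target _ x
  have hx : x ∈ c.source := mem_chart_source _ x
  obtain ⟨K, hK, hKn, hKt⟩ := exists_compact_subset c.open_target hy
  refine ⟨c.source ∩ c ⁻¹' (interior K), ?_, ?_⟩
  · exact (c.isOpen_inter_preimage isOpen_interior).mem_nhds ⟨hx, hKn⟩
  · have hm : MeasurableSet (c.source ∩ c ⁻¹' (interior K)) :=
      (c.isOpen_inter_preimage isOpen_interior).measurableSet
    have h1 : g.vol (c.source ∩ c ⁻¹' (interior K)) = g.chartVolume c (c.source ∩ c ⁻¹' (interior K)) := by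
      rw [← vol_restrict hc, Measure.restrict_apply hm, Set.inter_eq_left.2 Set.inter_subset_left]
    rw [h1, chartVolume_apply hm]
    obtain ⟨C, hC⟩ := hK.exists_bound_of_continuousOn ((continuousOn_volCoeff (g := g) hc).mono hKt)
    have hsub : c.target ∩ c.symm ⁻¹' (c.source ∩ c ⁻¹' (interior K)) ⊆ K := by
      rintro z ⟨hz, -, hz2⟩
      rw [Set.mem_preimage, c.right_inv hz] at hz2
      exact interior_subset hz2
    refine lt_of_le_of_lt (lintegral_mono_set hsub) ?_
    refine lt_of_le_of_lt (setLIntegral_mono_ae (g := fun _ => ENNReal.ofReal C)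
      aemeasurable_const (.of_forall fun z hz => ENNReal.ofReal_le_ofReal
        ((le_abs_self _).trans (hC z hz)))) ?_
    rw [setLIntegral_const]
    exact ENNReal.mul_lt_top ENNReal.ofReal_lt_top hK.measure_lt_top

end Volume

/-! ### Integration by parts -/

section Parts

variable {n : ℕ}

theorem hasCompactSupport_pd {u : Coord n → ℝ} (hs : HasCompactSupport u) (i : Fin n) :
    HasCompactSupport (pd i u) := by
  refine hs.mono' fun z hz => ?_
  by_contra h
  have h3 : u =ᶠ[𝓝 z] fun _ => 0 := notMem_tsupport_iff_eventuallyEq.1 h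
  exact hz (by rw [pd_congr h3, pd_const])

theorem integral_pd_eq_zero {u : Coord n → ℝ} (hu : ContDiff ℝ ∞ u) (hs : HasCompactSupport u)
    (i : Fin n) : ∫ z, pd i u z = 0 := by
  have h1 : Integrable (pd i u) :=
    (contDiff_pd hu i).continuous.integrable_of_hasCompactSupport (hasCompactSupport_pd hs i)
  have h2 : Integrable fun z => fderiv ℝ u z (Pi.single i 1) := h1
  have h := integral_mul_fderiv_eq_neg_fderiv_mul_of_integrable (μ := volume) (f := fun _ => (1 : ℝ))
    (g := u) (v := Pi.single i 1) (by simp) (by simpa using h2)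
    (by simpa using hu.continuous.integrable_of_hasCompactSupport hs)
    (fun _ _ => differentiableAt_const _) (fun _ _ => (hu.differentiable (by simp)) _)
  simpa [pd] using h

/-- A function with compact support in an open set, extended by zero. -/
theorem indicator_facts {u : Coord n → ℝ} {s K : Set (Coord n)} (hs : IsOpen s)
    (hu : ContDiffOn ℝ ∞ u s) (hK : IsCompact K) (hKs : K ⊆ s) (huK : ∀ z ∈ s, z ∉ K → u z = 0)
    (i : Fin n) : ContDiff ℝ ∞ (s.indicator u) ∧ HasCompactSupport (s.indicator u) ∧
      s.indicator (pd i u) = pd i (s.indicator u) := by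
  have h1 : ∀ z ∉ K, s.indicator u =ᶠ[𝓝 z] fun _ => 0 := fun z hz => by
    filter_upwards [hK.isClosed.isOpen_compl.mem_nhds hz] with w hw
    by_cases hws : w ∈ s
    · rw [Set.indicator_of_mem hws, huK w hws hw]
    · exact Set.indicator_of_notMem hws _
  have h2 : ∀ z ∈ s, s.indicator u =ᶠ[𝓝 z] u := fun z hz => by
    filter_upwards [hs.mem_nhds hz] with w hw using Set.indicator_of_mem hw _
  refine ⟨contDiff_iff_contDiffAt.2 fun z => ?_,
    HasCompactSupport.intro hK fun z hz => (h1 z hz).eq_of_nhds, funext fun z => ?_⟩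
  · by_cases hz : z ∈ s
    · exact (hu.contDiffAt (hs.mem_nhds hz)).congr_of_eventuallyEq (h2 z hz)
    · exact contDiffAt_const.congr_of_eventuallyEq (h1 z fun h => hz (hKs h))
  · by_cases hz : z ∈ s
    · rw [Set.indicator_of_mem hz, pd_congr (h2 z hz)]
    · rw [Set.indicator_of_notMem hz, pd_congr (h1 z fun h => hz (hKs h)), pd_const]

/-- The integral of a derivative of a function with compact support in an open set. -/
theorem setIntegral_pd_eq_zero {u : Coord n → ℝ} {s K : Set (Coord n)} (hs : IsOpen s)
    (hu : ContDiffOn ℝ ∞ u s) (hK : IsCompact K) (hKs : K ⊆ s) (huK : ∀ z ∈ s, z ∉ K → u z = 0)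
    (i : Fin n) : ∫ z in s, pd i u z = 0 := by
  obtain ⟨h1, h2, h3⟩ := indicator_facts hs hu hK hKs huK i
  rw [← integral_indicator hs.measurableSet, h3]
  exact integral_pd_eq_zero h1 h2 i

theorem integrableOn_pd {u : Coord n → ℝ} {s K : Set (Coord n)} (hs : IsOpen s)
    (hu : ContDiffOn ℝ ∞ u s) (hK : IsCompact K) (hKs : K ⊆ s) (huK : ∀ z ∈ s, z ∉ K → u z = 0)
    (i : Fin n) : IntegrableOn (pd i u) s := by
  obtain ⟨h1, h2, h3⟩ := indicator_facts hs hu hK hKs huK i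
  rw [← integrable_indicator_iff hs.measurableSet, h3]
  exact (contDiff_pd h1 i).continuous.integrable_of_hasCompactSupport
    (hasCompactSupport_pd h2 i)

end Parts

end ConformalQuantization
end

noncomputable section

namespace ConformalQuantization

/-! ### Formal adjoints of the quantized symbols -/

section Pairing

variable {n p : ℕ} {M : Type*} [TopologicalSpace M] [ChartedSpace (Coord n) M]
  [IsManifold 𝓘(ℝ, Coord n) ∞ M]
  {g : PseudoRiemannianMetric n M} {c : OpenPartialHomeomorph M (Coord n)}

omit [IsManifold 𝓘(ℝ, Coord n) ∞ M] in
theorem SmoothFun.continuous (f : SmoothFun n M) : Continuous f := f.contMDiff.continuous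

theorem integrable_mul_left [T2Space M] [SecondCountableTopology M] [MeasurableSpace M]
    [BorelSpace M] {f : SmoothFun n M} (hf : HasCompactSupport f) (k : SmoothFun n M) :
    Integrable (fun x => f x * k x) g.vol := by
  have := isLocallyFiniteMeasure_vol (g := g)
  exact (f.continuous.mul k.continuous).integrable_of_hasCompactSupport hf.mul_right

theorem integrable_mul_right [T2Space M] [SecondCountableTopology M] [MeasurableSpace M]
    [BorelSpace M] (f : SmoothFun n M) {k : SmoothFun n M} (hk : HasCompactSupport k) :
    Integrable (fun x => f x * k x) g.vol := by
  simpa only [mul_comm] using integrable_mul_left (g := g) hk f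

/-- A functional on functions with compact support vanishes if it does so locally. -/
theorem functional_eq_zero [T2Space M] {L : SmoothFun n M → ℝ}
    (hadd : ∀ f f' : SmoothFun n M, HasCompactSupport f → HasCompactSupport f' → ∀ t : ℝ,
      L (f + t • f') = L f + t * L f')
    (hloc : ∀ c ∈ atlas (Coord n) M, ∀ f : SmoothFun n M, HasCompactSupport f →
      tsupport f ⊆ c.source → L f = 0) {f : SmoothFun n M} (hf : HasCompactSupport f) :
    L f = 0 := by
  -- The inductive property is a partition-of-unity substitute: a cut-off G equal to 1 on S such
  -- that the functional vanishes on all multiples of G.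
  obtain ⟨G, hG1, -, hG⟩ := IsCompact.induction_on hf (p := fun S => ∃ G : SmoothFun n M,
    (∀ x ∈ S, G x = 1) ∧ HasCompactSupport G ∧ ∀ f : SmoothFun n M, L (f * G) = 0)
    ⟨0, fun x hx => hx.elim, HasCompactSupport.zero, fun f => by
      have := hadd 0 0 HasCompactSupport.zero HasCompactSupport.zero 1
      rw [one_smul, add_zero] at this
      rw [mul_zero]
      linarith⟩
    (fun S S' h ⟨G, h1, h2⟩ => ⟨G, fun x hx => h1 x (h hx), h2⟩)
    (fun S S' ⟨G, h1, h2, h3⟩ ⟨G', h1', h2', h3'⟩ =>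
      -- Inclusion and exclusion: G + G' - GG' is 1 wherever G or G' is, and its multiples split
      -- into multiples of G and of G'.
      ⟨(G + (1 : ℝ) • G') + (-1 : ℝ) • (G * G'), fun x hx => by
        change G x + 1 * G' x + -1 * (G x * G' x) = 1
        rcases hx with hx | hx
        · rw [h1 x hx]; ring
        · rw [h1' x hx]; ring,
       (h2.add (h2'.smul_left (f := fun _ => (1 : ℝ)))).add
        ((h2.mul_right (f' := G')).smul_left (f := fun _ => (-1 : ℝ))), fun f => by
        have e1 : f * ((G + (1 : ℝ) • G') + (-1 : ℝ) • (G * G'))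
            = (f * G + (1 : ℝ) • (f * G')) + (-1 : ℝ) • (f * G * G') := by
          ext x
          change f x * (G x + 1 * G' x + -1 * (G x * G' x))
            = f x * G x + 1 * (f x * G' x) + -1 * (f x * G x * G' x)
          ring
        rw [e1, hadd _ _ _ _, hadd _ _ _ _, h3, h3', h3']
        · ring
        · exact h2.mul_left
        · exact h2'.mul_left
        · exact (h2.mul_left (f := f)).add
            ((h2'.mul_left (f := f)).smul_left (f := fun _ => (1 : ℝ)))
        · exact h2'.mul_left⟩)
    (fun x hx => by
      have hc := chart_mem_atlas (Coord n) x
      set c := chartAt (Coord n) x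
      have hxs : x ∈ c.source := mem_chart_source _ x
      obtain ⟨F, hF, hF2, hF3⟩ := exists_smoothFun_germ hc (c.map_source hxs) Filter.univ_mem
        (u := fun _ => (1 : ℝ)) contDiffOn_const
      refine ⟨{z | F z = 1}, mem_nhdsWithin_of_mem_nhds ?_, F, fun z hz => hz, hF2,
        fun f => hloc c hc _ hF2.mul_left
          ((tsupport_mul_subset_right.trans hF3).trans Set.inter_subset_left)⟩
      filter_upwards [(c.continuousAt hxs).eventually hF, c.open_source.mem_nhds hxs] with z h1 h2
      rwa [c.left_inv h2] at h1)
  have h1 : f * G = f := by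
    ext x
    change f x * G x = f x
    by_cases hx : x ∈ tsupport f
    · rw [hG1 x hx, mul_one]
    · rw [image_eq_zero_of_notMem_tsupport hx, zero_mul]
  rw [← h1]
  exact hG f

omit [IsManifold 𝓘(ℝ, Coord n) ∞ M] in
theorem divergence_smul (hn : 0 < n) (hg : g.IsConformallyFlat p) (hc : c ∈ atlas (Coord n) M)
    {y : Coord n} (hy : y ∈ c.target) {u : Coord n → ℝ} {Z : Coord n → Coord n}
    (hu : DifferentiableAt ℝ u y) (hZ : ∀ i, DifferentiableAt ℝ (fun z => Z z i) y) :
    divergence (g.coeff c) (fun z i => u z * Z z i) y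
      = u y * divergence (g.coeff c) Z y + ∑ i, Z y i * pd i u y := by
  obtain ⟨σ, hσ⟩ := exists_conformalFactor hn hg hc hy
  rw [hσ.divergence_eq hZ, hσ.divergence_eq fun i => hu.fun_mul (hZ i)]
  have : ∀ i, pd i (fun z => u z * Z z i) y = _ := fun i => pd_mul hu (hZ i) i
  simp only [this, Finset.sum_add_distrib, mul_assoc, ← Finset.mul_sum]
  ring

omit [IsManifold 𝓘(ℝ, Coord n) ∞ M] in
theorem divergence_sub (hn : 0 < n) (hg : g.IsConformallyFlat p) (hc : c ∈ atlas (Coord n) M)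
    {y : Coord n} (hy : y ∈ c.target) {Z W : Coord n → Coord n}
    (hZ : ∀ i, DifferentiableAt ℝ (fun z => Z z i) y)
    (hW : ∀ i, DifferentiableAt ℝ (fun z => W z i) y) :
    divergence (g.coeff c) (fun z i => Z z i - W z i) y
      = divergence (g.coeff c) Z y - divergence (g.coeff c) W y := by
  obtain ⟨σ, hσ⟩ := exists_conformalFactor hn hg hc hy
  rw [hσ.divergence_eq hZ, hσ.divergence_eq hW, hσ.divergence_eq fun i => (hZ i).fun_sub (hW i)]
  have : ∀ i, pd i (fun z => Z z i - W z i) y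
      = pd i (fun z => Z z i) y - pd i (fun z => W z i) y := fun i => by
    unfold pd
    rw [fderiv_fun_sub (hZ i) (hW i)]
    rfl
  simp only [this, Finset.sum_sub_distrib, sub_mul]
  ring

/-- The integral of the divergence of a vector field with compact support in a chart. -/
theorem setIntegral_divergence_eq_zero (hn : 0 < n) (hg : g.IsConformallyFlat p)
    (hc : c ∈ atlas (Coord n) M) {Z : Coord n → Coord n}
    (hZ : ∀ y ∈ c.target, ∀ i, ContDiffAt ℝ ∞ (fun z => Z z i) y) {K : Set (Coord n)}
    (hK : IsCompact K) (hKc : K ⊆ c.target) (hZK : ∀ z ∈ c.target, z ∉ K → Z z = 0) :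
    ∫ z in c.target, volCoeff (g.coeff c) z * divergence (g.coeff c) Z z = 0 := by
  have h1 : ∀ z ∈ c.target, volCoeff (g.coeff c) z * divergence (g.coeff c) Z z
      = ∑ i, pd i (fun z => volCoeff (g.coeff c) z * Z z i) z := fun z hz => by
    rw [divergence, mul_div_cancel₀ _ (volCoeff_pos hc hz).ne']
  have h2 : ∀ i, ContDiffOn ℝ ∞ (fun z => volCoeff (g.coeff c) z * Z z i) c.target :=
    fun i y hy => by
      obtain ⟨σ, hσ⟩ := exists_conformalFactor hn hg hc hy
      exact (((contDiff_coe _).contDiffAt.congr_of_eventuallyEq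
        hσ.volCoeff_eventuallyEq).mul (hZ y hy i)).contDiffWithinAt
  have h3 : ∀ i, ∀ z ∈ c.target, z ∉ K → volCoeff (g.coeff c) z * Z z i = 0 :=
    fun i z hz hzK => by rw [hZK z hz hzK]; simp
  rw [setIntegral_congr_fun c.open_target.measurableSet h1, integral_finsetSum]
  · exact Finset.sum_eq_zero fun i _ =>
      setIntegral_pd_eq_zero c.open_target (h2 i) hK hKc (h3 i) i
  · exact fun i _ => integrableOn_pd c.open_target (h2 i) hK hKc (h3 i) i

variable {a b l : ℝ} {hn : 0 < n} {hg : g.IsConformallyFlat p} {hU : IsChartIndependent g p a b l}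

theorem quantLin_local (P : Symbol n M) {f : SmoothFun n M} {x : M}
    (h : ∀ᶠ z in 𝓝 x, f z = 0) : quantLin hn hg hU P f x = 0 := by
  have hc := chart_mem_atlas (Coord n) x
  have hx := mem_chart_source (Coord n) x
  set c := chartAt (Coord n) x
  have h1 : ∀ᶠ z in 𝓝 (c x), f (c.symm z) = 0 := by
    have := c.continuousAt_symm (c.map_source hx)
    rw [ContinuousAt, c.left_inv hx] at this
    exact this h
  have h2 : ∀ᶠ z in 𝓝 (c x), ∀ i, pd i (fun w => f (c.symm w)) z = 0 := by
    filter_upwards [eventually_eventually_nhds.2 h1] with z hz i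
    rw [pd_congr (v := fun _ => (0 : ℝ)) hz, pd_const]
  have h3 : divergence (g.coeff c) (flux c P f) (c x) = 0 := by
    rw [divergence, Finset.sum_eq_zero, zero_div]
    intro i _
    rw [pd_congr (v := fun _ => (0 : ℝ)), pd_const]
    filter_upwards [h2] with z hz
    simp [flux, hz]
  rw [quantLin_apply P f hc hx, chartQuant_eq, h3, h1.self_of_nhds]
  simp [h2.self_of_nhds]

variable [T2Space M] [SecondCountableTopology M] [MeasurableSpace M] [BorelSpace M]

omit [T2Space M] in
theorem integral_eq_zero_of_divergence (hn : 0 < n) (hg : g.IsConformallyFlat p)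
    (hc : c ∈ atlas (Coord n) M) {φ : SmoothFun n M} {S : Set M} (hS : IsCompact S)
    (hSc : S ⊆ c.source) (hφ : ∀ x ∉ S, φ x = 0) {Z : Coord n → Coord n}
    (hZ : ∀ y ∈ c.target, ∀ i, ContDiffAt ℝ ∞ (fun z => Z z i) y)
    (hZS : ∀ z ∈ c.target, c.symm z ∉ S → Z z = 0)
    (h : ∀ z ∈ c.target, φ (c.symm z) = divergence (g.coeff c) Z z) : ∫ x, φ x ∂g.vol = 0 := by
  rw [integral_vol hc φ.continuous fun x hx => hφ x fun h => hx (hSc h),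
    setIntegral_congr_fun c.open_target.measurableSet fun z hz => by rw [h z hz]]
  refine setIntegral_divergence_eq_zero hn hg hc hZ
    (hS.image_of_continuousOn (c.continuousOn.mono hSc)) ?_ fun z hz hzS => hZS z hz fun h => ?_
  · rintro _ ⟨x, hx, rfl⟩
    exact c.map_source (hSc hx)
  · exact hzS ⟨_, h, c.right_inv hz⟩

/-- In divergence form the operator is div(P₂ d·) plus a multiplication. The multiplication cancels
in the difference, and Green's identity treats the rest. -/
theorem integral_quantLin_two {P : Symbol n M} (h1 : P.1.2.1 = 0) {f : SmoothFun n M}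
    (hf : HasCompactSupport f) (k : SmoothFun n M) :
    ∫ x, (f x * quantLin hn hg hU P k x - quantLin hn hg hU P f x * k x) ∂g.vol = 0 := by
  set T := quantLin hn hg hU P with hT
  have hTs : ∀ f : SmoothFun n M, HasCompactSupport f → HasCompactSupport (T f) := fun f hf =>
    HasCompactSupport.intro hf fun x hx =>
      quantLin_local P (notMem_tsupport_iff_eventuallyEq.1 hx)
  refine functional_eq_zero (L := fun f => ∫ x, (f x * T k x - T f x * k x) ∂g.vol) ?_ ?_ hf
  · intro f f' hf hf' t
    have i1 := (integrable_mul_left (g := g) hf (T k)).sub (integrable_mul_left (hTs f hf) k)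
    have i2 := (integrable_mul_left (g := g) hf' (T k)).sub (integrable_mul_left (hTs f' hf') k)
    rw [← integral_const_mul]
    refine Eq.trans (integral_congr_ae (.of_forall fun x => ?_)) (integral_add i1 (i2.const_mul t))
    beta_reduce
    rw [map_add, map_smul]
    change (f x + t * f' x) * T k x - (T f x + t * T f' x) * k x
      = (f x * T k x - T f x * k x) + t * (f' x * T k x - T f' x * k x)
    ring
  · intro c hc f hf hfc
    have hs : ∀ (f : SmoothFun n M) {y}, y ∈ c.target →
      ContDiffAt ℝ ∞ (fun z => f (c.symm z)) y := fun f y hy =>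
        contDiffAt_comp_symm f.contMDiff hc hy
    have hfl : ∀ (f : SmoothFun n M) {y}, y ∈ c.target → ∀ i,
      ContDiffAt ℝ ∞ (fun z => flux c P f z i) y := fun f y hy i => contDiffAt_flux P f hc hy i
    -- The field of Green's second identity. By the symmetry of P₂ the products of first derivatives
    -- cancel in its divergence.
    refine integral_eq_zero_of_divergence (φ := f * T k - T f * k) hn hg hc hf hfc
      (fun x hx => ?_) (Z := fun z i => f (c.symm z) * flux c P k z i
        - k (c.symm z) * flux c P f z i)
      (fun y hy i => ((hs f hy).mul (hfl k hy i)).sub ((hs k hy).mul (hfl f hy i)))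
      (fun z hz hzS => ?_) fun z hz => ?_
    · change f x * T k x - T f x * k x = 0
      rw [image_eq_zero_of_notMem_tsupport hx,
        hT, quantLin_local P (notMem_tsupport_iff_eventuallyEq.1 hx)]
      ring
    · have h2 : differential f (c.symm z) = 0 := by
        have h3 : f =ᶠ[𝓝 (c.symm z)] (0 : SmoothFun n M) :=
          notMem_tsupport_iff_eventuallyEq.1 hzS
        rw [differential_congr h3]
        simpa using differential_smul 0 (0 : SmoothFun n M) (c.symm z)
      have h3 : ∀ j, pd j (fun w => f (c.symm w)) z = 0 := fun j => by
        have := differential_apply f hc (c.map_target hz) j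
        rw [c.right_inv hz, h2] at this
        exact this.symm
      funext i
      rw [image_eq_zero_of_notMem_tsupport hzS]
      simp [flux, h3]
    · have hd : ∀ {u : Coord n → ℝ}, ContDiffAt ℝ ∞ u z → DifferentiableAt ℝ u z :=
        fun h => h.differentiableAt (by simp)
      have h0 : ∀ f, T f (c.symm z) = chartQuant g p a b l c P f z := fun f => by
        rw [hT, quantLin_apply P f hc (c.map_target hz), c.right_inv hz]
      have h4 : P.comp1 c = fun _ _ => 0 := by funext z i; simp [Symbol.comp1, h1]
      rw [divergence_sub hn hg hc hz (fun i => (hd (hs f hz)).fun_mul (hd (hfl k hz i)))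
        (fun i => (hd (hs k hz)).fun_mul (hd (hfl f hz i))),
        divergence_smul hn hg hc hz (hd (hs f hz)) (fun i => hd (hfl k hz i)),
        divergence_smul hn hg hc hz (hd (hs k hz)) (fun i => hd (hfl f hz i))]
      change f (c.symm z) * T k (c.symm z) - T f (c.symm z) * k (c.symm z) = _
      rw [h0, h0, chartQuant_eq, chartQuant_eq, h4, divergence_zero]
      have h5 : ∑ i, flux c P k z i * pd i (fun z => f (c.symm z)) z
          = ∑ i, flux c P f z i * pd i (fun z => k (c.symm z)) z := by
        simp only [flux, Finset.sum_mul]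
        rw [Finset.sum_comm]
        refine Finset.sum_congr rfl fun i _ => Finset.sum_congr rfl fun j _ => ?_
        rw [show P.comp2 c z j i = P.comp2 c z i j from P.2.1 _ _ _]
        ring
      rw [h5]
      simp only [zero_mul, Finset.sum_const_zero]
      ring

/-- With the half divergence, f T k + T f k is exactly the divergence of f k P₁; this fixes the
coefficient 1/2. -/
theorem integral_quantLin_one {P : Symbol n M} (h2 : P.1.1 = 0) (h0 : P.1.2.2 = 0)
    {f : SmoothFun n M} (hf : HasCompactSupport f) (k : SmoothFun n M) :
    ∫ x, (f x * quantLin hn hg hU P k x + quantLin hn hg hU P f x * k x) ∂g.vol = 0 := by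
  set T := quantLin hn hg hU P with hT
  have hTs : ∀ f : SmoothFun n M, HasCompactSupport f → HasCompactSupport (T f) := fun f hf =>
    HasCompactSupport.intro hf fun x hx =>
      quantLin_local P (notMem_tsupport_iff_eventuallyEq.1 hx)
  refine functional_eq_zero (L := fun f => ∫ x, (f x * T k x + T f x * k x) ∂g.vol) ?_ ?_ hf
  · intro f f' hf hf' t
    have i1 := (integrable_mul_left (g := g) hf (T k)).add (integrable_mul_left (hTs f hf) k)
    have i2 := (integrable_mul_left (g := g) hf' (T k)).add (integrable_mul_left (hTs f' hf') k)
    rw [← integral_const_mul]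
    refine Eq.trans (integral_congr_ae (.of_forall fun x => ?_)) (integral_add i1 (i2.const_mul t))
    beta_reduce
    rw [map_add, map_smul]
    change (f x + t * f' x) * T k x + (T f x + t * T f' x) * k x
      = (f x * T k x + T f x * k x) + t * (f' x * T k x + T f' x * k x)
    ring
  · intro c hc f hf hfc
    have hs : ∀ (f : SmoothFun n M) {y}, y ∈ c.target →
      ContDiffAt ℝ ∞ (fun z => f (c.symm z)) y := fun f y hy =>
        contDiffAt_comp_symm f.contMDiff hc hy
    refine integral_eq_zero_of_divergence (φ := f * T k + T f * k) hn hg hc hf hfc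
      (fun x hx => ?_) (Z := fun z i => (f (c.symm z) * k (c.symm z)) * P.comp1 c z i)
      (fun y hy i => ((hs f hy).mul (hs k hy)).mul (contDiffAt_comp1 P hc hy i))
      (fun z hz hzS => ?_) fun z hz => ?_
    · change f x * T k x + T f x * k x = 0
      rw [image_eq_zero_of_notMem_tsupport hx,
        hT, quantLin_local P (notMem_tsupport_iff_eventuallyEq.1 hx)]
      ring
    · funext i
      rw [image_eq_zero_of_notMem_tsupport hzS]
      simp
    · have hd : ∀ {u : Coord n → ℝ}, ContDiffAt ℝ ∞ u z → DifferentiableAt ℝ u z :=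
        fun h => h.differentiableAt (by simp)
      have h3 : ∀ f, flux c P f = fun _ _ => 0 := fun f => by
        funext z i
        simp [flux, Symbol.comp2, h2]
      have h4 : chartPot g p a b l c P z = 0 := by
        have h5 : P.part2 = 0 := Subtype.ext (Prod.ext h2 rfl)
        rw [chartPot_eq, h5]
        exact chartQuant_zero hn hg hc hz a b l 1
      have h6 : P.comp0 c z = 0 := by simp [Symbol.comp0, h0]
      have hQ : ∀ f, T f (c.symm z) = ∑ i, P.comp1 c z i * pd i (fun x => f (c.symm x)) z
          + 1 / 2 * divergence (g.coeff c) (P.comp1 c) z * f (c.symm z) := fun f => by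
        rw [hT, quantLin_apply P f hc (c.map_target hz), c.right_inv hz, chartQuant_eq, h3,
          divergence_zero, h4, h6]
        ring
      rw [divergence_smul hn hg hc hz ((hd (hs f hz)).fun_mul (hd (hs k hz)))
        (fun i => hd (contDiffAt_comp1 P hc hz i))]
      change f (c.symm z) * T k (c.symm z) + T f (c.symm z) * k (c.symm z) = _
      rw [hQ, hQ]
      have h7 : ∀ i, pd i (fun z => f (c.symm z) * k (c.symm z)) z = _ := fun i =>
        pd_mul (hd (hs f hz)) (hd (hs k hz)) i
      simp only [h7, mul_add, Finset.sum_add_distrib, mul_left_comm _ (f (c.symm z)),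
        mul_left_comm _ (k (c.symm z)), ← Finset.mul_sum]
      ring

end Pairing

end ConformalQuantization
end

noncomputable section

namespace ConformalQuantization

/-! ### Symmetric quantizations in terms of real operators -/

theorem integral_complex_combination {α : Type*} [MeasurableSpace α] {μ : Measure α}
    (s t : ℝ) {u₁ u₂ u₃ u₄ v₁ v₂ v₃ v₄ : α → ℝ} (h₁ : Integrable u₁ μ) (h₂ : Integrable u₂ μ)
    (h₃ : Integrable u₃ μ) (h₄ : Integrable u₄ μ) (k₁ : Integrable v₁ μ) (k₂ : Integrable v₂ μ)
    (k₃ : Integrable v₃ μ) (k₄ : Integrable v₄ μ) :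
    ∫ x, (((s * (u₁ x + u₂ x) + t * (u₃ x - u₄ x) : ℝ) : ℂ)
        + Complex.I * ((s * (v₁ x - v₂ x) + t * (v₃ x + v₄ x) : ℝ) : ℂ)) ∂μ
      = ((s * ((∫ x, u₁ x ∂μ) + ∫ x, u₂ x ∂μ) + t * ((∫ x, u₃ x ∂μ) - ∫ x, u₄ x ∂μ) : ℝ) : ℂ)
        + Complex.I
          * ((s * ((∫ x, v₁ x ∂μ) - ∫ x, v₂ x ∂μ) + t * ((∫ x, v₃ x ∂μ) + ∫ x, v₄ x ∂μ) : ℝ) : ℂ) := by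
  have hu : Integrable (fun x => s * (u₁ x + u₂ x) + t * (u₃ x - u₄ x)) μ :=
    ((h₁.add h₂).const_mul s).add ((h₃.sub h₄).const_mul t)
  have hv : Integrable (fun x => s * (v₁ x - v₂ x) + t * (v₃ x + v₄ x)) μ :=
    ((k₁.sub k₂).const_mul s).add ((k₃.add k₄).const_mul t)
  have hu' : ∫ x, (s * (u₁ x + u₂ x) + t * (u₃ x - u₄ x)) ∂μ
      = s * ((∫ x, u₁ x ∂μ) + ∫ x, u₂ x ∂μ) + t * ((∫ x, u₃ x ∂μ) - ∫ x, u₄ x ∂μ) := by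
    rw [← integral_add h₁ h₂, ← integral_sub h₃ h₄, ← integral_const_mul, ← integral_const_mul]
    exact integral_add ((h₁.add h₂).const_mul s) ((h₃.sub h₄).const_mul t)
  have hv' : ∫ x, (s * (v₁ x - v₂ x) + t * (v₃ x + v₄ x)) ∂μ
      = s * ((∫ x, v₁ x ∂μ) - ∫ x, v₂ x ∂μ) + t * ((∫ x, v₃ x ∂μ) + ∫ x, v₄ x ∂μ) := by
    rw [← integral_sub k₁ k₂, ← integral_add k₃ k₄, ← integral_const_mul, ← integral_const_mul]
    exact integral_add ((k₁.sub k₂).const_mul s) ((k₃.add k₄).const_mul t)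
  rw [← hu', ← hv', ← integral_complex_ofReal, ← integral_complex_ofReal, ← integral_const_mul]
  exact integral_add hu.ofReal (hv.ofReal.const_mul _)

section Symmetric

variable {n : ℕ} {M : Type*} [TopologicalSpace M] [ChartedSpace (Coord n) M]
  [IsManifold 𝓘(ℝ, Coord n) ∞ M] [T2Space M] [SecondCountableTopology M] [MeasurableSpace M]
  [BorelSpace M] {g : PseudoRiemannianMetric n M}

/-- A real operator is formally self-adjoint for the pairing by integration. -/
def IsSelfAdjointOp (g : PseudoRiemannianMetric n M) (T : Module.End ℝ (SmoothFun n M)) : Prop :=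
  ∀ f k : SmoothFun n M, HasCompactSupport f → HasCompactSupport k →
    ∫ x, (f * T k - T f * k) x ∂g.vol = 0

/-- A real operator is formally skew-adjoint for the pairing by integration. -/
def IsSkewAdjointOp (g : PseudoRiemannianMetric n M) (T : Module.End ℝ (SmoothFun n M)) : Prop :=
  ∀ f k : SmoothFun n M, HasCompactSupport f → HasCompactSupport k →
    ∫ x, (f * T k + T f * k) x ∂g.vol = 0

theorem integrable_selfAdjoint (g : PseudoRiemannianMetric n M) (T : Module.End ℝ (SmoothFun n M))
    {f k : SmoothFun n M} (hf : HasCompactSupport f) (hk : HasCompactSupport k) :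
    Integrable (f * T k - T f * k) g.vol :=
  (integrable_mul_left (g := g) hf (T k)).sub (integrable_mul_right (g := g) (T f) hk)

theorem integrable_skewAdjoint (g : PseudoRiemannianMetric n M) (T : Module.End ℝ (SmoothFun n M))
    {f k : SmoothFun n M} (hf : HasCompactSupport f) (hk : HasCompactSupport k) :
    Integrable (f * T k + T f * k) g.vol :=
  (integrable_mul_left (g := g) hf (T k)).add (integrable_mul_right (g := g) (T f) hk)

theorem IsSelfAdjointOp.sub {S T : Module.End ℝ (SmoothFun n M)} (hS : IsSelfAdjointOp g S)
    (hT : IsSelfAdjointOp g T) : IsSelfAdjointOp g (S - T) := fun f k hf hk => by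
  have h := integral_sub (integrable_selfAdjoint g S hf hk) (integrable_selfAdjoint g T hf hk)
  rw [hS f k hf hk, hT f k hf hk, sub_zero] at h
  rw [← h]
  refine integral_congr_ae (.of_forall fun x => ?_)
  change f x * (S k x - T k x) - (S f x - T f x) * k x
    = (f x * S k x - S f x * k x) - (f x * T k x - T f x * k x)
  ring

theorem IsSkewAdjointOp.sub {S T : Module.End ℝ (SmoothFun n M)} (hS : IsSkewAdjointOp g S)
    (hT : IsSkewAdjointOp g T) : IsSkewAdjointOp g (S - T) := fun f k hf hk => by
  have h := integral_sub (integrable_skewAdjoint g S hf hk) (integrable_skewAdjoint g T hf hk)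
  rw [hS f k hf hk, hT f k hf hk, sub_zero] at h
  rw [← h]
  refine integral_congr_ae (.of_forall fun x => ?_)
  change f x * (S k x - T k x) + (S f x - T f x) * k x
    = (f x * S k x + S f x * k x) - (f x * T k x + T f x * k x)
  ring

/-- A real function as a complex function. -/
def ofRealFun (f : SmoothFun n M) : SmoothFunC n M :=
  ⟨fun x => (f x : ℂ), (Complex.ofRealCLM.contDiff (n := ∞)).contMDiff.comp f.contMDiff⟩

omit [IsManifold 𝓘(ℝ, Coord n) ∞ M] [T2Space M] [SecondCountableTopology M] [MeasurableSpace M]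
  [BorelSpace M] in
theorem rePart_ofRealFun (f : SmoothFun n M) : rePart (ofRealFun f) = f := by
  ext x; exact Complex.ofReal_re (f x)

omit [IsManifold 𝓘(ℝ, Coord n) ∞ M] [T2Space M] [SecondCountableTopology M] [MeasurableSpace M]
  [BorelSpace M] in
theorem imPart_ofRealFun (f : SmoothFun n M) : imPart (ofRealFun f) = 0 := by
  ext x; exact Complex.ofReal_im (f x)

variable {Q : QuantizationMap n M}

omit [IsManifold 𝓘(ℝ, Coord n) ∞ M] [T2Space M] [SecondCountableTopology M] [MeasurableSpace M]
  [BorelSpace M] in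
-- The degree-zero part is multiplication by a real function and drops out. The factor (iħ)² is real
-- and pairs with the self-adjoint defect of Q(P₂), while iħ is imaginary and pairs with the
-- skew-adjoint defect of Q(P₁).
theorem quantize_pairing (hQ : Q.PreservesPrincipalSymbol) (h : ℝ) (P : Symbol n M)
    (φ ψ : SmoothFunC n M) (x : M) :
    conj (φ x) * Q.quantize h P ψ x - conj (Q.quantize h P φ x) * ψ x
      = ((-h ^ 2 * ((rePart φ * Q.op P.part2 (rePart ψ) - Q.op P.part2 (rePart φ) * rePart ψ) x
          + (imPart φ * Q.op P.part2 (imPart ψ) - Q.op P.part2 (imPart φ) * imPart ψ) x)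
        + h * ((imPart φ * Q.op P.part1 (rePart ψ) + Q.op P.part1 (imPart φ) * rePart ψ) x
          - (rePart φ * Q.op P.part1 (imPart ψ) + Q.op P.part1 (rePart φ) * imPart ψ) x) : ℝ) : ℂ)
      + Complex.I
        * ((-h ^ 2 * ((rePart φ * Q.op P.part2 (imPart ψ) - Q.op P.part2 (rePart φ) * imPart ψ) x
          - (imPart φ * Q.op P.part2 (rePart ψ) - Q.op P.part2 (imPart φ) * rePart ψ) x)
        + h * ((rePart φ * Q.op P.part1 (rePart ψ) + Q.op P.part1 (rePart φ) * rePart ψ) x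
          + (imPart φ * Q.op P.part1 (imPart ψ) + Q.op P.part1 (imPart φ) * imPart ψ) x)
          : ℝ) : ℂ) := by
  have h0 : ∀ u, Q.op P.part0 u x = P.1.2.2 x * u x := fun u => (hQ P.part0).2.2 rfl rfl u x
  have hm : ∀ u v : SmoothFun n M, (u * v) x = u x * v x := fun _ _ => rfl
  have ha : ∀ u v : SmoothFun n M, (u + v) x = u x + v x := fun _ _ => rfl
  have hs : ∀ u v : SmoothFun n M, (u - v) x = u x - v x := fun _ _ => rfl
  have hφ : φ x = (rePart φ x : ℂ) + Complex.I * (imPart φ x : ℂ) := by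
    rw [mul_comm]; exact (Complex.re_add_im (φ x)).symm
  have hψ : ψ x = (rePart ψ x : ℂ) + Complex.I * (imPart ψ x : ℂ) := by
    rw [mul_comm]; exact (Complex.re_add_im (ψ x)).symm
  rw [hφ, hψ]
  simp only [QuantizationMap.quantize, complexify, h0, hm, ha, hs, map_add, map_mul, map_pow,
    Complex.conj_I, Complex.conj_ofReal]
  push_cast
  -- All terms are only moved to one side, so that after normalization the powers of the imaginary
  -- unit can be replaced by their values.
  linear_combination (norm := skip) (0 : ℂ) * Complex.I_sq
  ring_nf
  simp only [Complex.I_sq, show Complex.I ^ 3 = -Complex.I by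
    rw [pow_succ, Complex.I_sq]; ring, Complex.I_pow_four]
  ring

theorem integrable_quantize (Q : QuantizationMap n M) (h : ℝ) (P : Symbol n M)
    {φ : SmoothFunC n M} (ψ : SmoothFunC n M) (hφ : HasCompactSupport φ) :
    Integrable (fun x => conj (φ x) * Q.quantize h P ψ x) g.vol ∧
      Integrable (fun x => conj (Q.quantize h P ψ x) * φ x) g.vol := by
  have := isLocallyFiniteMeasure_vol (g := g)
  have h1 : Continuous (Q.quantize h P ψ) := by
    unfold QuantizationMap.quantize complexify
    have hc : ∀ T : SmoothFun n M, Continuous fun x => ((T x : ℝ) : ℂ) := fun T =>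
      Complex.continuous_ofReal.comp T.continuous
    exact ((continuous_const.mul ((hc _).add (continuous_const.mul (hc _)))).add
      (continuous_const.mul ((hc _).add (continuous_const.mul (hc _))))).add
      ((hc _).add (continuous_const.mul (hc _)))
  have h2 : Continuous φ := φ.contMDiff.continuous
  have h3 : HasCompactSupport fun x => conj (φ x) := hφ.comp_left (map_zero _)
  exact ⟨((Complex.continuous_conj.comp h2).mul h1).integrable_of_hasCompactSupport h3.mul_right,
    ((Complex.continuous_conj.comp h1).mul h2).integrable_of_hasCompactSupport hφ.mul_left⟩

/-- A quantization is symmetric if and only if it maps symbols of degree two to self-adjoint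
operators and symbols of degree one to skew-adjoint ones. -/
theorem isSymmetric_iff (hQ : Q.PreservesPrincipalSymbol) {h : ℝ} (hh : h ≠ 0) :
    Q.IsSymmetric g h ↔ ∀ P : Symbol n M,
      IsSelfAdjointOp g (Q.op P.part2) ∧ IsSkewAdjointOp g (Q.op P.part1) := by
  have hre : ∀ {φ : SmoothFunC n M}, HasCompactSupport φ → HasCompactSupport (rePart φ) :=
    fun hφ => hφ.comp_left Complex.zero_re
  have him : ∀ {φ : SmoothFunC n M}, HasCompactSupport φ → HasCompactSupport (imPart φ) :=
    fun hφ => hφ.comp_left Complex.zero_im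
  have key : ∀ (P : Symbol n M) {φ ψ : SmoothFunC n M}, HasCompactSupport φ →
      HasCompactSupport ψ →
      (∫ x, conj (φ x) * Q.quantize h P ψ x ∂g.vol) - ∫ x, conj (Q.quantize h P φ x) * ψ x ∂g.vol
      = ((-h ^ 2 *
          ((∫ x, (rePart φ * Q.op P.part2 (rePart ψ) - Q.op P.part2 (rePart φ) * rePart ψ) x ∂g.vol)
          + ∫ x, (imPart φ * Q.op P.part2 (imPart ψ) - Q.op P.part2 (imPart φ) * imPart ψ) x ∂g.vol)
        + h *
          ((∫ x, (imPart φ * Q.op P.part1 (rePart ψ) + Q.op P.part1 (imPart φ) * rePart ψ) x ∂g.vol)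
          - ∫ x, (rePart φ * Q.op P.part1 (imPart ψ) + Q.op P.part1 (rePart φ) * imPart ψ) x ∂g.vol)
          : ℝ) : ℂ)
      + Complex.I * ((-h ^ 2 *
          ((∫ x, (rePart φ * Q.op P.part2 (imPart ψ) - Q.op P.part2 (rePart φ) * imPart ψ) x ∂g.vol)
          - ∫ x, (imPart φ * Q.op P.part2 (rePart ψ) - Q.op P.part2 (imPart φ) * rePart ψ) x ∂g.vol)
        + h *
          ((∫ x, (rePart φ * Q.op P.part1 (rePart ψ) + Q.op P.part1 (rePart φ) * rePart ψ) x ∂g.vol)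
          + ∫ x, (imPart φ * Q.op P.part1 (imPart ψ) + Q.op P.part1 (imPart φ) * imPart ψ) x ∂g.vol)
          : ℝ) : ℂ) := by
    intro P φ ψ hφ hψ
    have a11 := integrable_selfAdjoint g (Q.op P.part2) (hre hφ) (hre hψ)
    have a12 := integrable_selfAdjoint g (Q.op P.part2) (hre hφ) (him hψ)
    have a21 := integrable_selfAdjoint g (Q.op P.part2) (him hφ) (hre hψ)
    have a22 := integrable_selfAdjoint g (Q.op P.part2) (him hφ) (him hψ)
    have b11 := integrable_skewAdjoint g (Q.op P.part1) (hre hφ) (hre hψ)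
    have b12 := integrable_skewAdjoint g (Q.op P.part1) (hre hφ) (him hψ)
    have b21 := integrable_skewAdjoint g (Q.op P.part1) (him hφ) (hre hψ)
    have b22 := integrable_skewAdjoint g (Q.op P.part1) (him hφ) (him hψ)
    rw [← integral_sub (integrable_quantize Q h P ψ hφ).1 (integrable_quantize Q h P φ hψ).2]
    simp_rw [quantize_pairing hQ]
    exact integral_complex_combination (-h ^ 2) h a11 a22 b21 b12 a12 a21 b11 b22
  constructor
  · intro hs P
    -- For real test functions the real part of the pairing contains only degree two and the
    -- imaginary part only degree one. Both can be divided by their powers of ħ because ħ is not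
    -- zero.
    have h1 : ∀ f k : SmoothFun n M, HasCompactSupport f → HasCompactSupport k →
        (∫ x, (f * Q.op P.part2 k - Q.op P.part2 f * k) x ∂g.vol) = 0 ∧
        (∫ x, (f * Q.op P.part1 k + Q.op P.part1 f * k) x ∂g.vol) = 0 := by
      intro f k hf hk
      have hf' : HasCompactSupport (ofRealFun f) :=
        HasCompactSupport.comp_left (g := fun r : ℝ => (r : ℂ)) hf Complex.ofReal_zero
      have hk' : HasCompactSupport (ofRealFun k) :=
        HasCompactSupport.comp_left (g := fun r : ℝ => (r : ℂ)) hk Complex.ofReal_zero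
      have h2 := key P hf' hk'
      rw [hs P _ _ hf' hk', sub_self] at h2
      simp only [rePart_ofRealFun, imPart_ofRealFun, map_zero, mul_zero, zero_mul, sub_zero,
        add_zero] at h2
      have hz : ∀ x, (0 : SmoothFun n M) x = 0 := fun _ => rfl
      simp only [hz, integral_zero] at h2
      have h3 := congrArg Complex.re h2
      have h4 := congrArg Complex.im h2
      simp only [add_zero, sub_zero, mul_zero, zero_add, Complex.add_re, Complex.add_im,
        Complex.mul_re, Complex.mul_im, Complex.I_re, Complex.I_im, Complex.ofReal_re,
        Complex.ofReal_im, zero_mul, one_mul, Complex.zero_re, Complex.zero_im] at h3 h4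
      constructor
      · have : -h ^ 2 ≠ 0 := neg_ne_zero.2 (pow_ne_zero 2 hh)
        exact (mul_eq_zero.1 h3.symm).resolve_left this
      · exact (mul_eq_zero.1 h4.symm).resolve_left hh
    exact ⟨fun f k hf hk => (h1 f k hf hk).1, fun f k hf hk => (h1 f k hf hk).2⟩
  · intro hs P φ ψ hφ hψ
    obtain ⟨ha, hb⟩ := hs P
    rw [← sub_eq_zero, key P hφ hψ, ha _ _ (hre hφ) (hre hψ), ha _ _ (hre hφ) (him hψ),
      ha _ _ (him hφ) (hre hψ), ha _ _ (him hφ) (him hψ), hb _ _ (hre hφ) (hre hψ),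
      hb _ _ (hre hφ) (him hψ), hb _ _ (him hφ) (hre hψ), hb _ _ (him hφ) (him hψ)]
    simp

end Symmetric

/-! ### Existence of symmetric conformal isomorphisms -/

section Existence

variable {n p : ℕ} {M : Type*} [TopologicalSpace M] [ChartedSpace (Coord n) M]
  [IsManifold 𝓘(ℝ, Coord n) ∞ M] [T2Space M] [SecondCountableTopology M] [MeasurableSpace M]
  [BorelSpace M] {g : PseudoRiemannianMetric n M} {a b l : ℝ}
  {hn : 0 < n} {hg : g.IsConformallyFlat p} {hU : IsChartIndependent g p a b l}

theorem isSymmetricConformal_quantLin {m h : ℝ} (hh : h ≠ 0) (hab : IsConformalWeights n a b l)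
    (hlm : l + m = 1) :
    (preservesSymbols_quantLin (hn := hn) (hg := hg) (hU := hU)).toQuantization.IsSymmetricConformal
      g p h l m where
  equivariant := quantLin_equivariant hab hlm
  principalSymbol := preservesSymbols_quantLin
  symmetric := (isSymmetric_iff (Q := preservesSymbols_quantLin.toQuantization)
    preservesSymbols_quantLin hh).2 fun P =>
    ⟨fun _ k hf _ => integral_quantLin_two (P := P.part2) rfl hf k,
      fun _ k hf _ => integral_quantLin_one (P := P.part1) rfl rfl hf k⟩

end Existence

end ConformalQuantization
end

noncomputable section

namespace ConformalQuantization

/-! ### Uniqueness of symmetric conformal isomorphisms -/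

section Adjoint

variable {n : ℕ} {M : Type*} [TopologicalSpace M] [ChartedSpace (Coord n) M]
  [IsManifold 𝓘(ℝ, Coord n) ∞ M] [T2Space M] [SecondCountableTopology M] [MeasurableSpace M]
  [BorelSpace M] {g : PseudoRiemannianMetric n M}

/-- If w(x) ≠ 0, testing with a cut-off F and with wF gives the integral of F²w², which is positive.
-/
theorem eq_zero_of_integral_mul {w : SmoothFun n M}
    (h : ∀ f k : SmoothFun n M, HasCompactSupport f → HasCompactSupport k →
      ∫ x, (f * (w * k)) x ∂g.vol = 0) : w = 0 := by
  have := isLocallyFiniteMeasure_vol (g := g)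
  have := isOpenPosMeasure_vol (g := g)
  ext x
  by_contra hw
  have hw : w x ≠ 0 := hw
  have hx := mem_chart_source (Coord n) x
  obtain ⟨F, hF, hF2, -⟩ := exists_smoothFun_germ (chart_mem_atlas (Coord n) x)
    ((chartAt (Coord n) x).map_source hx) Filter.univ_mem (u := fun _ => (1 : ℝ)) contDiffOn_const
  have hFx : F x = 1 := by
    have := hF.self_of_nhds
    rwa [(chartAt (Coord n) x).left_inv hx] at this
  have h1 : HasCompactSupport (w * F) := hF2.mul_left (f := w)
  have h2 := Continuous.integral_pos_of_hasCompactSupport_nonneg_nonzero (μ := g.vol)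
    (f := (F * (w * (w * F)) : SmoothFun n M)) (x := x) (SmoothFun.continuous _)
    (hF2.mul_right) (fun z => by
      change 0 ≤ F z * (w z * (w z * F z))
      nlinarith [mul_self_nonneg (F z * w z)]) (by
      change F x * (w x * (w x * F x)) ≠ 0
      simp [hFx, hw])
  exact h2.ne' (h F (w * F) hF2 h1)

/-- A multiplication operator is also self-adjoint, so being skew-adjoint makes twice its pairing
vanish. -/
theorem IsSkewAdjointOp.eq_zero {T : Module.End ℝ (SmoothFun n M)} (hT : IsSkewAdjointOp g T)
    (h : ∀ f, opComm T f = 0) : T = 0 := by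
  have h1 := eq_mul_of_opComm_eq_zero h
  have h2 : T 1 = 0 := eq_zero_of_integral_mul (g := g) fun f k hf hk => by
    have h3 := hT f k hf hk
    have h4 : f * T k + T f * k = (2 : ℝ) • (f * (T 1 * k)) := by
      rw [h1 k, h1 f, two_smul]
      ring
    rw [h4] at h3
    have h5 : ∫ x, 2 * (f * (T 1 * k)) x ∂g.vol = 0 := h3
    rw [integral_const_mul] at h5
    linarith
  refine LinearMap.ext fun u => ?_
  rw [h1, h2, zero_mul, LinearMap.zero_apply]

omit [IsManifold 𝓘(ℝ, Coord n) ∞ M] [T2Space M] [SecondCountableTopology M] [MeasurableSpace M]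
  [BorelSpace M] in
theorem hasCompactSupport_mul (u : SmoothFun n M) {f : SmoothFun n M} (hf : HasCompactSupport f) :
    HasCompactSupport (u * f) := HasCompactSupport.mul_left (f := ⇑u) hf

/-- A self-adjoint operator of order one has order zero. Comparing its self-adjointness on (f, uk)
and on (uf, k), all terms cancel except twice the integral of f · [T, u]1 · k. -/
theorem IsSelfAdjointOp.opComm_eq_zero {T : Module.End ℝ (SmoothFun n M)}
    (hT : IsSelfAdjointOp g T) (h : ∀ f f', opComm (opComm T f) f' = 0) (u : SmoothFun n M) :
    opComm T u = 0 := by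
  have h1 := eq_mul_of_opComm_eq_zero (h u)
  have h2 : opComm T u 1 = 0 := eq_zero_of_integral_mul (g := g) fun f k hf hk => by
    have h3 := hT f (u * k) hf (hasCompactSupport_mul u hk)
    have h4 := hT (u * f) k (hasCompactSupport_mul u hf) hk
    have h5 := integral_sub (integrable_selfAdjoint g T hf (hasCompactSupport_mul u hk))
      (integrable_selfAdjoint g T (hasCompactSupport_mul u hf) hk)
    have h6 : ∀ v, T (u * v) = u * T v + opComm T u 1 * v := fun v => by
      rw [← h1, opComm_apply]
      ring
    have h7 : (f * T (u * k) - T f * (u * k)) - (u * f * T k - T (u * f) * k)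
        = (2 : ℝ) • (f * (opComm T u 1 * k)) := by
      rw [h6, h6, two_smul]
      ring
    have h8 : ∫ x, ((f * T (u * k) - T f * (u * k)) - (u * f * T k - T (u * f) * k)) x ∂g.vol = 0 :=
      h5.trans (by
        change (∫ x, (f * T (u * k) - T f * (u * k)) x ∂g.vol)
          - ∫ x, (u * f * T k - T (u * f) * k) x ∂g.vol = 0
        rw [h3, h4, sub_zero])
    rw [h7] at h8
    have h9 : ∫ x, 2 * (f * (opComm T u 1 * k)) x ∂g.vol = 0 := h8
    rw [integral_const_mul] at h9
    linarith
  refine LinearMap.ext fun v => ?_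
  rw [h1, h2, zero_mul, LinearMap.zero_apply]

end Adjoint

section Uniqueness

variable {n p : ℕ} {M : Type*} [TopologicalSpace M] [ChartedSpace (Coord n) M]
  [IsManifold 𝓘(ℝ, Coord n) ∞ M] [T2Space M] [SecondCountableTopology M] [MeasurableSpace M]
  [BorelSpace M] {g : PseudoRiemannianMetric n M} {Q Q' : QuantizationMap n M} {h l m : ℝ}

/-- The operators `Q(P)`, as a linear function of `P`. -/
def QuantizationMap.opLin (Q : QuantizationMap n M) :
    Symbol n M →ₗ[ℝ] Module.End ℝ (SmoothFun n M) :=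
  (diffOps (SmoothFun n M) 2).subtype ∘ₗ (Q : Symbol n M →ₗ[ℝ] diffOps (SmoothFun n M) 2)

omit [IsManifold 𝓘(ℝ, Coord n) ∞ M] [T2Space M] [SecondCountableTopology M] [MeasurableSpace M]
  [BorelSpace M] in
theorem Symbol.part_add (P : Symbol n M) : P.part2 + P.part1 + P.part0 = P := by
  refine Subtype.ext (Prod.ext ?_ (Prod.ext ?_ ?_))
  · change P.1.1 + 0 + 0 = P.1.1
    rw [add_zero, add_zero]
  · change 0 + P.1.2.1 + 0 = P.1.2.1
    rw [zero_add, add_zero]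
  · change 0 + 0 + P.1.2.2 = P.1.2.2
    rw [zero_add, zero_add]

omit [IsManifold 𝓘(ℝ, Coord n) ∞ M] [T2Space M] [SecondCountableTopology M] [BorelSpace M] in
theorem QuantizationMap.IsSymmetricConformal.op_part0 (hQ : Q.IsSymmetricConformal g p h l m)
    (hQ' : Q'.IsSymmetricConformal g p h l m) (P : Symbol n M) :
    Q.op P.part0 = Q'.op P.part0 := by
  refine LinearMap.ext fun u => ?_
  ext x
  rw [(hQ.principalSymbol P.part0).2.2 rfl rfl, (hQ'.principalSymbol P.part0).2.2 rfl rfl]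

theorem QuantizationMap.IsSymmetricConformal.op_part1 (hh : h ≠ 0)
    (hQ : Q.IsSymmetricConformal g p h l m) (hQ' : Q'.IsSymmetricConformal g p h l m)
    (P : Symbol n M) : Q.op P.part1 = Q'.op P.part1 := by
  have h1 := ((isSymmetric_iff hQ.principalSymbol hh).1 hQ.symmetric P).2
  have h2 := ((isSymmetric_iff hQ'.principalSymbol hh).1 hQ'.symmetric P).2
  refine sub_eq_zero.1 ((h1.sub h2).eq_zero fun f => ?_)
  refine LinearMap.ext fun u => ?_
  ext x
  rw [opComm_sub]
  change opComm (Q.op P.part1) f u x - opComm (Q'.op P.part1) f u x = 0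
  rw [(hQ.principalSymbol P.part1).2.1 rfl, (hQ'.principalSymbol P.part1).2.1 rfl, sub_self]

theorem QuantizationMap.IsSymmetricConformal.opComm_part2 (hh : h ≠ 0)
    (hQ : Q.IsSymmetricConformal g p h l m) (hQ' : Q'.IsSymmetricConformal g p h l m)
    (P : Symbol n M) (f : SmoothFun n M) : opComm (Q.op P.part2 - Q'.op P.part2) f = 0 := by
  have h1 := ((isSymmetric_iff hQ.principalSymbol hh).1 hQ.symmetric P).1
  have h2 := ((isSymmetric_iff hQ'.principalSymbol hh).1 hQ'.symmetric P).1
  refine (h1.sub h2).opComm_eq_zero (fun f f' => ?_) f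
  refine LinearMap.ext fun u => ?_
  ext x
  rw [opComm_sub, opComm_sub]
  change opComm (opComm (Q.op P.part2) f) f' u x - opComm (opComm (Q'.op P.part2) f) f' u x = 0
  have e1 := PreservesSymbols.two (Q := Q.opLin) hQ.principalSymbol P.part2 f f' u x
  have e2 := PreservesSymbols.two (Q := Q'.opLin) hQ'.principalSymbol P.part2 f f' u x
  exact sub_eq_zero.2 (e1.trans e2.symm)

/-- The difference of two symmetric conformal isomorphisms is the multiplication by a function
which depends equivariantly on the symbol. -/
theorem QuantizationMap.IsSymmetricConformal.difference_equivariant (hn : 0 < n) (hh : h ≠ 0)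
    (hg : g.IsConformallyFlat p)
    (hQ : Q.IsSymmetricConformal g p h l m) (hQ' : Q'.IsSymmetricConformal g p h l m)
    {c : OpenPartialHomeomorph M (Coord n)} (hc : c ∈ atlas (Coord n) M) {y : Coord n}
    (hy : y ∈ c.target) {X : Coord n → Coord n} (hX : X ∈ conformalAlgebra n p) (hX0 : X y = 0)
    {P P' : Symbol n M} (hP1 : P.1.2.1 = 0) (hP0 : P.1.2.2 = 0) (hP1' : P'.1.2.1 = 0)
    (hP0' : P'.1.2.2 = 0)
    (hPP' : ∀ᶠ z in 𝓝 y, ∀ i j,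
      P'.comp2 c z i j = lieTensor (g.coeff c) (m - l) X (P.comp2 c) z i j) :
    (Q.op P' - Q'.op P') 1 (c.symm y)
      = (m - l) * divergence (g.coeff c) X y * (Q.op P - Q'.op P) 1 (c.symm y) := by
  have hc1 : ∀ P : Symbol n M, P.1.2.1 = 0 → P.comp1 c = fun _ _ => 0 := fun P h => by
    funext z i; simp [Symbol.comp1, h]
  have hc0 : ∀ P : Symbol n M, P.1.2.2 = 0 → P.comp0 c = fun _ => 0 := fun P h => by
    funext z; simp [Symbol.comp0, h]
  have hpart : P.part2 = P := Subtype.ext (Prod.ext rfl (Prod.ext hP1.symm hP0.symm))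
  obtain ⟨σ, hσ⟩ := exists_conformalFactor hn hg hc hy
  obtain ⟨Xr, -, hXr, -⟩ := exists_isRingConformal hX
  obtain ⟨f', hf', -, -⟩ := exists_smoothFun_germ hc hy Filter.univ_mem
    (contDiff_coe (algebraMap ℝ _ l * (volPow σ (-1)
      * ringDiv der (fun i => volPow σ 1 * Xr i)) : SmoothFn n)).contDiffOn
  have hpd : ∀ j y, pd j (fun x : Coord n => (1 : SmoothFun n M) (c.symm x)) y = 0 := fun j y =>
    pd_const (1 : ℝ) j y
  have hf : ∀ᶠ z in 𝓝 y, f' (c.symm z) = l * divergence (g.coeff c) X z := by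
    filter_upwards [hf', hσ.divergence_eventuallyEq (.of_forall hXr)] with z e1 e2
    rw [e1, e2]
    rfl
  have key : ∀ Q : QuantizationMap n M, Q.IsSymmetricConformal g p h l m →
      Q.op P' 1 (c.symm y) = m * divergence (g.coeff c) X y * Q.op P 1 (c.symm y)
        - Q.op P f' (c.symm y) := fun Q hQ => by
    have e := hQ.equivariant c hc X hX y hy P P' 1 f'
      (by
        filter_upwards [hPP'] with z hz
        refine ⟨hz, fun i => ?_, ?_⟩
        · simp [hc1 P' hP1', hc1 P hP1, lieVector, pd_const]
        · simp [hc0 P' hP0', hc0 P hP0, lieDensity, pd_const])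
      (by
        filter_upwards [hf] with z hz
        simp only [hz, lieDensity, hpd]
        simp)
    rw [e, lieDensity, hX0]
    simp
  -- The difference is a multiplication, so its value on the Lie derivative of 1 is l · div X times
  -- its value on 1. Together with the weight m of the target this yields m - l.
  have h1 := eq_mul_of_opComm_eq_zero (hQ.opComm_part2 hh hQ' P) f'
  rw [hpart] at h1
  have h2 : Q.op P f' (c.symm y) - Q'.op P f' (c.symm y)
      = (Q.op P - Q'.op P) 1 (c.symm y) * f' (c.symm y) :=
    congrArg (fun u : SmoothFun n M => u (c.symm y)) h1
  have h3 : (Q.op P - Q'.op P) 1 (c.symm y) = Q.op P 1 (c.symm y) - Q'.op P 1 (c.symm y) := rfl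
  have h4 : (Q.op P' - Q'.op P') 1 (c.symm y) = Q.op P' 1 (c.symm y) - Q'.op P' 1 (c.symm y) := rfl
  rw [hf.self_of_nhds] at h2
  rw [h4, key Q hQ, key Q' hQ', h3]
  rw [h3] at h2
  linear_combination -h2

/-- Symmetric conformal isomorphisms are unique for generic weights. -/
theorem QuantizationMap.IsSymmetricConformal.unique (hn : 0 < n) (hh : h ≠ 0)
    (hg : g.IsConformallyFlat p)
    (hQ : Q.IsSymmetricConformal g p h l m) (hQ' : Q'.IsSymmetricConformal g p h l m)
    (h1 : n * (m - l) ≠ 1) (h2 : n * (m - l) ≠ 1 + n / 2) (h3 : n * (m - l) ≠ n + 1) :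
    Q = Q' := by
  have key : ∀ P : Symbol n M, Q.op P.part2 = Q'.op P.part2 := fun P => by
    refine sub_eq_zero.1 (LinearMap.ext fun u => ?_)
    rw [eq_mul_of_opComm_eq_zero (hQ.opComm_part2 hh hQ' P)]
    ext x
    have hx := mem_chart_source (Coord n) x
    have hc := chart_mem_atlas (Coord n) x
    -- The functional P ↦ (Q(P) - Q'(P))1, evaluated at x, is equivariant for the isotropy algebra
    -- of x, so the resonance condition forces it to vanish on symbols of degree two.
    have e := symbolFunctional_eq_zero hn hg hc ((chartAt (Coord n) x).map_source hx)
      (δ := m - l) (P := P.part2)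
      { toFun := fun P => (Q.op P - Q'.op P) 1 ((chartAt (Coord n) x).symm (chartAt (Coord n) x x))
        map_add' := fun P P' => by
          have e1 : Q.op (P + P') = Q.op P + Q.op P' := map_add Q.opLin P P'
          have e2 : Q'.op (P + P') = Q'.op P + Q'.op P' := map_add Q'.opLin P P'
          rw [e1, e2, add_sub_add_comm]
          rfl
        map_smul' := fun t P => by
          have e1 : Q.op (t • P) = t • Q.op P := map_smul Q.opLin t P
          have e2 : Q'.op (t • P) = t • Q'.op P := map_smul Q'.opLin t P
          rw [e1, e2]
          exact (mul_sub t (Q.op P 1 _) (Q'.op P 1 _)).symm }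
      (fun X hX hX0 P P' hP1 hP0 hP1' hP0' hPP' => hQ.difference_equivariant hn hh hg hQ' hc
        ((chartAt (Coord n) x).map_source hx) hX hX0 hP1 hP0 hP1' hP0' hPP')
      h1 h2 h3 rfl rfl
    have e' : (Q.op P.part2 - Q'.op P.part2) 1 x = 0 := by
      rw [← (chartAt (Coord n) x).left_inv hx]
      exact e
    change (Q.op P.part2 - Q'.op P.part2) 1 x * u x = 0
    rw [e', zero_mul]
  refine LinearEquiv.ext fun P => Subtype.ext ?_
  change Q.opLin P = Q'.opLin P
  rw [← Symbol.part_add P]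
  simp only [map_add]
  exact congrArg₂ _ (congrArg₂ _ (key P) (hQ.op_part1 hh hQ' P)) (hQ.op_part0 hQ' P)

end Uniqueness

/-! ### The quantization of the metric -/

section Hamiltonian

variable {n p : ℕ} {M : Type*} [TopologicalSpace M] [ChartedSpace (Coord n) M]
  [IsManifold 𝓘(ℝ, Coord n) ∞ M] {g : PseudoRiemannianMetric n M}
  {c : OpenPartialHomeomorph M (Coord n)} {y : Coord n} {σ : SmoothFn n}

theorem HasConformalFactor.inv_apply {G : Coord n → Matrix (Fin n) (Fin n) ℝ}
    (hσ : G y = Real.exp (2 * σ y) • Matrix.diagonal (eta n p)) (i j : Fin n) :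
    (G y)⁻¹ i j = if i = j then Real.exp (-2 * σ y) * eta n p i else 0 := by
  have h1 : (G y)⁻¹ = Real.exp (-2 * σ y) • Matrix.diagonal (eta n p) := by
    refine Matrix.inv_eq_left_inv ?_
    rw [hσ, Matrix.smul_mul, Matrix.mul_smul, smul_smul, Matrix.diagonal_mul_diagonal,
      ← Real.exp_add]
    have : -2 * σ y + 2 * σ y = 0 := by ring
    simp only [this, eta_mul_self, Real.exp_zero, one_smul, Matrix.diagonal_one]
  rw [h1, Matrix.smul_apply, Matrix.diagonal_apply]
  split_ifs <;> simp

theorem volPow_div_apply (hn : 0 < n) (σ : SmoothFn n) (r : ℝ) (z : Coord n) :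
    volPow σ (r / n) z = Real.exp (r * σ z) := by
  have : (n : ℝ) ≠ 0 := by positivity
  simp [volPow, div_mul_cancel₀ r this]

/-- The components of the symbol `H` in a chart. -/
def metricComp (p : ℕ) (σ : SmoothFn n) (i j : Fin n) : SmoothFn n :=
  if i = j then volPow σ (-2 / n) * etaFun n p i else 0

theorem comp2_hamiltonian (hn : 0 < n) (hc : c ∈ atlas (Coord n) M) (hy : y ∈ c.target)
    (hσ : HasConformalFactor p (g.coeff c) σ y) :
    ∀ᶠ z in 𝓝 y, ∀ i j, g.hamiltonian.comp2 c z i j = metricComp p σ i j z := by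
  filter_upwards [hσ, c.open_target.mem_nhds hy] with z hz hzc i j
  have h1 : g.hamiltonian.comp2 c z i j = (g.coeff c z)⁻¹ i j := g.inv_coeff hc hzc i j
  rw [h1, HasConformalFactor.inv_apply hz, metricComp]
  split_ifs
  · rw [SmoothFn.mul_apply, volPow_div_apply hn, coe_etaFun]
  · rfl

/-- If `nδ = 2`, the symbol `H` is invariant. -/
theorem lieTensor_hamiltonian (hn : 0 < n) (hc : c ∈ atlas (Coord n) M) (hy : y ∈ c.target)
    (hσ : HasConformalFactor p (g.coeff c) σ y) {δ : ℝ} (hδ : n * δ = 2) (i j : Fin n) :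
    (fun z => lieTensor (g.coeff c) δ (fun z => z - y) (g.hamiltonian.comp2 c) z i j)
      =ᶠ[𝓝 y] fun _ => 0 := by
  have hn' : (n : ℝ) ≠ 0 := by positivity
  have h1 := hσ.lieTensor_eventuallyEq (X := fun z => z - y) (Xr := cen y) (fun z i => rfl)
    (comp2_hamiltonian hn hc hy hσ) δ i j
  -- H scales like exp(-2σ) and |vol|^δ like exp(nδσ). For nδ = 2 the density is the constant matrix
  -- η in flat coordinates, and the dilation acts on it by nδ - 2 = 0.
  have h2 : ∀ i j, volPow σ δ * metricComp p σ i j = if i = j then etaFun n p i else 0 := by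
    intro i j
    have h3 : volPow σ δ * volPow σ (-2 / n) = 1 := by
      rw [volPow_mul, show δ + -2 / n = 0 by field_simp; linarith, volPow_zero]
    rw [metricComp]
    split_ifs
    · rw [← mul_assoc, h3, one_mul]
    · rw [mul_zero]
  have h4 : ringLieTensor der (algebraMap ℝ _ δ) (cen y)
      (fun i j => volPow σ δ * metricComp p σ i j) i j = 0 := by
    have h5 : ∀ k, der k (if i = j then etaFun n p i else 0) = 0 := fun k => by
      split_ifs
      · exact der_etaFun _ _
      · exact map_zero _
    have h6 : algebraMap ℝ (SmoothFn n) δ * n = 2 := by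
      rw [← map_natCast (algebraMap ℝ (SmoothFn n)) n, ← map_mul, mul_comm, hδ, map_ofNat]
    simp only [h2, ringLieTensor, h5, ringDiv, der_cen, mul_zero, zero_sub, ite_mul, one_mul,
      zero_mul, Finset.sum_sub_distrib, Finset.sum_neg_distrib, Finset.sum_ite_eq,
      Finset.mem_univ, if_true, Finset.sum_const, Finset.card_univ, Fintype.card_fin, nsmul_one]
    split_ifs with hij
    · linear_combination etaFun n p i * h6
    · simp
  rw [h4, mul_zero] at h1
  exact h1

/-- The operator `Q(H)` is unique if `nδ = 2`. -/
theorem QuantizationMap.IsSymmetricConformal.op_hamiltonian [T2Space M]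
    [SecondCountableTopology M] [MeasurableSpace M] [BorelSpace M] {Q Q' : QuantizationMap n M}
    {h l m : ℝ} (hn : 0 < n) (hh : h ≠ 0) (hg : g.IsConformallyFlat p)
    (hQ : Q.IsSymmetricConformal g p h l m) (hQ' : Q'.IsSymmetricConformal g p h l m)
    (hδ : n * (m - l) = 2) : Q.op g.hamiltonian = Q'.op g.hamiltonian := by
  have hpart : g.hamiltonian.part2 = g.hamiltonian := rfl
  have h0 := hQ.opComm_part2 hh hQ' g.hamiltonian
  rw [hpart] at h0
  refine sub_eq_zero.1 (LinearMap.ext fun u => ?_)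
  rw [eq_mul_of_opComm_eq_zero h0]
  ext x
  have hx := mem_chart_source (Coord n) x
  have hc := chart_mem_atlas (Coord n) x
  have hy := (chartAt (Coord n) x).map_source hx
  obtain ⟨σ, hσ⟩ := exists_conformalFactor hn hg hc hy
  -- As the Lie derivative of H along the dilation vanishes, the symbol 0 may be used for it.
  -- Equivariance then reads 0 = nδ times the value of the difference on 1, and nδ = 2.
  have h1 := hQ.difference_equivariant hn hh hg hQ' hc hy (dilation_mem _) (sub_self _)
    (P := g.hamiltonian) (P' := 0) rfl rfl rfl rfl (by
      filter_upwards [Filter.eventually_all.2 fun i => Filter.eventually_all.2 fun j =>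
        lieTensor_hamiltonian hn hc hy hσ hδ i j] with z hz i j
      rw [hz]
      rfl)
  have h2 : Q.op 0 - Q'.op 0 = 0 := by
    have e1 : Q.op 0 = 0 := map_zero Q.opLin
    have e2 : Q'.op 0 = 0 := map_zero Q'.opLin
    rw [e1, e2, sub_zero]
  rw [h2, hσ.divergence_dilation, (chartAt (Coord n) x).left_inv hx] at h1
  have h3 : (0 : ℝ) = (m - l) * n * (Q.op g.hamiltonian - Q'.op g.hamiltonian) 1 x := h1
  have h4 : (Q.op g.hamiltonian - Q'.op g.hamiltonian) 1 x = 0 := by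
    linear_combination (-1 / 2) * h3
      - (1 / 2) * (Q.op g.hamiltonian - Q'.op g.hamiltonian) 1 x * hδ
  change (Q.op g.hamiltonian - Q'.op g.hamiltonian) 1 x * u x = 0
  rw [h4, zero_mul]

end Hamiltonian

end ConformalQuantization
end

noncomputable section

namespace ConformalQuantization

/-! ### Curvature and Laplacian of conformally flat metrics -/

section RingCurvature

variable {n : ℕ} {R : Type*} [CommRing R]

/-- The Christoffel symbols `Γᵏ_ij` of a conformally flat metric `exp(2σ) e`, with `s = dσ`. -/
def ringChristoffel (e s : Fin n → R) (k i j : Fin n) : R :=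
  (if j = k then s i else 0) + (if i = k then s j else 0) - if i = j then e i * e k * s k else 0

variable {e s : Fin n → R}

/-- No summation is involved: each single component whose upper index is repeated below equals the
same derivative of σ, so the full trace is n times it. -/
theorem ringChristoffel_trace (he : ∀ i, e i * e i = 1) (i j : Fin n) :
    ringChristoffel e s i i j = s j := by
  simp only [ringChristoffel, if_true]
  by_cases h : i = j
  · subst h
    simp only [if_true]
    linear_combination (-s i) * he i
  · simp [h, Ne.symm h]

theorem ringChristoffel_trace_right (he : ∀ i, e i * e i = 1) (i j : Fin n) :
    ringChristoffel e s j i j = s i := by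
  simp only [ringChristoffel, if_true]
  by_cases h : i = j
  · subst h
    simp only [if_true]
    linear_combination (-s i) * he i
  · simp [h]

theorem ringChristoffel_diag (k j : Fin n) :
    ringChristoffel e s k j j = (if k = j then 2 * s j else 0) - e j * e k * s k := by
  simp only [ringChristoffel, if_true, eq_comm (a := k)]
  split_ifs <;> ring

theorem sum_mul_ringChristoffel_diag (j : Fin n) (A : Fin n → R) :
    ∑ l, A l * ringChristoffel e s l j j = 2 * A j * s j - e j * ∑ l, e l * (A l * s l) := by
  simp only [ringChristoffel_diag, mul_sub, mul_ite, mul_zero, Finset.sum_sub_distrib,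
    Finset.sum_ite_eq', Finset.mem_univ, if_true, Finset.mul_sum]
  congr 1
  · ring
  · exact Finset.sum_congr rfl fun l _ => by ring

theorem sum_ringChristoffel_mul (i j : Fin n) (A : Fin n → R) :
    ∑ l, ringChristoffel e s i j l * A l
      = s j * A i + (if j = i then ∑ l, s l * A l else 0) - e j * e i * s i * A j := by
  simp only [ringChristoffel, sub_mul, add_mul, ite_mul, zero_mul, Finset.sum_sub_distrib,
    Finset.sum_add_distrib, Finset.sum_ite_eq, Finset.sum_ite_eq', Finset.mem_univ, if_true]
  congr 2
  split_ifs <;> simp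

theorem sum_ringChristoffel_sq (he : ∀ i, e i * e i = 1) (j : Fin n) :
    ∑ i, ∑ l, ringChristoffel e s i j l * ringChristoffel e s l i j
      = (n + 2) * s j ^ 2 - 2 * e j * ∑ l, e l * s l ^ 2 := by
  simp only [sum_ringChristoffel_mul, ringChristoffel_trace he, ringChristoffel_trace_right he,
    Finset.sum_sub_distrib, Finset.sum_add_distrib, Finset.sum_ite_eq, Finset.mem_univ, if_true,
    sum_mul_ringChristoffel_diag, Finset.sum_const, Finset.card_univ, Fintype.card_fin,
    nsmul_eq_mul]
  have h1 : ∑ i, e j * e i * s i * s i = e j * ∑ l, e l * s l ^ 2 := by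
    rw [Finset.mul_sum]
    exact Finset.sum_congr rfl fun l _ => by ring
  have h2 : ∑ l, e l * (s l * s l) = ∑ l, e l * s l ^ 2 :=
    Finset.sum_congr rfl fun l _ => by ring
  rw [h1, h2]
  ring

variable [Algebra ℝ R] {d : Fin n → Derivation ℝ R R}

/-- The scalar curvature of a conformally flat metric, up to the conformal factor. -/
theorem sum_ringRicci (he : ∀ i, e i * e i = 1) (hed : ∀ i j, d i (e j) = 0) :
    ∑ j, e j * ∑ i, (d i (ringChristoffel e s i j j) - d j (ringChristoffel e s i i j)
      + ∑ l, (ringChristoffel e s i i l * ringChristoffel e s l j j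
        - ringChristoffel e s i j l * ringChristoffel e s l i j))
      = -(2 * (n - 1) * ∑ i, e i * d i (s i)) - (n - 2) * (n - 1) * ∑ i, e i * s i ^ 2 := by
  have h0 : ∀ i j, d i (ringChristoffel e s i j j)
      = (if i = j then 2 * d j (s j) else 0) - e j * (e i * d i (s i)) := fun i j => by
    rw [ringChristoffel_diag, map_sub]
    congr 1
    · split_ifs with h
      · subst h
        rw [two_mul, two_mul, map_add]
      · exact map_zero _
    · simp only [Derivation.leibniz, hed, smul_eq_mul, mul_zero, add_zero]
      ring
  -- The diagonal Ricci components in flat coordinates. The off-diagonal ones are not needed, since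
  -- the inverse metric is diagonal.
  have h1 : ∀ j, ∑ i, (d i (ringChristoffel e s i j j) - d j (ringChristoffel e s i i j)
      + ∑ l, (ringChristoffel e s i i l * ringChristoffel e s l j j
        - ringChristoffel e s i j l * ringChristoffel e s l i j))
      = (2 - n) * d j (s j) - e j * ∑ i, e i * d i (s i) + (n - 2) * s j ^ 2
        - (n - 2) * (e j * ∑ l, e l * s l ^ 2) := fun j => by
    simp only [Finset.sum_add_distrib, Finset.sum_sub_distrib, sum_ringChristoffel_sq he]
    simp only [h0, ringChristoffel_trace he, sum_mul_ringChristoffel_diag, Finset.sum_sub_distrib,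
      Finset.sum_ite_eq', Finset.mem_univ, if_true, ← Finset.mul_sum, Finset.sum_const,
      Finset.card_univ, Fintype.card_fin, nsmul_eq_mul]
    have h2 : ∑ l, e l * (s l * s l) = ∑ l, e l * s l ^ 2 :=
      Finset.sum_congr rfl fun l _ => by ring
    rw [h2]
    ring
  simp only [h1]
  set B := ∑ i, e i * d i (s i)
  set S := ∑ l, e l * s l ^ 2
  have h3 : ∀ j, e j * ((2 - n) * d j (s j) - e j * B + (n - 2) * s j ^ 2 - (n - 2) * (e j * S))
      = (2 - n) * (e j * d j (s j)) + (n - 2) * (e j * s j ^ 2) - (B + (n - 2) * S) := fun j => by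
    linear_combination (-(B + (n - 2) * S)) * he j
  simp only [h3, Finset.sum_sub_distrib, Finset.sum_add_distrib, ← Finset.mul_sum,
    Finset.sum_const, Finset.card_univ, Fintype.card_fin, nsmul_eq_mul]
  ring

end RingCurvature

/-! ### Curvature and Laplacian in a chart, from the ring identities -/

section CoordCurvature

variable {n p : ℕ} {G : Coord n → Matrix (Fin n) (Fin n) ℝ} {y : Coord n} {σ : SmoothFn n}

theorem HasConformalFactor.christoffel_eq (h : HasConformalFactor p G σ y) (k i j : Fin n) :
    christoffel G k i j y = ringChristoffel (etaFun n p) (fun i => der i σ) k i j y := by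
  have h1 : ∀ i j l, pd i (fun z => G z j l) y
      = if j = l then 2 * Real.exp (2 * σ y) * der i σ y * eta n p j else 0 := fun i j l => by
    by_cases hjl : j = l
    · subst hjl
      have h2 : (fun z => G z j j) =ᶠ[𝓝 y] (smoothExp (2 * σ) * etaFun n p j : SmoothFn n) := by
        filter_upwards [h] with z hz
        rw [hz]
        have : (2 : SmoothFn n) z = 2 := rfl
        simp [this]
      rw [pd_congr h2, ← coe_der]
      have h3 : der i (smoothExp (2 * σ) * etaFun n p j)
          = 2 * (smoothExp (2 * σ) * der i σ * etaFun n p j) := by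
        simp only [Derivation.leibniz, der_smoothExp, der_etaFun, smul_eq_mul, derivation_two]
        ring
      have h4 : (2 : SmoothFn n) y = 2 := rfl
      rw [h3]
      simp only [SmoothFn.mul_apply, smoothExp_apply, h4, coe_etaFun, if_true]
      ring
    · have h2 : (fun z => G z j l) =ᶠ[𝓝 y] fun _ => 0 := by
        filter_upwards [h] with z hz
        rw [hz]
        simp [hjl]
      rw [pd_congr h2, pd_const, if_neg hjl]
  have h5 : Real.exp (-2 * σ y) * Real.exp (2 * σ y) = 1 := by
    rw [← Real.exp_add, show -2 * σ y + 2 * σ y = 0 by ring, Real.exp_zero]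
  have h6 : ∀ (P : Prop) [Decidable P] (u v : SmoothFn n),
      (if P then u else v) y = if P then u y else v y := fun P _ u v => by split_ifs <;> rfl
  simp only [christoffel, HasConformalFactor.inv_apply h.self_of_nhds, h1, ite_mul, zero_mul,
    Finset.sum_ite_eq, Finset.mem_univ, if_true, ringChristoffel, SmoothFn.sub_apply,
    SmoothFn.add_apply, h6, SmoothFn.mul_apply, coe_etaFun, SmoothFn.zero_apply]
  have h7 : ∀ k : Fin n, eta n p k * eta n p k = 1 := eta_mul_self
  have h8 : ∀ (P : Prop) [Decidable P] (u : ℝ),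
      (if P then u else 0) = (if P then 1 else 0) * u := fun P _ u => by split_ifs <;> simp
  have h9 : (if j = k then 2 * Real.exp (2 * σ y) * der i σ y * eta n p j else 0)
      = (if j = k then (1 : ℝ) else 0) * (2 * Real.exp (2 * σ y) * der i σ y * eta n p k) := by
    split_ifs with h
    · rw [h, one_mul]
    · rw [zero_mul]
  have h10 : (if i = k then 2 * Real.exp (2 * σ y) * der j σ y * eta n p i else 0)
      = (if i = k then (1 : ℝ) else 0) * (2 * Real.exp (2 * σ y) * der j σ y * eta n p k) := by
    split_ifs with h
    · rw [h, one_mul]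
    · rw [zero_mul]
  rw [h9, h10, h8 (i = j) (2 * Real.exp (2 * σ y) * der k σ y * eta n p i), h8 (j = k) (der i σ y),
    h8 (i = k) (der j σ y), h8 (i = j) (eta n p i * eta n p k * der k σ y)]
  set a : ℝ := if j = k then 1 else 0
  set b : ℝ := if i = k then 1 else 0
  set c : ℝ := if i = j then 1 else 0
  linear_combination (a * der i σ y + b * der j σ y) * (h5 + Real.exp (-2 * σ y)
    * Real.exp (2 * σ y) * (h7 k)) - c * eta n p i * eta n p k * der k σ y * h5

theorem HasConformalFactor.christoffel_eventuallyEq (h : HasConformalFactor p G σ y)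
    (k i j : Fin n) : christoffel G k i j
      =ᶠ[𝓝 y] (ringChristoffel (etaFun n p) (fun i => der i σ) k i j : SmoothFn n) := by
  filter_upwards [h.eventually] with z hz using hz.christoffel_eq k i j

/-- The scalar curvature of a conformally flat metric. -/
theorem HasConformalFactor.scalarCurvature_eq (h : HasConformalFactor p G σ y) :
    scalarCurvatureCoord G y = Real.exp (-2 * σ y)
      * (-(2 * (n - 1) * (∑ i, etaFun n p i * der i (der i σ) : SmoothFn n) y)
        - (n - 2) * (n - 1) * (∑ i, etaFun n p i * der i σ ^ 2 : SmoothFn n) y) := by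
  have key := congrArg (fun u : SmoothFn n => u y)
    (sum_ringRicci (d := der) (e := etaFun n p) (s := fun i => der i σ) etaFun_mul_self der_etaFun)
  have h2 : (2 : SmoothFn n) y = 2 := rfl
  have h1 : (1 : SmoothFn n) y = 1 := rfl
  have hneg : ∀ u : SmoothFn n, (-u) y = -(u y) := fun u => rfl
  have hR : ∀ j, ricci G j j y = (∑ i, (der i (ringChristoffel (etaFun n p) (fun i => der i σ) i j j)
      - der j (ringChristoffel (etaFun n p) (fun i => der i σ) i i j)
      + ∑ l, (ringChristoffel (etaFun n p) (fun i => der i σ) i i l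
          * ringChristoffel (etaFun n p) (fun i => der i σ) l j j
        - ringChristoffel (etaFun n p) (fun i => der i σ) i j l
          * ringChristoffel (etaFun n p) (fun i => der i σ) l i j)) : SmoothFn n) y := fun j => by
    simp only [ricci, h.christoffel_eq, pd_congr (h.christoffel_eventuallyEq _ _ _),
      SmoothFn.sum_apply, SmoothFn.add_apply, SmoothFn.sub_apply, SmoothFn.mul_apply, coe_der]
  have h3 : scalarCurvatureCoord G y
      = Real.exp (-2 * σ y) * ∑ j, eta n p j * ricci G j j y := by
    simp only [scalarCurvatureCoord, HasConformalFactor.inv_apply h.self_of_nhds, ite_mul,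
      zero_mul, Finset.sum_ite_eq, Finset.mem_univ, if_true, Finset.mul_sum, mul_assoc]
  rw [h3]
  congr 1
  simp only [hR]
  simp only [SmoothFn.sub_apply, hneg, SmoothFn.mul_apply, SmoothFn.natCast_apply, h1, h2] at key
  rw [← key, SmoothFn.sum_apply]
  refine Finset.sum_congr rfl fun j _ => ?_
  rw [SmoothFn.mul_apply, coe_etaFun]

/-- Complex functions are handled through real and imaginary parts, so that the ring of real smooth
functions suffices. The statement concerns germs in order to be iterated for second derivatives. -/
theorem pd_complex_eventuallyEq {u : Coord n → ℂ} {a b : SmoothFn n}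
    (h : ∀ᶠ z in 𝓝 y, u z = (a z : ℂ) + Complex.I * (b z : ℂ)) (i : Fin n) :
    ∀ᶠ z in 𝓝 y, pd i u z = (der i a z : ℂ) + Complex.I * (der i b z : ℂ) := by
  filter_upwards [eventually_eventually_nhds.2 h] with z hz
  have h1 : pd i u z = pd i (fun w => (a w : ℂ) + Complex.I * (b w : ℂ)) z := pd_congr hz i
  have ha := Complex.ofRealCLM.hasFDerivAt.comp z (differentiableAt_coe a z).hasFDerivAt
  have hb := (Complex.ofRealCLM.hasFDerivAt.comp z (differentiableAt_coe b z).hasFDerivAt).const_mul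
    Complex.I
  have hd : HasFDerivAt (fun w => (a w : ℂ) + Complex.I * (b w : ℂ)) _ z := ha.add hb
  rw [h1, pd, hd.fderiv]
  rfl

/-- The Laplace operator of a conformally flat metric. -/
def confLaplacian (p : ℕ) (σ a : SmoothFn n) : SmoothFn n :=
  ∑ i, etaFun n p i * (der i (der i a) + (n - 2) * (der i σ * der i a))

theorem HasConformalFactor.laplacian_eq (h : HasConformalFactor p G σ y) {u : Coord n → ℂ}
    {a b : SmoothFn n} (hu : ∀ᶠ z in 𝓝 y, u z = (a z : ℂ) + Complex.I * (b z : ℂ)) :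
    laplacianCoord G u y = Real.exp (-2 * σ y)
      * ((confLaplacian p σ a y : ℂ) + Complex.I * (confLaplacian p σ b y : ℂ)) := by
  have h1 := fun i => (pd_complex_eventuallyEq hu i)
  have h2 : ∀ i j, pd i (pd j u) y = (der i (der j a) y : ℂ) + Complex.I * (der i (der j b) y : ℂ) :=
    fun i j => (pd_complex_eventuallyEq (h1 j) i).self_of_nhds
  have h3 : ∀ w : Fin n → ℂ, ∑ i, (eta n p i : ℂ) * ∑ k,
      ((ringChristoffel (etaFun n p) (fun i => der i σ) k i i y : ℝ) : ℂ) * w k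
      = -((n : ℂ) - 2) * ∑ i, (eta n p i : ℂ) * (der i σ y * w i) := fun w => by
    have h6 : ∀ (P : Prop) [Decidable P] (u v : SmoothFn n),
      (if P then u else v) y = if P then u y else v y := fun P _ u v => by split_ifs <;> rfl
    have h7 : ∀ k : Fin n, (eta n p k : ℂ) * eta n p k = 1 := fun k => by
      rw [← Complex.ofReal_mul, eta_mul_self, Complex.ofReal_one]
    have h8 : ∀ i k, ((ringChristoffel (etaFun n p) (fun i => der i σ) k i i y : ℝ) : ℂ)
        = (if k = i then 2 * (der i σ y : ℂ) else 0)
          - (eta n p i : ℂ) * (eta n p k : ℂ) * (der k σ y : ℂ) := fun i k => by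
      have : (2 : SmoothFn n) y = 2 := rfl
      rw [ringChristoffel_diag, SmoothFn.sub_apply, h6]
      simp only [SmoothFn.mul_apply, coe_etaFun, SmoothFn.zero_apply, this]
      split_ifs <;> push_cast <;> ring
    simp only [h8, sub_mul, ite_mul, zero_mul, Finset.sum_sub_distrib, Finset.sum_ite_eq',
      Finset.mem_univ, if_true, mul_sub]
    have h9 : ∀ i, (eta n p i : ℂ) * ∑ k, (eta n p i : ℂ) * (eta n p k : ℂ) * (der k σ y : ℂ) * w k
        = ∑ k, (eta n p k : ℂ) * (der k σ y * w k) := fun i => by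
      rw [Finset.mul_sum]
      refine Finset.sum_congr rfl fun k _ => ?_
      linear_combination ((eta n p k : ℂ) * (der k σ y : ℂ) * w k) * h7 i
    simp only [h9, Finset.sum_const, Finset.card_univ, Fintype.card_fin, nsmul_eq_mul]
    have h10 : ∑ i, (eta n p i : ℂ) * (2 * (der i σ y : ℂ) * w i)
        = 2 * ∑ k, (eta n p k : ℂ) * (der k σ y * w k) := by
      rw [Finset.mul_sum]
      exact Finset.sum_congr rfl fun k _ => by ring
    rw [h10]
    ring
  have h4 : ∀ i, pd i u y = (der i a y : ℂ) + Complex.I * (der i b y : ℂ) :=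
    fun i => (h1 i).self_of_nhds
  have h5 : laplacianCoord G u y = Real.exp (-2 * σ y)
      * ((∑ i, (eta n p i : ℂ) * pd i (pd i u) y) - ∑ i, (eta n p i : ℂ) * ∑ k,
        ((ringChristoffel (etaFun n p) (fun i => der i σ) k i i y : ℝ) : ℂ) * pd k u y) := by
    simp only [laplacianCoord, HasConformalFactor.inv_apply h.self_of_nhds, h.christoffel_eq]
    rw [← Finset.sum_sub_distrib, Finset.mul_sum]
    refine Finset.sum_congr rfl fun i _ => ?_
    rw [Finset.sum_eq_single i (fun j _ hj => by simp [Ne.symm hj]) (by simp), if_pos rfl]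
    push_cast
    ring
  have h6 : ∀ a : SmoothFn n, ((confLaplacian p σ a y : ℝ) : ℂ)
      = ∑ i, (eta n p i : ℂ) * (der i (der i a) y + (n - 2) * (der i σ y * der i a y)) := fun a => by
    have : ((n : SmoothFn n) - 2) y = n - 2 := by
      rw [SmoothFn.sub_apply, SmoothFn.natCast_apply]
      rfl
    simp only [confLaplacian, SmoothFn.sum_apply, SmoothFn.mul_apply, SmoothFn.add_apply, this,
      coe_etaFun]
    push_cast
    rfl
  rw [h5, h3, h6, h6]
  congr 1
  simp only [h2, h4, Finset.mul_sum, ← Finset.sum_sub_distrib, ← Finset.sum_add_distrib]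
  exact Finset.sum_congr rfl fun i _ => by ring

end CoordCurvature

end ConformalQuantization
end

noncomputable section

namespace ConformalQuantization

/-! ### The quantization of the metric and the Yamabe-type operators -/

section RingHamiltonian

variable {n p : ℕ}

theorem der_der_volPow (σ : SmoothFn n) (r : ℝ) (i : Fin n) :
    der i (der i (volPow σ r)) = volPow σ r * (algebraMap ℝ _ (r * n) * der i (der i σ)
      + algebraMap ℝ _ (r * n) ^ 2 * der i σ ^ 2) := by
  simp only [der_volPow, Derivation.leibniz, Derivation.map_algebraMap, smul_eq_mul, mul_zero,
    add_zero]
  ring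

/-- The zeroth order term of the quantization of `H`, in terms of the conformal factor. -/
theorem ringOp_hamiltonian (hn : 0 < n) (σ : SmoothFn n) (a b l : ℝ) :
    volPow σ (l - 1) * ringOp der (etaFun n p) (algebraMap ℝ _ a) (algebraMap ℝ _ b)
        (fun i j => volPow σ (1 - 2 * l) * metricComp p σ i j) (volPow σ l)
      = volPow σ (-2 / n) * (algebraMap ℝ _ (n * l + (a + n * b) * (n * (1 - 2 * l) - 2))
          * ∑ i, etaFun n p i * der i (der i σ)
        + algebraMap ℝ _ (n * l * (n * (1 - l) - 2) + (a + n * b) * (n * (1 - 2 * l) - 2) ^ 2)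
          * ∑ i, etaFun n p i * der i σ ^ 2) := by
  have hn' : (n : ℝ) ≠ 0 := by positivity
  -- In flat coordinates the density-valued symbol is |vol|^s η, with sn = nδ - 2; the whole
  -- computation is about derivatives of powers of |vol|.
  set s := 1 - 2 * l + -2 / n with hs
  have hsn : s * n = n * (1 - 2 * l) - 2 := by rw [hs]; field_simp; ring
  have hsn' : algebraMap ℝ (SmoothFn n) (s * n) = algebraMap ℝ _ (n * (1 - 2 * l) - 2) := by
    rw [hsn]
  have hq : ∀ i j, volPow σ (1 - 2 * l) * metricComp p σ i j
      = if i = j then volPow σ s * etaFun n p i else 0 := fun i j => by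
    rw [metricComp, hs, ← volPow_mul]
    split_ifs <;> ring
  have h1 : ringDivGrad der (fun i j => volPow σ (1 - 2 * l) * metricComp p σ i j) (volPow σ l)
      = volPow σ s * volPow σ l * (algebraMap ℝ _ (l * n) * ∑ i, etaFun n p i * der i (der i σ)
        + algebraMap ℝ _ (l * n) * (algebraMap ℝ _ (s * n) + algebraMap ℝ _ (l * n))
          * ∑ i, etaFun n p i * der i σ ^ 2) := by
    simp only [ringDivGrad, hq, ite_mul, zero_mul]
    have h2 : ∀ i j, der i (if i = j then volPow σ s * etaFun n p i * der j (volPow σ l) else 0)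
        = if i = j then der i (volPow σ s * etaFun n p i * der j (volPow σ l)) else 0 := fun i j => by
      split_ifs
      · rfl
      · exact map_zero _
    simp only [h2, Finset.sum_ite_eq, Finset.mem_univ, if_true, mul_add, Finset.mul_sum,
      ← Finset.sum_add_distrib]
    refine Finset.sum_congr rfl fun i _ => ?_
    simp only [Derivation.leibniz, der_volPow, der_etaFun, Derivation.map_algebraMap, smul_eq_mul]
    ring
  have h2 : ringPot der (etaFun n p) (algebraMap ℝ _ a) (algebraMap ℝ _ b)
      (fun i j => volPow σ (1 - 2 * l) * metricComp p σ i j)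
      = (algebraMap ℝ _ a + algebraMap ℝ _ b * n) * (volPow σ s * (algebraMap ℝ _ (s * n)
          * ∑ i, etaFun n p i * der i (der i σ)
        + algebraMap ℝ _ (s * n) ^ 2 * ∑ i, etaFun n p i * der i σ ^ 2)) := by
    have h3 : ∀ i, der i (der i (volPow σ s * etaFun n p i))
        = etaFun n p i * der i (der i (volPow σ s)) := fun i => by
      simp only [Derivation.leibniz, der_etaFun, smul_eq_mul, mul_zero, zero_add, add_zero]
    have h4 : ∀ i k, der i (der i (volPow σ s * etaFun n p k))
        = etaFun n p k * der i (der i (volPow σ s)) := fun i k => by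
      simp only [Derivation.leibniz, der_etaFun, smul_eq_mul, mul_zero, zero_add, add_zero]
    have h5 : ∀ i j, der i (der j (if i = j then volPow σ s * etaFun n p i else 0))
        = if i = j then der i (der i (volPow σ s * etaFun n p i)) else 0 := fun i j => by
      split_ifs with h
      · rw [h]
      · rw [map_zero, map_zero]
    have h6 : ∀ i k, etaFun n p i * etaFun n p k * (etaFun n p k * der i (der i (volPow σ s)))
        = etaFun n p i * der i (der i (volPow σ s)) := fun i k => by
      linear_combination etaFun n p i * der i (der i (volPow σ s)) * etaFun_mul_self (p := p) k
    have h7 : ∑ i, etaFun n p i * der i (der i (volPow σ s)) = volPow σ s * (algebraMap ℝ _ (s * n)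
          * ∑ i, etaFun n p i * der i (der i σ)
        + algebraMap ℝ _ (s * n) ^ 2 * ∑ i, etaFun n p i * der i σ ^ 2) := by
      simp only [der_der_volPow, mul_add, Finset.mul_sum, ← Finset.sum_add_distrib]
      exact Finset.sum_congr rfl fun i _ => by ring
    simp only [ringPot, hq, if_true, h5, h3, h4, h6, Finset.sum_ite_eq, Finset.mem_univ,
      Finset.sum_const, Finset.card_univ, Fintype.card_fin, nsmul_eq_mul, ← Finset.mul_sum, h7]
    ring
  have h3 : volPow σ (l - 1) * (volPow σ s * volPow σ l) = volPow σ (-2 / n) := by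
    rw [volPow_mul, volPow_mul, hs]
    congr 1
    ring
  rw [ringOp, h1, h2, hsn']
  simp only [map_add, map_sub, map_mul, map_pow, map_natCast, map_one, map_ofNat]
  rw [← h3]
  ring

/-- The second order part of the quantization of `H`. -/
theorem ringDiv_hamiltonian (hn : 0 < n) (σ a : SmoothFn n) :
    volPow σ (-1) * ringDiv der (fun i => volPow σ 1 * ∑ j, metricComp p σ i j * der j a)
      = volPow σ (-2 / n) * confLaplacian p σ a := by
  have hn' : (n : ℝ) ≠ 0 := by positivity
  have h0 : volPow σ (-1) * volPow σ (1 + -2 / n) = volPow σ (-2 / n) := by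
    rw [volPow_mul]; congr 1; ring
  have h1 : ∀ i, volPow σ 1 * ∑ j, metricComp p σ i j * der j a
      = volPow σ (1 + -2 / n) * (etaFun n p i * der i a) := fun i => by
    simp only [metricComp, ite_mul, zero_mul, Finset.sum_ite_eq, Finset.mem_univ, if_true]
    rw [← volPow_mul]
    ring
  have h2 : algebraMap ℝ (SmoothFn n) ((1 + -2 / n) * n) = n - 2 := by
    rw [show (1 + -2 / (n : ℝ)) * n = n - 2 by field_simp; ring, map_sub, map_natCast, map_ofNat]
  simp only [h1, ringDiv, confLaplacian, ← h0, mul_assoc]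
  congr 1
  rw [Finset.mul_sum]
  refine Finset.sum_congr rfl fun i _ => ?_
  simp only [Derivation.leibniz, der_volPow, der_etaFun, h2, smul_eq_mul]
  ring

end RingHamiltonian

section Hamiltonian

variable {n p : ℕ} {M : Type*} [TopologicalSpace M] [ChartedSpace (Coord n) M]
  [IsManifold 𝓘(ℝ, Coord n) ∞ M] {g : PseudoRiemannianMetric n M}
  {c : OpenPartialHomeomorph M (Coord n)} {y : Coord n} {σ : SmoothFn n}
  {a b l : ℝ} {hn : 0 < n} {hg : g.IsConformallyFlat p} {hU : IsChartIndependent g p a b l}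

/-- The potential and the scalar curvature are both exp(-2σ) times a combination of □σ and |dσ|².
The two hypotheses match the coefficients with the curvature's -2(n - 1) and -(n - 2)(n - 1), with
one common factor K. -/
theorem chartPot_hamiltonian (hn : 0 < n) (hc : c ∈ atlas (Coord n) M) (hy : y ∈ c.target)
    (hσ : HasConformalFactor p (g.coeff c) σ y) (a b l : ℝ) {K : ℝ}
    (h1 : n * l + (a + n * b) * (n * (1 - 2 * l) - 2) = -(2 * (n - 1) * K))
    (h2 : n * l * (n * (1 - l) - 2) + (a + n * b) * (n * (1 - 2 * l) - 2) ^ 2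
      = -((n - 2) * (n - 1) * K)) :
    chartPot g p a b l c g.hamiltonian y = K * scalarCurvatureCoord (g.coeff c) y := by
  rw [chartPot, (hσ.confPot_eventuallyEq a b l (comp2_hamiltonian hn hc hy hσ)).eq_of_nhds,
    ringOp_hamiltonian hn, h1, h2, hσ.scalarCurvature_eq]
  simp only [SmoothFn.mul_apply, SmoothFn.add_apply, SmoothFn.algebraMap_apply,
    volPow_div_apply hn]
  ring

theorem quantLin_hamiltonian {x : M} (hc : c ∈ atlas (Coord n) M) (hx : x ∈ c.source)
    (hσ : HasConformalFactor p (g.coeff c) σ (c x)) {K : ℝ}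
    (h1 : n * l + (a + n * b) * (n * (1 - 2 * l) - 2) = -(2 * (n - 1) * K))
    (h2 : n * l * (n * (1 - l) - 2) + (a + n * b) * (n * (1 - 2 * l) - 2) ^ 2
      = -((n - 2) * (n - 1) * K))
    {f : SmoothFun n M} {r : SmoothFn n} (hf : (fun z => f (c.symm z)) =ᶠ[𝓝 (c x)] r) :
    quantLin hn hg hU g.hamiltonian f x = Real.exp (-2 * σ (c x)) * confLaplacian p σ r (c x)
      + K * scalarCurvatureCoord (g.coeff c) (c x) * f x := by
  have hy := c.map_source hx
  have hfl : ∀ᶠ z in 𝓝 (c x), ∀ i, flux c g.hamiltonian f z i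
      = (∑ j, metricComp p σ i j * der j r : SmoothFn n) z := by
    filter_upwards [comp2_hamiltonian hn hc hy hσ, Filter.eventually_all.2 fun j =>
      eventuallyEq_pd hf j] with z e1 e2 i
    simp only [flux, e1, e2, SmoothFn.sum_apply, SmoothFn.mul_apply, coe_der]
  have h3 : g.hamiltonian.comp1 c = fun _ _ => 0 := by
    funext z i
    exact map_zero (coordCovec c z i)
  have h4 : g.hamiltonian.comp0 c (c x) = 0 := rfl
  rw [quantLin_apply _ f hc hx, chartQuant_eq, chartPot_hamiltonian hn hc hy hσ a b l h1 h2,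
    (hσ.divergence_eventuallyEq hfl).eq_of_nhds, ringDiv_hamiltonian hn, h3, h4, divergence_zero,
    c.left_inv hx, SmoothFn.mul_apply, volPow_div_apply hn]
  simp

theorem quantize_hamiltonian {Q : QuantizationMap n M} {h K : ℝ}
    (hQ : Q.op g.hamiltonian = quantLin hn hg hU g.hamiltonian)
    (h1 : n * l + (a + n * b) * (n * (1 - 2 * l) - 2) = -(2 * (n - 1) * K))
    (h2 : n * l * (n * (1 - l) - 2) + (a + n * b) * (n * (1 - 2 * l) - 2) ^ 2
      = -((n - 2) * (n - 1) * K)) (φ : SmoothFunC n M) (x : M) :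
    Q.quantize h g.hamiltonian φ x
      = -(h : ℂ) ^ 2 * (g.laplacian φ x + (K : ℂ) * (g.scalarCurvature x : ℂ) * φ x) := by
  have hc := chart_mem_atlas (Coord n) x
  have hx := mem_chart_source (Coord n) x
  have hy := (chartAt (Coord n) x).map_source hx
  obtain ⟨σ, hσ⟩ := exists_conformalFactor hn hg hc hy
  obtain ⟨u, hu⟩ := exists_rep (rePart φ) hc hy
  obtain ⟨v, hv⟩ := exists_rep (imPart φ) hc hy
  have hφ : ∀ z, φ z = (rePart φ z : ℂ) + Complex.I * (imPart φ z : ℂ) := fun z => by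
    rw [mul_comm]; exact (Complex.re_add_im (φ z)).symm
  have hL := hσ.laplacian_eq (u := fun z => φ ((chartAt (Coord n) x).symm z)) (a := u) (b := v) (by
    filter_upwards [hu, hv] with z e1 e2
    rw [hφ, e1, e2])
  have e2 : g.hamiltonian.part2 = g.hamiltonian := rfl
  have e1 : g.hamiltonian.part1 = 0 := Subtype.ext (Prod.ext rfl (Prod.ext rfl rfl))
  have e0 : g.hamiltonian.part0 = 0 := Subtype.ext (Prod.ext rfl (Prod.ext rfl rfl))
  have hz : Q.op 0 = 0 := by
    rw [QuantizationMap.op, map_zero, ZeroMemClass.coe_zero]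
  have hz' : complexify (0 : Module.End ℝ (SmoothFun n M)) φ x = 0 := by
    simp [complexify]
  rw [QuantizationMap.quantize, e2, e1, e0, hz, hz', complexify, hQ,
    quantLin_hamiltonian hc hx hσ h1 h2 hu, quantLin_hamiltonian hc hx hσ h1 h2 hv,
    PseudoRiemannianMetric.laplacian, hL, PseudoRiemannianMetric.scalarCurvature, hφ x]
  push_cast
  rw [mul_pow, Complex.I_sq]
  ring

end Hamiltonian

/-! ### Existence, uniqueness and the quantized metric for admissible weights -/

section Weights

variable {n p : ℕ} {M : Type*} [TopologicalSpace M] [ChartedSpace (Coord n) M]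
  [IsManifold 𝓘(ℝ, Coord n) ∞ M] [T2Space M] [SecondCountableTopology M] [MeasurableSpace M]
  [BorelSpace M] {g : PseudoRiemannianMetric n M}

/-- Q(H) is determined either because the whole isomorphism is unique, or because nδ = 2 makes H
invariant under dilations. The second alternative covers the resonant case. -/
theorem exists_isSymmetricConformal (hn : 0 < n) (hg : g.IsConformallyFlat p) {h a b l m K : ℝ}
    (hh : h ≠ 0) (hU : IsChartIndependent g p a b l) (hab : IsConformalWeights n a b l)
    (hlm : l + m = 1)
    (hδ : n * (m - l) = 2 ∨
      n * (m - l) ≠ 1 ∧ n * (m - l) ≠ 1 + n / 2 ∧ n * (m - l) ≠ n + 1)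
    (h1 : n * l + (a + n * b) * (n * (1 - 2 * l) - 2) = -(2 * (n - 1) * K))
    (h2 : n * l * (n * (1 - l) - 2) + (a + n * b) * (n * (1 - 2 * l) - 2) ^ 2
      = -((n - 2) * (n - 1) * K)) :
    (∃ Q : QuantizationMap n M, Q.IsSymmetricConformal g p h l m) ∧
      ∀ Q : QuantizationMap n M, Q.IsSymmetricConformal g p h l m →
        ∀ (φ : SmoothFunC n M) (x : M), Q.quantize h g.hamiltonian φ x
          = -(h : ℂ) ^ 2 * (g.laplacian φ x + (K : ℂ) * (g.scalarCurvature x : ℂ) * φ x) := by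
  have hQ₀ := isSymmetricConformal_quantLin (hn := hn) (hg := hg) (hU := hU) hh hab hlm
  refine ⟨⟨_, hQ₀⟩, fun Q hQ => quantize_hamiltonian (hn := hn) (hg := hg) (hU := hU) ?_ h1 h2⟩
  rw [← preservesSymbols_quantLin.toQuantization_op]
  rcases hδ with hδ | ⟨k1, k2, k3⟩
  · exact hQ.op_hamiltonian hn hh hg hQ₀ hδ
  · rw [hQ.unique hn hh hg hQ₀ k1 k2 k3]

end Weights

end ConformalQuantization
end

noncomputable section

namespace ConformalQuantization

/-! ### The three pairs of weights -/

section Weights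

variable {n p : ℕ} {M : Type*} [TopologicalSpace M] [ChartedSpace (Coord n) M]
  [IsManifold 𝓘(ℝ, Coord n) ∞ M] [T2Space M]
  {g : PseudoRiemannianMetric n M}

omit [IsManifold 𝓘(ℝ, Coord n) ∞ M] [T2Space M] in
theorem isChartIndependent_zero (hn : 0 < n) (hg : g.IsConformallyFlat p) :
    IsChartIndependent g p 0 0 0 := fun c hc c' hc' x hx hx' P => by
  rw [chartPot_zero hn hg hc (c.map_source hx), chartPot_zero hn hg hc' (c'.map_source hx')]

theorem isChartIndependent_of_generic (hn : 0 < n) (hM : IsFlatConformalAtlas n p M)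
    (hg : g.IsConformallyFlat p) {a b l m : ℝ} (hab : IsConformalWeights n a b l) (hlm : l + m = 1)
    (hδ : n * (m - l) ≠ 1 ∧ n * (m - l) ≠ 1 + n / 2 ∧ n * (m - l) ≠ n + 1) :
    IsChartIndependent g p a b l := fun c hc c' hc' x hx hx' P => by
  obtain rfl : m = 1 - l := by linear_combination hlm
  rw [show 1 - l - l = 1 - 2 * l by ring] at hδ
  exact chartPot_change hn hM hg hab hδ.1 hδ.2.1 hδ.2.2 hc hc' hx hx' P

variable [SecondCountableTopology M] [MeasurableSpace M] [BorelSpace M]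

/-- Here nδ = n, which meets the resonance 1 + n/2 exactly for n = 2. -/
theorem generic_zero_one (hn : 3 ≤ n) :
    (n : ℝ) * (1 - 0) ≠ 1 ∧ (n : ℝ) * (1 - 0) ≠ 1 + n / 2 ∧ (n : ℝ) * (1 - 0) ≠ n + 1 := by
  have h : (3 : ℝ) ≤ n := by exact_mod_cast hn
  refine ⟨?_, ?_, ?_⟩ <;> intro h' <;> linarith

theorem quantization_zero_one (hn : 2 ≤ n) (hg : g.IsConformallyFlat p) {h : ℝ} (hh : h ≠ 0) :
    (∃ Q : QuantizationMap n M, Q.IsSymmetricConformal g p h 0 1) ∧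
      ∀ Q : QuantizationMap n M, Q.IsSymmetricConformal g p h 0 1 →
        ∀ (φ : SmoothFunC n M) (x : M),
          Q.quantize h g.hamiltonian φ x = -(h : ℂ) ^ 2 * g.laplacian φ x := by
  have hn0 : 0 < n := by omega
  -- For λ = 0 the equations are solved by a = b = 0, and there is no potential to glue; so
  -- existence needs no genericity. In dimension two nδ = 2 determines the operator Q(H).
  have key := exists_isSymmetricConformal (M := M) hn0 hg (K := 0) (m := 1) hh
    (isChartIndependent_zero hn0 hg) (by constructor <;> simp) (by ring) (by
      rcases Nat.lt_or_ge n 3 with h3 | h3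
      · obtain rfl : n = 2 := by omega
        left
        norm_num
      · exact Or.inr (generic_zero_one h3)) (by ring) (by ring)
  simpa using key

theorem generic_yamabe (hn : 3 ≤ n) {l m : ℝ} (hl : l = (n - 2) / (2 * n))
    (hm : m = (n + 2) / (2 * n)) :
    n * (m - l) ≠ 1 ∧ n * (m - l) ≠ 1 + n / 2 ∧ n * (m - l) ≠ n + 1 := by
  have h : (3 : ℝ) ≤ n := by exact_mod_cast hn
  have h' : n * (m - l) = 2 := by
    rw [hl, hm]
    field_simp
    ring
  rw [h']
  refine ⟨?_, ?_, ?_⟩ <;> intro h' <;> linarith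

theorem quantization_yamabe (hn : 2 ≤ n) (hM : IsFlatConformalAtlas n p M)
    (hg : g.IsConformallyFlat p) {h l m : ℝ} (hh : h ≠ 0) (hl : l = (n - 2) / (2 * n))
    (hm : m = (n + 2) / (2 * n)) :
    (∃ Q : QuantizationMap n M, Q.IsSymmetricConformal g p h l m) ∧
      ∀ Q : QuantizationMap n M, Q.IsSymmetricConformal g p h l m →
        ∀ (φ : SmoothFunC n M) (x : M), Q.quantize h g.hamiltonian φ x
          = -(h : ℂ) ^ 2 * (g.laplacian φ x
            - ((n - 2) / (4 * (n - 1)) : ℂ) * (g.scalarCurvature x : ℂ) * φ x) := by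
  rcases Nat.lt_or_ge n 3 with h3 | h3
  -- In dimension two the pair is (0, 1) and the coefficient of R is zero.
  · obtain rfl : n = 2 := by omega
    obtain rfl : l = 0 := by rw [hl]; norm_num
    obtain rfl : m = 1 := by rw [hm]; norm_num
    simpa using quantization_zero_one (M := M) le_rfl hg hh
  · have hn0 : 0 < n := by omega
    have h3' : (3 : ℝ) ≤ n := by exact_mod_cast h3
    have e1 : (n : ℝ) ≠ 0 := by linarith
    have e2 : (n : ℝ) - 1 ≠ 0 := by linarith
    have hlm : l + m = 1 := by rw [hl, hm]; field_simp; ring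
    have hnl : n * l = (n - 2) / 2 := by rw [hl]; field_simp
    have hnl' : (n : ℝ) * (1 - 2 * l) = 2 := by linear_combination -2 * hnl
    -- With nδ = 2 and nλ = (n - 2)/2 the equations read a(2 - 2n) = -(n - 2)/2 and a = (n - 2) b.
    have hab : IsConformalWeights n ((n - 2) / (4 * (n - 1))) (1 / (4 * (n - 1))) l := by
      constructor
      · rw [mul_assoc 2 (n : ℝ), hnl', mul_comm l, hnl]
        field_simp
        ring
      · rw [mul_assoc 2 (n : ℝ), hnl']
        field_simp
        ring
    -- As nδ - 2 = 0, a and b drop out of the potential of H, and K comes from nλ = -2(n - 1)K.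
    have key := exists_isSymmetricConformal (M := M) hn0 hg (m := m)
      (K := -((n - 2) / (4 * (n - 1)))) hh
      (isChartIndependent_of_generic hn0 hM hg hab hlm (generic_yamabe h3 hl hm)) hab hlm
      (Or.inr (generic_yamabe h3 hl hm)) (by
        rw [hnl', hnl]
        field_simp
        ring) (by
        rw [hnl', show (n : ℝ) * (1 - l) = n - (n - 2) / 2 by linear_combination -hnl, hnl]
        field_simp
        ring)
    refine ⟨key.1, fun Q hQ φ x => ?_⟩
    rw [key.2 Q hQ]
    push_cast
    ring

/-- Here nδ = n + 2 exceeds all three resonances, so dimension two is not exceptional. -/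
theorem generic_neg_inv (hn : 2 ≤ n) {l m : ℝ} (hl : l = -1 / n) (hm : m = (n + 1) / n) :
    n * (m - l) ≠ 1 ∧ n * (m - l) ≠ 1 + n / 2 ∧ n * (m - l) ≠ n + 1 := by
  have h : (2 : ℝ) ≤ n := by exact_mod_cast hn
  have h' : n * (m - l) = n + 2 := by
    rw [hl, hm]
    field_simp
    ring
  rw [h']
  refine ⟨?_, ?_, ?_⟩ <;> intro h' <;> linarith

theorem quantization_neg_inv (hn : 2 ≤ n) (hM : IsFlatConformalAtlas n p M)
    (hg : g.IsConformallyFlat p) {h l m : ℝ} (hh : h ≠ 0) (hl : l = -1 / n)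
    (hm : m = (n + 1) / n) :
    (∃ Q : QuantizationMap n M, Q.IsSymmetricConformal g p h l m) ∧
      ∀ Q : QuantizationMap n M, Q.IsSymmetricConformal g p h l m →
        ∀ (φ : SmoothFunC n M) (x : M), Q.quantize h g.hamiltonian φ x
          = -(h : ℂ) ^ 2 * (g.laplacian φ x
            + (1 / ((n - 1) * (n + 2)) : ℂ) * (g.scalarCurvature x : ℂ) * φ x) := by
  have hn0 : 0 < n := by omega
  have h2' : (2 : ℝ) ≤ n := by exact_mod_cast hn
  have e1 : (n : ℝ) ≠ 0 := by linarith
  have e2 : (n : ℝ) - 1 ≠ 0 := by linarith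
  have e3 : (n : ℝ) + 2 ≠ 0 := by linarith
  have hlm : l + m = 1 := by rw [hl, hm]; field_simp; ring
  have hnl : n * l = -1 := by rw [hl]; field_simp
  have hnl' : (n : ℝ) * (1 - 2 * l) = n + 2 := by linear_combination -2 * hnl
  -- With nδ = n + 2 and nλ = -1 the equations read 2a = 1 and a + (n + 2) b = 0.
  have hab : IsConformalWeights n (1 / 2) (-1 / (2 * (n + 2))) l := by
    constructor
    · rw [mul_assoc 2 (n : ℝ), hnl', mul_comm l, hnl]
      ring
    · rw [mul_assoc 2 (n : ℝ), hnl']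
      field_simp
      ring
  -- Now a + nb = 1/(n + 2) and nδ - 2 = n, so the coefficient of □σ is -1 + n/(n + 2) = -2/(n + 2)
  -- = -2(n - 1)K.
  have key := exists_isSymmetricConformal (M := M) hn0 hg (m := m)
    (K := 1 / ((n - 1) * (n + 2))) hh
    (isChartIndependent_of_generic hn0 hM hg hab hlm (generic_neg_inv hn hl hm)) hab hlm
    (Or.inr (generic_neg_inv hn hl hm)) (by
      rw [hnl', hnl]
      field_simp
      ring) (by
      rw [hnl', show (n : ℝ) * (1 - l) = n + 1 by linear_combination -hnl, hnl]
      field_simp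
      ring)
  refine ⟨key.1, fun Q hQ φ x => ?_⟩
  rw [key.2 Q hQ]
  push_cast
  ring

end Weights

end ConformalQuantization
end

open ConformalQuantization in
theorem proposition4p5 {n p : ℕ} (hn : 2 ≤ n) (hp : p ≤ n)
    {M : Type*} [TopologicalSpace M] [T2Space M] [SecondCountableTopology M]
    [MeasurableSpace M] [BorelSpace M]
    [ChartedSpace (Coord n) M] [IsManifold 𝓘(ℝ, Coord n) ∞ M]
    (hM : IsFlatConformalAtlas n p M)
    (g : PseudoRiemannianMetric n M) (hg : g.IsConformallyFlat p)
    (h : ℝ) (hh : h ≠ 0) :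
    -- the weights `((n - 2) / 2n, (n + 2) / 2n)`
    ((∃ Q : QuantizationMap n M,
        Q.IsSymmetricConformal g p h ((n - 2) / (2 * n)) ((n + 2) / (2 * n))) ∧
      (3 ≤ n → ∀ Q Q' : QuantizationMap n M,
        Q.IsSymmetricConformal g p h ((n - 2) / (2 * n)) ((n + 2) / (2 * n)) →
        Q'.IsSymmetricConformal g p h ((n - 2) / (2 * n)) ((n + 2) / (2 * n)) → Q = Q') ∧
      (∀ Q : QuantizationMap n M,
        Q.IsSymmetricConformal g p h ((n - 2) / (2 * n)) ((n + 2) / (2 * n)) →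
        ∀ (φ : SmoothFunC n M) (x : M),
          Q.quantize h g.hamiltonian φ x
            = -(h : ℂ) ^ 2 * (g.laplacian φ x
                - ((n - 2) / (4 * (n - 1)) : ℂ) * (g.scalarCurvature x : ℂ) * φ x))) ∧
    -- the weights `(0, 1)`
    ((∃ Q : QuantizationMap n M, Q.IsSymmetricConformal g p h 0 1) ∧
      (3 ≤ n → ∀ Q Q' : QuantizationMap n M,
        Q.IsSymmetricConformal g p h 0 1 → Q'.IsSymmetricConformal g p h 0 1 → Q = Q') ∧
      (∀ Q : QuantizationMap n M, Q.IsSymmetricConformal g p h 0 1 →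
        ∀ (φ : SmoothFunC n M) (x : M),
          Q.quantize h g.hamiltonian φ x = -(h : ℂ) ^ 2 * g.laplacian φ x)) ∧
    -- the weights `(-1 / n, (n + 1) / n)`
    ((∃ Q : QuantizationMap n M,
        Q.IsSymmetricConformal g p h (-1 / n) ((n + 1) / n)) ∧
      (∀ Q Q' : QuantizationMap n M,
        Q.IsSymmetricConformal g p h (-1 / n) ((n + 1) / n) →
        Q'.IsSymmetricConformal g p h (-1 / n) ((n + 1) / n) → Q = Q') ∧
      (∀ Q : QuantizationMap n M,
        Q.IsSymmetricConformal g p h (-1 / n) ((n + 1) / n) →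
        ∀ (φ : SmoothFunC n M) (x : M),
          Q.quantize h g.hamiltonian φ x
            = -(h : ℂ) ^ 2 * (g.laplacian φ x
                + (1 / ((n - 1) * (n + 2)) : ℂ) * (g.scalarCurvature x : ℂ) * φ x))) := by
  have hn0 : 0 < n := by omega
  obtain ⟨e1, f1⟩ := quantization_yamabe (M := M) hn hM hg hh rfl rfl
  obtain ⟨e2, f2⟩ := quantization_zero_one (M := M) hn hg hh
  obtain ⟨e3, f3⟩ := quantization_neg_inv (M := M) hn hM hg hh rfl rfl
  refine ⟨⟨e1, fun h3 Q Q' hQ hQ' => ?_, f1⟩, ⟨e2, fun h3 Q Q' hQ hQ' => ?_, f2⟩,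
    ⟨e3, fun Q Q' hQ hQ' => ?_, f3⟩⟩
  · have k := generic_yamabe h3 rfl rfl
    exact hQ.unique hn0 hh hg hQ' k.1 k.2.1 k.2.2
  · have k := generic_zero_one h3
    exact hQ.unique hn0 hh hg hQ' k.1 k.2.1 k.2.2
  · have k := generic_neg_inv hn rfl rfl
    exact hQ.unique hn0 hh hg hQ' k.1 k.2.1 k.2.2
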